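/- **Setting.** Let $a>b>c>0$ be the parameters of the triaxial ellipsoid $x^2/a+y^2/b+z^2/c=1$. Put $E=(0,c)$, $H_1=(c,b)$, $H_2=(b,a)$, and let $$\Lambda=\{(\lambda_1,\lambda_2)\in\mathbb R^2:\ \lambda_1<\lambda_2,\ \lambda_1\in E\cup H_1,\ \lambda_2\in H_1\cup H_2\}$$ be the nonsingular caustic space. For $\lambda=(\lambda_1,\lambda_2)\in\Lambda$ order the set $\{a,b,c,\lambda_1,\lambda_2\}=\{c_1<\dots<c_5\}$, put $c_0=0$, $T(s)=\prod_{i=1}^5(c_i-s)$ and $$K_{ij}=\int_{c_{2j}}^{c_{2j+1}}\frac{s^i\,ds}{\sqrt{T(s)}},\qquad i=0,1,\quad j=0,1,2.$$ The frequency map $\omega=(\omega_1,\omega_2):\Lambda\to\mathbb R^2$ is defined by letting $\omega(\lambda)$ be the unique solution of the linear system $K_{i0}-2\omega_1K_{i1}+2\omega_2K_{i2}=0$, $i=0,1$. For $0<\beta<\alpha$ and $\lambda\in(0,\beta)\cup(\beta,\alpha)$ put $$\rho(\lambda;\beta,\alpha)=\frac{\int_0^{\min(\beta,\lambda)}\frac{ds}{\sqrt{(\lambda-s)(\beta-s)(\alpha-s)}}}{2\int_{\max(\beta,\lambda)}^{\alpha}\frac{ds}{\sqrt{(\lambda-s)(\beta-s)(\alpha-s)}}},$$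 and extend $\rho(\cdot\,;\beta,\alpha)$ continuously to $[0,\alpha]$. Let $\rho_x=\rho(\cdot\,;c,b)$ on $[0,b]$, $\rho_y=\rho(\cdot\,;c,a)$ on $[0,a]$ and $\rho_z=\rho(\cdot\,;b,a)$ on $[0,a]$ (the rotation functions of the three principal sections). Write $\underline m=\min(\lambda,c)$, $\overline m=\max(\lambda,c)$, $T_x(s)=(\lambda-s)(c-s)(b-s)$, $T_y(s)=(c-s)(\lambda-s)(a-s)$, $T_z(s)=(\underline m-s)(b-s)(a-s)$. The functions $\nu_x$ and $\nu_z$ (for $\lambda\in E\cup H_1$) and $\nu_y$ (for $\lambda\in H_2$) are defined by $$\int_0^{\underline m}\frac{ds}{(a-s)\sqrt{T_x(s)}}-2\rho_x(\lambda)\int_{\overline m}^{b}\frac{ds}{(a-s)\sqrt{T_x(s)}}+\frac{2\pi\nu_x(\lambda)}{\sqrt{-T_x(a)}}=0,$$ $$\int_0^{c}\frac{ds}{(b-s)\sqrt{T_y(s)}}+2\rho_y(\lambda)\int_{\lambda}^{a}\frac{ds}{(s-b)\sqrt{T_y(s)}}-\frac{2\pi\nu_y(\lambda)}{\sqrt{-T_y(b)}}=0,$$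 $$\int_0^{\underline m}\frac{ds}{(\overline m-s)\sqrt{T_z(s)}}+2\rho_z(\underline m)\int_{b}^{a}\frac{ds}{(s-\overline m)\sqrt{T_z(s)}}-\frac{2\pi\nu_z(\lambda)}{\sqrt{-T_z(\overline m)}}=0,$$ and are extended continuously to $[0,b]$ ($\nu_x$, $\nu_z$) and $[b,a]$ ($\nu_y$). Below, limits are taken along points of $\Lambda$; $O(f,g)$ means $O(|f|+|g|)$; and $u\asymp v$ means that $u_i-v_i=o(v_i)$ for each component $i=1,2$. **Theorem.** The frequency map is well defined on $\Lambda$ and has the following properties. (i) $\omega$ is real analytic in $\Lambda$. (ii) $\omega$ extends to a continuous map on $\overline\Lambda=\Lambda\cup\partial\Lambda$, still denoted by $\omega$, with - $\omega(0,\lambda_2)=(0,0)$ for $c\le\lambda_2\le a$; - $\omega(\lambda_1,b)=(\rho_y(\lambda_1),\rho_y(\lambda_1))$ for $0\le\lambda_1\le b$; - $\omega(c,\lambda_2)=(1/2,\rho_z(\lambda_2))$ for $c\le\lambda_2\le a$; - $\omega(\lambda_1,a)=(\rho_x(\lambda_1),\nu_x(\lambda_1))$ for $0\le\lambda_1\le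 b$; - $\omega(b,\lambda_2)=(\nu_y(\lambda_2),\rho_y(\lambda_2))$ for $b\le\lambda_2\le a$; - $\omega(\lambda_1,c)=(\nu_z(\lambda_1),\rho_z(\lambda_1))$ for $0\le\lambda_1\le c$; - $\omega(\lambda_1,\lambda_1)=(\nu_z(\lambda_1),\rho_z(c))$ for $c\le\lambda_1\le b$. (iii) Let $S=\big(\{c\}\times(H_1\cup H_2)\big)\cup\big((E\cup H_1)\times\{b\}\big)$ be the union of the four inner edges of $\Lambda$, and let $R=(E\times\{c\})\cup\{(t,t):t\in H_1\}\cup(\{b\}\times H_2)\cup(E\times\{a\})\cup(H_1\times\{a\})$. There are analytic functions $\kappa^G:H_1\cup H_2\to(0,\infty)^2$ and $\kappa^S:S\to\mathbb R^2$ such that - for each $\lambda_2\in H_1\cup H_2$: $\omega(\lambda_1,\lambda_2)=\kappa^G(\lambda_2)\lambda_1^{1/2}+O(\lambda_1^{3/2})$ as $\lambda_1\to0^+$; - for each $\lambda_2\in H_1\cup H_2$: $\omega(\lambda_1,\lambda_2)-\omega(c,\lambda_2)\asymp\kappa^S(c,\lambda_2)/\log|c-\lambda_1|$ as $\lambda_1\to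 c$; - for each $\lambda_1\in E\cup H_1$: $\omega(\lambda_1,\lambda_2)-\omega(\lambda_1,b)\asymp\kappa^S(\lambda_1,b)/\log|b-\lambda_2|$ as $\lambda_2\to b$; - for each $\lambda^R\in R$: $\omega(\lambda)-\omega(\lambda^R)=O(\lambda-\lambda^R)$ as $\lambda\to\lambda^R$. (iv) At the eight vertexes of $\Lambda$: - $\omega(\lambda)=O(\lambda_1^{1/2})$ as $\lambda\to(0,c)$, as $\lambda\to(0,b)$, and as $\lambda\to(0,a)$; - $\omega(\lambda)=(1/2,\rho_z(c))+O(1/\log|c-\lambda_1|,\ \lambda_2-c)$ as $\lambda\to(c,c)$; - $\omega(\lambda)=(1/2,1/2)+O(1/\log|c-\lambda_1|,\ 1/\log|b-\lambda_2|)$ as $\lambda\to(c,b)$; - $\omega(\lambda)=(1/2,\rho_z(a))+O(1/\log|c-\lambda_1|,\ a-\lambda_2)$ as $\lambda\to(c,a)$; - $\omega(\lambda)=(\rho_y(b),\rho_y(b))+O(b-\lambda_1,\ 1/\log|b-\lambda_2|)$ as $\lambda\to(b,b)$; - $\omega(\lambda)=(\rho_x(b),\rho_y(a))+O(b-\lambda_1,\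 a-\lambda_2)$ as $\lambda\to(b,a)$. -/

import Mathlib

open Filter Topology Asymptotics Set

noncomputable section

namespace TriaxialBilliard

/-! Throughout, `a > b > c > 0` are the parameters of the triaxial ellipsoid
`x² / a + y² / b + z² / c = 1`, and a pair `p = (lam1, lam2)` is a caustic parameter. -/

/-- Parameters `E = (0, c)` of the confocal ellipsoids. -/
def E (c : ℝ) : Set ℝ := Ioo 0 c

/-- Parameters `H₁ = (c, b)` of the confocal one-sheet hyperboloids. -/
def H1 (b c : ℝ) : Set ℝ := Ioo c b

/-- Parameters `H₂ = (b, a)` of the confocal two-sheet hyperboloids. -/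
def H2 (a b : ℝ) : Set ℝ := Ioo b a

/-- The nonsingular caustic space
`(E × H₁) ∪ (H₁ ⊗ H₁) ∪ (E × H₂) ∪ (H₁ × H₂)`, where
`H₁ ⊗ H₁` is the part `lam1 < lam2` of `H₁ × H₁`. -/
def causticSpace (a b c : ℝ) : Set (ℝ × ℝ) :=
  {p | p.1 < p.2 ∧ p.1 ∈ E c ∪ H1 b c ∧ p.2 ∈ H1 b c ∪ H2 a b}

/-- The union `R` of the five edges of the caustic space that are neither on `lam1 = 0`,
nor on `lam1 = c`, nor on `lam2 = b`. -/
def edgesR (a b c : ℝ) : Set (ℝ × ℝ) :=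
  (E c ×ˢ {c}) ∪ {p | p.1 = p.2 ∧ p.1 ∈ H1 b c} ∪ ({b} ×ˢ H2 a b) ∪ (E c ×ˢ {a}) ∪
    (H1 b c ×ˢ {a})

/-! ### The frequency map

For `p` in the caustic space, the ordered sequence `0 = c₀ < c₁ < ⋯ < c₅` with
`{c₁, …, c₅} = {a, b, c, lam1, lam2}` is
`0, min c lam1, max c lam1, min b lam2, max b lam2, a`. -/

/-- `T(s) = ∏ (cᵢ - s)`. -/
def T (a b c : ℝ) (p : ℝ × ℝ) (s : ℝ) : ℝ :=
  (a - s) * (b - s) * (c - s) * (p.1 - s) * (p.2 - s)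

/-- The integral of `s ^ i / √T(s)` over `(c₀, c₁)`. -/
def K0 (a b c : ℝ) (p : ℝ × ℝ) (i : ℕ) : ℝ :=
  ∫ s in (0 : ℝ)..(min c p.1), s ^ i / √(T a b c p s)

/-- The integral of `s ^ i / √T(s)` over `(c₂, c₃)`. -/
def K1 (a b c : ℝ) (p : ℝ × ℝ) (i : ℕ) : ℝ :=
  ∫ s in (max c p.1)..(min b p.2), s ^ i / √(T a b c p s)

/-- The integral of `s ^ i / √T(s)` over `(c₄, c₅)`. -/
def K2 (a b c : ℝ) (p : ℝ × ℝ) (i : ℕ) : ℝ :=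
  ∫ s in (max b p.2)..a, s ^ i / √(T a b c p s)

/-- The linear system `K₀ + 2 ∑ⱼ (-1)ʲ wⱼ Kⱼ = 0` that defines the frequency. -/
def IsFrequency (a b c : ℝ) (p w : ℝ × ℝ) : Prop :=
  ∀ i ∈ ({0, 1} : Set ℕ),
    K0 a b c p i + 2 * (-(w.1 * K1 a b c p i) + w.2 * K2 a b c p i) = 0

/-- The frequency map: the solution `w` of the linear system `IsFrequency a b c p w`. -/
def frequencyMap (a b c : ℝ) (p : ℝ × ℝ) : ℝ × ℝ :=
  Classical.epsilon (IsFrequency a b c p)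

/-! ### The rotation functions of the three principal sections -/

/-- The rotation number `ρ(lam; b, a)` of the billiard inside the ellipse
`x² / a + y² / b = 1`, `a > b > 0`, for a nonsingular caustic parameter
`lam ∈ (0, b) ∪ (b, a)`. -/
def rotationNumber (lam b a : ℝ) : ℝ :=
  (∫ s in (0 : ℝ)..(min b lam), 1 / √((lam - s) * (b - s) * (a - s))) /
    (2 * ∫ s in (max b lam)..a, 1 / √((lam - s) * (b - s) * (a - s)))

/-- The rotation function of the ellipse, extended by continuity from
`(0, b) ∪ (b, a)` to `[0, a]`. -/
def rotationFunction (b a : ℝ) : ℝ → ℝ :=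
  extendFrom (Ioo 0 b ∪ Ioo b a) (fun lam => rotationNumber lam b a)

/-- Rotation function on `[0, b]` of the section by `x = 0`. -/
def rhoX (b c : ℝ) : ℝ → ℝ := rotationFunction c b

/-- Rotation function on `[0, a]` of the section by `y = 0`. -/
def rhoY (a c : ℝ) : ℝ → ℝ := rotationFunction c a

/-- Rotation function on `[0, a]` of the section by `z = 0`. -/
def rhoZ (a b : ℝ) : ℝ → ℝ := rotationFunction b a

/-! ### The auxiliary functions

Each one is given on an open set by a linear identity, here solved for its unknown, and is
then extended by continuity. -/

/-- `T_x(s) = (lam - s) (c - s) (b - s)`. -/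
def Tx (b c lam s : ℝ) : ℝ := (lam - s) * (c - s) * (b - s)

/-- `T_y(s) = (c - s) (lam - s) (a - s)`. -/
def Ty (a c lam s : ℝ) : ℝ := (c - s) * (lam - s) * (a - s)

/-- `T_z(s) = (min lam c - s) (b - s) (a - s)`. -/
def Tz (a b c lam s : ℝ) : ℝ := (min lam c - s) * (b - s) * (a - s)

/-- The function `ν_x` on `E ∪ H₁`. -/
def nuXInterior (a b c lam : ℝ) : ℝ :=
  √(-Tx b c lam a) / (2 * Real.pi) *
    (2 * rotationNumber lam c b *
        (∫ s in (max lam c)..b, 1 / ((a - s) * √(Tx b c lam s))) -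
      ∫ s in (0 : ℝ)..(min lam c), 1 / ((a - s) * √(Tx b c lam s)))

/-- The function `ν_y` on `H₂`. -/
def nuYInterior (a b c lam : ℝ) : ℝ :=
  √(-Ty a c lam b) / (2 * Real.pi) *
    ((∫ s in (0 : ℝ)..c, 1 / ((b - s) * √(Ty a c lam s))) +
      2 * rotationNumber lam c a * ∫ s in lam..a, 1 / ((s - b) * √(Ty a c lam s)))

/-- The function `ν_z` on `E ∪ H₁`. -/
def nuZInterior (a b c lam : ℝ) : ℝ :=
  √(-Tz a b c lam (max lam c)) / (2 * Real.pi) *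
    ((∫ s in (0 : ℝ)..(min lam c), 1 / ((max lam c - s) * √(Tz a b c lam s))) +
      2 * rotationNumber (min lam c) b a *
        ∫ s in b..a, 1 / ((s - max lam c) * √(Tz a b c lam s)))

/-- The function `ν_x`, extended by continuity to `[0, b]`. -/
def nuX (a b c : ℝ) : ℝ → ℝ := extendFrom (E c ∪ H1 b c) (nuXInterior a b c)

/-- The function `ν_y`, extended by continuity to `[b, a]`. -/
def nuY (a b c : ℝ) : ℝ → ℝ := extendFrom (H2 a b) (nuYInterior a b c)

/-- The function `ν_z`, extended by continuity to `[0, b]`. -/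
def nuZ (a b c : ℝ) : ℝ → ℝ := extendFrom (E c ∪ H1 b c) (nuZInterior a b c)

/-- The reciprocal `1 / log |x|` of the logarithm of the distance to a singular value. -/
def invLog (x : ℝ) : ℝ := 1 / Real.log |x|

end TriaxialBilliard

end

open TriaxialBilliard

open TriaxialBilliard

/-! The entries of the linear system are periods of the hyperelliptic curve y² = T(s), and the
behaviour of ω is decided by which neighbouring roots c₁ < ... < c₅ of T collide.

Harmless collisions. If c₂ = c₃ or c₄ = c₅, an interval of integration collapses between its own two
end points. Rescaled to [0,1], the period is the integral of an analytic family of continuous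
functions against 1/√(σ(1-σ)), so it continues analytically through the collision, where it equals π
times the remaining factor (`intB_self`). In the same way the period over (0,c₁) is √c₁ times a
function that is analytic up to c₁ = 0. The determinant of the system is positive, because the mean
of s over (c₄,c₅) exceeds its mean over (c₂,c₃) (`freqDet_pos`). Hence ω = √c₁ · `normFreq`, and
`normFreq` is analytic away from λ₁ = c and λ₂ = b (`analyticAt_normFreq`). This gives analyticity,
the square root law at λ₁ = 0 and the linear estimates on R. On an edge where T has a double root d,
multiplication by d - s turns the periods into elliptic ones, and the system becomes the definition
of one ρ and one ν (`sqrt_smul_normFreq_double_right`, `sqrt_smul_normFreq_double_left`).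

Singular collisions. If c₁ and c₂ collide (λ₁ → c), or c₃ and c₄ (λ₂ → b), the two periods on either
side of the pinched gap diverge like a logarithm. An involution that permutes the branch points
carries one period into a part of the other, so their difference stays bounded
(`abs_cubicPeriod_sub_le`). Division by the divergent period gives ω₁ - 1/2, respectively ω₁ - ω₂,
of order 1/log. A second combination of the equations, whose multiplier vanishes at a colliding
root, tends to the elliptic relation that defines a rotation number and fixes the other component.
The constants depend only on a few gaps (`exists_abs_sub_le_of_collision_low`,
`exists_abs_sub_le_of_collision_high`, `exists_abs_sub_le_of_double_collision`), so the same
estimates serve the vertexes and give the continuous extension.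

The exact coefficient of 1/log is the limit of the regularized difference of the two divergent
periods, corrected by the third one (`tendsto_collision_low`, `tendsto_collision_high`). An
elementary primitive expresses it through `lowPole` or `highPole`, and a Chebyshev type inequality
shows that it does not vanish (`lowPole_neg`, `highPole_pos`). That is what makes the estimate an
asymptotic equivalence in each component. -/

/-! ### Analytic families of continuous functions on `[0, 1]` -/

/-- The binomial series for `(1 + z) ^ (-1/2)` in the algebra of continuous functions. -/
noncomputable def rsqrtSeries : FormalMultilinearSeries ℝ C(Icc (0 : ℝ) 1, ℝ) C(Icc (0 : ℝ) 1, ℝ) :=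
  binomialSeries C(Icc (0 : ℝ) 1, ℝ) (-(1 / 2) : ℝ)

/-- The norms of the terms of a scalar series depend only on the scalars, so the radius agrees with
that of the real binomial series. -/
theorem one_le_radius_rsqrtSeries : 1 ≤ rsqrtSeries.radius := by
  have h := binomialSeries_radius_ge_one (𝕂 := ℝ) (𝔸 := ℝ) (a := (-(1 / 2) : ℝ))
  have hn : ∀ n, ‖rsqrtSeries n‖ = ‖binomialSeries ℝ (-(1 / 2) : ℝ) n‖ := fun n => by
    rw [rsqrtSeries, binomialSeries, binomialSeries, FormalMultilinearSeries.ofScalars_norm,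
      FormalMultilinearSeries.ofScalars_norm]
  simpa only [FormalMultilinearSeries.radius, hn] using h

/-- Evaluation at a point is a continuous algebra homomorphism, so it carries the series to the real
binomial series. -/
theorem rsqrtSeries_sum_apply (z : C(Icc (0 : ℝ) 1, ℝ)) (hz : ‖z‖ < 1) (x : Icc (0 : ℝ) 1) :
    rsqrtSeries.sum z x = 1 / √(1 + z x) := by
  have hb : z ∈ Metric.eball (0 : C(Icc (0 : ℝ) 1, ℝ)) rsqrtSeries.radius := by
    refine Metric.eball_subset_eball one_le_radius_rsqrtSeries ?_
    rw [← ENNReal.ofReal_one, Metric.eball_ofReal]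
    simpa using hz
  have hs := (rsqrtSeries.hasSum hb).map
    (ContinuousMap.evalCLM ℝ x : C(Icc (0 : ℝ) 1, ℝ) →L[ℝ] ℝ) (ContinuousLinearMap.continuous _)
  have hx : |z x| < 1 := lt_of_le_of_lt (z.norm_coe_le_norm x) hz
  have hr := (Real.one_add_rpow_hasFPowerSeriesOnBall_zero (a := -(1 / 2))).hasSum
    (y := z x) (by rw [← ENNReal.ofReal_one, Metric.eball_ofReal]; simpa using hx)
  have he : rsqrtSeries.sum z x = (1 + z x) ^ (-(1 / 2) : ℝ) := by
    refine HasSum.unique (L := SummationFilter.unconditional ℕ)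
      (f := fun n => Ring.choose (-(1 / 2) : ℝ) n * z x ^ n) ?_ ?_
    · convert hs using 1
      · ext n
        simp [rsqrtSeries]
      · rfl
    · rw [zero_add] at hr
      have hf : (fun n => Ring.choose (-(1 / 2) : ℝ) n * z x ^ n) =
          fun n => binomialSeries ℝ (-(1 / 2) : ℝ) n fun _ => z x := by
        ext n
        rw [binomialSeries_apply]
        simp
      rw [hf]
      exact hr
  have hp : 0 < 1 + z x := by linarith [(abs_lt.1 hx).1]
  rw [he, Real.rpow_neg hp.le, Real.sqrt_eq_rpow, inv_eq_one_div]

/-- `Φ x` is near `x₀` given by an analytic family of continuous functions on `[0, 1]`. -/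
def IsAnalyticFamily {X : Type*} [NormedAddCommGroup X] [NormedSpace ℝ X]
    (Φ : X → ℝ → ℝ) (x₀ : X) : Prop :=
  ∃ Ψ : X → C(Icc (0 : ℝ) 1, ℝ), AnalyticAt ℝ Ψ x₀ ∧
    ∀ᶠ x in 𝓝 x₀, ∀ σ : Icc (0 : ℝ) 1, Ψ x σ = Φ x σ

namespace IsAnalyticFamily

variable {X : Type*} [NormedAddCommGroup X] [NormedSpace ℝ X] {x₀ : X}

theorem param {f : X → ℝ} (hf : AnalyticAt ℝ f x₀) : IsAnalyticFamily (fun x _ => f x) x₀ := by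
  refine ⟨fun x => f x • 1, hf.smul analyticAt_const, Eventually.of_forall fun x σ => by simp⟩

theorem of_continuous {g : ℝ → ℝ} (hg : Continuous g) :
    IsAnalyticFamily (fun (_ : X) σ => g σ) x₀ :=
  ⟨fun _ => ⟨fun σ => g σ, by fun_prop⟩, analyticAt_const, Eventually.of_forall fun x σ => rfl⟩

theorem add {Φ Φ' : X → ℝ → ℝ} (h : IsAnalyticFamily Φ x₀) (h' : IsAnalyticFamily Φ' x₀) :
    IsAnalyticFamily (fun x σ => Φ x σ + Φ' x σ) x₀ := by
  obtain ⟨Ψ, hΨ, e⟩ := h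
  obtain ⟨Ψ', hΨ', e'⟩ := h'
  refine ⟨fun x => Ψ x + Ψ' x, hΨ.add hΨ', ?_⟩
  filter_upwards [e, e'] with x h h' σ
  simp [h, h']

theorem mul {Φ Φ' : X → ℝ → ℝ} (h : IsAnalyticFamily Φ x₀) (h' : IsAnalyticFamily Φ' x₀) :
    IsAnalyticFamily (fun x σ => Φ x σ * Φ' x σ) x₀ := by
  obtain ⟨Ψ, hΨ, e⟩ := h
  obtain ⟨Ψ', hΨ', e'⟩ := h'
  refine ⟨fun x => Ψ x * Ψ' x, hΨ.mul hΨ', ?_⟩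
  filter_upwards [e, e'] with x h h' σ
  simp [h, h']

theorem congr {Φ Φ' : X → ℝ → ℝ} (h : IsAnalyticFamily Φ x₀)
    (h' : ∀ᶠ x in 𝓝 x₀, ∀ σ ∈ Icc (0 : ℝ) 1, Φ x σ = Φ' x σ) : IsAnalyticFamily Φ' x₀ := by
  obtain ⟨Ψ, hΨ, e⟩ := h
  refine ⟨Ψ, hΨ, ?_⟩
  filter_upwards [e, h'] with x h h' σ
  rw [h, h' σ σ.2]

theorem sub {Φ Φ' : X → ℝ → ℝ} (h : IsAnalyticFamily Φ x₀) (h' : IsAnalyticFamily Φ' x₀) :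
    IsAnalyticFamily (fun x σ => Φ x σ - Φ' x σ) x₀ :=
  (h.add ((param (analyticAt_const (v := (-1 : ℝ)))).mul h')).congr
    (Eventually.of_forall fun x σ _ => by ring)

theorem pow {Φ : X → ℝ → ℝ} (h : IsAnalyticFamily Φ x₀) (n : ℕ) :
    IsAnalyticFamily (fun x σ => Φ x σ ^ n) x₀ := by
  induction n with
  | zero => simpa using param (x₀ := x₀) (analyticAt_const (v := (1 : ℝ)))
  | succ n ih => simpa [pow_succ] using ih.mul h

/-- Factor out the value at x₀: Φ x = Φ x₀ · (1 + z), where z tends to 0 in the sup norm. The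
binomial series in the Banach algebra of continuous functions then gives (1 + z)^(-1/2), analytic in
x. -/
theorem rsqrt {Φ : X → ℝ → ℝ} (h : IsAnalyticFamily Φ x₀)
    (hpos : ∀ σ ∈ Icc (0 : ℝ) 1, 0 < Φ x₀ σ) :
    IsAnalyticFamily (fun x σ => 1 / √(Φ x σ)) x₀ := by
  obtain ⟨Ψ, hΨ, e⟩ := h
  have hp : ∀ σ : Icc (0 : ℝ) 1, 0 < Ψ x₀ σ := fun σ => by
    rw [e.self_of_nhds σ]; exact hpos σ σ.2
  let u : C(Icc (0 : ℝ) 1, ℝ) :=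
    ⟨fun σ => (Ψ x₀ σ)⁻¹, (Ψ x₀).continuous.inv₀ fun σ => (hp σ).ne'⟩
  let v : C(Icc (0 : ℝ) 1, ℝ) :=
    ⟨fun σ => 1 / √(Ψ x₀ σ), by
      refine continuous_const.div (Ψ x₀).continuous.sqrt fun σ => ?_
      exact (Real.sqrt_pos.2 (hp σ)).ne'⟩
  have hz : AnalyticAt ℝ (fun x => u * Ψ x - 1) x₀ :=
    (analyticAt_const.mul hΨ).sub analyticAt_const
  have hz0 : u * Ψ x₀ - 1 = 0 := by
    ext σ
    simp [u, (hp σ).ne']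
  have hs : AnalyticAt ℝ rsqrtSeries.sum (u * Ψ x₀ - 1) := by
    rw [hz0]
    exact (rsqrtSeries.hasFPowerSeriesOnBall
      (lt_of_lt_of_le one_pos one_le_radius_rsqrtSeries)).analyticAt
  refine ⟨fun x => v * rsqrtSeries.sum (u * Ψ x - 1),
    analyticAt_const.mul (hs.comp_of_eq hz rfl), ?_⟩
  have hc : ∀ᶠ x in 𝓝 x₀, ‖u * Ψ x - 1‖ < 1 := by
    have := hz.continuousAt.norm
    rw [ContinuousAt, hz0, norm_zero] at this
    exact this.eventually_lt_const one_pos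
  filter_upwards [e, hc] with x hx hlt σ
  have h1 : 0 < (Ψ x₀ σ) := hp σ
  rw [ContinuousMap.mul_apply, rsqrtSeries_sum_apply _ hlt, ← hx]
  simp only [u, v, ContinuousMap.sub_apply, ContinuousMap.mul_apply, ContinuousMap.coe_mk,
    ContinuousMap.one_apply]
  rw [div_mul_div_comm, ← Real.sqrt_mul h1.le]
  congr 2
  · ring
  · field_simp
    ring

theorem inv {Φ : X → ℝ → ℝ} (h : IsAnalyticFamily Φ x₀)
    (hpos : ∀ σ ∈ Icc (0 : ℝ) 1, 0 < Φ x₀ σ) :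
    IsAnalyticFamily (fun x σ => 1 / Φ x σ) x₀ := by
  -- Squaring 1/√Φ returns 1/Φ only where Φ ≥ 0. The minimum of Φ x₀ over the compact interval keeps
  -- Φ x nonnegative for x near x₀.
  have hev : ∀ᶠ x in 𝓝 x₀, ∀ σ ∈ Icc (0 : ℝ) 1, 0 ≤ Φ x σ := by
    obtain ⟨Ψ, hΨ, e⟩ := h
    have hp : ∀ σ : Icc (0 : ℝ) 1, 0 < Ψ x₀ σ := fun σ => by
      rw [e.self_of_nhds σ]; exact hpos σ σ.2
    obtain ⟨σ₀, -, hσ₀⟩ := isCompact_univ.exists_isMinOn univ_nonempty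
      (Ψ x₀).continuous.continuousOn
    have hc : ∀ᶠ x in 𝓝 x₀, dist (Ψ x) (Ψ x₀) < Ψ x₀ σ₀ :=
      Metric.tendsto_nhds.1 hΨ.continuousAt _ (hp σ₀)
    filter_upwards [e, hc] with x hx hd σ hσ
    have h1 := (ContinuousMap.dist_apply_le_dist (f := Ψ x) (g := Ψ x₀) ⟨σ, hσ⟩).trans_lt hd
    rw [Real.dist_eq, abs_lt] at h1
    have h2 := hσ₀ (mem_univ (⟨σ, hσ⟩ : Icc (0 : ℝ) 1))
    have h3 := hx ⟨σ, hσ⟩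
    simp only [mem_ofPred_eq] at h2 h3
    linarith [h1.1]
  refine ((h.rsqrt hpos).pow 2).congr ?_
  filter_upwards [hev] with x hx σ hσ
  rw [div_pow, one_pow, Real.sq_sqrt (hx σ hσ)]

/-- Integration against an integrable weight is a continuous linear functional on C([0,1]), and
composition with it preserves analyticity. All singularities of the periods are put into the fixed
weight w. -/
theorem analyticAt_integral {Φ : X → ℝ → ℝ} (h : IsAnalyticFamily Φ x₀) {w : ℝ → ℝ}
    (hw : IntervalIntegrable w MeasureTheory.volume 0 1) :
    AnalyticAt ℝ (fun x => ∫ σ in (0 : ℝ)..1, w σ * Φ x σ) x₀ := by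
  obtain ⟨Ψ, hΨ, e⟩ := h
  have hint : ∀ f : C(Icc (0 : ℝ) 1, ℝ), IntervalIntegrable
      (fun σ => w σ * IccExtend zero_le_one f σ) MeasureTheory.volume 0 1 := fun f =>
    hw.mul_continuousOn (f.continuous.Icc_extend').continuousOn
  let L : C(Icc (0 : ℝ) 1, ℝ) →ₗ[ℝ] ℝ :=
    { toFun := fun f => ∫ σ in (0 : ℝ)..1, w σ * IccExtend zero_le_one f σ
      map_add' := fun f g => by
        rw [← intervalIntegral.integral_add (hint f) (hint g)]
        congr 1; ext σ
        simp [IccExtend, mul_add]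
      map_smul' := fun r f => by
        rw [RingHom.id_apply, smul_eq_mul, ← intervalIntegral.integral_const_mul]
        congr 1; ext σ
        simp [IccExtend]; ring }
  have hL : ∀ f, ‖L f‖ ≤ (∫ σ in (0 : ℝ)..1, ‖w σ‖) * ‖f‖ := fun f => by
    calc ‖L f‖ ≤ ∫ σ in (0 : ℝ)..1, ‖w σ‖ * ‖f‖ := by
          refine intervalIntegral.norm_integral_le_of_norm_le zero_le_one
            (Eventually.of_forall fun σ _ => ?_) (hw.norm.mul_const _)
          rw [norm_mul]
          exact mul_le_mul_of_nonneg_left (f.norm_coe_le_norm _) (norm_nonneg _)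
      _ = _ := by rw [intervalIntegral.integral_mul_const]
  have := ((L.mkContinuous _ hL).analyticAt (Ψ x₀)).comp hΨ
  refine this.congr ?_
  filter_upwards [e] with x hx
  change (∫ σ in (0 : ℝ)..1, w σ * IccExtend zero_le_one (Ψ x) σ) = _
  refine intervalIntegral.integral_congr fun σ hσ => ?_
  rw [uIcc_of_le zero_le_one] at hσ
  rw [IccExtend_of_mem _ _ hσ, hx]

end IsAnalyticFamily

/-! ### Integrals with inverse square root singularities -/

/-- Lebesgue integrability of `f` between `u` and `v`. -/
abbrev IntOn (f : ℝ → ℝ) (u v : ℝ) : Prop := IntervalIntegrable f MeasureTheory.volume u v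

theorem IntOn.of_abs_le {u v : ℝ} (huv : u ≤ v) {g k : ℝ → ℝ} (hk : IntOn k u v)
    (hg : Measurable g) (h : ∀ s ∈ Ioo u v, |g s| ≤ k s) : IntOn g u v := by
  rw [IntOn, intervalIntegrable_iff_integrableOn_Ioo_of_le huv] at *
  refine MeasureTheory.Integrable.mono' hk hg.aestronglyMeasurable ?_
  refine (MeasureTheory.ae_restrict_iff' measurableSet_Ioo).2 (Eventually.of_forall h)

theorem integral_le_of_le_Ioo {u v : ℝ} (huv : u ≤ v) {f g : ℝ → ℝ} (hf : IntOn f u v)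
    (hg : IntOn g u v) (h : ∀ s ∈ Ioo u v, f s ≤ g s) :
    (∫ s in u..v, f s) ≤ ∫ s in u..v, g s :=
  intervalIntegral.integral_mono_on_of_le_Ioo huv hf hg h

theorem abs_integral_le_of_abs_le {u v : ℝ} (huv : u ≤ v) {g k : ℝ → ℝ} (hk : IntOn k u v)
    (hg : Measurable g) (h : ∀ s ∈ Ioo u v, |g s| ≤ k s) :
    |∫ s in u..v, g s| ≤ ∫ s in u..v, k s := by
  have hi := IntOn.of_abs_le huv hk hg h
  refine abs_le.2 ⟨?_, integral_le_of_le_Ioo huv hi hk fun s hs => (abs_le.1 (h s hs)).2⟩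
  rw [← intervalIntegral.integral_neg]
  exact integral_le_of_le_Ioo huv hk.neg hi fun s hs => (abs_le.1 (h s hs)).1

theorem integral_congr_Ioo {u v : ℝ} (huv : u ≤ v) {f g : ℝ → ℝ} (h : ∀ s ∈ Ioo u v, f s = g s) :
    (∫ s in u..v, f s) = ∫ s in u..v, g s :=
  intervalIntegral.integral_congr_Ioo_of_le huv h

theorem IntOn.congr_Ioo {u v : ℝ} (huv : u ≤ v) {f g : ℝ → ℝ} (hf : IntOn f u v)
    (h : ∀ s ∈ Ioo u v, f s = g s) : IntOn g u v := by
  rw [IntOn, intervalIntegrable_iff_integrableOn_Ioo_of_le huv] at *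
  exact hf.congr_fun h measurableSet_Ioo

theorem integral_nonneg_Ioo {u v : ℝ} (huv : u ≤ v) {f : ℝ → ℝ} (h : ∀ s ∈ Ioo u v, 0 ≤ f s) :
    0 ≤ ∫ s in u..v, f s := by
  rw [intervalIntegral.integral_of_le huv, MeasureTheory.integral_Ioc_eq_integral_Ioo]
  exact MeasureTheory.setIntegral_nonneg measurableSet_Ioo h

/-- A nonnegative derivative is automatically integrable, so improper integrals need nothing beyond
a primitive that is continuous up to the end points. -/
theorem ftc_of_nonneg {u v : ℝ} (huv : u ≤ v) {F f : ℝ → ℝ} (hc : ContinuousOn F (Icc u v))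
    (hd : ∀ s ∈ Ioo u v, HasDerivAt F (f s) s) (hpos : ∀ s ∈ Ioo u v, 0 ≤ f s) :
    IntOn f u v ∧ (∫ s in u..v, f s) = F v - F u := by
  have hi : IntOn f u v := by
    apply intervalIntegral.intervalIntegrable_deriv_of_nonneg (g := F)
    · rwa [uIcc_of_le huv]
    · rwa [min_eq_left huv, max_eq_right huv]
    · rwa [min_eq_left huv, max_eq_right huv]
  exact ⟨hi, intervalIntegral.integral_eq_sub_of_hasDerivAt_of_le huv hc hd hi⟩

theorem intOn_rsqrt_right {u v : ℝ} (huv : u ≤ v) : IntOn (fun s => 1 / √(v - s)) u v ∧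
    (∫ s in u..v, 1 / √(v - s)) = 2 * √(v - u) := by
  have := ftc_of_nonneg huv (F := fun s => -(2 * √(v - s))) (f := fun s => 1 / √(v - s))
    (by fun_prop) (fun s hs => by
      have hp : 0 < v - s := sub_pos.2 hs.2
      have h1 := (((hasDerivAt_id s).const_sub v).sqrt hp.ne').const_mul (2 : ℝ) |>.neg
      refine h1.congr_deriv ?_
      simp only [id]
      field_simp) (fun s hs => by positivity)
  refine ⟨this.1, this.2.trans ?_⟩
  simp

theorem intOn_rsqrt_left {u v : ℝ} (huv : u ≤ v) : IntOn (fun s => 1 / √(s - u)) u v ∧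
    (∫ s in u..v, 1 / √(s - u)) = 2 * √(v - u) := by
  have := ftc_of_nonneg huv (F := fun s => 2 * √(s - u)) (f := fun s => 1 / √(s - u))
    (by fun_prop) (fun s hs => by
      have hp : 0 < s - u := sub_pos.2 hs.1
      have h1 := (((hasDerivAt_id s).sub_const u).sqrt hp.ne').const_mul (2 : ℝ)
      refine h1.congr_deriv ?_
      simp only [id]
      field_simp) (fun s hs => by positivity)
  refine ⟨this.1, this.2.trans ?_⟩
  simp

theorem intOn_rsqrt_both {u v : ℝ} (huv : u < v) : IntOn (fun s => 1 / √((s - u) * (v - s))) u v ∧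
    (∫ s in u..v, 1 / √((s - u) * (v - s))) = Real.pi := by
  have hvu : 0 < v - u := sub_pos.2 huv
  have := ftc_of_nonneg huv.le (F := fun s => Real.arcsin ((2 * s - u - v) / (v - u)))
    (f := fun s => 1 / √((s - u) * (v - s)))
    (Real.continuous_arcsin.comp (by fun_prop)).continuousOn (fun s hs => by
      have h1 : 0 < s - u := sub_pos.2 hs.1
      have h2 : 0 < v - s := sub_pos.2 hs.2
      have hx1 : (2 * s - u - v) / (v - u) ≠ -1 := by
        rw [Ne, div_eq_iff hvu.ne']; intro h; linarith
      have hx2 : (2 * s - u - v) / (v - u) ≠ 1 := by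
        rw [Ne, div_eq_iff hvu.ne']; intro h; linarith
      have hl : HasDerivAt (fun s => (2 * s - u - v) / (v - u)) (2 / (v - u)) s := by
        have := ((((hasDerivAt_id s).const_mul (2 : ℝ)).sub_const u).sub_const v).div_const (v - u)
        simpa using this
      have h3 := (Real.hasDerivAt_arcsin hx1 hx2).comp s hl
      refine h3.congr_deriv ?_
      have h4 : 1 - ((2 * s - u - v) / (v - u)) ^ 2 = (2 / (v - u)) ^ 2 * ((s - u) * (v - s)) := by
        field_simp
        ring
      rw [h4, Real.sqrt_mul (by positivity), Real.sqrt_sq (by positivity)]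
      have : 0 < √((s - u) * (v - s)) := Real.sqrt_pos.2 (mul_pos h1 h2)
      field_simp) (fun s hs => by positivity)
  refine ⟨this.1, this.2.trans ?_⟩
  have e1 : (2 * v - u - v) / (v - u) = 1 := by rw [div_eq_one_iff_eq hvu.ne']; ring
  have e2 : (2 * u - u - v) / (v - u) = -1 := by rw [div_eq_iff hvu.ne']; ring
  simp only [e1, e2, Real.arcsin_one, Real.arcsin_neg_one]
  ring

/-- Normalized form of `∫ G s / √(v - s)` over `(u, v)`. -/
noncomputable def intR (u v : ℝ) (G : ℝ → ℝ) : ℝ :=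
  ∫ σ in (0 : ℝ)..1, 1 / √(1 - σ) * G (u + (v - u) * σ)

/-- Normalized form of `∫ G s / √(s - u)` over `(u, v)`. -/
noncomputable def intL (u v : ℝ) (G : ℝ → ℝ) : ℝ :=
  ∫ σ in (0 : ℝ)..1, 1 / √σ * G (u + (v - u) * σ)

/-- Normalized form of `∫ G s / √((s - u) * (v - s))` over `(u, v)`. -/
noncomputable def intB (u v : ℝ) (G : ℝ → ℝ) : ℝ :=
  ∫ σ in (0 : ℝ)..1, 1 / √(σ * (1 - σ)) * G (u + (v - u) * σ)

theorem integral_eq_unit (u v : ℝ) (F : ℝ → ℝ) :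
    (∫ s in u..v, F s) = ∫ σ in (0 : ℝ)..1, (v - u) * F (u + (v - u) * σ) := by
  have := intervalIntegral.smul_integral_comp_add_mul (a := 0) (b := 1) F (v - u) u
  rw [intervalIntegral.integral_const_mul, ← smul_eq_mul, this]
  simp

theorem integral_div_sqrt_right {u v : ℝ} (huv : u ≤ v) (G : ℝ → ℝ) :
    (∫ s in u..v, G s / √(v - s)) = √(v - u) * intR u v G := by
  rw [integral_eq_unit, intR, ← intervalIntegral.integral_const_mul]
  refine integral_congr_Ioo zero_le_one fun σ hσ => ?_
  have h0 : 0 ≤ v - u := sub_nonneg.2 huv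
  have e : v - (u + (v - u) * σ) = (v - u) * (1 - σ) := by ring
  rw [e, Real.sqrt_mul h0]
  nth_rewrite 1 [← Real.mul_self_sqrt h0]
  -- The interval may be degenerate, in which case both sides vanish.
  rcases eq_or_ne (√(v - u)) 0 with h | h
  · simp [h]
  · have : √(1 - σ) ≠ 0 := (Real.sqrt_pos.2 (sub_pos.2 hσ.2)).ne'
    field_simp

theorem integral_div_sqrt_left {u v : ℝ} (huv : u ≤ v) (G : ℝ → ℝ) :
    (∫ s in u..v, G s / √(s - u)) = √(v - u) * intL u v G := by
  rw [integral_eq_unit, intL, ← intervalIntegral.integral_const_mul]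
  refine integral_congr_Ioo zero_le_one fun σ hσ => ?_
  have h0 : 0 ≤ v - u := sub_nonneg.2 huv
  have e : u + (v - u) * σ - u = (v - u) * σ := by ring
  rw [e, Real.sqrt_mul h0]
  nth_rewrite 1 [← Real.mul_self_sqrt h0]
  rcases eq_or_ne (√(v - u)) 0 with h | h
  · simp [h]
  · have : √σ ≠ 0 := (Real.sqrt_pos.2 hσ.1).ne'
    field_simp

theorem integral_div_sqrt_both {u v : ℝ} (huv : u < v) (G : ℝ → ℝ) :
    (∫ s in u..v, G s / √((s - u) * (v - s))) = intB u v G := by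
  rw [integral_eq_unit, intB]
  refine integral_congr_Ioo zero_le_one fun σ hσ => ?_
  have h0 : 0 < v - u := sub_pos.2 huv
  have e : (u + (v - u) * σ - u) * (v - (u + (v - u) * σ)) = (v - u) ^ 2 * (σ * (1 - σ)) := by ring
  rw [e, Real.sqrt_mul (by positivity), Real.sqrt_sq h0.le]
  have : √(σ * (1 - σ)) ≠ 0 := (Real.sqrt_pos.2 (mul_pos hσ.1 (sub_pos.2 hσ.2))).ne'
  field_simp

/-- This is why a period survives the collision of its own end points: the length of the interval
cancels in the normalized form, and only the mass π of the weight remains. -/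
theorem intB_self (u : ℝ) (G : ℝ → ℝ) : intB u u G = Real.pi * G u := by
  have := (intOn_rsqrt_both (u := 0) (v := 1) one_pos).2
  simp only [sub_zero] at this
  simp only [intB, sub_self, zero_mul, add_zero]
  rw [intervalIntegral.integral_mul_const, this]

theorem intOn_weight_both : IntOn (fun σ => 1 / √(σ * (1 - σ))) 0 1 := by
  simpa using (intOn_rsqrt_both (u := 0) (v := 1) one_pos).1

theorem intOn_weight_right : IntOn (fun σ => 1 / √(1 - σ)) 0 1 :=
  (intOn_rsqrt_right (u := 0) (v := 1) zero_le_one).1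

theorem intOn_weight_left : IntOn (fun σ => 1 / √σ) 0 1 := by
  simpa using (intOn_rsqrt_left (u := 0) (v := 1) zero_le_one).1

/-! ### Analytic dependence on parameters -/

section

variable {X : Type*} [NormedAddCommGroup X] [NormedSpace ℝ X] {x₀ : X} {u v : X → ℝ}

theorem IsAnalyticFamily.affine (hu : AnalyticAt ℝ u x₀) (hv : AnalyticAt ℝ v x₀) :
    IsAnalyticFamily (fun x σ => u x + (v x - u x) * σ) x₀ :=
  (param hu).add ((param (hv.sub hu)).mul (of_continuous continuous_id))

theorem analyticAt_intR {G : X → ℝ → ℝ}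
    (h : IsAnalyticFamily (fun x σ => G x (u x + (v x - u x) * σ)) x₀) :
    AnalyticAt ℝ (fun x => intR (u x) (v x) (G x)) x₀ :=
  h.analyticAt_integral intOn_weight_right

theorem analyticAt_intL {G : X → ℝ → ℝ}
    (h : IsAnalyticFamily (fun x σ => G x (u x + (v x - u x) * σ)) x₀) :
    AnalyticAt ℝ (fun x => intL (u x) (v x) (G x)) x₀ :=
  h.analyticAt_integral intOn_weight_left

theorem analyticAt_intB {G : X → ℝ → ℝ}
    (h : IsAnalyticFamily (fun x σ => G x (u x + (v x - u x) * σ)) x₀) :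
    AnalyticAt ℝ (fun x => intB (u x) (v x) (G x)) x₀ :=
  h.analyticAt_integral intOn_weight_both

end

theorem affine_mem_Icc {u v σ : ℝ} (huv : u ≤ v) (hσ : σ ∈ Icc (0 : ℝ) 1) :
    u + (v - u) * σ ∈ Icc u v := by
  constructor <;> nlinarith [hσ.1, hσ.2]

theorem intOn_unit_of_continuousOn {w G : ℝ → ℝ} (hw : IntOn w 0 1) {u v : ℝ} (huv : u ≤ v)
    (hG : ContinuousOn G (Icc u v)) : IntOn (fun σ => w σ * G (u + (v - u) * σ)) 0 1 := by
  refine hw.mul_continuousOn ?_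
  rw [uIcc_of_le zero_le_one]
  exact hG.comp (by fun_prop) fun σ hσ => affine_mem_Icc huv hσ

/-! ### Positivity and linearity of the normalized integrals -/

theorem intR_pos {u v : ℝ} (huv : u ≤ v) {G : ℝ → ℝ} (hG : ContinuousOn G (Icc u v))
    (hp : ∀ s ∈ Icc u v, 0 < G s) : 0 < intR u v G := by
  refine intervalIntegral.intervalIntegral_pos_of_pos_on
    (intOn_unit_of_continuousOn intOn_weight_right huv hG) (fun σ hσ => ?_) one_pos
  have h1 : 0 < √(1 - σ) := Real.sqrt_pos.2 (sub_pos.2 hσ.2)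
  have h2 := hp _ (affine_mem_Icc huv ⟨hσ.1.le, hσ.2.le⟩)
  positivity

theorem intB_pos {u v : ℝ} (huv : u ≤ v) {G : ℝ → ℝ} (hG : ContinuousOn G (Icc u v))
    (hp : ∀ s ∈ Icc u v, 0 < G s) : 0 < intB u v G := by
  refine intervalIntegral.intervalIntegral_pos_of_pos_on
    (intOn_unit_of_continuousOn intOn_weight_both huv hG) (fun σ hσ => ?_) one_pos
  have h1 : 0 < √(σ * (1 - σ)) := Real.sqrt_pos.2 (mul_pos hσ.1 (sub_pos.2 hσ.2))
  have h2 := hp _ (affine_mem_Icc huv ⟨hσ.1.le, hσ.2.le⟩)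
  positivity

theorem intR_mono {u v : ℝ} (huv : u ≤ v) {G H : ℝ → ℝ} (hG : ContinuousOn G (Icc u v))
    (hH : ContinuousOn H (Icc u v)) (h : ∀ s ∈ Icc u v, G s ≤ H s) : intR u v G ≤ intR u v H :=
  integral_le_of_le_Ioo zero_le_one (intOn_unit_of_continuousOn intOn_weight_right huv hG)
    (intOn_unit_of_continuousOn intOn_weight_right huv hH) fun σ hσ =>
    mul_le_mul_of_nonneg_left (h _ (affine_mem_Icc huv ⟨hσ.1.le, hσ.2.le⟩)) (by positivity)

theorem intB_mono {u v : ℝ} (huv : u ≤ v) {G H : ℝ → ℝ} (hG : ContinuousOn G (Icc u v))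
    (hH : ContinuousOn H (Icc u v)) (h : ∀ s ∈ Icc u v, G s ≤ H s) : intB u v G ≤ intB u v H :=
  integral_le_of_le_Ioo zero_le_one (intOn_unit_of_continuousOn intOn_weight_both huv hG)
    (intOn_unit_of_continuousOn intOn_weight_both huv hH) fun σ hσ =>
    mul_le_mul_of_nonneg_left (h _ (affine_mem_Icc huv ⟨hσ.1.le, hσ.2.le⟩)) (by positivity)

theorem intR_const_mul (u v r : ℝ) (G : ℝ → ℝ) :
    intR u v (fun s => r * G s) = r * intR u v G := by
  rw [intR, intR, ← intervalIntegral.integral_const_mul]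
  congr 1; ext σ; ring

theorem intB_const_mul (u v r : ℝ) (G : ℝ → ℝ) :
    intB u v (fun s => r * G s) = r * intB u v G := by
  rw [intB, intB, ← intervalIntegral.integral_const_mul]
  congr 1; ext σ; ring

theorem intR_sub {u v : ℝ} (huv : u ≤ v) {G H : ℝ → ℝ} (hG : ContinuousOn G (Icc u v))
    (hH : ContinuousOn H (Icc u v)) : intR u v (fun s => G s - H s) = intR u v G - intR u v H := by
  rw [intR, intR, intR, ← intervalIntegral.integral_sub
    (intOn_unit_of_continuousOn intOn_weight_right huv hG)
    (intOn_unit_of_continuousOn intOn_weight_right huv hH)]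
  congr 1; ext σ; ring

theorem intB_sub {u v : ℝ} (huv : u ≤ v) {G H : ℝ → ℝ} (hG : ContinuousOn G (Icc u v))
    (hH : ContinuousOn H (Icc u v)) : intB u v (fun s => G s - H s) = intB u v G - intB u v H := by
  rw [intB, intB, intB, ← intervalIntegral.integral_sub
    (intOn_unit_of_continuousOn intOn_weight_both huv hG)
    (intOn_unit_of_continuousOn intOn_weight_both huv hH)]
  congr 1; ext σ; ring

theorem intR_congr {u v : ℝ} (huv : u ≤ v) {G H : ℝ → ℝ} (h : ∀ s ∈ Icc u v, G s = H s) :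
    intR u v G = intR u v H :=
  integral_congr_Ioo zero_le_one fun σ hσ => by
    simp only [h _ (affine_mem_Icc huv ⟨hσ.1.le, hσ.2.le⟩)]

theorem intB_congr {u v : ℝ} (huv : u ≤ v) {G H : ℝ → ℝ} (h : ∀ s ∈ Icc u v, G s = H s) :
    intB u v G = intB u v H :=
  integral_congr_Ioo zero_le_one fun σ hσ => by
    simp only [h _ (affine_mem_Icc huv ⟨hσ.1.le, hσ.2.le⟩)]

theorem continuousOn_rsqrt {g : ℝ → ℝ} (hg : Continuous g) {S : Set ℝ} (h : ∀ s ∈ S, 0 < g s) :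
    ContinuousOn (fun s => 1 / √(g s)) S :=
  continuousOn_const.div hg.sqrt.continuousOn fun s hs => (Real.sqrt_pos.2 (h s hs)).ne'

/-! ### Normalized periods -/

/-- The factor of the integrand on `(0, c₁)` that is regular at `c₁`. -/
noncomputable def weight0 (c2 c3 c4 c5 s : ℝ) : ℝ :=
  1 / √((c2 - s) * (c3 - s) * (c4 - s) * (c5 - s))

/-- The factor of the integrand on `(c₂, c₃)` that is regular at the end points. -/
noncomputable def weight1 (c1 c4 c5 s : ℝ) : ℝ := 1 / √((s - c1) * (c4 - s) * (c5 - s))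

/-- The factor of the integrand on `(c₄, c₅)` that is regular at the end points. -/
noncomputable def weight2 (c1 c2 c3 s : ℝ) : ℝ := 1 / √((s - c1) * (s - c2) * (s - c3))

/-- The period over `(0, c₁)` divided by `√c₁`. -/
noncomputable def normK0 (i : ℕ) (c1 c2 c3 c4 c5 : ℝ) : ℝ :=
  intR 0 c1 fun s => s ^ i * weight0 c2 c3 c4 c5 s

/-- The period over `(c₂, c₃)`, in a form that makes sense for `c₂ = c₃`. -/
noncomputable def normK1 (i : ℕ) (c1 c2 c3 c4 c5 : ℝ) : ℝ :=
  intB c2 c3 fun s => s ^ i * weight1 c1 c4 c5 s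

/-- The period over `(c₄, c₅)`, in a form that makes sense for `c₄ = c₅`. -/
noncomputable def normK2 (i : ℕ) (c1 c2 c3 c4 c5 : ℝ) : ℝ :=
  intB c4 c5 fun s => s ^ i * weight2 c1 c2 c3 s

section weights

variable {c1 c2 c3 c4 c5 : ℝ}

theorem weight0_pos (h2 : c1 < c2) (h3 : c1 < c3) (h4 : c1 < c4) (h5 : c1 < c5) {s : ℝ}
    (hs : s ∈ Icc 0 c1) : 0 < weight0 c2 c3 c4 c5 s := by
  have := hs.2
  refine one_div_pos.2 (Real.sqrt_pos.2 (mul_pos (mul_pos (mul_pos ?_ ?_) ?_) ?_)) <;> linarith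

theorem weight1_pos (h2 : c1 < c2) (h4 : c3 < c4) (h5 : c3 < c5) {s : ℝ}
    (hs : s ∈ Icc c2 c3) : 0 < weight1 c1 c4 c5 s := by
  obtain ⟨_, _⟩ := hs
  refine one_div_pos.2 (Real.sqrt_pos.2 (mul_pos (mul_pos ?_ ?_) ?_)) <;> linarith

theorem weight2_pos (h1 : c1 < c4) (h2 : c2 < c4) (h3 : c3 < c4) {s : ℝ}
    (hs : s ∈ Icc c4 c5) : 0 < weight2 c1 c2 c3 s := by
  obtain ⟨_, _⟩ := hs
  refine one_div_pos.2 (Real.sqrt_pos.2 (mul_pos (mul_pos ?_ ?_) ?_)) <;> linarith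

theorem continuousOn_weight0 (h2 : c1 < c2) (h3 : c1 < c3) (h4 : c1 < c4) (h5 : c1 < c5) :
    ContinuousOn (weight0 c2 c3 c4 c5) (Icc 0 c1) :=
  continuousOn_rsqrt (by fun_prop) fun s hs =>
    Real.sqrt_pos.1 (one_div_pos.1 (weight0_pos h2 h3 h4 h5 hs))

theorem continuousOn_weight1 (h2 : c1 < c2) (h4 : c3 < c4) (h5 : c3 < c5) :
    ContinuousOn (weight1 c1 c4 c5) (Icc c2 c3) :=
  continuousOn_rsqrt (by fun_prop) fun s hs =>
    Real.sqrt_pos.1 (one_div_pos.1 (weight1_pos h2 h4 h5 hs))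

theorem continuousOn_weight2 (h1 : c1 < c4) (h2 : c2 < c4) (h3 : c3 < c4) :
    ContinuousOn (weight2 c1 c2 c3) (Icc c4 c5) :=
  continuousOn_rsqrt (by fun_prop) fun s hs =>
    Real.sqrt_pos.1 (one_div_pos.1 (weight2_pos h1 h2 h3 hs))

theorem normK0_pos (h1 : 0 ≤ c1) (h2 : c1 < c2) (h3 : c1 < c3) (h4 : c1 < c4) (h5 : c1 < c5) :
    0 < normK0 0 c1 c2 c3 c4 c5 := by
  simp only [normK0, pow_zero, one_mul]
  exact intR_pos h1 (continuousOn_weight0 h2 h3 h4 h5) fun s hs => weight0_pos h2 h3 h4 h5 hs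

theorem normK1_pos (h2 : c1 < c2) (h3 : c2 ≤ c3) (h4 : c3 < c4) (h5 : c3 < c5) :
    0 < normK1 0 c1 c2 c3 c4 c5 := by
  simp only [normK1, pow_zero, one_mul]
  exact intB_pos h3 (continuousOn_weight1 h2 h4 h5) fun s hs => weight1_pos h2 h4 h5 hs

theorem normK2_pos (h1 : c1 < c4) (h2 : c2 < c4) (h3 : c3 < c4) (h5 : c4 ≤ c5) :
    0 < normK2 0 c1 c2 c3 c4 c5 := by
  simp only [normK2, pow_zero, one_mul]
  exact intB_pos h5 (continuousOn_weight2 h1 h2 h3) fun s hs => weight2_pos h1 h2 h3 hs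

/-- On the interval of integration s is at most its right end point. This and the next three
comparisons locate the mean value of s for each period, which is all that the positivity statements
for `freqDet` and `normFreq` need. -/
theorem normK0_one_le (h1 : 0 ≤ c1) (h2 : c1 < c2) (h3 : c1 < c3) (h4 : c1 < c4) (h5 : c1 < c5) :
    normK0 1 c1 c2 c3 c4 c5 ≤ c1 * normK0 0 c1 c2 c3 c4 c5 := by
  have hw := continuousOn_weight0 h2 h3 h4 h5
  simp only [normK0, pow_zero, one_mul, pow_one]
  rw [← intR_const_mul]
  exact intR_mono h1 (continuousOn_id.mul hw) (continuousOn_const.mul hw) fun s hs =>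
    mul_le_mul_of_nonneg_right hs.2 (weight0_pos h2 h3 h4 h5 hs).le

theorem normK1_one_le (h2 : c1 < c2) (h3 : c2 ≤ c3) (h4 : c3 < c4) (h5 : c3 < c5) :
    normK1 1 c1 c2 c3 c4 c5 ≤ c3 * normK1 0 c1 c2 c3 c4 c5 := by
  have hw := continuousOn_weight1 h2 h4 h5
  simp only [normK1, pow_zero, one_mul, pow_one]
  rw [← intB_const_mul]
  exact intB_mono h3 (continuousOn_id.mul hw) (continuousOn_const.mul hw) fun s hs =>
    mul_le_mul_of_nonneg_right hs.2 (weight1_pos h2 h4 h5 hs).le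

theorem le_normK1_one (h2 : c1 < c2) (h3 : c2 ≤ c3) (h4 : c3 < c4) (h5 : c3 < c5) :
    c2 * normK1 0 c1 c2 c3 c4 c5 ≤ normK1 1 c1 c2 c3 c4 c5 := by
  have hw := continuousOn_weight1 h2 h4 h5
  simp only [normK1, pow_zero, one_mul, pow_one]
  rw [← intB_const_mul]
  exact intB_mono h3 (continuousOn_const.mul hw) (continuousOn_id.mul hw) fun s hs =>
    mul_le_mul_of_nonneg_right hs.1 (weight1_pos h2 h4 h5 hs).le

theorem le_normK2_one (h1 : c1 < c4) (h2 : c2 < c4) (h3 : c3 < c4) (h5 : c4 ≤ c5) :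
    c4 * normK2 0 c1 c2 c3 c4 c5 ≤ normK2 1 c1 c2 c3 c4 c5 := by
  have hw := continuousOn_weight2 (c5 := c5) h1 h2 h3
  simp only [normK2, pow_zero, one_mul, pow_one]
  rw [← intB_const_mul]
  exact intB_mono h5 (continuousOn_const.mul hw) (continuousOn_id.mul hw) fun s hs =>
    mul_le_mul_of_nonneg_right hs.1 (weight2_pos h1 h2 h3 hs).le

/-- The zeroth and first moments combine to any linear factor d - s. It is used with d a double root
of the quintic, where the factor cancels √((d - s)²). -/
theorem sub_mul_normK0 (h1 : 0 ≤ c1) (h2 : c1 < c2) (h3 : c1 < c3) (h4 : c1 < c4) (h5 : c1 < c5)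
    (d : ℝ) : d * normK0 0 c1 c2 c3 c4 c5 - normK0 1 c1 c2 c3 c4 c5 =
      intR 0 c1 fun s => (d - s) * weight0 c2 c3 c4 c5 s := by
  have hw := continuousOn_weight0 h2 h3 h4 h5
  simp only [normK0, pow_zero, one_mul, pow_one]
  rw [← intR_const_mul, ← intR_sub h1 (G := fun s => d * weight0 c2 c3 c4 c5 s) (H := fun s => s * weight0 c2 c3 c4 c5 s)
    (continuousOn_const.mul hw) (continuousOn_id.mul hw)]
  congr 1; ext s; ring

theorem sub_mul_normK1 (h2 : c1 < c2) (h3 : c2 ≤ c3) (h4 : c3 < c4) (h5 : c3 < c5)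
    (d : ℝ) : d * normK1 0 c1 c2 c3 c4 c5 - normK1 1 c1 c2 c3 c4 c5 =
      intB c2 c3 fun s => (d - s) * weight1 c1 c4 c5 s := by
  have hw := continuousOn_weight1 h2 h4 h5
  simp only [normK1, pow_zero, one_mul, pow_one]
  rw [← intB_const_mul, ← intB_sub h3 (G := fun s => d * weight1 c1 c4 c5 s) (H := fun s => s * weight1 c1 c4 c5 s)
    (continuousOn_const.mul hw) (continuousOn_id.mul hw)]
  congr 1; ext s; ring

theorem sub_mul_normK2 (h1 : c1 < c4) (h2 : c2 < c4) (h3 : c3 < c4) (h5 : c4 ≤ c5)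
    (d : ℝ) : d * normK2 0 c1 c2 c3 c4 c5 - normK2 1 c1 c2 c3 c4 c5 =
      intB c4 c5 fun s => (d - s) * weight2 c1 c2 c3 s := by
  have hw := continuousOn_weight2 (c5 := c5) h1 h2 h3
  simp only [normK2, pow_zero, one_mul, pow_one]
  rw [← intB_const_mul, ← intB_sub h5 (G := fun s => d * weight2 c1 c2 c3 s) (H := fun s => s * weight2 c1 c2 c3 s)
    (continuousOn_const.mul hw) (continuousOn_id.mul hw)]
  congr 1; ext s; ring

/-- `∏ (cᵢ - s)` for five parameters. -/
def quintic (c1 c2 c3 c4 c5 s : ℝ) : ℝ := (c1 - s) * (c2 - s) * (c3 - s) * (c4 - s) * (c5 - s)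

theorem rsqrt_quintic_zero {s : ℝ} (hs : s ≤ c1) :
    1 / √(quintic c1 c2 c3 c4 c5 s) = weight0 c2 c3 c4 c5 s / √(c1 - s) := by
  have : quintic c1 c2 c3 c4 c5 s = (c1 - s) * ((c2 - s) * (c3 - s) * (c4 - s) * (c5 - s)) := by
    rw [quintic]; ring
  rw [this, Real.sqrt_mul (sub_nonneg.2 hs), weight0, div_div, mul_comm]

theorem rsqrt_quintic_one {s : ℝ} (hs : s ∈ Icc c2 c3) :
    1 / √(quintic c1 c2 c3 c4 c5 s) = weight1 c1 c4 c5 s / √((s - c2) * (c3 - s)) := by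
  have : quintic c1 c2 c3 c4 c5 s =
      ((s - c2) * (c3 - s)) * ((s - c1) * (c4 - s) * (c5 - s)) := by
    rw [quintic]; ring
  rw [this, Real.sqrt_mul (mul_nonneg (sub_nonneg.2 hs.1) (sub_nonneg.2 hs.2)), weight1, div_div,
    mul_comm]

theorem rsqrt_quintic_two {s : ℝ} (hs : s ∈ Icc c4 c5) :
    1 / √(quintic c1 c2 c3 c4 c5 s) = weight2 c1 c2 c3 s / √((s - c4) * (c5 - s)) := by
  have : quintic c1 c2 c3 c4 c5 s =
      ((s - c4) * (c5 - s)) * ((s - c1) * (s - c2) * (s - c3)) := by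
    rw [quintic]; ring
  rw [this, Real.sqrt_mul (mul_nonneg (sub_nonneg.2 hs.1) (sub_nonneg.2 hs.2)), weight2, div_div,
    mul_comm]

theorem integral_quintic_zero (h : 0 ≤ c1) (i : ℕ) :
    (∫ s in (0 : ℝ)..c1, s ^ i / √(quintic c1 c2 c3 c4 c5 s)) =
      √c1 * normK0 i c1 c2 c3 c4 c5 := by
  have := integral_div_sqrt_right h (fun s => s ^ i * weight0 c2 c3 c4 c5 s)
  rw [sub_zero] at this
  rw [normK0, ← this]
  refine integral_congr_Ioo h fun s hs => ?_
  rw [div_eq_mul_one_div, rsqrt_quintic_zero hs.2.le, mul_div_assoc]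

theorem integral_quintic_one (h : c2 < c3) (i : ℕ) :
    (∫ s in c2..c3, s ^ i / √(quintic c1 c2 c3 c4 c5 s)) = normK1 i c1 c2 c3 c4 c5 := by
  rw [normK1, ← integral_div_sqrt_both h]
  refine integral_congr_Ioo h.le fun s hs => ?_
  rw [div_eq_mul_one_div, rsqrt_quintic_one ⟨hs.1.le, hs.2.le⟩, mul_div_assoc]

theorem integral_quintic_two (h : c4 < c5) (i : ℕ) :
    (∫ s in c4..c5, s ^ i / √(quintic c1 c2 c3 c4 c5 s)) = normK2 i c1 c2 c3 c4 c5 := by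
  rw [normK2, ← integral_div_sqrt_both h]
  refine integral_congr_Ioo h.le fun s hs => ?_
  rw [div_eq_mul_one_div, rsqrt_quintic_two ⟨hs.1.le, hs.2.le⟩, mul_div_assoc]

end weights

/-! ### The normalized frequency -/

/-- The determinant of the linear system for the normalized frequency. -/
noncomputable def freqDet (c1 c2 c3 c4 c5 : ℝ) : ℝ :=
  normK1 0 c1 c2 c3 c4 c5 * normK2 1 c1 c2 c3 c4 c5 -
    normK1 1 c1 c2 c3 c4 c5 * normK2 0 c1 c2 c3 c4 c5

/-- The frequency divided by `√c₁`. -/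
noncomputable def normFreq (c1 c2 c3 c4 c5 : ℝ) : ℝ × ℝ :=
  ((normK0 0 c1 c2 c3 c4 c5 * normK2 1 c1 c2 c3 c4 c5 -
      normK0 1 c1 c2 c3 c4 c5 * normK2 0 c1 c2 c3 c4 c5) / (2 * freqDet c1 c2 c3 c4 c5),
    (normK0 0 c1 c2 c3 c4 c5 * normK1 1 c1 c2 c3 c4 c5 -
      normK0 1 c1 c2 c3 c4 c5 * normK1 0 c1 c2 c3 c4 c5) / (2 * freqDet c1 c2 c3 c4 c5))

section normFreq

variable {c1 c2 c3 c4 c5 : ℝ}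

/-- The quotients of first by zeroth moments are mean values of s: at most c₃ on the middle interval
and at least c₄ on the last one. -/
theorem freqDet_pos (h2 : c1 < c2) (h3 : c2 ≤ c3) (h4 : c3 < c4) (h5 : c4 ≤ c5) :
    0 < freqDet c1 c2 c3 c4 c5 := by
  have p1 := normK1_pos h2 h3 h4 (h4.trans_le h5)
  have p2 := normK2_pos (by linarith) (by linarith : c2 < c4) h4 h5 (c1 := c1)
  have q1 := normK1_one_le h2 h3 h4 (h4.trans_le h5)
  have q2 := le_normK2_one (by linarith) (by linarith : c2 < c4) h4 h5 (c1 := c1)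
  have := mul_pos (mul_pos p1 p2) (sub_pos.2 h4)
  rw [freqDet]
  nlinarith

/-- The numerators are positive for the same reason as the determinant: mean values of s over (0,c₁)
and (c₄,c₅) are compared for the first component, over (0,c₁) and (c₂,c₃) for the second. -/
theorem normFreq_pos (h1 : 0 ≤ c1) (h2 : c1 < c2) (h3 : c2 ≤ c3) (h4 : c3 < c4) (h5 : c4 ≤ c5) :
    0 < (normFreq c1 c2 c3 c4 c5).1 ∧ 0 < (normFreq c1 c2 c3 c4 c5).2 := by
  have hD := freqDet_pos h2 h3 h4 h5
  have p0 := normK0_pos h1 h2 (by linarith) (by linarith : c1 < c4) (by linarith : c1 < c5)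
    (c3 := c3)
  have p1 := normK1_pos h2 h3 h4 (h4.trans_le h5)
  have p2 := normK2_pos (by linarith) (by linarith : c2 < c4) h4 h5 (c1 := c1)
  have q0 := normK0_one_le h1 h2 (by linarith) (by linarith : c1 < c4) (by linarith : c1 < c5)
    (c3 := c3)
  have q1 := le_normK1_one h2 h3 h4 (h4.trans_le h5)
  have q2 := le_normK2_one (by linarith) (by linarith : c2 < c4) h4 h5 (c1 := c1)
  constructor
  · refine div_pos ?_ (by positivity)
    have := mul_pos (mul_pos p0 p2) (by linarith : 0 < c4 - c1)
    nlinarith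
  · refine div_pos ?_ (by positivity)
    have := mul_pos (mul_pos p0 p1) (by linarith : 0 < c2 - c1)
    nlinarith

/-- Cramer's rule. The scalar x will be √c₁, the factor that was removed from the first period. -/
theorem normFreq_unique (hD : freqDet c1 c2 c3 c4 c5 ≠ 0) (x : ℝ) (w : ℝ × ℝ) :
    (∀ i ∈ ({0, 1} : Set ℕ), x * normK0 i c1 c2 c3 c4 c5 +
      2 * (-(w.1 * normK1 i c1 c2 c3 c4 c5) + w.2 * normK2 i c1 c2 c3 c4 c5) = 0) ↔
    w = x • normFreq c1 c2 c3 c4 c5 := by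
  obtain ⟨w1, w2⟩ := w
  constructor
  · intro h
    have e0 := h 0 (by simp)
    have e1 := h 1 (by simp)
    simp only at e0 e1
    ext
    · simp only [normFreq, Prod.smul_mk, smul_eq_mul]
      rw [← mul_div_assoc, eq_div_iff (by simpa using hD), freqDet]
      linear_combination -normK2 1 c1 c2 c3 c4 c5 * e0 + normK2 0 c1 c2 c3 c4 c5 * e1
    · simp only [normFreq, Prod.smul_mk, smul_eq_mul]
      rw [← mul_div_assoc, eq_div_iff (by simpa using hD), freqDet]
      linear_combination -normK1 1 c1 c2 c3 c4 c5 * e0 + normK1 0 c1 c2 c3 c4 c5 * e1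
  · intro h
    obtain ⟨rfl, rfl⟩ := Prod.mk.inj h
    intro i hi
    simp only [normFreq, smul_eq_mul]
    rcases hi with rfl | rfl <;>
    · field_simp
      rw [freqDet]
      ring

end normFreq

/-! ### Analyticity of the normalized periods -/

section analytic

variable {X : Type*} [NormedAddCommGroup X] [NormedSpace ℝ X] {x₀ : X}
  {c1 c2 c3 c4 c5 : X → ℝ}

theorem analyticAt_normK0 (a1 : AnalyticAt ℝ c1 x₀) (a2 : AnalyticAt ℝ c2 x₀)
    (a3 : AnalyticAt ℝ c3 x₀) (a4 : AnalyticAt ℝ c4 x₀) (a5 : AnalyticAt ℝ c5 x₀)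
    (h1 : 0 ≤ c1 x₀) (h2 : c1 x₀ < c2 x₀) (h3 : c1 x₀ < c3 x₀) (h4 : c1 x₀ < c4 x₀)
    (h5 : c1 x₀ < c5 x₀) (i : ℕ) :
    AnalyticAt ℝ (fun x => normK0 i (c1 x) (c2 x) (c3 x) (c4 x) (c5 x)) x₀ := by
  have ha := IsAnalyticFamily.affine (analyticAt_const (v := (0 : ℝ))) a1
  refine analyticAt_intR (u := fun _ => 0) (v := c1) ((ha.pow i).mul (.rsqrt
    (.mul (.mul (.mul (.sub (.param a2) ha) (.sub (.param a3) ha)) (.sub (.param a4) ha))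
      (.sub (.param a5) ha)) fun σ hσ => ?_))
  have := (affine_mem_Icc h1 hσ).2
  refine mul_pos (mul_pos (mul_pos ?_ ?_) ?_) ?_ <;> linarith

theorem analyticAt_normK1 (a1 : AnalyticAt ℝ c1 x₀) (a2 : AnalyticAt ℝ c2 x₀)
    (a3 : AnalyticAt ℝ c3 x₀) (a4 : AnalyticAt ℝ c4 x₀) (a5 : AnalyticAt ℝ c5 x₀)
    (h2 : c1 x₀ < c2 x₀) (h3 : c2 x₀ ≤ c3 x₀) (h4 : c3 x₀ < c4 x₀)
    (h5 : c3 x₀ < c5 x₀) (i : ℕ) :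
    AnalyticAt ℝ (fun x => normK1 i (c1 x) (c2 x) (c3 x) (c4 x) (c5 x)) x₀ := by
  have ha := IsAnalyticFamily.affine a2 a3
  refine analyticAt_intB (u := c2) (v := c3) ((ha.pow i).mul (.rsqrt
    (.mul (.mul (.sub ha (.param a1)) (.sub (.param a4) ha)) (.sub (.param a5) ha))
      fun σ hσ => ?_))
  have := affine_mem_Icc h3 hσ
  refine mul_pos (mul_pos ?_ ?_) ?_ <;> linarith [this.1, this.2]

theorem analyticAt_normK2 (a1 : AnalyticAt ℝ c1 x₀) (a2 : AnalyticAt ℝ c2 x₀)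
    (a3 : AnalyticAt ℝ c3 x₀) (a4 : AnalyticAt ℝ c4 x₀) (a5 : AnalyticAt ℝ c5 x₀)
    (h1 : c1 x₀ < c4 x₀) (h2 : c2 x₀ < c4 x₀) (h3 : c3 x₀ < c4 x₀)
    (h5 : c4 x₀ ≤ c5 x₀) (i : ℕ) :
    AnalyticAt ℝ (fun x => normK2 i (c1 x) (c2 x) (c3 x) (c4 x) (c5 x)) x₀ := by
  have ha := IsAnalyticFamily.affine a4 a5
  refine analyticAt_intB (u := c4) (v := c5) ((ha.pow i).mul (.rsqrt
    (.mul (.mul (.sub ha (.param a1)) (.sub ha (.param a2))) (.sub ha (.param a3)))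
      fun σ hσ => ?_))
  have := affine_mem_Icc h5 hσ
  refine mul_pos (mul_pos ?_ ?_) ?_ <;> linarith [this.1, this.2]

/-- The point is in the weak inequalities: c₁ = 0, c₂ = c₃ and c₄ = c₅ are allowed, and only the
collisions c₁ = c₂ and c₃ = c₄ are excluded. Analyticity holds in a full neighbourhood, so also
across the border. -/
theorem analyticAt_normFreq (a1 : AnalyticAt ℝ c1 x₀) (a2 : AnalyticAt ℝ c2 x₀)
    (a3 : AnalyticAt ℝ c3 x₀) (a4 : AnalyticAt ℝ c4 x₀) (a5 : AnalyticAt ℝ c5 x₀)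
    (h1 : 0 ≤ c1 x₀) (h2 : c1 x₀ < c2 x₀) (h3 : c2 x₀ ≤ c3 x₀) (h4 : c3 x₀ < c4 x₀)
    (h5 : c4 x₀ ≤ c5 x₀) :
    AnalyticAt ℝ (fun x => normFreq (c1 x) (c2 x) (c3 x) (c4 x) (c5 x)) x₀ := by
  have k0 := analyticAt_normK0 a1 a2 a3 a4 a5 h1 h2 (by linarith) (by linarith) (by linarith)
  have k1 := analyticAt_normK1 a1 a2 a3 a4 a5 h2 h3 h4 (by linarith)
  have k2 := analyticAt_normK2 a1 a2 a3 a4 a5 (by linarith) (by linarith) h4 h5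
  have hD : AnalyticAt ℝ (fun x => 2 * freqDet (c1 x) (c2 x) (c3 x) (c4 x) (c5 x)) x₀ :=
    analyticAt_const.mul (((k1 0).mul (k2 1)).sub ((k1 1).mul (k2 0)))
  have hD0 : 2 * freqDet (c1 x₀) (c2 x₀) (c3 x₀) (c4 x₀) (c5 x₀) ≠ 0 := by
    have := freqDet_pos h2 h3 h4 h5
    positivity
  exact ((((k0 0).mul (k2 1)).sub ((k0 1).mul (k2 0))).div hD hD0).prod
    ((((k0 0).mul (k1 1)).sub ((k0 1).mul (k1 0))).div hD hD0)

end analytic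

/-! ### The frequency map in terms of the normalized frequency -/

/-- The frequency as a function of the sorted parameters, also on the regular part of the border. -/
noncomputable def freqExt (a b c : ℝ) (p : ℝ × ℝ) : ℝ × ℝ :=
  √(min c p.1) • normFreq (min c p.1) (max c p.1) (min b p.2) (max b p.2) a

theorem mul_sub_min_max (x y s : ℝ) : (min x y - s) * (max x y - s) = (x - s) * (y - s) := by
  rcases le_total x y with h | h
  · rw [min_eq_left h, max_eq_right h]
  · rw [min_eq_right h, max_eq_left h, mul_comm]

theorem T_eq_quintic (a b c : ℝ) (p : ℝ × ℝ) (s : ℝ) :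
    T a b c p s = quintic (min c p.1) (max c p.1) (min b p.2) (max b p.2) a s := by
  rw [quintic, mul_sub_min_max, mul_assoc ((c - s) * (p.1 - s)), mul_sub_min_max, T]
  ring

section

variable {a b c : ℝ} {p : ℝ × ℝ}

theorem sorted_of_mem (hc : 0 < c) (hcb : c < b) (hba : b < a) (hp : p ∈ causticSpace a b c) :
    0 < min c p.1 ∧ min c p.1 < max c p.1 ∧ max c p.1 < min b p.2 ∧ min b p.2 < max b p.2 ∧
      max b p.2 < a := by
  obtain ⟨h, h1, h2⟩ := hp
  simp only [E, H1, H2, mem_union, mem_Ioo] at h1 h2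
  refine ⟨lt_min hc ?_, min_lt_max.2 ?_, max_lt (lt_min hcb ?_) (lt_min ?_ h), min_lt_max.2 ?_,
    max_lt hba ?_⟩
  · rcases h1 with h1 | h1 <;> linarith [h1.1]
  · rcases h1 with h1 | h1
    · exact h1.2.ne'
    · exact h1.1.ne
  · rcases h2 with h2 | h2 <;> linarith [h2.1]
  · rcases h1 with h1 | h1 <;> linarith [h1.2]
  · rcases h2 with h2 | h2
    · exact h2.2.ne'
    · exact h2.1.ne
  · rcases h2 with h2 | h2 <;> linarith [h2.2]

theorem isFrequency_iff (hc : 0 < c) (hcb : c < b) (hba : b < a) (hp : p ∈ causticSpace a b c)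
    (w : ℝ × ℝ) : IsFrequency a b c p w ↔ w = freqExt a b c p := by
  obtain ⟨h0, h1, h2, h3, h4⟩ := sorted_of_mem hc hcb hba hp
  rw [freqExt, ← normFreq_unique (freqDet_pos h1 h2.le h3 h4.le).ne', IsFrequency]
  simp only [K0, K1, K2, T_eq_quintic, integral_quintic_zero h0.le, integral_quintic_one h2,
    integral_quintic_two h4]

theorem isFrequency_frequencyMap (hc : 0 < c) (hcb : c < b) (hba : b < a)
    (hp : p ∈ causticSpace a b c) : IsFrequency a b c p (frequencyMap a b c p) :=
  Classical.epsilon_spec ⟨_, (isFrequency_iff hc hcb hba hp _).2 rfl⟩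

theorem frequencyMap_eq (hc : 0 < c) (hcb : c < b) (hba : b < a) (hp : p ∈ causticSpace a b c) :
    frequencyMap a b c p = freqExt a b c p :=
  (isFrequency_iff hc hcb hba hp _).1 (isFrequency_frequencyMap hc hcb hba hp)

theorem frequencyMap_pos (hc : 0 < c) (hcb : c < b) (hba : b < a) (hp : p ∈ causticSpace a b c) :
    0 < (frequencyMap a b c p).1 ∧ 0 < (frequencyMap a b c p).2 := by
  obtain ⟨h0, h1, h2, h3, h4⟩ := sorted_of_mem hc hcb hba hp
  have := normFreq_pos h0.le h1 h2.le h3 h4.le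
  rw [frequencyMap_eq hc hcb hba hp, freqExt]
  exact ⟨mul_pos (Real.sqrt_pos.2 h0) this.1, mul_pos (Real.sqrt_pos.2 h0) this.2⟩

theorem analyticAt_min_const {X : Type*} [NormedAddCommGroup X] [NormedSpace ℝ X] {x₀ : X}
    {f : X → ℝ} (hf : AnalyticAt ℝ f x₀) {c : ℝ} (h : f x₀ ≠ c) :
    AnalyticAt ℝ (fun x => min c (f x)) x₀ := by
  rcases lt_or_gt_of_ne h with h | h
  · refine hf.congr ?_
    filter_upwards [hf.continuousAt.eventually_lt_const h] with x hx
    exact (min_eq_right hx.le).symm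
  · refine (analyticAt_const (v := c)).congr ?_
    filter_upwards [hf.continuousAt.eventually_const_lt h] with x hx
    exact (min_eq_left hx.le).symm

theorem analyticAt_max_const {X : Type*} [NormedAddCommGroup X] [NormedSpace ℝ X] {x₀ : X}
    {f : X → ℝ} (hf : AnalyticAt ℝ f x₀) {c : ℝ} (h : f x₀ ≠ c) :
    AnalyticAt ℝ (fun x => max c (f x)) x₀ := by
  rcases lt_or_gt_of_ne h with h | h
  · refine (analyticAt_const (v := c)).congr ?_
    filter_upwards [hf.continuousAt.eventually_lt_const h] with x hx
    exact (max_eq_left hx.le).symm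
  · refine hf.congr ?_
    filter_upwards [hf.continuousAt.eventually_const_lt h] with x hx
    exact (max_eq_right hx.le).symm

/-- The closure of the caustic space. -/
def causticClosure (a b c : ℝ) : Set (ℝ × ℝ) :=
  {p | p.1 ≤ p.2 ∧ p.1 ∈ Icc 0 b ∧ p.2 ∈ Icc c a}

/-- Away from λ₁ = c and λ₂ = b each minimum and maximum is locally one of its two arguments. The
diagonal causes no trouble, since the normalized middle period is analytic through c₂ = c₃. -/
theorem analyticAt_normFreq_sorted (hc : 0 < c) (hcb : c < b) (hba : b < a)
    (hp : p ∈ causticClosure a b c) (h1 : p.1 ≠ c) (h2 : p.2 ≠ b) :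
    AnalyticAt ℝ (fun q : ℝ × ℝ =>
      normFreq (min c q.1) (max c q.1) (min b q.2) (max b q.2) a) p := by
  obtain ⟨h, k1, k2⟩ := hp
  refine analyticAt_normFreq (analyticAt_min_const analyticAt_fst h1)
    (analyticAt_max_const analyticAt_fst h1) (analyticAt_min_const analyticAt_snd h2)
    (analyticAt_max_const analyticAt_snd h2) analyticAt_const (le_min hc.le k1.1)
    (min_lt_max.2 h1.symm) (max_le (le_min hcb.le k2.1) (le_min k1.2 h)) (min_lt_max.2 h2.symm)
    (max_le hba.le k2.2)

theorem analyticAt_sqrt {X : Type*} [NormedAddCommGroup X] [NormedSpace ℝ X] {x₀ : X}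
    {f : X → ℝ} (hf : AnalyticAt ℝ f x₀) (h : 0 < f x₀) : AnalyticAt ℝ (fun x => √(f x)) x₀ :=
  (Real.contDiffAt_sqrt (n := ⊤) h.ne').analyticAt.comp hf

theorem analyticAt_freqExt (hc : 0 < c) (hcb : c < b) (hba : b < a)
    (hp : p ∈ causticClosure a b c) (h0 : p.1 ≠ 0) (h1 : p.1 ≠ c) (h2 : p.2 ≠ b) :
    AnalyticAt ℝ (freqExt a b c) p :=
  (analyticAt_sqrt (analyticAt_min_const analyticAt_fst h1)
    (lt_min hc (lt_of_le_of_ne hp.2.1.1 h0.symm))).smul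
      (analyticAt_normFreq_sorted hc hcb hba hp h1 h2)

theorem continuousAt_freqExt (hc : 0 < c) (hcb : c < b) (hba : b < a)
    (hp : p ∈ causticClosure a b c) (h1 : p.1 ≠ c) (h2 : p.2 ≠ b) :
    ContinuousAt (freqExt a b c) p :=
  (by fun_prop : ContinuousAt (fun q : ℝ × ℝ => √(min c q.1)) p).smul
    (analyticAt_normFreq_sorted hc hcb hba hp h1 h2).continuousAt

end

/-! ### Rotation numbers -/

/-- The quotient of the periods over `(0, e₁)` and `(e₂, e₃)`, divided by `√e₁`. -/
noncomputable def normRotation (e1 e2 e3 : ℝ) : ℝ :=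
  intR 0 e1 (fun s => 1 / √((e2 - s) * (e3 - s))) / (2 * intB e2 e3 (fun s => 1 / √(s - e1)))

/-- The rotation number as a function of the sorted parameters. -/
noncomputable def sortedRotation (e1 e2 e3 : ℝ) : ℝ := √e1 * normRotation e1 e2 e3

section rotation

variable {e1 e2 e3 : ℝ}

theorem intB_rotation_pos (h1 : e1 < e2) (h2 : e2 ≤ e3) :
    0 < intB e2 e3 (fun s => 1 / √(s - e1)) := by
  have : ∀ s ∈ Icc e2 e3, 0 < s - e1 := fun s hs => by linarith [hs.1]
  exact intB_pos h2 (continuousOn_rsqrt (by fun_prop) this) fun s hs =>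
    one_div_pos.2 (Real.sqrt_pos.2 (this s hs))

theorem integral_rotation_zero (h0 : 0 ≤ e1) :
    (∫ s in (0 : ℝ)..e1, 1 / √((e1 - s) * (e2 - s) * (e3 - s))) =
      √e1 * intR 0 e1 (fun s => 1 / √((e2 - s) * (e3 - s))) := by
  have := integral_div_sqrt_right h0 (fun s => 1 / √((e2 - s) * (e3 - s)))
  rw [sub_zero] at this
  rw [← this]
  refine integral_congr_Ioo h0 fun s hs => ?_
  rw [mul_assoc, Real.sqrt_mul (sub_nonneg.2 hs.2.le), div_div, mul_comm]

theorem integral_rotation_one (h2 : e2 < e3) :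
    (∫ s in e2..e3, 1 / √((e1 - s) * (e2 - s) * (e3 - s))) =
      intB e2 e3 (fun s => 1 / √(s - e1)) := by
  rw [← integral_div_sqrt_both h2]
  refine integral_congr_Ioo h2.le fun s hs => ?_
  have : (e1 - s) * (e2 - s) * (e3 - s) = ((s - e2) * (e3 - s)) * (s - e1) := by ring
  rw [this, Real.sqrt_mul (mul_nonneg (sub_nonneg.2 hs.1.le) (sub_nonneg.2 hs.2.le)), div_div,
    mul_comm]

theorem sortedRotation_eq (h0 : 0 ≤ e1) (h2 : e2 < e3) : sortedRotation e1 e2 e3 =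
    (∫ s in (0 : ℝ)..e1, 1 / √((e1 - s) * (e2 - s) * (e3 - s))) /
      (2 * ∫ s in e2..e3, 1 / √((e1 - s) * (e2 - s) * (e3 - s))) := by
  rw [sortedRotation, normRotation, integral_rotation_zero h0, integral_rotation_one h2,
    mul_div_assoc]

theorem rotationNumber_eq {lam β α : ℝ} (hβ : 0 ≤ β) (hβα : β < α) (h0 : 0 ≤ lam) (h1 : lam < α) :
    rotationNumber lam β α = sortedRotation (min β lam) (max β lam) α := by
  rw [sortedRotation_eq (le_min hβ h0) (max_lt hβα h1), rotationNumber]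
  simp only [mul_sub_min_max, mul_comm (β - _)]

variable {X : Type*} [NormedAddCommGroup X] [NormedSpace ℝ X] {x₀ : X} {f1 f2 f3 : X → ℝ}

theorem analyticAt_normRotation (a1 : AnalyticAt ℝ f1 x₀) (a2 : AnalyticAt ℝ f2 x₀)
    (a3 : AnalyticAt ℝ f3 x₀) (h0 : 0 ≤ f1 x₀) (h1 : f1 x₀ < f2 x₀) (h2 : f2 x₀ ≤ f3 x₀) :
    AnalyticAt ℝ (fun x => normRotation (f1 x) (f2 x) (f3 x)) x₀ := by
  have ha := IsAnalyticFamily.affine (analyticAt_const (v := (0 : ℝ))) a1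
  have hb := IsAnalyticFamily.affine a2 a3
  refine AnalyticAt.div (analyticAt_intR (u := fun _ => 0) (v := f1)
    (G := fun x s => 1 / √((f2 x - s) * (f3 x - s))) (.rsqrt
    (.mul (.sub (.param a2) ha) (.sub (.param a3) ha)) fun σ hσ => ?_))
    (analyticAt_const.mul (analyticAt_intB (u := f2) (v := f3)
      (G := fun x s => 1 / √(s - f1 x)) (.rsqrt (.sub hb (.param a1)) fun σ hσ => ?_))) ?_
  · have := (affine_mem_Icc h0 hσ).2
    refine mul_pos ?_ ?_ <;> linarith
  · have := (affine_mem_Icc h2 hσ).1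
    linarith
  · have := intB_rotation_pos h1 h2
    positivity

theorem analyticAt_sortedRotation (a1 : AnalyticAt ℝ f1 x₀) (a2 : AnalyticAt ℝ f2 x₀)
    (a3 : AnalyticAt ℝ f3 x₀) (h0 : 0 < f1 x₀) (h1 : f1 x₀ < f2 x₀) (h2 : f2 x₀ ≤ f3 x₀) :
    AnalyticAt ℝ (fun x => sortedRotation (f1 x) (f2 x) (f3 x)) x₀ :=
  (analyticAt_sqrt a1 h0).mul (analyticAt_normRotation a1 a2 a3 h0.le h1 h2)

theorem continuousAt_sortedRotation {β α t : ℝ} (hβ : 0 < β) (hβα : β < α) (ht : t ∈ Icc 0 α)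
    (htβ : t ≠ β) : ContinuousAt (fun s => sortedRotation (min β s) (max β s) α) t :=
  (by fun_prop : ContinuousAt (fun s : ℝ => √(min β s)) t).mul
    (analyticAt_normRotation (analyticAt_min_const analyticAt_id htβ)
      (analyticAt_max_const analyticAt_id htβ) analyticAt_const (le_min hβ.le ht.1)
      (min_lt_max.2 htβ.symm) (max_le hβα.le ht.2)).continuousAt

theorem closure_rotation_domain {β α : ℝ} (hβ : 0 < β) (hβα : β < α) :
    closure (Ioo 0 β ∪ Ioo β α) = Icc 0 α := by
  rw [closure_union, closure_Ioo hβ.ne, closure_Ioo hβα.ne, Icc_union_Icc_eq_Icc hβ.le hβα.le]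

/-- For t ≠ β the formula in the sorted parameters is already continuous, also at the two end
points, so it is its own extension. The value at t = β requires a genuine limit and is obtained
later from the vertex (c,b). -/
theorem rotationFunction_eq {β α t : ℝ} (hβ : 0 < β) (hβα : β < α) (ht : t ∈ Icc 0 α)
    (htβ : t ≠ β) : rotationFunction β α t = sortedRotation (min β t) (max β t) α := by
  refine extendFrom_eq (by rwa [closure_rotation_domain hβ hβα]) ?_
  refine ((continuousAt_sortedRotation hβ hβα ht htβ).tendsto.mono_left inf_le_left).congr' ?_
  filter_upwards [self_mem_nhdsWithin] with s hs
  have : 0 ≤ s ∧ s < α := by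
    rcases hs with hs | hs
    · exact ⟨hs.1.le, hs.2.trans hβα⟩
    · exact ⟨(hβ.trans hs.1).le, hs.2⟩
  exact (rotationNumber_eq hβ.le hβα this.1 this.2).symm

end rotation

/-! ### The frequency on the regular edges -/

section edges

/-- At the double root d = c₄ = c₅ the last period is a point evaluation, so the multiplier d - s
removes it and cancels the double root in the other two. What remains is the elliptic equation for
the rotation number. The zeroth equation then determines the second component. -/
theorem sqrt_smul_normFreq_double_right {c1 c2 c3 d : ℝ} (h0 : 0 ≤ c1) (h1 : c1 < c2)
    (h2 : c2 ≤ c3) (h3 : c3 < d) :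
    √c1 • normFreq c1 c2 c3 d d = (sortedRotation c1 c2 c3,
      √((d - c1) * (d - c2) * (d - c3)) / (2 * Real.pi) *
        (2 * sortedRotation c1 c2 c3 * normK1 0 c1 c2 c3 d d - √c1 * normK0 0 c1 c2 c3 d d)) := by
  symm
  have hP : 0 < √((d - c1) * (d - c2) * (d - c3)) := by
    refine Real.sqrt_pos.2 (mul_pos (mul_pos ?_ ?_) ?_) <;> linarith
  have hpi := Real.pi_pos
  have e20 : normK2 0 c1 c2 c3 d d = Real.pi / √((d - c1) * (d - c2) * (d - c3)) := by
    rw [normK2, intB_self, weight2]; ring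
  have e21 : normK2 1 c1 c2 c3 d d = d * normK2 0 c1 c2 c3 d d := by
    rw [normK2, normK2, intB_self, intB_self]; ring
  have s0 := sub_mul_normK0 h0 h1 (h1.trans_le h2) (by linarith : c1 < d) (by linarith : c1 < d) d
    (c3 := c3)
  have s1 := sub_mul_normK1 h1 h2 h3 h3 d
  have r0 : (intR 0 c1 fun s => (d - s) * weight0 c2 c3 d d s) =
      intR 0 c1 fun s => 1 / √((c2 - s) * (c3 - s)) := by
    refine intR_congr h0 fun s hs => ?_
    have hd : 0 < d - s := by linarith [hs.2]
    have : (c2 - s) * (c3 - s) * (d - s) * (d - s) = ((c2 - s) * (c3 - s)) * (d - s) ^ 2 := by ring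
    rw [weight0, this, Real.sqrt_mul' _ (by positivity), Real.sqrt_sq hd.le]
    field_simp
  have r1 : (intB c2 c3 fun s => (d - s) * weight1 c1 d d s) =
      intB c2 c3 fun s => 1 / √(s - c1) := by
    refine intB_congr h2 fun s hs => ?_
    have hd : 0 < d - s := by linarith [hs.2]
    have : (s - c1) * (d - s) * (d - s) = (s - c1) * (d - s) ^ 2 := by ring
    rw [weight1, this, Real.sqrt_mul' _ (by positivity), Real.sqrt_sq hd.le]
    field_simp
  rw [r0] at s0
  rw [r1] at s1
  have hB := intB_rotation_pos h1 h2
  have hR : 2 * sortedRotation c1 c2 c3 * intB c2 c3 (fun s => 1 / √(s - c1)) =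
      √c1 * intR 0 c1 (fun s => 1 / √((c2 - s) * (c3 - s))) := by
    rw [sortedRotation, normRotation]; field_simp
  rw [← normFreq_unique (freqDet_pos h1 h2 h3 le_rfl).ne']
  -- The zeroth equation. The first one is d times it minus the elliptic equation produced by the
  -- multiplier d - s.
  have E0 : √c1 * normK0 0 c1 c2 c3 d d + 2 * (-(sortedRotation c1 c2 c3 * normK1 0 c1 c2 c3 d d) +
      √((d - c1) * (d - c2) * (d - c3)) / (2 * Real.pi) * (2 * sortedRotation c1 c2 c3 *
        normK1 0 c1 c2 c3 d d - √c1 * normK0 0 c1 c2 c3 d d) * normK2 0 c1 c2 c3 d d) = 0 := by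
    rw [e20]
    field_simp
    ring
  intro i hi
  rcases hi with rfl | rfl
  · exact E0
  · simp only at E0 ⊢
    rw [e21]
    linear_combination d * E0 - √c1 * s0 + 2 * sortedRotation c1 c2 c3 * s1 + hR

/-- The same reduction with the double root d = c₂ = c₃ on the middle interval. On (c₄,c₅) the
factor d - s is negative, hence the change of sign in the last integral. -/
theorem sqrt_smul_normFreq_double_left {c1 d c4 c5 : ℝ} (h0 : 0 ≤ c1) (h1 : c1 < d)
    (h2 : d < c4) (h3 : c4 ≤ c5) :
    √c1 • normFreq c1 d d c4 c5 = (√((d - c1) * (c4 - d) * (c5 - d)) / (2 * Real.pi) *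
        (√c1 * normK0 0 c1 d d c4 c5 + 2 * sortedRotation c1 c4 c5 * normK2 0 c1 d d c4 c5),
      sortedRotation c1 c4 c5) := by
  symm
  have hP : 0 < √((d - c1) * (c4 - d) * (c5 - d)) := by
    refine Real.sqrt_pos.2 (mul_pos (mul_pos ?_ ?_) ?_) <;> linarith
  have hpi := Real.pi_pos
  have e20 : normK1 0 c1 d d c4 c5 = Real.pi / √((d - c1) * (c4 - d) * (c5 - d)) := by
    rw [normK1, intB_self, weight1]; ring
  have e21 : normK1 1 c1 d d c4 c5 = d * normK1 0 c1 d d c4 c5 := by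
    rw [normK1, normK1, intB_self, intB_self]; ring
  have s0 := sub_mul_normK0 h0 h1 h1 (by linarith : c1 < c4) (by linarith : c1 < c5) d
  have s1 := sub_mul_normK2 (by linarith : c1 < c4) h2 h2 h3 d
  have r0 : (intR 0 c1 fun s => (d - s) * weight0 d d c4 c5 s) =
      intR 0 c1 fun s => 1 / √((c4 - s) * (c5 - s)) := by
    refine intR_congr h0 fun s hs => ?_
    have hd : 0 < d - s := by linarith [hs.2]
    have : (d - s) * (d - s) * (c4 - s) * (c5 - s) = ((c4 - s) * (c5 - s)) * (d - s) ^ 2 := by ring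
    rw [weight0, this, Real.sqrt_mul' _ (by positivity), Real.sqrt_sq hd.le]
    field_simp
  have r1 : (intB c4 c5 fun s => (d - s) * weight2 c1 d d s) =
      -intB c4 c5 fun s => 1 / √(s - c1) := by
    rw [← neg_one_mul, ← intB_const_mul]
    refine intB_congr h3 fun s hs => ?_
    have hd : 0 < s - d := by linarith [hs.1]
    have : (s - c1) * (s - d) * (s - d) = (s - c1) * (s - d) ^ 2 := by ring
    rw [weight2, this, Real.sqrt_mul' _ (by positivity), Real.sqrt_sq hd.le]
    field_simp
    ring
  rw [r0] at s0
  rw [r1] at s1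
  have hB := intB_rotation_pos (by linarith : c1 < c4) h3
  have hR : 2 * sortedRotation c1 c4 c5 * intB c4 c5 (fun s => 1 / √(s - c1)) =
      √c1 * intR 0 c1 (fun s => 1 / √((c4 - s) * (c5 - s))) := by
    rw [sortedRotation, normRotation]; field_simp
  rw [← normFreq_unique (freqDet_pos h1 le_rfl h2 h3).ne']
  have E0 : √c1 * normK0 0 c1 d d c4 c5 + 2 * (-(√((d - c1) * (c4 - d) * (c5 - d)) /
      (2 * Real.pi) * (√c1 * normK0 0 c1 d d c4 c5 + 2 * sortedRotation c1 c4 c5 *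
        normK2 0 c1 d d c4 c5) * normK1 0 c1 d d c4 c5) +
        sortedRotation c1 c4 c5 * normK2 0 c1 d d c4 c5) = 0 := by
    rw [e20]
    field_simp
    ring
  intro i hi
  rcases hi with rfl | rfl
  · exact E0
  · simp only at E0 ⊢
    rw [e21]
    linear_combination d * E0 - √c1 * s0 - 2 * sortedRotation c1 c4 c5 * s1 + hR

end edges

/-! ### The border values ν_x, ν_y, ν_z as double root limits -/

section

variable {a b c t : ℝ}

theorem sqrt_mul_sq_abs (x y : ℝ) : √(x * y ^ 2) = |y| * √x := by
  rw [Real.sqrt_mul' _ (sq_nonneg y), Real.sqrt_sq_eq_abs, mul_comm]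

theorem freqExt_edge_x (hc : 0 < c) (hcb : c < b) (hba : b < a) (ht : t ∈ E c ∪ H1 b c) :
    freqExt a b c (t, a) = (rotationNumber t c b, nuXInterior a b c t) := by
  have ht' : 0 < t ∧ t < b ∧ t ≠ c := by
    rcases ht with h | h
    · exact ⟨h.1, h.2.trans hcb, h.2.ne⟩
    · exact ⟨hc.trans h.1, h.2, h.1.ne'⟩
  have k1 : 0 < min c t := lt_min hc ht'.1
  have k2 : min c t < max c t := min_lt_max.2 ht'.2.2.symm
  have k3 : max c t < b := max_lt hcb ht'.2.1
  have hq : ∀ s, quintic (min c t) (max c t) b a a s = Tx b c t s * (a - s) ^ 2 := fun s => by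
    rw [quintic, mul_sub_min_max, Tx]; ring
  have h0 := integral_quintic_zero (c1 := min c t) (c2 := max c t) (c3 := b) (c4 := a) (c5 := a)
    k1.le 0
  have h1 := integral_quintic_one (c1 := min c t) (c2 := max c t) (c3 := b) (c4 := a) (c5 := a)
    k3 0
  have e0 : (∫ s in (0 : ℝ)..(min t c), 1 / ((a - s) * √(Tx b c t s))) =
      √(min c t) * normK0 0 (min c t) (max c t) b a a := by
    rw [← h0, min_comm]
    refine integral_congr_Ioo k1.le fun s hs => ?_
    rw [hq, sqrt_mul_sq_abs, abs_of_pos (by linarith [hs.2]), pow_zero]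
  have e1 : (∫ s in (max t c)..b, 1 / ((a - s) * √(Tx b c t s))) =
      normK1 0 (min c t) (max c t) b a a := by
    rw [← h1, max_comm]
    refine integral_congr_Ioo k3.le fun s hs => ?_
    rw [hq, sqrt_mul_sq_abs, abs_of_pos (by linarith [hs.2]), pow_zero]
  have e2 : -Tx b c t a = (a - min c t) * (a - max c t) * (a - b) := by
    have := mul_sub_min_max c t a
    rw [Tx]
    linear_combination (b - a) * this
  simp only [freqExt, min_eq_left hba.le, max_eq_right hba.le]
  rw [sqrt_smul_normFreq_double_right k1.le k2 k3.le hba, nuXInterior, e0, e1, e2,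
    rotationNumber_eq hc.le hcb ht'.1.le ht'.2.1]

theorem freqExt_edge_y (hc : 0 < c) (hcb : c < b) (ht : t ∈ H2 a b) :
    freqExt a b c (b, t) = (nuYInterior a b c t, rotationNumber t c a) := by
  have hbt : b < t := ht.1
  have hta : t < a := ht.2
  have hq : ∀ s, quintic c b b t a s = Ty a c t s * (b - s) ^ 2 := fun s => by
    rw [quintic, Ty]; ring
  have h0 := integral_quintic_zero (c1 := c) (c2 := b) (c3 := b) (c4 := t) (c5 := a) hc.le 0
  have h1 := integral_quintic_two (c1 := c) (c2 := b) (c3 := b) (c4 := t) (c5 := a) hta 0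
  have e0 : (∫ s in (0 : ℝ)..c, 1 / ((b - s) * √(Ty a c t s))) = √c * normK0 0 c b b t a := by
    rw [← h0]
    refine integral_congr_Ioo hc.le fun s hs => ?_
    rw [hq, sqrt_mul_sq_abs, abs_of_pos (by linarith [hs.2]), pow_zero]
  have e1 : (∫ s in t..a, 1 / ((s - b) * √(Ty a c t s))) = normK2 0 c b b t a := by
    rw [← h1]
    refine integral_congr_Ioo hta.le fun s hs => ?_
    rw [hq, sqrt_mul_sq_abs, abs_of_neg (by linarith [hs.1]), pow_zero, neg_sub]
  have e2 : -Ty a c t b = (b - c) * (t - b) * (a - b) := by rw [Ty]; ring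
  simp only [freqExt, min_eq_left hcb.le, max_eq_right hcb.le, min_eq_left hbt.le,
    max_eq_right hbt.le]
  rw [sqrt_smul_normFreq_double_left hc.le hcb hbt hta.le, nuYInterior, e0, e1, e2,
    rotationNumber_eq hc.le (by linarith) (by linarith) hta, min_eq_left (by linarith),
    max_eq_right (by linarith)]

/-- Two edges at once: the double root is max c t, which is c on the edge λ₂ = c and t on the
diagonal. -/
theorem normFreq_edge_z (hc : 0 < c) (hcb : c < b) (hba : b < a) (ht : t ∈ E c ∪ H1 b c) :
    √(min c t) • normFreq (min c t) (max c t) (max c t) b a =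
      (nuZInterior a b c t, sortedRotation (min c t) b a) := by
  have ht' : 0 < t ∧ t < b ∧ t ≠ c := by
    rcases ht with h | h
    · exact ⟨h.1, h.2.trans hcb, h.2.ne⟩
    · exact ⟨hc.trans h.1, h.2, h.1.ne'⟩
  have k1 : 0 < min c t := lt_min hc ht'.1
  have k2 : min c t < max c t := min_lt_max.2 ht'.2.2.symm
  have k3 : max c t < b := max_lt hcb ht'.2.1
  have hq : ∀ s, quintic (min c t) (max c t) (max c t) b a s =
      Tz a b c t s * (max c t - s) ^ 2 := fun s => by
    rw [quintic, Tz, min_comm]; ring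
  have h0 := integral_quintic_zero (c1 := min c t) (c2 := max c t) (c3 := max c t) (c4 := b)
    (c5 := a) k1.le 0
  have h1 := integral_quintic_two (c1 := min c t) (c2 := max c t) (c3 := max c t) (c4 := b)
    (c5 := a) hba 0
  have e0 : (∫ s in (0 : ℝ)..(min t c), 1 / ((max t c - s) * √(Tz a b c t s))) =
      √(min c t) * normK0 0 (min c t) (max c t) (max c t) b a := by
    rw [← h0, min_comm, max_comm]
    refine integral_congr_Ioo k1.le fun s hs => ?_
    rw [hq, sqrt_mul_sq_abs, abs_of_pos (by linarith [hs.2]), pow_zero]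
  have e1 : (∫ s in b..a, 1 / ((s - max t c) * √(Tz a b c t s))) =
      normK2 0 (min c t) (max c t) (max c t) b a := by
    rw [← h1, max_comm]
    refine integral_congr_Ioo hba.le fun s hs => ?_
    rw [hq, sqrt_mul_sq_abs, abs_of_neg (by linarith [hs.1]), pow_zero, neg_sub]
  have e2 : -Tz a b c t (max t c) =
      (max c t - min c t) * (b - max c t) * (a - max c t) := by
    rw [Tz, min_comm, max_comm]; ring
  have e3 : rotationNumber (min t c) b a = sortedRotation (min c t) b a := by
    rw [min_comm, rotationNumber_eq (by linarith) hba k1.le (by linarith),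
      min_eq_right (k2.trans k3).le, max_eq_left (k2.trans k3).le]
  rw [sqrt_smul_normFreq_double_left k1.le k2 k3 hba.le, nuZInterior, e0, e1, e2, e3]

end

/-! ### Elliptic periods with two or three colliding roots -/

section

variable {e1 e2 e3 : ℝ}

/-- The inverse square root of the cubic with roots `e₁, e₂, e₃`. -/
noncomputable def cubicWeight (e1 e2 e3 s : ℝ) : ℝ := 1 / √((e1 - s) * (e2 - s) * (e3 - s))

theorem measurable_cubicWeight : Measurable (cubicWeight e1 e2 e3) := by
  unfold cubicWeight; fun_prop

theorem cubicWeight_nonneg (s : ℝ) : 0 ≤ cubicWeight e1 e2 e3 s := by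
  unfold cubicWeight; positivity

/-- The involution that swaps `e₃` with `∞` and `e₁` with `e₂`. -/
noncomputable def swapRoots (e1 e2 e3 s : ℝ) : ℝ := e3 - (e3 - e1) * (e3 - e2) / (e3 - s)

theorem swapRoots_image (h1 : 0 < e1) (h12 : e1 < e2) (h23 : e2 < e3) :
    swapRoots e1 e2 e3 '' Ioo 0 e1 = Ioo e2 (swapRoots e1 e2 e3 0) := by
  have p1 : 0 < e3 - e1 := by linarith
  have p2 : 0 < e3 - e2 := by linarith
  have hP := mul_pos p1 p2
  ext y
  simp only [mem_image, mem_Ioo, swapRoots]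
  constructor
  · rintro ⟨s, ⟨hs0, hs1⟩, rfl⟩
    have hs : 0 < e3 - s := by linarith
    constructor
    · have : (e3 - e1) * (e3 - e2) / (e3 - s) < e3 - e2 := by
        rw [div_lt_iff₀ hs]; nlinarith
      linarith
    · have : (e3 - e1) * (e3 - e2) / (e3 - 0) < (e3 - e1) * (e3 - e2) / (e3 - s) := by
        apply div_lt_div_of_pos_left hP hs; linarith
      linarith
  · rintro ⟨hy1, hy2⟩
    have hq : 0 < (e3 - e1) * (e3 - e2) / (e3 - 0) := div_pos hP (by linarith)
    have hy : 0 < e3 - y := by linarith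
    have e : (e3 - (e3 - (e3 - e1) * (e3 - e2) / (e3 - y))) = (e3 - e1) * (e3 - e2) / (e3 - y) := by
      ring
    refine ⟨e3 - (e3 - e1) * (e3 - e2) / (e3 - y), ⟨?_, ?_⟩, ?_⟩
    · have : (e3 - e1) * (e3 - e2) / (e3 - y) < e3 := by
        rw [div_lt_iff₀ hy]
        have h3 : (e3 - e1) * (e3 - e2) / (e3 - 0) < e3 - y := by linarith
        rw [div_lt_iff₀ (by linarith)] at h3
        linarith
      linarith
    · have : e3 - e1 < (e3 - e1) * (e3 - e2) / (e3 - y) := by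
        rw [lt_div_iff₀ hy]; nlinarith
      linarith
    · rw [e]; field_simp; ring

/-- The involution permutes the branch points e₁, e₂, e₃, ∞, so it preserves ds/√cubic up to sign.
It maps (0,e₁) onto the initial part of (e₂,e₃) that ends at the image of 0. -/
theorem integral_swapRoots (h1 : 0 < e1) (h12 : e1 < e2) (h23 : e2 < e3) (φ : ℝ → ℝ) :
    (∫ s in e2..(swapRoots e1 e2 e3 0), cubicWeight e1 e2 e3 s * φ s) =
      ∫ s in (0 : ℝ)..e1, cubicWeight e1 e2 e3 s * φ (swapRoots e1 e2 e3 s) := by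
  have p1 : 0 < e3 - e1 := by linarith
  have p2 : 0 < e3 - e2 := by linarith
  have hP := mul_pos p1 p2
  have hle : e2 ≤ swapRoots e1 e2 e3 0 := by
    have : (e3 - e1) * (e3 - e2) / (e3 - 0) < e3 - e2 := by
      rw [div_lt_iff₀ (by linarith)]; nlinarith
    rw [swapRoots]; linarith
  rw [intervalIntegral.integral_of_le hle, MeasureTheory.integral_Ioc_eq_integral_Ioo,
    intervalIntegral.integral_of_le h1.le, MeasureTheory.integral_Ioc_eq_integral_Ioo,
    ← swapRoots_image h1 h12 h23]
  have hd : ∀ s ∈ Ioo 0 e1, HasDerivWithinAt (swapRoots e1 e2 e3)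
      (-((e3 - e1) * (e3 - e2) / (e3 - s) ^ 2)) (Ioo 0 e1) s := fun s hs => by
    have hs : e3 - s ≠ 0 := by linarith [hs.2]
    have := (((hasDerivAt_id s).const_sub e3).inv hs).const_mul ((e3 - e1) * (e3 - e2)) |>.const_sub e3
    refine (this.congr_deriv ?_).hasDerivWithinAt
    simp only [id]
    field_simp
  rw [MeasureTheory.integral_image_eq_integral_abs_deriv_smul measurableSet_Ioo hd]
  · refine MeasureTheory.setIntegral_congr_fun measurableSet_Ioo fun s hs => ?_
    have q1 : 0 < e1 - s := by linarith [hs.2]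
    have q2 : 0 < e2 - s := by linarith [hs.2]
    have q3 : 0 < e3 - s := by linarith [hs.2]
    simp only [smul_eq_mul]
    rw [← mul_assoc]
    congr 1
    have e : (e1 - swapRoots e1 e2 e3 s) * (e2 - swapRoots e1 e2 e3 s) *
        (e3 - swapRoots e1 e2 e3 s) =
        ((e1 - s) * (e2 - s) * (e3 - s)) * ((e3 - e1) * (e3 - e2) / (e3 - s) ^ 2) ^ 2 := by
      rw [swapRoots]; field_simp; ring
    have hQ : 0 < (e3 - e1) * (e3 - e2) / (e3 - s) ^ 2 := by positivity
    have hR : 0 < √((e1 - s) * (e2 - s) * (e3 - s)) := Real.sqrt_pos.2 (by positivity)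
    rw [cubicWeight, e, sqrt_mul_sq_abs, abs_neg, abs_of_pos hQ, cubicWeight]
    field_simp
  · intro s hs s' hs' h
    have q3 : 0 < e3 - s := by linarith [hs.2]
    have q3' : 0 < e3 - s' := by linarith [hs'.2]
    simp only [swapRoots] at h
    have h' : (e3 - e1) * (e3 - e2) / (e3 - s) = (e3 - e1) * (e3 - e2) / (e3 - s') := by linarith
    rw [div_eq_div_iff q3.ne' q3'.ne'] at h'
    have := mul_left_cancel₀ hP.ne' h'
    linarith

theorem intOn_cubicWeight_outer {u : ℝ} (hu : u ≤ e1) (h12 : e1 < e2) (h23 : e2 < e3) :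
    IntOn (cubicWeight e1 e2 e3) u e1 := by
  refine IntOn.of_abs_le hu
    ((intOn_rsqrt_right hu).1.const_mul (1 / √((e2 - e1) * (e3 - e1))))
    measurable_cubicWeight fun s hs => ?_
  have q1 : 0 < e1 - s := by linarith [hs.2]
  have p2 : 0 < e2 - e1 := by linarith
  have p3 : 0 < e3 - e1 := by linarith
  rw [abs_of_nonneg (cubicWeight_nonneg s), cubicWeight, mul_assoc, Real.sqrt_mul q1.le, mul_comm,
    one_div_mul_one_div]
  refine one_div_le_one_div_of_le (mul_pos (Real.sqrt_pos.2 (mul_pos p2 p3)) (Real.sqrt_pos.2 q1))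
    (mul_le_mul_of_nonneg_right (Real.sqrt_le_sqrt ?_) (Real.sqrt_nonneg _))
  nlinarith [hs.2]

theorem intOn_cubicWeight_inner (h12 : e1 < e2) (h23 : e2 < e3) :
    IntOn (cubicWeight e1 e2 e3) e2 e3 := by
  refine IntOn.of_abs_le h23.le
    ((intOn_rsqrt_both h23).1.const_mul (1 / √(e2 - e1)))
    measurable_cubicWeight fun s hs => ?_
  have q2 : 0 < s - e2 := by linarith [hs.1]
  have q3 : 0 < e3 - s := by linarith [hs.2]
  have p2 : 0 < e2 - e1 := by linarith
  have e : (e1 - s) * (e2 - s) * (e3 - s) = (s - e1) * ((s - e2) * (e3 - s)) := by ring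
  rw [abs_of_nonneg (cubicWeight_nonneg s), cubicWeight, e, Real.sqrt_mul (by linarith),
    one_div_mul_one_div]
  refine one_div_le_one_div_of_le (mul_pos (Real.sqrt_pos.2 p2) (Real.sqrt_pos.2 (mul_pos q2 q3)))
    (mul_le_mul_of_nonneg_right (Real.sqrt_le_sqrt ?_) (Real.sqrt_nonneg _))
  linarith

/-- The two periods of an elliptic curve agree up to a bounded error. -/
theorem abs_cubicPeriod_sub_le (h1 : 0 < e1) (h12 : e1 < e2) (h23 : e2 < e3) :
    |(∫ s in (0 : ℝ)..e1, cubicWeight e1 e2 e3 s) - ∫ s in e2..e3, cubicWeight e1 e2 e3 s| ≤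
      2 * √(e3 / (e1 * e2)) := by
  have p1 : 0 < e3 - e1 := by linarith
  have p2 : 0 < e3 - e2 := by linarith
  have hP := mul_pos p1 p2
  have h3 : 0 < e3 := by linarith
  have h2 : 0 < e2 := by linarith
  set σ := swapRoots e1 e2 e3 0 with hσ
  have hσ3 : e3 - σ = (e3 - e1) * (e3 - e2) / e3 := by rw [hσ, swapRoots]; ring
  have hσ2 : σ - e2 = (e3 - e2) * e1 / e3 := by rw [hσ, swapRoots, sub_zero]; field_simp; ring
  have hσ1 : σ - e1 = (e3 - e1) * e2 / e3 := by rw [hσ, swapRoots, sub_zero]; field_simp; ring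
  have g3 : 0 < e3 - σ := by rw [hσ3]; positivity
  have g2 : 0 < σ - e2 := by rw [hσ2]; positivity
  have g1 : 0 < σ - e1 := by rw [hσ1]; positivity
  have hi := intOn_cubicWeight_inner h12 h23
  have hi1 : IntOn (cubicWeight e1 e2 e3) e2 σ :=
    hi.mono_set (by rw [uIcc_of_le h23.le, uIcc_of_le (by linarith)]; exact Icc_subset_Icc le_rfl (by linarith))
  have hi2 : IntOn (cubicWeight e1 e2 e3) σ e3 :=
    hi.mono_set (by rw [uIcc_of_le h23.le, uIcc_of_le (by linarith)]; exact Icc_subset_Icc (by linarith) le_rfl)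
  -- The outer period equals the inner one cut off at σ, so the difference of the periods is the
  -- tail over (σ,e₃). There only the root e₃ is close, and an inverse square root bound suffices.
  have h := integral_swapRoots h1 h12 h23 (fun _ => 1)
  simp only [mul_one] at h
  rw [← hσ] at h
  rw [← h, ← intervalIntegral.integral_add_adjacent_intervals hi1 hi2]
  have hs : ∀ s ∈ Ioo σ e3, |cubicWeight e1 e2 e3 s| ≤
      1 / √((σ - e1) * (σ - e2)) * (1 / √(e3 - s)) := fun s hs => by
    have q3 : 0 < e3 - s := by linarith [hs.2]
    have e : (e1 - s) * (e2 - s) * (e3 - s) = ((s - e1) * (s - e2)) * (e3 - s) := by ring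
    rw [abs_of_nonneg (cubicWeight_nonneg s), cubicWeight, e, Real.sqrt_mul' _ q3.le,
      one_div_mul_one_div]
    refine one_div_le_one_div_of_le
      (mul_pos (Real.sqrt_pos.2 (mul_pos g1 g2)) (Real.sqrt_pos.2 q3))
      (mul_le_mul_of_nonneg_right (Real.sqrt_le_sqrt ?_) (Real.sqrt_nonneg _))
    nlinarith [hs.1]
  have hb := abs_integral_le_of_abs_le (by linarith)
    ((intOn_rsqrt_right (by linarith : σ ≤ e3)).1.const_mul _) measurable_cubicWeight hs
  rw [intervalIntegral.integral_const_mul, (intOn_rsqrt_right (by linarith : σ ≤ e3)).2] at hb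
  have hval : 1 / √((σ - e1) * (σ - e2)) * (2 * √(e3 - σ)) = 2 * √(e3 / (e1 * e2)) := by
    have : e3 / (e1 * e2) = (e3 - σ) / ((σ - e1) * (σ - e2)) := by
      rw [hσ1, hσ2, hσ3]; field_simp
    rw [this, Real.sqrt_div' _ (mul_pos g1 g2).le]
    ring
  rw [hval] at hb
  rwa [show ∀ x y : ℝ, x - (x + y) = -y by intros; ring, abs_neg]

end

/-! ### Weighted periods and limits when two roots merge -/

section

variable {e1 e2 e3 : ℝ}

theorem cubicWeight_outer_le (h12 : e1 < e2) (h23 : e2 < e3) {s : ℝ} (hs : s < e1) :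
    (e1 - s) * cubicWeight e1 e2 e3 s ≤ 1 / √(e1 - s) := by
  have q1 : 0 < e1 - s := by linarith
  have h : (e1 - s) * (e1 - s) ^ 2 ≤ (e1 - s) * (e2 - s) * (e3 - s) := by
    rw [mul_assoc, pow_two]
    gcongr <;> linarith
  have h' := Real.sqrt_le_sqrt h
  rw [sqrt_mul_sq_abs, abs_of_pos q1] at h'
  have p1 := Real.sqrt_pos.2 q1
  rw [cubicWeight, mul_one_div, div_le_div_iff₀ (lt_of_lt_of_le (by positivity) h') p1]
  linarith

theorem cubicWeight_inner_eq {s : ℝ} (h12 : e1 < e2) (hs : s ∈ Ioo e2 e3) :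
    (s - e1) * cubicWeight e1 e2 e3 s = √(s - e1) / √((s - e2) * (e3 - s)) := by
  have q1 : 0 < s - e1 := by linarith [hs.1]
  have e : (e1 - s) * (e2 - s) * (e3 - s) = (s - e1) * ((s - e2) * (e3 - s)) := by ring
  rw [cubicWeight, e, Real.sqrt_mul q1.le]
  nth_rewrite 1 [← Real.mul_self_sqrt q1.le]
  have := Real.sqrt_pos.2 q1
  field_simp

/-- If `φ` is close to the constant `φ₀` near the colliding roots, the two weighted periods agree
up to a bounded error. -/
theorem abs_weightedPeriod_sub_le (h1 : 0 < e1) (h12 : e1 < e2) (h23 : e2 < e3) {φ : ℝ → ℝ}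
    (hφ : Measurable φ) {φ₀ C : ℝ}
    (ho : ∀ s ∈ Ioo 0 e1, |φ s - φ₀| ≤ C * (e1 - s) / √s)
    (hi : ∀ s ∈ Ioo e2 e3, |φ s - φ₀| ≤ C * (s - e1) / √s) :
    IntOn (fun s => cubicWeight e1 e2 e3 s * φ s) 0 e1 ∧
    IntOn (fun s => cubicWeight e1 e2 e3 s * φ s) e2 e3 ∧
    |(∫ s in (0 : ℝ)..e1, cubicWeight e1 e2 e3 s * φ s) -
      ∫ s in e2..e3, cubicWeight e1 e2 e3 s * φ s| ≤
      2 * Real.pi * C + |φ₀| * (2 * √(e3 / (e1 * e2))) := by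
  have hC : 0 ≤ C := by
    have hm : e1 / 2 ∈ Ioo 0 e1 := ⟨by linarith, by linarith⟩
    have h := (abs_nonneg _).trans (ho _ hm)
    by_contra hC
    have : C * (e1 - e1 / 2) / √(e1 / 2) < 0 :=
      div_neg_of_neg_of_pos (mul_neg_of_neg_of_pos (not_le.1 hC) (by linarith))
        (Real.sqrt_pos.2 hm.1)
    linarith
  have hm : Measurable fun s => cubicWeight e1 e2 e3 s * (φ s - φ₀) :=
    measurable_cubicWeight.mul (hφ.sub_const _)
  -- The bound on φ - φ₀ contains a factor that vanishes at e₁ and cancels the pinched singularity.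
  -- An arcsine kernel of mass π is left on each interval, which is the source of 2πC. The divisor
  -- √s allows φ to blow up at 0, as it does after the reflection s = c₅ - u.
  have bo : ∀ s ∈ Ioo 0 e1, |cubicWeight e1 e2 e3 s * (φ s - φ₀)| ≤
      C * (1 / √((s - 0) * (e1 - s))) := fun s hs => by
    have p := Real.sqrt_pos.2 hs.1
    have h := cubicWeight_outer_le h12 h23 hs.2
    rw [abs_mul, abs_of_nonneg (cubicWeight_nonneg s), sub_zero, Real.sqrt_mul hs.1.le]
    calc cubicWeight e1 e2 e3 s * |φ s - φ₀| ≤ cubicWeight e1 e2 e3 s * (C * (e1 - s) / √s) :=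
          mul_le_mul_of_nonneg_left (ho s hs) (cubicWeight_nonneg s)
      _ = C / √s * ((e1 - s) * cubicWeight e1 e2 e3 s) := by ring
      _ ≤ C / √s * (1 / √(e1 - s)) := mul_le_mul_of_nonneg_left h (by positivity)
      _ = _ := by rw [div_mul_div_comm, mul_one, mul_one_div]
  have bi : ∀ s ∈ Ioo e2 e3, |cubicWeight e1 e2 e3 s * (φ s - φ₀)| ≤
      C * (1 / √((s - e2) * (e3 - s))) := fun s hs => by
    have hs0 : 0 < s := by linarith [hs.1]
    have p := Real.sqrt_pos.2 hs0
    rw [abs_mul, abs_of_nonneg (cubicWeight_nonneg s)]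
    calc cubicWeight e1 e2 e3 s * |φ s - φ₀| ≤ cubicWeight e1 e2 e3 s * (C * (s - e1) / √s) :=
          mul_le_mul_of_nonneg_left (hi s hs) (cubicWeight_nonneg s)
      _ = C / √s * ((s - e1) * cubicWeight e1 e2 e3 s) := by ring
      _ = C * (√(s - e1) / √s) * (1 / √((s - e2) * (e3 - s))) := by
          rw [cubicWeight_inner_eq h12 hs]; ring
      _ ≤ C * 1 * (1 / √((s - e2) * (e3 - s))) := by
          gcongr
          rw [div_le_one p]
          exact Real.sqrt_le_sqrt (by linarith)
      _ = _ := by ring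
  have jo := (intOn_rsqrt_both h1)
  have ji := (intOn_rsqrt_both h23)
  have io := IntOn.of_abs_le h1.le (jo.1.const_mul C) hm bo
  have ii := IntOn.of_abs_le h23.le (ji.1.const_mul C) hm bi
  have ao := abs_integral_le_of_abs_le h1.le (jo.1.const_mul C) hm bo
  have ai := abs_integral_le_of_abs_le h23.le (ji.1.const_mul C) hm bi
  rw [intervalIntegral.integral_const_mul, jo.2] at ao
  rw [intervalIntegral.integral_const_mul, ji.2] at ai
  have ko := intOn_cubicWeight_outer h1.le h12 h23
  have ki := intOn_cubicWeight_inner h12 h23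
  have heq : (fun s => cubicWeight e1 e2 e3 s * φ s) =
      fun s => φ₀ * cubicWeight e1 e2 e3 s + cubicWeight e1 e2 e3 s * (φ s - φ₀) := by
    ext s; ring
  rw [heq]
  refine ⟨(ko.const_mul φ₀).add io, (ki.const_mul φ₀).add ii, ?_⟩
  rw [intervalIntegral.integral_add (ko.const_mul φ₀) io,
    intervalIntegral.integral_add (ki.const_mul φ₀) ii, intervalIntegral.integral_const_mul,
    intervalIntegral.integral_const_mul]
  have hk := mul_le_mul_of_nonneg_left (abs_cubicPeriod_sub_le h1 h12 h23) (abs_nonneg φ₀)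
  rw [← abs_mul] at hk
  have hk := abs_le.1 hk
  have ao := abs_le.1 ao
  have ai := abs_le.1 ai
  rw [abs_le]
  constructor <;> nlinarith

theorem sqrt_sub_sqrt_le {x y : ℝ} (hx : 0 ≤ x) (hxy : x ≤ y) : √y - √x ≤ √(y - x) := by
  have hd := sub_nonneg.2 hxy
  rw [sub_le_iff_le_add, Real.sqrt_le_iff]
  refine ⟨by positivity, ?_⟩
  nlinarith [Real.sq_sqrt hx, Real.sq_sqrt hd, mul_nonneg (Real.sqrt_nonneg x)
    (Real.sqrt_nonneg (y - x))]

/-- The pair of close roots contributes √(s-e₁)/√(s-e₂), whose distance to 1 is at most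
√(e₂-e₁)/√(s-e₂). The remaining kernel is again the arcsine one, and π ≤ 4. -/
theorem abs_integral_inner_sub_le (h1 : 0 < e1) (h12 : e1 < e2) (h23 : e2 < e3) {φ : ℝ → ℝ}
    (hφ : Measurable φ) {C : ℝ} (hC : 0 ≤ C) (h : ∀ s ∈ Ioo e2 e3, |φ s| ≤ C / √s) :
    IntOn (fun s => (s - e1) * cubicWeight e1 e2 e3 s * φ s) e2 e3 ∧
    IntOn (fun s => φ s / √(e3 - s)) e2 e3 ∧
    |(∫ s in e2..e3, (s - e1) * cubicWeight e1 e2 e3 s * φ s) - ∫ s in e2..e3, φ s / √(e3 - s)| ≤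
      4 * C * √(e2 - e1) / √e1 := by
  have p1 := Real.sqrt_pos.2 h1
  have hφ' : ∀ s ∈ Ioo e2 e3, |φ s| ≤ C / √e1 := fun s hs => (h s hs).trans <| by
    gcongr
    linarith [hs.1]
  have i2 : IntOn (fun s => φ s / √(e3 - s)) e2 e3 := by
    refine IntOn.of_abs_le h23.le ((intOn_rsqrt_right h23.le).1.const_mul (C / √e1))
      (by fun_prop) fun s hs => ?_
    rw [abs_div, abs_of_nonneg (Real.sqrt_nonneg _), div_eq_mul_one_div]
    exact mul_le_mul_of_nonneg_right (hφ' s hs) (by positivity)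
  have hm : Measurable fun s => (s - e1) * cubicWeight e1 e2 e3 s * φ s - φ s / √(e3 - s) := by
    have := measurable_cubicWeight (e1 := e1) (e2 := e2) (e3 := e3)
    fun_prop
  have hb : ∀ s ∈ Ioo e2 e3, |(s - e1) * cubicWeight e1 e2 e3 s * φ s - φ s / √(e3 - s)| ≤
      C * √(e2 - e1) / √e1 * (1 / √((s - e2) * (e3 - s))) := fun s hs => by
    have q2 : 0 < s - e2 := by linarith [hs.1]
    have q3 : 0 < e3 - s := by linarith [hs.2]
    have r2 := Real.sqrt_pos.2 q2
    have r3 := Real.sqrt_pos.2 q3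
    have e : (s - e1) * cubicWeight e1 e2 e3 s * φ s - φ s / √(e3 - s) =
        φ s * ((√(s - e1) - √(s - e2)) * (1 / √((s - e2) * (e3 - s)))) := by
      rw [cubicWeight_inner_eq h12 hs, Real.sqrt_mul q2.le]
      field_simp
    have hd := sqrt_sub_sqrt_le q2.le (by linarith : s - e2 ≤ s - e1)
    have hd0 : 0 ≤ √(s - e1) - √(s - e2) :=
      sub_nonneg.2 (Real.sqrt_le_sqrt (by linarith))
    rw [show s - e1 - (s - e2) = e2 - e1 by ring] at hd
    rw [e, abs_mul, abs_of_nonneg (mul_nonneg hd0 (by positivity))]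
    calc |φ s| * ((√(s - e1) - √(s - e2)) * (1 / √((s - e2) * (e3 - s)))) ≤
        C / √e1 * (√(e2 - e1) * (1 / √((s - e2) * (e3 - s)))) := by
          gcongr
          exact hφ' s hs
      _ = _ := by ring
  have j := (intOn_rsqrt_both h23).1.const_mul (C * √(e2 - e1) / √e1)
  have i1 := IntOn.of_abs_le h23.le j hm hb
  have i3 : IntOn (fun s => (s - e1) * cubicWeight e1 e2 e3 s * φ s) e2 e3 := by
    simpa using i1.add i2
  refine ⟨i3, i2, ?_⟩
  have hle := abs_integral_le_of_abs_le h23.le j hm hb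
  rw [intervalIntegral.integral_sub i3 i2, intervalIntegral.integral_const_mul,
    (intOn_rsqrt_both h23).2] at hle
  refine hle.trans ?_
  have : C * √(e2 - e1) / √e1 * Real.pi ≤ C * √(e2 - e1) / √e1 * 4 :=
    mul_le_mul_of_nonneg_left Real.pi_le_four (by positivity)
  linarith [this, (by ring : C * √(e2 - e1) / √e1 * 4 = 4 * C * √(e2 - e1) / √e1)]

/-- Here the pair contributes √(e₁-s)/√(e₂-s), and φ may have an inverse square root singularity at
0. The two difficulties sit at opposite ends of the interval and are separated at e₁/2. -/
theorem abs_integral_outer_sub_le (h1 : 0 < e1) (h12 : e1 < e2) (h23 : e2 < e3) {φ : ℝ → ℝ}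
    (hφ : Measurable φ) {C : ℝ} (hC : 0 ≤ C) (h : ∀ s ∈ Ioo 0 e1, |φ s| ≤ C / √s) :
    IntOn (fun s => (e1 - s) * cubicWeight e1 e2 e3 s * φ s) 0 e1 ∧
    IntOn (fun s => φ s / √(e3 - s)) 0 e1 ∧
    |(∫ s in (0 : ℝ)..e1, (e1 - s) * cubicWeight e1 e2 e3 s * φ s) -
      ∫ s in (0 : ℝ)..e1, φ s / √(e3 - s)| ≤ 8 * C * √(e2 - e1) / √e1 := by
  have p1 := Real.sqrt_pos.2 h1
  have hε : 0 < e2 - e1 := by linarith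
  have i2 : IntOn (fun s => φ s / √(e3 - s)) 0 e1 := by
    refine IntOn.of_abs_le h1.le
      ((intOn_rsqrt_left h1.le).1.const_mul (C / √(e3 - e1)))
      (by fun_prop) fun s hs => ?_
    rw [abs_div, abs_of_nonneg (Real.sqrt_nonneg _), sub_zero]
    calc |φ s| / √(e3 - s) ≤ (C / √s) / √(e3 - e1) := by
          have : 0 < √(e3 - e1) := Real.sqrt_pos.2 (by linarith)
          gcongr
          · exact h s hs
          · exact hs.2.le
      _ = _ := by ring
  have hm : Measurable fun s => (e1 - s) * cubicWeight e1 e2 e3 s * φ s - φ s / √(e3 - s) := by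
    have := measurable_cubicWeight (e1 := e1) (e2 := e2) (e3 := e3)
    fun_prop
  have hb : ∀ s ∈ Ioo 0 e1, |(e1 - s) * cubicWeight e1 e2 e3 s * φ s - φ s / √(e3 - s)| ≤
      C * (2 / √e1) * (1 / √(e1 - s) - 1 / √(e2 - s)) +
        C * (2 * √(e2 - e1) / e1) * (1 / √(s - 0)) := fun s hs => by
    have q1 : 0 < e1 - s := by linarith [hs.2]
    have q2 : 0 < e2 - s := by linarith [hs.2]
    have q3 : 0 < e3 - s := by linarith [hs.2]
    have r1 := Real.sqrt_pos.2 q1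
    have r2 := Real.sqrt_pos.2 q2
    have r3 := Real.sqrt_pos.2 q3
    have r0 := Real.sqrt_pos.2 hs.1
    have hAB : √(e1 - s) ≤ √(e2 - s) := Real.sqrt_le_sqrt (by linarith)
    have hBD : √(e2 - s) ≤ √(e3 - s) := Real.sqrt_le_sqrt (by linarith)
    have hd := sqrt_sub_sqrt_le q1.le (by linarith : e1 - s ≤ e2 - s)
    rw [show e2 - s - (e1 - s) = e2 - e1 by ring] at hd
    have e : (e1 - s) * cubicWeight e1 e2 e3 s * φ s - φ s / √(e3 - s) =
        -(φ s * ((√(e2 - s) - √(e1 - s)) / (√(e2 - s) * √(e3 - s)))) := by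
      rw [cubicWeight, Real.sqrt_mul (mul_pos q1 q2).le, Real.sqrt_mul q1.le]
      nth_rewrite 1 [← Real.mul_self_sqrt q1.le]
      field_simp
      ring
    have hn : 0 ≤ √(e2 - s) - √(e1 - s) := sub_nonneg.2 hAB
    rw [e, abs_neg, abs_mul, abs_of_nonneg (div_nonneg hn (by positivity)), sub_zero]
    have hE : (√(e2 - s) - √(e1 - s)) / (√(e2 - s) * √(e3 - s)) ≤
        (√(e2 - s) - √(e1 - s)) / (√(e2 - s) * √(e2 - s)) := by gcongr
    have hE1 : (√(e2 - s) - √(e1 - s)) / (√(e2 - s) * √(e2 - s)) ≤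
        1 / √(e1 - s) - 1 / √(e2 - s) := by
      rw [div_sub_div _ _ r1.ne' r2.ne', one_mul, mul_one]
      gcongr
    have hE0 : 0 ≤ 1 / √(e1 - s) - 1 / √(e2 - s) := le_trans (by positivity) hE1
    have hφs : |φ s| * ((√(e2 - s) - √(e1 - s)) / (√(e2 - s) * √(e3 - s))) ≤
        C / √s * ((√(e2 - s) - √(e1 - s)) / (√(e2 - s) * √(e2 - s))) :=
      mul_le_mul (h s hs) hE (div_nonneg hn (by positivity)) (by positivity)
    refine hφs.trans ?_
    -- Near the roots the error is dominated by 1/√(e₁-s) - 1/√(e₂-s), whose integral is small. Near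
    -- 0 it is dominated by the square root of the gap, divided by √s.
    rcases le_total (e1 / 2) s with hse | hse
    · have h2 : 1 / √s ≤ 2 / √e1 := by
        rw [div_le_div_iff₀ r0 p1]
        have : √e1 ≤ √(2 ^ 2 * s) := Real.sqrt_le_sqrt (by linarith)
        rw [Real.sqrt_mul (by norm_num), Real.sqrt_sq (by norm_num)] at this
        linarith
      have : C / √s * ((√(e2 - s) - √(e1 - s)) / (√(e2 - s) * √(e2 - s))) ≤
          C * (2 / √e1) * (1 / √(e1 - s) - 1 / √(e2 - s)) := by
        rw [div_eq_mul_one_div C]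
        gcongr
      have h0 : 0 ≤ C * (2 * √(e2 - e1) / e1) * (1 / √s) := by positivity
      linarith
    · have h2 : (√(e2 - s) - √(e1 - s)) / (√(e2 - s) * √(e2 - s)) ≤ 2 * √(e2 - e1) / e1 := by
        rw [Real.mul_self_sqrt q2.le]
        calc (√(e2 - s) - √(e1 - s)) / (e2 - s) ≤ √(e2 - e1) / (e1 / 2) := by
              gcongr
              linarith
          _ = _ := by ring
      have : C / √s * ((√(e2 - s) - √(e1 - s)) / (√(e2 - s) * √(e2 - s))) ≤
          C * (2 * √(e2 - e1) / e1) * (1 / √s) := by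
        calc _ ≤ C / √s * (2 * √(e2 - e1) / e1) := by gcongr
          _ = _ := by ring
      have h0 : 0 ≤ C * (2 / √e1) * (1 / √(e1 - s) - 1 / √(e2 - s)) := by positivity
      linarith
  have j1 := intOn_rsqrt_right h1.le
  have j2 := intOn_rsqrt_left h1.le
  have j3 := intOn_rsqrt_right (h1.trans h12).le
  have j4 := intOn_rsqrt_right h12.le
  have j3' : IntOn (fun s => 1 / √(e2 - s)) 0 e1 :=
    j3.1.mono_set (by rw [uIcc_of_le h1.le, uIcc_of_le (by linarith)]; exact Icc_subset_Icc le_rfl h12.le)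
  have j5 := intervalIntegral.integral_add_adjacent_intervals j3' j4.1
  rw [j3.2, j4.2] at j5
  have j := ((j1.1.sub j3').const_mul (C * (2 / √e1))).add
    (j2.1.const_mul (C * (2 * √(e2 - e1) / e1)))
  have i1 := IntOn.of_abs_le h1.le j hm hb
  have i3 : IntOn (fun s => (e1 - s) * cubicWeight e1 e2 e3 s * φ s) 0 e1 := by
    simpa using i1.add i2
  refine ⟨i3, i2, ?_⟩
  have hle := abs_integral_le_of_abs_le h1.le j hm hb
  rw [intervalIntegral.integral_sub i3 i2, intervalIntegral.integral_add
    ((j1.1.sub j3').const_mul _) (j2.1.const_mul _), intervalIntegral.integral_const_mul,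
    intervalIntegral.integral_const_mul, intervalIntegral.integral_sub j1.1 j3', j1.2, j2.2] at hle
  refine hle.trans ?_
  simp only [sub_zero] at j5 ⊢
  have hs12 : √e1 ≤ √e2 := Real.sqrt_le_sqrt h12.le
  -- The integral of 1/√(e₂-s) over (0,e₁) is 2√e₂ - 2√(e₂-e₁), and √e₁ ≤ √e₂.
  have hx : 2 * √e1 - (∫ s in (0 : ℝ)..e1, 1 / √(e2 - s)) ≤ 2 * √(e2 - e1) := by linarith
  have hy : C * (2 / √e1) * (2 * √e1 - (∫ s in (0 : ℝ)..e1, 1 / √(e2 - s))) ≤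
      C * (2 / √e1) * (2 * √(e2 - e1)) := mul_le_mul_of_nonneg_left hx (by positivity)
  have hz : C * (2 * √(e2 - e1) / e1) * (2 * √e1) = 4 * C * √(e2 - e1) / √e1 := by
    calc _ = 4 * C * √(e2 - e1) * (√e1 / e1) := by ring
      _ = _ := by rw [Real.sqrt_div_self']; ring
  rw [hz]
  calc _ ≤ C * (2 / √e1) * (2 * √(e2 - e1)) + 4 * C * √(e2 - e1) / √e1 := by gcongr
    _ = _ := by ring

/-- The merged integral also runs over the gap (e₁,e₂), which belongs to neither of the two periods.
Its contribution is of the order of the square root of the gap. -/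
theorem abs_integral_gap_le (h1 : 0 < e1) (h12 : e1 < e2) (h23 : e2 < e3) {φ : ℝ → ℝ}
    (hφ : Measurable φ) {C : ℝ} (hC : 0 ≤ C) (h : ∀ s ∈ Ioo e1 e2, |φ s| ≤ C / √s) :
    IntOn (fun s => φ s / √(e3 - s)) e1 e2 ∧
    |∫ s in e1..e2, φ s / √(e3 - s)| ≤ 2 * C * √(e2 - e1) / √e1 := by
  have p1 := Real.sqrt_pos.2 h1
  have hb : ∀ s ∈ Ioo e1 e2, |φ s / √(e3 - s)| ≤ C / √e1 * (1 / √(e2 - s)) := fun s hs => by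
    have r2 : 0 < √(e2 - s) := Real.sqrt_pos.2 (by linarith [hs.2])
    rw [abs_div, abs_of_nonneg (Real.sqrt_nonneg _)]
    calc |φ s| / √(e3 - s) ≤ (C / √e1) / √(e2 - s) := by
          gcongr
          exact (h s hs).trans (by gcongr; exact hs.1.le)
      _ = _ := by ring
  have j := intOn_rsqrt_right h12.le
  refine ⟨IntOn.of_abs_le h12.le (j.1.const_mul _) (by fun_prop) hb, ?_⟩
  have := abs_integral_le_of_abs_le h12.le (j.1.const_mul _) (by fun_prop) hb
  rw [intervalIntegral.integral_const_mul, j.2] at this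
  refine this.trans (le_of_eq (by ring))

/-- As `e₁` and `e₂` collide, `∫ (e₁ - s) φ / √cubic` becomes an integral over `(0, e₃)`. -/
theorem abs_integral_merge_le (h1 : 0 < e1) (h12 : e1 < e2) (h23 : e2 < e3) {φ : ℝ → ℝ}
    (hφ : Measurable φ) {C : ℝ} (hC : 0 ≤ C) (h : ∀ s ∈ Ioo 0 e3, |φ s| ≤ C / √s) :
    IntOn (fun s => φ s / √(e3 - s)) 0 e3 ∧
    |(∫ s in (0 : ℝ)..e1, (e1 - s) * cubicWeight e1 e2 e3 s * φ s) +
      (∫ s in e2..e3, (s - e1) * cubicWeight e1 e2 e3 s * φ s) -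
      ∫ s in (0 : ℝ)..e3, φ s / √(e3 - s)| ≤ 14 * C * √(e2 - e1) / √e1 := by
  obtain ⟨-, i1, b1⟩ := abs_integral_outer_sub_le h1 h12 h23 hφ hC
    fun s hs => h s ⟨hs.1, by linarith [hs.2]⟩
  obtain ⟨i2, b2⟩ := abs_integral_gap_le h1 h12 h23 hφ hC
    fun s hs => h s ⟨by linarith [hs.1], by linarith [hs.2]⟩
  obtain ⟨-, i3, b3⟩ := abs_integral_inner_sub_le h1 h12 h23 hφ hC
    fun s hs => h s ⟨by linarith [hs.1], by linarith [hs.2]⟩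
  refine ⟨(i1.trans i2).trans i3, ?_⟩
  rw [← intervalIntegral.integral_add_adjacent_intervals (i1.trans i2) i3,
    ← intervalIntegral.integral_add_adjacent_intervals i1 i2]
  -- The constant 14 is 8 + 2 + 4: outer interval, gap, inner interval.
  have e : 14 * C * √(e2 - e1) / √e1 = 8 * C * √(e2 - e1) / √e1 + 2 * C * √(e2 - e1) / √e1 +
      4 * C * √(e2 - e1) / √e1 := by ring
  rw [e]
  rw [abs_le] at *
  constructor <;> linarith [b1.1, b1.2, b2.1, b2.2, b3.1, b3.2]

theorem pi_div_le_cubicPeriod (h12 : e1 < e2) (h23 : e2 < e3) :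
    Real.pi / √(e3 - e1) ≤ ∫ s in e2..e3, cubicWeight e1 e2 e3 s := by
  have j := intOn_rsqrt_both h23
  have := integral_le_of_le_Ioo h23.le (j.1.const_mul (1 / √(e3 - e1)))
    (intOn_cubicWeight_inner h12 h23) fun s hs => by
      have q2 : 0 < s - e2 := by linarith [hs.1]
      have q3 : 0 < e3 - s := by linarith [hs.2]
      have p1 : 0 < s - e1 := by linarith
      have e : (e1 - s) * (e2 - s) * (e3 - s) = (s - e1) * ((s - e2) * (e3 - s)) := by ring
      rw [cubicWeight, e, Real.sqrt_mul p1.le, one_div_mul_one_div]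
      refine one_div_le_one_div_of_le (mul_pos (Real.sqrt_pos.2 p1)
        (Real.sqrt_pos.2 (mul_pos q2 q3))) ?_
      exact mul_le_mul_of_nonneg_right (Real.sqrt_le_sqrt (by linarith)) (Real.sqrt_nonneg _)
  rw [intervalIntegral.integral_const_mul, j.2] at this
  refine le_trans (le_of_eq ?_) this
  ring

theorem integral_one_div_sub (h12 : e1 < e2) (h23 : e2 ≤ e3) :
    IntOn (fun s => 1 / (s - e1)) e2 e3 ∧
    (∫ s in e2..e3, 1 / (s - e1)) = Real.log ((e3 - e1) / (e2 - e1)) := by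
  have h2 : 0 < e2 - e1 := by linarith
  have h3 : 0 < e3 - e1 := by linarith
  have := ftc_of_nonneg h23 (F := fun s => Real.log (s - e1)) (f := fun s => 1 / (s - e1))
    (ContinuousOn.log (by fun_prop) fun s hs => by
      have : 0 < s - e1 := by linarith [hs.1]
      exact this.ne')
    (fun s hs => by
      have : s - e1 ≠ 0 := by
        have : 0 < s - e1 := by linarith [hs.1]
        exact this.ne'
      simpa using ((hasDerivAt_id s).sub_const e1).log this)
    (fun s hs => by
      have : 0 < s - e1 := by linarith [hs.1]
      positivity)
  refine ⟨this.1, this.2.trans ?_⟩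
  rw [Real.log_div h3.ne' h2.ne']

theorem log_div_le_cubicPeriod (h12 : e1 < e2) (h23 : e2 < e3) :
    Real.log ((e3 - e1) / (e2 - e1)) / √(e3 - e2) ≤ ∫ s in e2..e3, cubicWeight e1 e2 e3 s := by
  have j := integral_one_div_sub h12 h23.le
  have := integral_le_of_le_Ioo h23.le (j.1.const_mul (1 / √(e3 - e2)))
    (intOn_cubicWeight_inner h12 h23) fun s hs => by
      have q2 : 0 < s - e2 := by linarith [hs.1]
      have q3 : 0 < e3 - s := by linarith [hs.2]
      have p1 : 0 < s - e1 := by linarith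
      have e : (e1 - s) * (e2 - s) * (e3 - s) = ((s - e1) * (s - e2)) * (e3 - s) := by ring
      rw [cubicWeight, one_div_mul_one_div]
      refine one_div_le_one_div_of_le (Real.sqrt_pos.2 (by rw [e]; positivity)) ?_
      have e' : √(e3 - e2) * (s - e1) = √((s - e1) ^ 2 * (e3 - e2)) := by
        rw [mul_comm ((s - e1) ^ 2), sqrt_mul_sq_abs, abs_of_pos p1, mul_comm]
      rw [e', e]
      refine Real.sqrt_le_sqrt (mul_le_mul ?_ ?_ q3.le (by positivity))
      · nlinarith
      · linarith [hs.1]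
  rw [intervalIntegral.integral_const_mul, j.2] at this
  refine le_trans (le_of_eq ?_) this
  ring

/-- The period between the roots diverges at least like the logarithm of the gap. -/
theorem log_le_cubicPeriod (h12 : e1 < e2) (h23 : e2 < e3) {U : ℝ} (hU : e3 - e2 ≤ U)
    (hε : e2 - e1 < 1) :
    min (1 / (2 * √U)) (Real.pi / 4) * Real.log (1 / (e2 - e1)) ≤
      ∫ s in e2..e3, cubicWeight e1 e2 e3 s := by
  have h2 : 0 < e2 - e1 := by linarith
  have h3 : 0 < e3 - e1 := by linarith
  have h32 : 0 < e3 - e2 := by linarith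
  have hl : 0 < Real.log (1 / (e2 - e1)) := Real.log_pos (by rw [lt_div_iff₀ h2]; linarith)
  have r := Real.sqrt_pos.2 h2
  -- The bound must be uniform in e₃ - e₁, because at the vertexes (c,c) and (b,b) all three roots
  -- collide. If e₃ - e₁ is at least the square root of the gap, half of the logarithm survives.
  -- Otherwise the interval is so short that π/√(e₃-e₁) beats the logarithm.
  rcases le_total (√(e2 - e1)) (e3 - e1) with h | h
  · refine le_trans ?_ (log_div_le_cubicPeriod h12 h23)
    have hlog : 1 / 2 * Real.log (1 / (e2 - e1)) ≤ Real.log ((e3 - e1) / (e2 - e1)) := by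
      have e : 1 / 2 * Real.log (1 / (e2 - e1)) = Real.log (√(e2 - e1) / (e2 - e1)) := by
        rw [Real.log_div r.ne' h2.ne', Real.log_sqrt h2.le, one_div (e2 - e1), Real.log_inv]
        ring
      rw [e]
      exact Real.log_le_log (by positivity) (by gcongr)
    calc _ ≤ 1 / (2 * √U) * Real.log (1 / (e2 - e1)) :=
          mul_le_mul_of_nonneg_right (min_le_left _ _) hl.le
      _ = (1 / 2 * Real.log (1 / (e2 - e1))) / √U := by field_simp
      _ ≤ Real.log ((e3 - e1) / (e2 - e1)) / √(e3 - e2) := by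
          have := Real.sqrt_pos.2 h32
          have := le_trans (by positivity) hlog
          gcongr
  · refine le_trans ?_ (pi_div_le_cubicPeriod h12 h23)
    have rr := Real.sqrt_pos.2 r
    -- Writing ε as the fourth power of its fourth root and using log x ≤ x - 1 gives log(1/ε) ≤ 4
    -- ε^(-1/4).
    have hlog : Real.log (1 / (e2 - e1)) ≤ 4 * (1 / √√(e2 - e1)) := by
      have e : Real.log (1 / (e2 - e1)) = 4 * Real.log (1 / √√(e2 - e1)) := by
        rw [one_div, one_div, Real.log_inv, Real.log_inv, Real.log_sqrt r.le, Real.log_sqrt h2.le]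
        ring
      rw [e]
      have := Real.log_le_sub_one_of_pos (x := 1 / √√(e2 - e1)) (by positivity)
      linarith
    calc _ ≤ Real.pi / 4 * Real.log (1 / (e2 - e1)) :=
          mul_le_mul_of_nonneg_right (min_le_right _ _) hl.le
      _ ≤ Real.pi / 4 * (4 * (1 / √√(e2 - e1))) :=
          mul_le_mul_of_nonneg_left hlog (by positivity)
      _ = Real.pi / √√(e2 - e1) := by ring
      _ ≤ Real.pi / √(e3 - e1) := by
          have := Real.sqrt_pos.2 h3
          have := Real.pi_pos
          gcongr

end

/-! ### Linear combinations of the period equations -/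

/-- The parameters are positive and strictly increasing. -/
structure Sorted5 (c1 c2 c3 c4 c5 : ℝ) : Prop where
  pos : 0 < c1
  lt12 : c1 < c2
  lt23 : c2 < c3
  lt34 : c3 < c4
  lt45 : c4 < c5

/-- The linear system for the frequency in terms of sorted parameters. -/
def SolvesPeriods (c1 c2 c3 c4 c5 : ℝ) (w : ℝ × ℝ) : Prop :=
  ∀ i ∈ ({0, 1} : Set ℕ), (∫ s in (0 : ℝ)..c1, s ^ i / √(quintic c1 c2 c3 c4 c5 s)) +
    2 * (-(w.1 * ∫ s in c2..c3, s ^ i / √(quintic c1 c2 c3 c4 c5 s)) +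
      w.2 * ∫ s in c4..c5, s ^ i / √(quintic c1 c2 c3 c4 c5 s)) = 0

/-- The integral over `(0, c₁)` of `|c₄ - s| / √T(s)`. -/
noncomputable def perA0 (c1 c2 c3 c4 c5 : ℝ) : ℝ :=
  ∫ s in (0 : ℝ)..c1, (c4 - s) / √(quintic c1 c2 c3 c4 c5 s)

/-- The integral over `(c₂, c₃)` of `|c₄ - s| / √T(s)`. -/
noncomputable def perA1 (c1 c2 c3 c4 c5 : ℝ) : ℝ :=
  ∫ s in c2..c3, (c4 - s) / √(quintic c1 c2 c3 c4 c5 s)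

/-- The integral over `(c₄, c₅)` of `|c₄ - s| / √T(s)`. -/
noncomputable def perA2 (c1 c2 c3 c4 c5 : ℝ) : ℝ :=
  ∫ s in c4..c5, (s - c4) / √(quintic c1 c2 c3 c4 c5 s)

/-- The integral over `(0, c₁)` of `|s - c₁| / √T(s)`. -/
noncomputable def perB0 (c1 c2 c3 c4 c5 : ℝ) : ℝ :=
  ∫ s in (0 : ℝ)..c1, (c1 - s) / √(quintic c1 c2 c3 c4 c5 s)

/-- The integral over `(c₂, c₃)` of `|s - c₁| / √T(s)`. -/
noncomputable def perB1 (c1 c2 c3 c4 c5 : ℝ) : ℝ :=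
  ∫ s in c2..c3, (s - c1) / √(quintic c1 c2 c3 c4 c5 s)

/-- The integral over `(c₄, c₅)` of `|s - c₁| / √T(s)`. -/
noncomputable def perB2 (c1 c2 c3 c4 c5 : ℝ) : ℝ :=
  ∫ s in c4..c5, (s - c1) / √(quintic c1 c2 c3 c4 c5 s)

namespace Sorted5

variable {c1 c2 c3 c4 c5 : ℝ} {w : ℝ × ℝ}

theorem intOn_zero (h : Sorted5 c1 c2 c3 c4 c5) {q : ℝ → ℝ} (hq : Continuous q) :
    IntOn (fun s => q s / √(quintic c1 c2 c3 c4 c5 s)) 0 c1 := by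
  obtain ⟨h0, h12, h23, h34, h45⟩ := h
  have hw : ContinuousOn (fun s => q s * weight0 c2 c3 c4 c5 s) (uIcc 0 c1) := by
    rw [uIcc_of_le h0.le]
    exact hq.continuousOn.mul (continuousOn_weight0 h12 (by linarith) (by linarith) (by linarith))
  refine IntOn.congr_Ioo h0.le ((intOn_rsqrt_right h0.le).1.continuousOn_mul hw) fun s hs => ?_
  rw [div_eq_mul_one_div (q s), rsqrt_quintic_zero hs.2.le]
  ring

theorem intOn_one (h : Sorted5 c1 c2 c3 c4 c5) {q : ℝ → ℝ} (hq : Continuous q) :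
    IntOn (fun s => q s / √(quintic c1 c2 c3 c4 c5 s)) c2 c3 := by
  obtain ⟨h0, h12, h23, h34, h45⟩ := h
  have hw : ContinuousOn (fun s => q s * weight1 c1 c4 c5 s) (uIcc c2 c3) := by
    rw [uIcc_of_le h23.le]
    exact hq.continuousOn.mul (continuousOn_weight1 h12 h34 (by linarith))
  refine IntOn.congr_Ioo h23.le ((intOn_rsqrt_both h23).1.continuousOn_mul hw) fun s hs => ?_
  rw [div_eq_mul_one_div (q s), rsqrt_quintic_one ⟨hs.1.le, hs.2.le⟩]
  ring

theorem intOn_two (h : Sorted5 c1 c2 c3 c4 c5) {q : ℝ → ℝ} (hq : Continuous q) :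
    IntOn (fun s => q s / √(quintic c1 c2 c3 c4 c5 s)) c4 c5 := by
  obtain ⟨h0, h12, h23, h34, h45⟩ := h
  have hw : ContinuousOn (fun s => q s * weight2 c1 c2 c3 s) (uIcc c4 c5) := by
    rw [uIcc_of_le h45.le]
    exact hq.continuousOn.mul (continuousOn_weight2 (by linarith) (by linarith) h34)
  refine IntOn.congr_Ioo h45.le ((intOn_rsqrt_both h45).1.continuousOn_mul hw) fun s hs => ?_
  rw [div_eq_mul_one_div (q s), rsqrt_quintic_two ⟨hs.1.le, hs.2.le⟩]
  ring

theorem period_combination {u v : ℝ}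
    (hi : ∀ q : ℝ → ℝ, Continuous q → IntOn (fun s => q s / √(quintic c1 c2 c3 c4 c5 s)) u v)
    (x y : ℝ) : (∫ s in u..v, (x + y * s) / √(quintic c1 c2 c3 c4 c5 s)) =
      x * (∫ s in u..v, s ^ 0 / √(quintic c1 c2 c3 c4 c5 s)) +
        y * ∫ s in u..v, s ^ 1 / √(quintic c1 c2 c3 c4 c5 s) := by
  have h0 := hi (fun s => s ^ 0) (by fun_prop)
  have h1 := hi (fun s => s ^ 1) (by fun_prop)
  rw [← intervalIntegral.integral_const_mul, ← intervalIntegral.integral_const_mul,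
    ← intervalIntegral.integral_add (h0.const_mul x) (h1.const_mul y)]
  congr 1; ext s; ring

theorem equation (h : Sorted5 c1 c2 c3 c4 c5) (hw : SolvesPeriods c1 c2 c3 c4 c5 w) (x y : ℝ) :
    (∫ s in (0 : ℝ)..c1, (x + y * s) / √(quintic c1 c2 c3 c4 c5 s)) +
    2 * (-(w.1 * ∫ s in c2..c3, (x + y * s) / √(quintic c1 c2 c3 c4 c5 s)) +
      w.2 * ∫ s in c4..c5, (x + y * s) / √(quintic c1 c2 c3 c4 c5 s)) = 0 := by
  rw [period_combination (fun q hq => h.intOn_zero hq),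
    period_combination (fun q hq => h.intOn_one hq),
    period_combination (fun q hq => h.intOn_two hq)]
  have h0 := hw 0 (by simp)
  have h1 := hw 1 (by simp)
  linear_combination x * h0 + y * h1

/-- The multiplier c₄ - s makes every term nonnegative and weakens the root c₄. So the last period
stays bounded even when c₃ is close to c₄, while the first two still diverge when c₁ and c₂ collide.
-/
theorem equationA (h : Sorted5 c1 c2 c3 c4 c5) (hw : SolvesPeriods c1 c2 c3 c4 c5 w) :
    perA0 c1 c2 c3 c4 c5 = 2 * w.1 * perA1 c1 c2 c3 c4 c5 + 2 * w.2 * perA2 c1 c2 c3 c4 c5 := by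
  have e := h.equation hw c4 (-1)
  have e2 : (∫ s in c4..c5, (c4 + -1 * s) / √(quintic c1 c2 c3 c4 c5 s)) =
      -perA2 c1 c2 c3 c4 c5 := by
    rw [perA2, ← intervalIntegral.integral_neg]; congr 1; ext s; ring
  have ea : ∀ s : ℝ, c4 + -1 * s = c4 - s := fun s => by ring
  rw [e2] at e
  simp only [ea] at e
  rw [perA0, perA1]
  linear_combination e

/-- The mirror image of `equationA`: the multiplier s - c₁ weakens the root c₁, so the first period
stays bounded even when c₂ is close to c₁. -/
theorem equationB (h : Sorted5 c1 c2 c3 c4 c5) (hw : SolvesPeriods c1 c2 c3 c4 c5 w) :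
    perB0 c1 c2 c3 c4 c5 + 2 * w.1 * perB1 c1 c2 c3 c4 c5 = 2 * w.2 * perB2 c1 c2 c3 c4 c5 := by
  have e := h.equation hw (-c1) 1
  have e2 : (∫ s in (0 : ℝ)..c1, (-c1 + 1 * s) / √(quintic c1 c2 c3 c4 c5 s)) =
      -perB0 c1 c2 c3 c4 c5 := by
    rw [perB0, ← intervalIntegral.integral_neg]; congr 1; ext s; ring
  have ea : ∀ s : ℝ, -c1 + 1 * s = s - c1 := fun s => by ring
  rw [e2] at e
  simp only [ea] at e
  rw [perB1, perB2]
  linear_combination -e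

theorem perA1_nonneg (h : Sorted5 c1 c2 c3 c4 c5) : 0 ≤ perA1 c1 c2 c3 c4 c5 :=
  integral_nonneg_Ioo h.lt23.le fun s hs => div_nonneg
    (by linarith [hs.2, h.lt34]) (Real.sqrt_nonneg _)

theorem perA2_nonneg (h : Sorted5 c1 c2 c3 c4 c5) : 0 ≤ perA2 c1 c2 c3 c4 c5 :=
  integral_nonneg_Ioo h.lt45.le fun s hs => div_nonneg
    (by linarith [hs.1]) (Real.sqrt_nonneg _)

theorem perB0_nonneg (h : Sorted5 c1 c2 c3 c4 c5) : 0 ≤ perB0 c1 c2 c3 c4 c5 :=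
  integral_nonneg_Ioo h.pos.le fun s hs => div_nonneg
    (by linarith [hs.2]) (Real.sqrt_nonneg _)

theorem perB1_nonneg (h : Sorted5 c1 c2 c3 c4 c5) : 0 ≤ perB1 c1 c2 c3 c4 c5 :=
  integral_nonneg_Ioo h.lt23.le fun s hs => div_nonneg
    (by linarith [hs.1, h.lt12]) (Real.sqrt_nonneg _)

/-! #### The periods in terms of cubic weights -/

theorem div_sqrt_quintic_low {q s : ℝ} (hs : s < c4) (h45 : c4 < c5) :
    q / √(quintic c1 c2 c3 c4 c5 s) =
      cubicWeight c1 c2 c3 s * (q / √((c4 - s) * (c5 - s))) := by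
  have h4 : 0 < c4 - s := by linarith
  have h5 : 0 < c5 - s := by linarith
  have e : quintic c1 c2 c3 c4 c5 s =
      ((c1 - s) * (c2 - s) * (c3 - s)) * ((c4 - s) * (c5 - s)) := by rw [quintic]; ring
  rw [e, Real.sqrt_mul' _ (mul_pos h4 h5).le, cubicWeight, div_mul_div_comm, one_mul]

/-- The reflection s = c₅ - u turns the collision of c₃ and c₄ into one of the two smallest roots of
a cubic, so that the estimates for the lower pair can be reused. The remaining factor vanishes at u
= 0, and this is why those estimates tolerate 1/√s. -/
theorem div_sqrt_quintic_high {q u : ℝ} (hu0 : 0 < u) (hu : u < c5 - c1) :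
    q / √(quintic c1 c2 c3 c4 c5 (c5 - u)) =
      cubicWeight (c5 - c4) (c5 - c3) (c5 - c2) u * (q / √((c5 - c1 - u) * u)) := by
  have e : quintic c1 c2 c3 c4 c5 (c5 - u) =
      ((c5 - c4 - u) * (c5 - c3 - u) * (c5 - c2 - u)) * ((c5 - c1 - u) * u) := by
    rw [quintic]; ring
  rw [e, Real.sqrt_mul' _ (mul_pos (by linarith) hu0).le, cubicWeight, div_mul_div_comm, one_mul]

theorem integral_low_zero (h : Sorted5 c1 c2 c3 c4 c5) (q : ℝ → ℝ) :
    (∫ s in (0 : ℝ)..c1, q s / √(quintic c1 c2 c3 c4 c5 s)) =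
      ∫ s in (0 : ℝ)..c1, cubicWeight c1 c2 c3 s * (q s / √((c4 - s) * (c5 - s))) :=
  integral_congr_Ioo h.pos.le fun s hs =>
    div_sqrt_quintic_low (by linarith [hs.2, h.lt12, h.lt23, h.lt34]) h.lt45

theorem integral_low_one (h : Sorted5 c1 c2 c3 c4 c5) (q : ℝ → ℝ) :
    (∫ s in c2..c3, q s / √(quintic c1 c2 c3 c4 c5 s)) =
      ∫ s in c2..c3, cubicWeight c1 c2 c3 s * (q s / √((c4 - s) * (c5 - s))) :=
  integral_congr_Ioo h.lt23.le fun s hs =>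
    div_sqrt_quintic_low (by linarith [hs.2, h.lt34]) h.lt45

theorem integral_high_two (h : Sorted5 c1 c2 c3 c4 c5) (q : ℝ → ℝ) :
    (∫ s in c4..c5, q s / √(quintic c1 c2 c3 c4 c5 s)) =
      ∫ u in (0 : ℝ)..(c5 - c4), cubicWeight (c5 - c4) (c5 - c3) (c5 - c2) u *
        (q (c5 - u) / √((c5 - c1 - u) * u)) := by
  have := intervalIntegral.integral_comp_sub_left (a := 0) (b := c5 - c4)
    (fun s => q s / √(quintic c1 c2 c3 c4 c5 s)) c5
  rw [sub_sub_cancel, sub_zero] at this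
  rw [← this]
  exact integral_congr_Ioo (by linarith [h.lt45]) fun u hu =>
    div_sqrt_quintic_high hu.1 (by linarith [hu.2, h.lt12, h.lt23, h.lt34])

theorem integral_high_one (h : Sorted5 c1 c2 c3 c4 c5) (q : ℝ → ℝ) :
    (∫ s in c2..c3, q s / √(quintic c1 c2 c3 c4 c5 s)) =
      ∫ u in (c5 - c3)..(c5 - c2), cubicWeight (c5 - c4) (c5 - c3) (c5 - c2) u *
        (q (c5 - u) / √((c5 - c1 - u) * u)) := by
  have := intervalIntegral.integral_comp_sub_left (a := c5 - c3) (b := c5 - c2)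
    (fun s => q s / √(quintic c1 c2 c3 c4 c5 s)) c5
  rw [sub_sub_cancel, sub_sub_cancel] at this
  rw [← this]
  exact integral_congr_Ioo (by linarith [h.lt23]) fun u hu =>
    div_sqrt_quintic_high (by linarith [hu.1, h.lt34, h.lt45])
      (by linarith [hu.2, h.lt12])

end Sorted5

/-- The difference of two quotients of square roots. -/
theorem abs_sqrt_div_sub_le {x y x₀ y₀ m : ℝ} (hx : 0 ≤ x) (hy : 0 < y) (hx₀ : 0 ≤ x₀) (hy₀ : 0 < y₀)
    (hm : 0 < m) (hmx : m ≤ √x * √y₀ + √x₀ * √y) :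
    |√x / √y - √x₀ / √y₀| ≤ |x * y₀ - x₀ * y| / (m * (√y * √y₀)) := by
  have p := Real.sqrt_pos.2 hy
  have p₀ := Real.sqrt_pos.2 hy₀
  have e : √x / √y - √x₀ / √y₀ =
      (x * y₀ - x₀ * y) / ((√x * √y₀ + √x₀ * √y) * (√y * √y₀)) := by
    have hs : 0 < √x * √y₀ + √x₀ * √y := lt_of_lt_of_le hm hmx
    rw [div_sub_div _ _ p.ne' p₀.ne', div_eq_div_iff (by positivity) (by positivity)]
    have e1 : x * y₀ - x₀ * y = (√x * √x) * (√y₀ * √y₀) - (√x₀ * √x₀) * (√y * √y) := by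
      rw [Real.mul_self_sqrt hx, Real.mul_self_sqrt hy.le, Real.mul_self_sqrt hx₀,
        Real.mul_self_sqrt hy₀.le]
    rw [e1]; ring
  rw [e, abs_div, abs_of_pos (mul_pos (lt_of_lt_of_le hm hmx) (mul_pos p p₀))]
  gcongr

/-! ### Bounded differences of logarithmically divergent periods -/

namespace Sorted5

variable {c1 c2 c3 c4 c5 : ℝ} {w : ℝ × ℝ} {L η U : ℝ}

/-- Apart from the cubic with roots c₁, c₂, c₃, both integrands carry the weight √(c₄-s)/√(c₅-s),
which is Lipschitz at c₁ under the gap hypotheses. The comparison of weighted periods applies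
without any lower bound on c₂ - c₁. -/
theorem abs_perA0_sub_perA1_le (h : Sorted5 c1 c2 c3 c4 c5) (hL : 0 < L) (hη : 0 < η)
    (h1 : L ≤ c1) (h41 : η ≤ c4 - c1) (h53 : η ≤ c5 - c3) (hU : c5 ≤ U) :
    |perA0 c1 c2 c3 c4 c5 - perA1 c1 c2 c3 c4 c5| ≤
      2 * Real.pi * (U * √U / (η * η)) + 2 * √(U / (L * L)) := by
  have ⟨h0, h12, h23, h34, h45⟩ := h
  have e : ∀ s, s < c4 → (c4 - s) / √((c4 - s) * (c5 - s)) = √(c4 - s) / √(c5 - s) := fun s hs => by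
    have h4 : 0 < c4 - s := by linarith
    rw [Real.sqrt_mul h4.le, ← div_div, Real.div_sqrt]
  have e0 : perA0 c1 c2 c3 c4 c5 =
      ∫ s in (0 : ℝ)..c1, cubicWeight c1 c2 c3 s * (√(c4 - s) / √(c5 - s)) := by
    rw [perA0, h.integral_low_zero (fun s => c4 - s)]
    exact integral_congr_Ioo h0.le fun s hs => by rw [e s (by linarith [hs.2])]
  have e1 : perA1 c1 c2 c3 c4 c5 =
      ∫ s in c2..c3, cubicWeight c1 c2 c3 s * (√(c4 - s) / √(c5 - s)) := by
    rw [perA1, h.integral_low_one (fun s => c4 - s)]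
    exact integral_congr_Ioo h23.le fun s hs => by rw [e s (by linarith [hs.2])]
  have hb : ∀ s, 0 < s → s < c3 → |√(c4 - s) / √(c5 - s) - √(c4 - c1) / √(c5 - c1)| ≤
      U * √U / (η * η) * |s - c1| / √s := fun s hs0 hs => by
    have q5 : 0 < c5 - s := by linarith
    have q51 : 0 < c5 - c1 := by linarith
    have q41 : 0 < c4 - c1 := by linarith
    have hU0 : 0 < U := by linarith
    have r0 := Real.sqrt_pos.2 hs0
    have := abs_sqrt_div_sub_le (x := c4 - s) (y := c5 - s) (x₀ := c4 - c1) (y₀ := c5 - c1)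
      (m := √η * √η) (by linarith) q5 q41.le q51
      (mul_pos (Real.sqrt_pos.2 hη) (Real.sqrt_pos.2 hη))
      (le_trans (mul_le_mul (Real.sqrt_le_sqrt h41) (Real.sqrt_le_sqrt (by linarith))
        (Real.sqrt_nonneg _) (Real.sqrt_nonneg _)) (le_add_of_nonneg_left (by positivity)))
    refine this.trans ?_
    have en : (c4 - s) * (c5 - c1) - (c4 - c1) * (c5 - s) = -((s - c1) * (c5 - c4)) := by ring
    rw [en, abs_neg, abs_mul, abs_of_pos (by linarith : 0 < c5 - c4), Real.mul_self_sqrt hη.le]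
    have hd : η ≤ √(c5 - s) * √(c5 - c1) := by
      calc η = √η * √η := (Real.mul_self_sqrt hη.le).symm
        _ ≤ _ := mul_le_mul (Real.sqrt_le_sqrt (by linarith)) (Real.sqrt_le_sqrt (by linarith))
          (Real.sqrt_nonneg _) (Real.sqrt_nonneg _)
    -- This factor is inserted only to reach the form required by `abs_weightedPeriod_sub_le`.
    have hs1 : 1 ≤ √U / √s := by
      rw [one_le_div r0]
      exact Real.sqrt_le_sqrt (by linarith)
    calc |s - c1| * (c5 - c4) / (η * (√(c5 - s) * √(c5 - c1))) ≤ |s - c1| * U / (η * η) := by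
          gcongr
          linarith
      _ ≤ |s - c1| * U / (η * η) * (√U / √s) := le_mul_of_one_le_right (by positivity) hs1
      _ = _ := by ring
  obtain ⟨-, -, H⟩ := abs_weightedPeriod_sub_le h0 h12 h23 (φ := fun s => √(c4 - s) / √(c5 - s))
    (by fun_prop) (φ₀ := √(c4 - c1) / √(c5 - c1)) (C := U * √U / (η * η))
    (fun s hs => by
      have := hb s hs.1 (by linarith [hs.2])
      rwa [abs_of_neg (by linarith [hs.2] : s - c1 < 0), neg_sub] at this)
    (fun s hs => by
      have := hb s (by linarith [hs.1]) hs.2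
      rwa [abs_of_pos (by linarith [hs.1] : 0 < s - c1)] at this)
  rw [← e0, ← e1] at H
  refine H.trans (add_le_add le_rfl ?_)
  have hφ : |√(c4 - c1) / √(c5 - c1)| ≤ 1 := by
    rw [abs_of_nonneg (by positivity)]
    exact div_le_one_of_le₀ (Real.sqrt_le_sqrt (by linarith)) (Real.sqrt_nonneg _)
  calc _ ≤ 1 * (2 * √(c3 / (c1 * c2))) := by gcongr
    _ ≤ 2 * √(U / (L * L)) := by
      rw [one_mul]
      gcongr <;> linarith

/-- The reflected counterpart: the pinched pair is c₅ - c₄, c₅ - c₃, and the weight is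
√(c₅-c₁-u)/√u. -/
theorem abs_perB2_sub_perB1_le (h : Sorted5 c1 c2 c3 c4 c5) (hη : 0 < η)
    (h54 : η ≤ c5 - c4) (h41 : η ≤ c4 - c1) (hU : c5 ≤ U) :
    |perB2 c1 c2 c3 c4 c5 - perB1 c1 c2 c3 c4 c5| ≤
      2 * Real.pi * (U / (η * √η)) + √U / √η * (2 * √(U / (η * η))) := by
  have ⟨h0, h12, h23, h34, h45⟩ := h
  have e : ∀ u, 0 < u → u < c5 - c1 →
      (c5 - u - c1) / √((c5 - c1 - u) * u) = √(c5 - c1 - u) / √u := fun u hu0 hu => by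
    have h4 : 0 < c5 - c1 - u := by linarith
    rw [Real.sqrt_mul h4.le, ← div_div, show c5 - u - c1 = c5 - c1 - u by ring, Real.div_sqrt]
  have e2 : perB2 c1 c2 c3 c4 c5 = ∫ u in (0 : ℝ)..(c5 - c4),
      cubicWeight (c5 - c4) (c5 - c3) (c5 - c2) u * (√(c5 - c1 - u) / √u) := by
    rw [perB2, h.integral_high_two (fun s => s - c1)]
    exact integral_congr_Ioo (by linarith) fun u hu => by rw [e u hu.1 (by linarith [hu.2])]
  have e1 : perB1 c1 c2 c3 c4 c5 = ∫ u in (c5 - c3)..(c5 - c2),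
      cubicWeight (c5 - c4) (c5 - c3) (c5 - c2) u * (√(c5 - c1 - u) / √u) := by
    rw [perB1, h.integral_high_one (fun s => s - c1)]
    exact integral_congr_Ioo (by linarith) fun u hu => by
      rw [e u (by linarith [hu.1]) (by linarith [hu.2])]
  have hη' := Real.sqrt_pos.2 hη
  have hb : ∀ u, 0 < u → u < c5 - c2 → (u ≤ c5 - c4 ∨ c5 - c4 ≤ u) →
      |√(c5 - c1 - u) / √u - √(c4 - c1) / √(c5 - c4)| ≤
        U / (η * √η) * |u - (c5 - c4)| / √u := fun u hu0 hu hcase => by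
    have r0 := Real.sqrt_pos.2 hu0
    have hU0 : 0 < U := by linarith
    -- Neither summand is bounded below on the whole range: u may tend to 0, and c₅ - c₁ - u may be
    -- small at the other end. On each side of c₅ - c₄ one of them is.
    have hm : √η * √η ≤ √(c5 - c1 - u) * √(c5 - c4) + √(c4 - c1) * √u := by
      rcases hcase with hc | hc
      · exact le_trans (mul_le_mul (Real.sqrt_le_sqrt (by linarith)) (Real.sqrt_le_sqrt h54)
          (Real.sqrt_nonneg _) (Real.sqrt_nonneg _)) (le_add_of_nonneg_right (by positivity))
      · exact le_trans (mul_le_mul (Real.sqrt_le_sqrt h41) (Real.sqrt_le_sqrt (by linarith))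
          (Real.sqrt_nonneg _) (Real.sqrt_nonneg _)) (le_add_of_nonneg_left (by positivity))
    have := abs_sqrt_div_sub_le (x := c5 - c1 - u) (y := u) (x₀ := c4 - c1) (y₀ := c5 - c4)
      (m := √η * √η) (by linarith) hu0 (by linarith) (by linarith) (by positivity) hm
    refine this.trans ?_
    have en : (c5 - c1 - u) * (c5 - c4) - (c4 - c1) * u = -((u - (c5 - c4)) * (c5 - c1)) := by ring
    rw [en, abs_neg, abs_mul, abs_of_pos (by linarith : 0 < c5 - c1), Real.mul_self_sqrt hη.le]
    calc |u - (c5 - c4)| * (c5 - c1) / (η * (√u * √(c5 - c4))) ≤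
        |u - (c5 - c4)| * U / (η * (√u * √η)) := by
          gcongr
          linarith
      _ = _ := by field_simp
  obtain ⟨-, -, H⟩ := abs_weightedPeriod_sub_le (e1 := c5 - c4) (e2 := c5 - c3) (e3 := c5 - c2)
    (by linarith) (by linarith) (by linarith) (φ := fun u => √(c5 - c1 - u) / √u)
    (by fun_prop) (φ₀ := √(c4 - c1) / √(c5 - c4)) (C := U / (η * √η))
    (fun s hs => by
      have := hb s hs.1 (by linarith [hs.2]) (.inl hs.2.le)
      rwa [abs_of_neg (by linarith [hs.2] : s - (c5 - c4) < 0), neg_sub] at this)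
    (fun s hs => by
      have := hb s (by linarith [hs.1]) hs.2 (.inr (by linarith [hs.1]))
      rwa [abs_of_pos (by linarith [hs.1] : 0 < s - (c5 - c4))] at this)
  rw [← e1, ← e2] at H
  refine H.trans (add_le_add le_rfl ?_)
  rw [abs_of_nonneg (by positivity)]
  have hU0 : 0 < U := by linarith
  gcongr <;> linarith

end Sorted5

/-- Together with its converse below, this turns bounds for the integrands into polynomial
inequalities between products of gaps. -/
theorem div_sqrt_le_of_sq_mul_le {q x Q : ℝ} (hq : 0 ≤ q) (hx : 0 < x)
    (h : x * q ^ 2 ≤ Q) : q / √Q ≤ 1 / √x := by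
  have hx' := Real.sqrt_pos.2 hx
  have h1 := Real.sqrt_le_sqrt h
  rw [sqrt_mul_sq_abs, abs_of_nonneg hq] at h1
  rcases eq_or_lt_of_le hq with rfl | hq
  · simp
  · rw [div_le_div_iff₀ (lt_of_lt_of_le (by positivity) h1) hx', one_mul]
    exact h1

theorem one_div_sqrt_le_div_sqrt {q x Q : ℝ} (hq : 0 ≤ q) (hx : 0 < x) (hQ : 0 < Q)
    (h : Q ≤ x * q ^ 2) : 1 / √x ≤ q / √Q := by
  have hx' := Real.sqrt_pos.2 hx
  have hQ' := Real.sqrt_pos.2 hQ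
  have h1 := Real.sqrt_le_sqrt h
  rw [sqrt_mul_sq_abs, abs_of_nonneg hq] at h1
  rw [div_le_div_iff₀ hx' hQ', one_mul]
  exact h1

theorem integral_const_interval (u v r : ℝ) : (∫ _ in u..v, r) = (v - u) * r := by
  simp

/-! ### Upper and lower bounds for the individual periods -/

namespace Sorted5

variable {c1 c2 c3 c4 c5 : ℝ} {w : ℝ × ℝ} {L η U : ℝ}

theorem le_perA1 (h : Sorted5 c1 c2 c3 c4 c5) (hη : 0 < η) (h43 : η ≤ c4 - c3) (hU : c5 ≤ U)
    (hε : c2 - c1 < 1) :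
    √η / √U * min (1 / (2 * √U)) (Real.pi / 4) * Real.log (1 / (c2 - c1)) ≤
      perA1 c1 c2 c3 c4 c5 := by
  have ⟨h0, h12, h23, h34, h45⟩ := h
  have hk := log_le_cubicPeriod h12 h23 (U := U) (by linarith) hε
  rw [mul_assoc]
  refine (mul_le_mul_of_nonneg_left hk (by positivity)).trans ?_
  rw [perA1, ← intervalIntegral.integral_const_mul]
  refine integral_le_of_le_Ioo h23.le ((intOn_cubicWeight_inner h12 h23).const_mul _)
    (h.intOn_one (by fun_prop)) fun s hs => ?_
  rw [div_sqrt_quintic_low (by linarith [hs.2]) h45, mul_comm]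
  refine mul_le_mul_of_nonneg_left ?_ (cubicWeight_nonneg s)
  have h4 : 0 < c4 - s := by linarith [hs.2]
  have h5 : 0 < c5 - s := by linarith
  rw [Real.sqrt_mul h4.le, ← div_div, Real.div_sqrt]
  have := Real.sqrt_pos.2 h5
  gcongr <;> linarith [hs.1, hs.2]

theorem le_perB1 (h : Sorted5 c1 c2 c3 c4 c5) (hη : 0 < η) (h21 : η ≤ c2 - c1) (hU : c5 ≤ U)
    (hε : c4 - c3 < 1) :
    √η / √U * min (1 / (2 * √U)) (Real.pi / 4) * Real.log (1 / (c4 - c3)) ≤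
      perB1 c1 c2 c3 c4 c5 := by
  have ⟨h0, h12, h23, h34, h45⟩ := h
  have hk := log_le_cubicPeriod (e1 := c5 - c4) (e2 := c5 - c3) (e3 := c5 - c2) (U := U)
    (by linarith) (by linarith) (by linarith) (by linarith)
  rw [show c5 - c3 - (c5 - c4) = c4 - c3 by ring] at hk
  rw [mul_assoc]
  refine (mul_le_mul_of_nonneg_left hk (by positivity)).trans ?_
  have hB := h.integral_high_one (fun s => s - c1)
  rw [perB1, hB, ← intervalIntegral.integral_const_mul]
  have hi : IntOn (fun u => cubicWeight (c5 - c4) (c5 - c3) (c5 - c2) u *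
      ((c5 - u - c1) / √((c5 - c1 - u) * u))) (c5 - c3) (c5 - c2) := by
    have := (h.intOn_one (q := fun s => s - c1) (by fun_prop)).comp_sub_left c5
    refine IntOn.congr_Ioo (by linarith) this.symm fun u hu => ?_
    exact div_sqrt_quintic_high (by linarith [hu.1]) (by linarith [hu.2])
  refine integral_le_of_le_Ioo (by linarith)
    ((intOn_cubicWeight_inner (by linarith) (by linarith)).const_mul _) hi fun u hu => ?_
  rw [mul_comm]
  refine mul_le_mul_of_nonneg_left ?_ (cubicWeight_nonneg u)
  have h4 : 0 < c5 - c1 - u := by linarith [hu.2]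
  have h5 : 0 < u := by linarith [hu.1]
  rw [Real.sqrt_mul h4.le, ← div_div, show c5 - u - c1 = c5 - c1 - u by ring, Real.div_sqrt]
  have := Real.sqrt_pos.2 h5
  gcongr <;> linarith [hu.1, hu.2]

theorem quintic_eq_one (s : ℝ) : quintic c1 c2 c3 c4 c5 s =
    (s - c1) * (s - c2) * (c3 - s) * (c4 - s) * (c5 - s) := by rw [quintic]; ring

theorem quintic_eq_two (s : ℝ) : quintic c1 c2 c3 c4 c5 s =
    (s - c1) * (s - c2) * (s - c3) * (s - c4) * (c5 - s) := by rw [quintic]; ring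

/-- Unlike `le_perA1`, this needs no lower bound on c₄ - c₃, since c₃ - s ≤ c₄ - s absorbs that root
into the multiplier. It serves the double collision, where c₃ - c₁ is bounded below instead. -/
theorem log_le_perA1 (h : Sorted5 c1 c2 c3 c4 c5) (hU : c5 ≤ U) :
    Real.log ((c3 - c1) / (c2 - c1)) / √U ≤ perA1 c1 c2 c3 c4 c5 := by
  have ⟨h0, h12, h23, h34, h45⟩ := h
  have j := integral_one_div_sub h12 h23.le
  rw [← j.2, div_eq_inv_mul, ← intervalIntegral.integral_const_mul]
  refine integral_le_of_le_Ioo h23.le (j.1.const_mul _) (h.intOn_one (by fun_prop)) fun s hs => ?_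
  obtain ⟨hs1, hs2⟩ := hs
  have q1 : 0 < s - c1 := by linarith
  have q2 : 0 < s - c2 := by linarith
  have q3 : 0 < c3 - s := by linarith
  have q4 : 0 < c4 - s := by linarith
  have q5 : 0 < c5 - s := by linarith
  have hU0 : 0 < U := by linarith
  have e : (√U)⁻¹ * (1 / (s - c1)) = 1 / √(U * (s - c1) ^ 2) := by
    rw [sqrt_mul_sq_abs, abs_of_pos q1]; field_simp
  rw [e]
  refine one_div_sqrt_le_div_sqrt q4.le (by positivity) ?_ ?_
  · rw [quintic_eq_one]; positivity
  · rw [quintic_eq_one]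
    calc (s - c1) * (s - c2) * (c3 - s) * (c4 - s) * (c5 - s) ≤
        (s - c1) * (s - c1) * (c4 - s) * (c4 - s) * U := by
          gcongr <;> linarith
      _ = _ := by ring

theorem log_le_perB1 (h : Sorted5 c1 c2 c3 c4 c5) (hU : c5 ≤ U) :
    Real.log ((c4 - c2) / (c4 - c3)) / √U ≤ perB1 c1 c2 c3 c4 c5 := by
  have ⟨h0, h12, h23, h34, h45⟩ := h
  have j := integral_one_div_sub (e1 := -c4) (e2 := -c3) (e3 := -c2) (by linarith) (by linarith)
  rw [show -c2 - -c4 = c4 - c2 by ring, show -c3 - -c4 = c4 - c3 by ring] at j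
  have j1 : IntOn (fun s => 1 / (c4 - s)) c2 c3 := by
    have := j.1.comp_sub_left 0
    simp only [zero_sub, zero_add, sub_neg_eq_add] at this
    refine IntOn.congr_Ioo h23.le this.symm fun s _ => ?_
    rw [neg_add_eq_sub]
  have j2 : (∫ s in c2..c3, 1 / (c4 - s)) = Real.log ((c4 - c2) / (c4 - c3)) := by
    rw [← j.2]
    have := intervalIntegral.integral_comp_sub_left (a := c2) (b := c3)
      (fun s => 1 / (s - -c4)) 0
    simp only [zero_sub, sub_neg_eq_add, neg_add_eq_sub] at this
    simp only [sub_neg_eq_add]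
    rw [← this]
  rw [← j2, div_eq_inv_mul, ← intervalIntegral.integral_const_mul]
  refine integral_le_of_le_Ioo h23.le (j1.const_mul _) (h.intOn_one (by fun_prop)) fun s hs => ?_
  obtain ⟨hs1, hs2⟩ := hs
  have q1 : 0 < s - c1 := by linarith
  have q2 : 0 < s - c2 := by linarith
  have q3 : 0 < c3 - s := by linarith
  have q4 : 0 < c4 - s := by linarith
  have q5 : 0 < c5 - s := by linarith
  have hU0 : 0 < U := by linarith
  have e : (√U)⁻¹ * (1 / (c4 - s)) = 1 / √(U * (c4 - s) ^ 2) := by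
    rw [sqrt_mul_sq_abs, abs_of_pos q4]; field_simp
  rw [e]
  refine one_div_sqrt_le_div_sqrt q1.le (by positivity) ?_ ?_
  · rw [quintic_eq_one]; positivity
  · rw [quintic_eq_one]
    calc (s - c1) * (s - c2) * (c3 - s) * (c4 - s) * (c5 - s) ≤
        (s - c1) * (s - c1) * (c4 - s) * (c4 - s) * U := by
          gcongr <;> linarith
      _ = _ := by ring

/-- The multiplier cancels both close roots, because s - c₄ ≤ s - c₃. Hence no lower bound on c₄ -
c₃ is needed. -/
theorem perA2_le (h : Sorted5 c1 c2 c3 c4 c5) (hη : 0 < η) (h42 : η ≤ c4 - c2) (hU : c5 ≤ U) :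
    perA2 c1 c2 c3 c4 c5 ≤ 1 / η * (2 * √U) := by
  have ⟨h0, h12, h23, h34, h45⟩ := h
  have j := intOn_rsqrt_right h45.le
  have : perA2 c1 c2 c3 c4 c5 ≤ ∫ s in c4..c5, 1 / η * (1 / √(c5 - s)) := by
    refine integral_le_of_le_Ioo h45.le (h.intOn_two (by fun_prop)) (j.1.const_mul _) fun s hs => ?_
    obtain ⟨hs1, hs2⟩ := hs
    have q4 : 0 < s - c4 := by linarith
    have q5 : 0 < c5 - s := by linarith
    have q1 : 0 < s - c1 := by linarith
    have q2 : 0 < s - c2 := by linarith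
    have e : 1 / η * (1 / √(c5 - s)) = 1 / √((c5 - s) * η ^ 2) := by
      rw [sqrt_mul_sq_abs, abs_of_pos hη, one_div_mul_one_div]
    rw [e]
    refine div_sqrt_le_of_sq_mul_le q4.le (by positivity) ?_
    rw [quintic_eq_two]
    calc (c5 - s) * η ^ 2 * (s - c4) ^ 2 = η * η * (s - c4) * (s - c4) * (c5 - s) := by ring
      _ ≤ _ := by gcongr <;> first | positivity | linarith
  rw [intervalIntegral.integral_const_mul, j.2] at this
  refine this.trans ?_
  gcongr
  linarith

/-- The same cancellation at the lower pair: c₁ - s ≤ c₂ - s makes the bound independent of c₂ - c₁.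
-/
theorem perB0_le (h : Sorted5 c1 c2 c3 c4 c5) (hη : 0 < η) (h31 : η ≤ c3 - c1) (hU : c5 ≤ U) :
    perB0 c1 c2 c3 c4 c5 ≤ U * (1 / √(η ^ 3)) := by
  have ⟨h0, h12, h23, h34, h45⟩ := h
  have : perB0 c1 c2 c3 c4 c5 ≤ ∫ s in (0 : ℝ)..c1, 1 / √(η ^ 3) := by
    refine integral_le_of_le_Ioo h0.le (h.intOn_zero (by fun_prop)) intervalIntegrable_const
      fun s hs => ?_
    obtain ⟨hs1, hs2⟩ := hs
    have q1 : 0 < c1 - s := by linarith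
    have q2 : 0 < c2 - s := by linarith
    have q3 : 0 < c3 - s := by linarith
    have q4 : 0 < c4 - s := by linarith
    refine div_sqrt_le_of_sq_mul_le q1.le (by positivity) ?_
    rw [quintic]
    calc η ^ 3 * (c1 - s) ^ 2 = (c1 - s) * (c1 - s) * η * η * η := by ring
      _ ≤ _ := by gcongr <;> first | positivity | linarith
  rw [integral_const_interval, sub_zero] at this
  refine this.trans ?_
  gcongr
  linarith

/-- A crude bound, with each of the five factors replaced by U. It keeps a coefficient of the second
frequency away from 0 whatever c₃ does. -/
theorem le_perA2 (h : Sorted5 c1 c2 c3 c4 c5) (hη : 0 < η) (h54 : η ≤ c5 - c4) (hU : c5 ≤ U) :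
    η ^ 2 / (2 * √(U ^ 5)) ≤ perA2 c1 c2 c3 c4 c5 := by
  have ⟨h0, h12, h23, h34, h45⟩ := h
  have hU0 : 0 < U := by linarith
  have hU5 : 0 < √(U ^ 5) := Real.sqrt_pos.2 (by positivity)
  have j : IntOn (fun s => (s - c4) / √(U ^ 5)) c4 c5 :=
    Continuous.intervalIntegrable (by fun_prop) _ _
  have : (∫ s in c4..c5, (s - c4) / √(U ^ 5)) ≤ perA2 c1 c2 c3 c4 c5 := by
    refine integral_le_of_le_Ioo h45.le j (h.intOn_two (by fun_prop)) fun s hs => ?_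
    obtain ⟨hs1, hs2⟩ := hs
    have q1 : 0 < s - c1 := by linarith
    have q2 : 0 < s - c2 := by linarith
    have q3 : 0 < s - c3 := by linarith
    have q4 : 0 < s - c4 := by linarith
    have q5 : 0 < c5 - s := by linarith
    have hQ : 0 < quintic c1 c2 c3 c4 c5 s := by rw [quintic_eq_two]; positivity
    refine div_le_div_of_nonneg_left q4.le (Real.sqrt_pos.2 hQ) (Real.sqrt_le_sqrt ?_)
    rw [quintic_eq_two]
    calc _ ≤ U * U * U * U * U := by gcongr <;> linarith
      _ = _ := by ring
  refine le_trans ?_ this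
  have e : (∫ s in c4..c5, (s - c4) / √(U ^ 5)) = (c5 - c4) ^ 2 / (2 * √(U ^ 5)) := by
    rw [intervalIntegral.integral_div, intervalIntegral.integral_sub
      (Continuous.intervalIntegrable (by fun_prop) _ _) (by simp), integral_id,
      intervalIntegral.integral_const]
    simp only [smul_eq_mul]
    field_simp
    ring
  rw [e]
  gcongr

/-! #### Comparison with the periods of the limit cubics -/

/-- When c₁ and c₂ merge, the multiplier |s - c₁| cancels the pair, and the two intervals join to
(0,c₃). The limit is a period of the cubic with roots c₃, c₄, c₅, with an error of the order of the
square root of the gap. -/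
theorem abs_perB0_add_perB1_sub_le (h : Sorted5 c1 c2 c3 c4 c5) (hη : 0 < η) (h43 : η ≤ c4 - c3)
    (hU : c5 ≤ U) :
    |perB0 c1 c2 c3 c4 c5 + perB1 c1 c2 c3 c4 c5 - ∫ s in (0 : ℝ)..c3, cubicWeight c3 c4 c5 s| ≤
      14 * (√U / η) * √(c2 - c1) / √c1 ∧
    |perB1 c1 c2 c3 c4 c5 - ∫ s in c2..c3, cubicWeight c3 c4 c5 s| ≤
      4 * (√U / η) * √(c2 - c1) / √c1 := by
  have ⟨h0, h12, h23, h34, h45⟩ := h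
  have hU0 : 0 < U := by linarith
  have hφ : ∀ s, 0 < s → s < c3 → |1 / √((c4 - s) * (c5 - s))| ≤ √U / η / √s := fun s h1 h2 => by
    have r := Real.sqrt_pos.2 h1
    rw [abs_of_nonneg (by positivity)]
    have h1' : η ≤ √((c4 - s) * (c5 - s)) := by
      refine Real.le_sqrt_of_sq_le ?_
      rw [pow_two]
      gcongr <;> linarith
    calc 1 / √((c4 - s) * (c5 - s)) ≤ 1 / η := by gcongr
      _ ≤ 1 / η * (√U / √s) := by
        refine le_mul_of_one_le_right (by positivity) ?_
        rw [one_le_div r]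
        exact Real.sqrt_le_sqrt (by linarith)
      _ = _ := by ring
  have e0 : perB0 c1 c2 c3 c4 c5 =
      ∫ s in (0 : ℝ)..c1, (c1 - s) * cubicWeight c1 c2 c3 s * (1 / √((c4 - s) * (c5 - s))) := by
    rw [perB0, h.integral_low_zero (fun s => c1 - s)]
    congr 1; ext s; ring
  have e1 : perB1 c1 c2 c3 c4 c5 =
      ∫ s in c2..c3, (s - c1) * cubicWeight c1 c2 c3 s * (1 / √((c4 - s) * (c5 - s))) := by
    rw [perB1, h.integral_low_one (fun s => s - c1)]
    congr 1; ext s; ring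
  have er : ∀ s, s < c3 → cubicWeight c3 c4 c5 s = 1 / √((c4 - s) * (c5 - s)) / √(c3 - s) :=
    fun s hs => by
      rw [cubicWeight, mul_assoc, Real.sqrt_mul (by linarith), div_div, mul_comm]
  rw [e0, e1]
  constructor
  · rw [integral_congr_Ioo (by linarith) fun s hs => er s hs.2]
    exact (abs_integral_merge_le h0 h12 h23 (φ := fun s => 1 / √((c4 - s) * (c5 - s)))
      (by fun_prop) (by positivity) fun s hs => hφ s hs.1 hs.2).2
  · rw [integral_congr_Ioo h23.le fun s hs => er s hs.2]
    exact (abs_integral_inner_sub_le h0 h12 h23 (φ := fun s => 1 / √((c4 - s) * (c5 - s)))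
      (by fun_prop) (by positivity) fun s hs => hφ s (by linarith [hs.1]) hs.2).2.2

/-- On (c₄,c₅) the merged pair contributes (s-c₁)/√((s-c₁)(s-c₂)), which lies between 1 and 1 +
(c₂-c₁)/η. -/
theorem perB2_sub_mem (h : Sorted5 c1 c2 c3 c4 c5) (hη : 0 < η) (h42 : η ≤ c4 - c2) :
    (∫ s in c4..c5, cubicWeight c3 c4 c5 s) ≤ perB2 c1 c2 c3 c4 c5 ∧
    perB2 c1 c2 c3 c4 c5 ≤ (1 + (c2 - c1) / η) * ∫ s in c4..c5, cubicWeight c3 c4 c5 s := by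
  have ⟨h0, h12, h23, h34, h45⟩ := h
  have hi := intOn_cubicWeight_inner h34 h45
  have key : ∀ s ∈ Ioo c4 c5, (s - c1) / √(quintic c1 c2 c3 c4 c5 s) =
      (s - c1) / √((s - c1) * (s - c2)) * cubicWeight c3 c4 c5 s := fun s hs => by
    have q : 0 < (s - c1) * (s - c2) := mul_pos (by linarith [hs.1]) (by linarith [hs.1])
    have e : quintic c1 c2 c3 c4 c5 s =
        ((s - c1) * (s - c2)) * ((c3 - s) * (c4 - s) * (c5 - s)) := by rw [quintic]; ring
    rw [e, Real.sqrt_mul q.le, cubicWeight, div_mul_div_comm, mul_one]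
  have hB : perB2 c1 c2 c3 c4 c5 =
      ∫ s in c4..c5, (s - c1) / √((s - c1) * (s - c2)) * cubicWeight c3 c4 c5 s :=
    integral_congr_Ioo h45.le key
  have hiB := (h.intOn_two (q := fun s => s - c1) (by fun_prop)).congr_Ioo h45.le key
  rw [hB, ← intervalIntegral.integral_const_mul]
  constructor
  · refine integral_le_of_le_Ioo h45.le hi hiB fun s hs => ?_
    have q1 : 0 < s - c1 := by linarith [hs.1]
    have q2 : 0 < s - c2 := by linarith [hs.1]
    refine le_mul_of_one_le_left (cubicWeight_nonneg s) ?_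
    rw [one_le_div (Real.sqrt_pos.2 (mul_pos q1 q2)), Real.sqrt_le_left q1.le, pow_two]
    gcongr
  · refine integral_le_of_le_Ioo h45.le hiB (hi.const_mul _) fun s hs => ?_
    have q1 : 0 < s - c1 := by linarith [hs.1]
    have q2 : 0 < s - c2 := by linarith [hs.1]
    refine mul_le_mul_of_nonneg_right ?_ (cubicWeight_nonneg s)
    calc (s - c1) / √((s - c1) * (s - c2)) ≤ (s - c1) / (s - c2) := by
          refine div_le_div_of_nonneg_left q1.le q2 (Real.le_sqrt_of_sq_le ?_)
          rw [pow_two]; gcongr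
      _ = 1 + (c2 - c1) / (s - c2) := by field_simp; ring
      _ ≤ _ := by gcongr; linarith [hs.1]

theorem perA0_sub_mem (h : Sorted5 c1 c2 c3 c4 c5) (hη : 0 < η) (h31 : η ≤ c3 - c1) :
    (∫ s in (0 : ℝ)..c1, cubicWeight c1 c2 c5 s) ≤ perA0 c1 c2 c3 c4 c5 ∧
    perA0 c1 c2 c3 c4 c5 ≤ (1 + (c4 - c3) / η) * ∫ s in (0 : ℝ)..c1, cubicWeight c1 c2 c5 s := by
  have ⟨h0, h12, h23, h34, h45⟩ := h
  have hi := intOn_cubicWeight_outer h0.le h12 (by linarith : c2 < c5)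
  have key : ∀ s ∈ Ioo 0 c1, (c4 - s) / √(quintic c1 c2 c3 c4 c5 s) =
      (c4 - s) / √((c4 - s) * (c3 - s)) * cubicWeight c1 c2 c5 s := fun s hs => by
    have q : 0 < (c4 - s) * (c3 - s) := mul_pos (by linarith [hs.2]) (by linarith [hs.2])
    have e : quintic c1 c2 c3 c4 c5 s =
        ((c4 - s) * (c3 - s)) * ((c1 - s) * (c2 - s) * (c5 - s)) := by rw [quintic]; ring
    rw [e, Real.sqrt_mul q.le, cubicWeight, div_mul_div_comm, mul_one]
  have hB : perA0 c1 c2 c3 c4 c5 =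
      ∫ s in (0 : ℝ)..c1, (c4 - s) / √((c4 - s) * (c3 - s)) * cubicWeight c1 c2 c5 s :=
    integral_congr_Ioo h0.le key
  have hiB := (h.intOn_zero (q := fun s => c4 - s) (by fun_prop)).congr_Ioo h0.le key
  rw [hB, ← intervalIntegral.integral_const_mul]
  constructor
  · refine integral_le_of_le_Ioo h0.le hi hiB fun s hs => ?_
    have q1 : 0 < c4 - s := by linarith [hs.2]
    have q2 : 0 < c3 - s := by linarith [hs.2]
    refine le_mul_of_one_le_left (cubicWeight_nonneg s) ?_
    rw [one_le_div (Real.sqrt_pos.2 (mul_pos q1 q2)), Real.sqrt_le_left q1.le, pow_two]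
    gcongr
  · refine integral_le_of_le_Ioo h0.le hiB (hi.const_mul _) fun s hs => ?_
    have q1 : 0 < c4 - s := by linarith [hs.2]
    have q2 : 0 < c3 - s := by linarith [hs.2]
    refine mul_le_mul_of_nonneg_right ?_ (cubicWeight_nonneg s)
    calc (c4 - s) / √((c4 - s) * (c3 - s)) ≤ (c4 - s) / (c3 - s) := by
          refine div_le_div_of_nonneg_left q1.le q2 (Real.le_sqrt_of_sq_le ?_)
          rw [pow_two]; gcongr
      _ = 1 + (c4 - c3) / (c3 - s) := by field_simp; ring
      _ ≤ _ := by gcongr; linarith [hs.2]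

/-- The reflected version of the merging: when c₃ and c₄ collide, the intervals (c₂,c₃) and (c₄,c₅)
join, and the cubic with roots c₁, c₂, c₅ remains. -/
theorem abs_perA1_add_perA2_sub_le (h : Sorted5 c1 c2 c3 c4 c5) (hη : 0 < η) (h21 : η ≤ c2 - c1) :
    |perA1 c1 c2 c3 c4 c5 + perA2 c1 c2 c3 c4 c5 - ∫ s in c2..c5, cubicWeight c1 c2 c5 s| ≤
      14 * (1 / √η) * √(c4 - c3) / √(c5 - c4) ∧
    |perA1 c1 c2 c3 c4 c5 - ∫ s in c2..c3, cubicWeight c1 c2 c5 s| ≤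
      4 * (1 / √η) * √(c4 - c3) / √(c5 - c4) := by
  have ⟨h0, h12, h23, h34, h45⟩ := h
  have hη' := Real.sqrt_pos.2 hη
  have hφ : ∀ u, 0 < u → u < c5 - c2 → |1 / √((c5 - c1 - u) * u)| ≤ 1 / √η / √u :=
    fun u h1 h2 => by
      have r := Real.sqrt_pos.2 h1
      rw [abs_of_nonneg (by positivity), Real.sqrt_mul (by linarith), ← div_div]
      gcongr
      linarith
  have e2 : perA2 c1 c2 c3 c4 c5 = ∫ u in (0 : ℝ)..(c5 - c4), (c5 - c4 - u) *
      cubicWeight (c5 - c4) (c5 - c3) (c5 - c2) u * (1 / √((c5 - c1 - u) * u)) := by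
    rw [perA2, h.integral_high_two (fun s => s - c4)]
    congr 1; ext u; ring
  have e1 : perA1 c1 c2 c3 c4 c5 = ∫ u in (c5 - c3)..(c5 - c2), (u - (c5 - c4)) *
      cubicWeight (c5 - c4) (c5 - c3) (c5 - c2) u * (1 / √((c5 - c1 - u) * u)) := by
    rw [perA1, h.integral_high_one (fun s => c4 - s)]
    congr 1; ext u; ring
  have er : ∀ u, 0 < u → u < c5 - c2 →
      cubicWeight c1 c2 c5 (c5 - u) = 1 / √((c5 - c1 - u) * u) / √(c5 - c2 - u) :=
    fun u h1 h2 => by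
      have e : (c1 - (c5 - u)) * (c2 - (c5 - u)) * (c5 - (c5 - u)) =
        ((c5 - c1 - u) * u) * (c5 - c2 - u) := by ring
      rw [cubicWeight, e, Real.sqrt_mul' _ (by linarith), div_div]
  have r1 := intervalIntegral.integral_comp_sub_left (a := 0) (b := c5 - c2)
    (fun s => cubicWeight c1 c2 c5 s) c5
  have r2 := intervalIntegral.integral_comp_sub_left (a := c5 - c3) (b := c5 - c2)
    (fun s => cubicWeight c1 c2 c5 s) c5
  rw [sub_sub_cancel, sub_zero] at r1
  rw [sub_sub_cancel, sub_sub_cancel] at r2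
  have hc : c4 - c3 = c5 - c3 - (c5 - c4) := by ring
  rw [e1, e2, ← r1, ← r2, hc]
  constructor
  · rw [integral_congr_Ioo (by linarith) fun u hu => er u hu.1 hu.2]
    have := (abs_integral_merge_le (e1 := c5 - c4) (e2 := c5 - c3) (e3 := c5 - c2)
      (by linarith) (by linarith) (by linarith) (φ := fun u => 1 / √((c5 - c1 - u) * u))
      (by fun_prop) (by positivity) fun u hu => hφ u hu.1 hu.2).2
    rwa [add_comm (∫ u in (0 : ℝ)..(c5 - c4), _)] at this
  · rw [integral_congr_Ioo (by linarith) fun u hu => er u (by linarith [hu.1]) hu.2]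
    exact (abs_integral_inner_sub_le (e1 := c5 - c4) (e2 := c5 - c3) (e3 := c5 - c2)
      (by linarith) (by linarith) (by linarith) (φ := fun u => 1 / √((c5 - c1 - u) * u))
      (by fun_prop) (by positivity) fun u hu => hφ u (by linarith [hu.1]) hu.2).2.2

end Sorted5

/-! ### Upper bounds for the limit periods, and logarithm inequalities -/

section

variable {e1 e2 e3 η : ℝ}

theorem cubicPeriod_le (hη : 0 < η) (h21 : η ≤ e2 - e1) (h23 : e2 < e3) :
    (∫ s in e2..e3, cubicWeight e1 e2 e3 s) ≤ 1 / √η * Real.pi := by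
  have j := intOn_rsqrt_both h23
  rw [← j.2, ← intervalIntegral.integral_const_mul]
  refine integral_le_of_le_Ioo h23.le (intOn_cubicWeight_inner (by linarith) h23)
    (j.1.const_mul _) fun s hs => ?_
  have q1 : 0 < s - e1 := by linarith [hs.1]
  have e : (e1 - s) * (e2 - s) * (e3 - s) = (s - e1) * ((s - e2) * (e3 - s)) := by ring
  have hη' := Real.sqrt_pos.2 hη
  rw [cubicWeight, e, Real.sqrt_mul q1.le, ← one_div_mul_one_div]
  gcongr
  linarith [hs.1]

theorem cubicPeriod_zero_le (h1 : 0 ≤ e1) (hη : 0 < η) (h21 : η ≤ e2 - e1) (h23 : e2 < e3) :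
    (∫ s in (0 : ℝ)..e1, cubicWeight e1 e2 e3 s) ≤ 1 / η * (2 * √e1) := by
  have j := intOn_rsqrt_right h1
  rw [sub_zero] at j
  rw [← j.2, ← intervalIntegral.integral_const_mul]
  refine integral_le_of_le_Ioo h1 (intOn_cubicWeight_outer h1 (by linarith) h23)
    (j.1.const_mul _) fun s hs => ?_
  have q1 : 0 < e1 - s := by linarith [hs.2]
  have q1' := Real.sqrt_pos.2 q1
  rw [cubicWeight, mul_assoc, Real.sqrt_mul q1.le, ← one_div_mul_one_div, mul_comm]
  gcongr
  refine Real.le_sqrt_of_sq_le ?_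
  rw [pow_two]
  gcongr <;> linarith [hs.2]

end

/-- Errors of the order of the square root of the gap are thereby negligible against 1/log. -/
theorem sqrt_mul_log_le {ε : ℝ} (h0 : 0 < ε) : √ε * Real.log (1 / ε) ≤ 2 := by
  have hs := Real.sqrt_pos.2 h0
  have h1 : Real.log (1 / ε) = 2 * Real.log (1 / √ε) := by
    rw [one_div, one_div, Real.log_inv, Real.log_inv, Real.log_sqrt h0.le]; ring
  have h2 := Real.log_le_sub_one_of_pos (one_div_pos.2 hs)
  rw [h1]
  calc √ε * (2 * Real.log (1 / √ε)) ≤ √ε * (2 * (1 / √ε)) := by gcongr; linarith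
    _ = 2 := by field_simp

theorem log_one_div_ge {ε : ℝ} (h0 : 0 < ε) (h1 : ε ≤ 1 / 2) :
    Real.log 2 ≤ Real.log (1 / ε) := by
  refine Real.log_le_log two_pos ?_
  rw [le_div_iff₀ h0]; linarith

/-- Since ε ≤ η², a numerator d ≥ η ≥ √ε costs at most half of the logarithm. -/
theorem half_log_one_div_le {ε η d : ℝ} (h0 : 0 < ε) (h1 : ε ≤ η ^ 2) (hη : 0 < η) (hd : η ≤ d) :
    Real.log (1 / ε) / 2 ≤ Real.log (d / ε) := by
  have e1 : Real.log (1 / ε) = -Real.log ε := by rw [one_div, Real.log_inv]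
  have e2 : Real.log (d / ε) = Real.log d - Real.log ε :=
    Real.log_div (by linarith) h0.ne'
  have e3 : Real.log ε ≤ 2 * Real.log η := by
    have := Real.log_le_log h0 h1
    rwa [Real.log_pow, Nat.cast_ofNat] at this
  have e4 := Real.log_le_log hη hd
  linarith

/-! ### Uniform estimates of the frequency at collisions -/

namespace Sorted5

variable {L η U : ℝ}

/-- Collision of `c₁` and `c₂`. -/
theorem exists_abs_sub_le_of_collision_low (hL : 0 < L) (hη : 0 < η) (hU : 0 < U) :
    ∃ C : ℝ, ∀ (c1 c2 c3 c4 c5 : ℝ) (w : ℝ × ℝ), Sorted5 c1 c2 c3 c4 c5 →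
      SolvesPeriods c1 c2 c3 c4 c5 w → 0 < w.1 → 0 < w.2 → L ≤ c1 → η ≤ c4 - c3 → c5 ≤ U →
      c2 - c1 ≤ 1 / 2 →
      |w.1 - 1 / 2| * Real.log (1 / (c2 - c1)) ≤ C ∧
      |w.2 - sortedRotation c3 c4 c5| * Real.log (1 / (c2 - c1)) ≤ C := by
  have hl2 : 0 < Real.log 2 := Real.log_pos one_lt_two
  have hsU := Real.sqrt_pos.2 hU
  have hsη := Real.sqrt_pos.2 hη
  have hsL := Real.sqrt_pos.2 hL
  -- Roles of the constants: D bounds |A₀ - A₁|; k is the logarithmic rate of A₁; M bounds B₀ + B₁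
  -- and the limit period r₀; ρ is a lower bound for r₁ and B₂; a2 bounds A₂; W1 and W2 are a priori
  -- bounds for the two frequencies; E1 is the final constant for the first one.
  obtain ⟨D, hD⟩ : ∃ D, D = 2 * Real.pi * (U * √U / (η * η)) + 2 * √(U / (L * L)) := ⟨_, rfl⟩
  obtain ⟨k, hk⟩ : ∃ k, k = √η / √U * min (1 / (2 * √U)) (Real.pi / 4) := ⟨_, rfl⟩
  have hk0 : 0 < k := by
    rw [hk]; exact mul_pos (by positivity) (lt_min (by positivity) (by positivity))
  have hD0 : 0 ≤ D := by rw [hD]; positivity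
  obtain ⟨W1, hW1⟩ : ∃ W1, W1 = 1 / 2 + D / (2 * (k * Real.log 2)) := ⟨_, rfl⟩
  obtain ⟨M, hM⟩ : ∃ M, M = 2 * √U / η + 14 * (√U / η) / √L := ⟨_, rfl⟩
  obtain ⟨ρ, hρ⟩ : ∃ ρ, ρ = Real.pi / √U := ⟨_, rfl⟩
  have hρ0 : 0 < ρ := by rw [hρ]; positivity
  have hM0 : 0 ≤ M := by rw [hM]; positivity
  obtain ⟨W2, hW2⟩ : ∃ W2, W2 = (M + 2 * W1 * M) / (2 * ρ) := ⟨_, rfl⟩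
  obtain ⟨a2, ha2⟩ : ∃ a2, a2 = 1 / η * (2 * √U) := ⟨_, rfl⟩
  obtain ⟨E1, hE1⟩ : ∃ E1, E1 = (D + 2 * W2 * a2) / (2 * k) := ⟨_, rfl⟩
  refine ⟨max E1 ((2 * (14 * (√U / η) / √L) + 2 * E1 * M + 2 * (M / η)) / (2 * ρ)), ?_⟩
  intro c1 c2 c3 c4 c5 w h hw w1 w2 h1 h43 h5U hε
  have ⟨h0, h12, h23, h34, h45⟩ := h
  obtain ⟨ε, hεd⟩ : ∃ ε, ε = c2 - c1 := ⟨_, rfl⟩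
  have hε0 : 0 < ε := by linarith
  rw [← hεd] at hε ⊢
  obtain ⟨l, hl⟩ : ∃ l, l = Real.log (1 / ε) := ⟨_, rfl⟩
  have hll : Real.log 2 ≤ l := hl ▸ log_one_div_ge hε0 hε
  have hl0 : 0 < l := by linarith
  have hsl : √ε * l ≤ 2 := hl ▸ sqrt_mul_log_le hε0
  have hs1 : √ε ≤ 1 := Real.sqrt_le_one.2 (by linarith)
  have hεl : ε * l ≤ 2 := by
    have : ε ≤ √ε := by
      rw [Real.le_sqrt' hε0]; nlinarith
    exact (mul_le_mul_of_nonneg_right this hl0.le).trans hsl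
  rw [← hl]
  have hA := h.equationA hw
  have hB := h.equationB hw
  have hAd := h.abs_perA0_sub_perA1_le hL hη h1 (by linarith) (by linarith) h5U
  have hA1 := h.le_perA1 hη h43 h5U (by linarith)
  have hA2 := h.perA2_le hη (by linarith) h5U
  have hBs := (h.abs_perB0_add_perB1_sub_le hη h43 h5U).1
  obtain ⟨hB2, hB2'⟩ := h.perB2_sub_mem hη (by linarith)
  have hr1 := pi_div_le_cubicPeriod h34 h45
  have hr0 := cubicPeriod_zero_le (by linarith) hη h43 h45
  have hr0n : 0 ≤ ∫ s in (0 : ℝ)..c3, cubicWeight c3 c4 c5 s :=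
    integral_nonneg_Ioo (by linarith) fun s _ => cubicWeight_nonneg s
  have hR : sortedRotation c3 c4 c5 = (∫ s in (0 : ℝ)..c3, cubicWeight c3 c4 c5 s) /
      (2 * ∫ s in c4..c5, cubicWeight c3 c4 c5 s) := sortedRotation_eq (by linarith) h45
  have n0 := h.perB0_nonneg
  have n1 := h.perB1_nonneg
  have n2 := h.perA2_nonneg
  rw [← hD] at hAd
  rw [← hεd, ← hl, ← hk] at hA1
  rw [← ha2] at hA2
  rw [← hεd] at hBs hB2'
  generalize sortedRotation c3 c4 c5 = R at hR ⊢
  generalize perA0 c1 c2 c3 c4 c5 = A0 at *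
  generalize perA1 c1 c2 c3 c4 c5 = A1 at *
  generalize perA2 c1 c2 c3 c4 c5 = A2 at *
  generalize perB0 c1 c2 c3 c4 c5 = B0 at *
  generalize perB1 c1 c2 c3 c4 c5 = B1 at *
  generalize perB2 c1 c2 c3 c4 c5 = B2 at *
  generalize (∫ s in c4..c5, cubicWeight c3 c4 c5 s) = r1 at *
  generalize (∫ s in (0 : ℝ)..c3, cubicWeight c3 c4 c5 s) = r0 at *
  have hρ1 : ρ ≤ r1 := by
    refine le_trans ?_ hr1
    rw [hρ]
    have : 0 < √(c5 - c3) := Real.sqrt_pos.2 (by linarith)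
    gcongr
    linarith
  have hr0U : r0 ≤ 2 * √U / η := by
    refine hr0.trans ?_
    have : √c3 ≤ √U := Real.sqrt_le_sqrt (by linarith)
    calc 1 / η * (2 * √c3) ≤ 1 / η * (2 * √U) := by gcongr
      _ = _ := by ring
  have hBs' : |B0 + B1 - r0| ≤ 14 * (√U / η) / √L * √ε := by
    refine hBs.trans ?_
    have : √L ≤ √c1 := Real.sqrt_le_sqrt h1
    calc 14 * (√U / η) * √ε / √c1 ≤ 14 * (√U / η) * √ε / √L := by gcongr
      _ = _ := by ring
  have hP0 : 0 ≤ 14 * (√U / η) / √L := by positivity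
  generalize 14 * (√U / η) / √L = P at *
  have hB01 : B0 + B1 ≤ M := by
    have := (abs_le.1 hBs').2
    have : P * √ε ≤ P := mul_le_of_le_one_right hP0 hs1
    rw [hM]; linarith
  have hkl : k * Real.log 2 ≤ A1 := le_trans (by gcongr) hA1
  have hkl0 : 0 < k * Real.log 2 := by positivity
  have hA10 : 0 < A1 := by linarith
  -- A priori bounds: equation A without its nonnegative term w₂A₂ controls the first frequency, and
  -- equation B then controls the second.
  have hw1 : w.1 ≤ W1 := by
    have : (w.1 - 1 / 2) * (2 * A1) ≤ D := by
      have := (abs_le.1 hAd).2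
      have : 0 ≤ w.2 * A2 := by positivity
      linarith
    have : w.1 - 1 / 2 ≤ D / (2 * A1) := by
      rwa [le_div_iff₀ (by linarith)]
    have : D / (2 * A1) ≤ D / (2 * (k * Real.log 2)) := by gcongr
    rw [hW1]; linarith
  have hW10 : 0 ≤ W1 := by linarith
  have hB20 : 0 < B2 := by linarith
  have hw2 : w.2 ≤ W2 := by
    rw [hW2, le_div_iff₀ (by linarith)]
    calc w.2 * (2 * ρ) ≤ w.2 * (2 * B2) := by gcongr; linarith
      _ = B0 + 2 * w.1 * B1 := by linarith
      _ ≤ M + 2 * W1 * M := by gcongr <;> linarith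
  have hW20 : 0 ≤ W2 := by linarith
  have c1' : |w.1 - 1 / 2| * l ≤ E1 := by
    rw [hE1, le_div_iff₀ (by linarith)]
    -- Equation A rewritten: the right side is bounded, while A₁ grows like the logarithm.
    have e : (w.1 - 1 / 2) * (2 * A1) = (A0 - A1) - 2 * w.2 * A2 := by linarith
    have : |w.1 - 1 / 2| * (2 * A1) ≤ D + 2 * W2 * a2 := by
      rw [← abs_of_pos (by linarith : 0 < 2 * A1), ← abs_mul, e]
      refine (abs_sub _ _).trans (add_le_add hAd ?_)
      rw [abs_of_nonneg (by positivity)]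
      gcongr
    calc |w.1 - 1 / 2| * l * (2 * k) = |w.1 - 1 / 2| * (2 * (k * l)) := by ring
      _ ≤ |w.1 - 1 / 2| * (2 * A1) := by gcongr
      _ ≤ _ := this
  have hE10 : 0 ≤ E1 := le_trans (by positivity) c1'
  refine ⟨c1'.trans (le_max_left _ _), le_trans ?_ (le_max_right _ _)⟩
  have hr10 : 0 < r1 := by linarith
  have er : r0 = 2 * R * r1 := by rw [hR]; field_simp
  -- Equation B minus the elliptic relation r₀ = 2 R r₁ that defines the rotation number. Each term
  -- on the right is O(1/log).
  have e : (w.2 - R) * (2 * B2) = (B0 + B1 - r0) + 2 * (w.1 - 1 / 2) * B1 + 2 * R * (r1 - B2) := by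
    linear_combination -hB + er
  have hRB : |2 * R * (r1 - B2)| ≤ M * (ε / η) := by
    have hRn : 0 ≤ R := by rw [hR]; positivity
    rw [abs_mul, abs_of_nonneg (by positivity : 0 ≤ 2 * R), abs_sub_comm,
      abs_of_nonneg (by linarith)]
    calc 2 * R * (B2 - r1) ≤ 2 * R * (ε / η * r1) := by gcongr; linarith
      _ = r0 * (ε / η) := by rw [er]; ring
      _ ≤ M * (ε / η) := by
        gcongr
        rw [hM]; linarith
  rw [le_div_iff₀ (by linarith)]
  calc |w.2 - R| * l * (2 * ρ) ≤ |w.2 - R| * l * (2 * B2) := by gcongr; linarith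
    _ = |(w.2 - R) * (2 * B2)| * l := by
      rw [abs_mul, abs_of_pos (by linarith : 0 < 2 * B2)]; ring
    _ ≤ (P * √ε + 2 * |w.1 - 1 / 2| * M + M * (ε / η)) * l := by
      gcongr
      rw [e]
      refine (abs_add_three _ _ _).trans (add_le_add_three hBs' ?_ hRB)
      rw [abs_mul, abs_mul, abs_two, abs_of_nonneg n1]
      gcongr
      linarith
    _ = P * (√ε * l) + 2 * (|w.1 - 1 / 2| * l) * M + M / η * (ε * l) := by ring
    _ ≤ P * 2 + 2 * E1 * M + M / η * 2 := by gcongr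
    _ = _ := by ring

/-- Collision of `c₃` and `c₄`. -/
theorem exists_abs_sub_le_of_collision_high (hη : 0 < η) (hU : 0 < U) :
    ∃ C : ℝ, ∀ (c1 c2 c3 c4 c5 : ℝ) (w : ℝ × ℝ), Sorted5 c1 c2 c3 c4 c5 →
      SolvesPeriods c1 c2 c3 c4 c5 w → 0 < w.1 → 0 < w.2 → η ≤ c2 - c1 → η ≤ c5 - c4 → c5 ≤ U →
      c4 - c3 ≤ 1 / 2 →
      |w.1 - w.2| * Real.log (1 / (c4 - c3)) ≤ C ∧
      |w.2 - sortedRotation c1 c2 c5| * Real.log (1 / (c4 - c3)) ≤ C := by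
  have hl2 : 0 < Real.log 2 := Real.log_pos one_lt_two
  have hsU := Real.sqrt_pos.2 hU
  have hsη := Real.sqrt_pos.2 hη
  -- Here D bounds |B₂ - B₁|, k is the logarithmic rate of B₁, b0 bounds B₀, q bounds the limit
  -- period r₀, α bounds A₂ from below, ρ bounds r₁ from below, P√ε bounds |A₁ + A₂ - r₁|, and a1
  -- bounds A₁.
  obtain ⟨D, hD⟩ : ∃ D, D = 2 * Real.pi * (U / (η * √η)) + √U / √η * (2 * √(U / (η * η))) :=
    ⟨_, rfl⟩
  obtain ⟨k, hk⟩ : ∃ k, k = √η / √U * min (1 / (2 * √U)) (Real.pi / 4) := ⟨_, rfl⟩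
  have hk0 : 0 < k := by
    rw [hk]; exact mul_pos (by positivity) (lt_min (by positivity) (by positivity))
  have hD0 : 0 ≤ D := by rw [hD]; positivity
  obtain ⟨b0, hb0⟩ : ∃ b0, b0 = U * (1 / √(η ^ 3)) := ⟨_, rfl⟩
  obtain ⟨q, hq⟩ : ∃ q, q = 1 / η * (2 * √U) := ⟨_, rfl⟩
  have hq0 : 0 < q := by rw [hq]; positivity
  obtain ⟨α, hα⟩ : ∃ α, α = η ^ 2 / (2 * √(U ^ 5)) := ⟨_, rfl⟩
  have hα0 : 0 < α := by rw [hα]; positivity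
  obtain ⟨ρ, hρ⟩ : ∃ ρ, ρ = Real.pi / √U := ⟨_, rfl⟩
  have hρ0 : 0 < ρ := by rw [hρ]; positivity
  obtain ⟨W2, hW2⟩ : ∃ W2, W2 = ((1 + 1 / η) * q) / (2 * α) := ⟨_, rfl⟩
  obtain ⟨P, hP⟩ : ∃ P, P = 14 * (1 / √η) / √η := ⟨_, rfl⟩
  have hP0 : 0 ≤ P := by rw [hP]; positivity
  obtain ⟨a1, ha1⟩ : ∃ a1, a1 = 1 / √η * Real.pi + P := ⟨_, rfl⟩
  obtain ⟨E1, hE1⟩ : ∃ E1, E1 = (2 * W2 * D + b0) / (2 * k) := ⟨_, rfl⟩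
  refine ⟨max E1 ((2 * (q / η) + 2 * E1 * a1 + 2 * (q / ρ * P)) / (2 * α)), ?_⟩
  intro c1 c2 c3 c4 c5 w h hw w1 w2 h21 h54 h5U hε
  have ⟨h0, h12, h23, h34, h45⟩ := h
  obtain ⟨ε, hεd⟩ : ∃ ε, ε = c4 - c3 := ⟨_, rfl⟩
  have hε0 : 0 < ε := by linarith
  rw [← hεd] at hε ⊢
  obtain ⟨l, hl⟩ : ∃ l, l = Real.log (1 / ε) := ⟨_, rfl⟩
  have hll : Real.log 2 ≤ l := hl ▸ log_one_div_ge hε0 hε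
  have hl0 : 0 < l := by linarith
  have hsl : √ε * l ≤ 2 := hl ▸ sqrt_mul_log_le hε0
  have hs1 : √ε ≤ 1 := Real.sqrt_le_one.2 (by linarith)
  have hεl : ε * l ≤ 2 := by
    have : ε ≤ √ε := by
      rw [Real.le_sqrt' hε0]; nlinarith
    exact (mul_le_mul_of_nonneg_right this hl0.le).trans hsl
  rw [← hl]
  have hA := h.equationA hw
  have hB := h.equationB hw
  have hBd := h.abs_perB2_sub_perB1_le hη h54 (by linarith) h5U
  have hB1 := h.le_perB1 hη h21 h5U (by linarith)
  have hB0 := h.perB0_le hη (by linarith) h5U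
  have hA2 := h.le_perA2 hη h54 h5U
  have hAs := (h.abs_perA1_add_perA2_sub_le hη h21).1
  obtain ⟨hA0, hA0'⟩ := h.perA0_sub_mem hη (by linarith)
  have hr1 := pi_div_le_cubicPeriod h12 (by linarith : c2 < c5)
  have hr1' := cubicPeriod_le hη h21 (by linarith : c2 < c5)
  have hr0 := cubicPeriod_zero_le h0.le hη h21 (by linarith : c2 < c5)
  have hr0n : 0 ≤ ∫ s in (0 : ℝ)..c1, cubicWeight c1 c2 c5 s :=
    integral_nonneg_Ioo h0.le fun s _ => cubicWeight_nonneg s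
  have hR : sortedRotation c1 c2 c5 = (∫ s in (0 : ℝ)..c1, cubicWeight c1 c2 c5 s) /
      (2 * ∫ s in c2..c5, cubicWeight c1 c2 c5 s) := sortedRotation_eq (e2 := c2) h0.le (by linarith : c2 < c5)
  have n0 := h.perB0_nonneg
  have n1 := h.perA1_nonneg
  rw [← hD] at hBd
  rw [← hεd, ← hl, ← hk] at hB1
  rw [← hb0] at hB0
  rw [← hα] at hA2
  rw [← hεd] at hAs hA0'
  generalize sortedRotation c1 c2 c5 = R at hR ⊢
  generalize perA0 c1 c2 c3 c4 c5 = A0 at *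
  generalize perA1 c1 c2 c3 c4 c5 = A1 at *
  generalize perA2 c1 c2 c3 c4 c5 = A2 at *
  generalize perB0 c1 c2 c3 c4 c5 = B0 at *
  generalize perB1 c1 c2 c3 c4 c5 = B1 at *
  generalize perB2 c1 c2 c3 c4 c5 = B2 at *
  generalize (∫ s in c2..c5, cubicWeight c1 c2 c5 s) = r1 at *
  generalize (∫ s in (0 : ℝ)..c1, cubicWeight c1 c2 c5 s) = r0 at *
  have hρ1 : ρ ≤ r1 := by
    refine le_trans ?_ hr1
    rw [hρ]
    have : 0 < √(c5 - c1) := Real.sqrt_pos.2 (by linarith)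
    gcongr
    linarith
  have hr0U : r0 ≤ q := by
    refine hr0.trans ?_
    rw [hq]
    gcongr
    linarith
  have hAs' : |A1 + A2 - r1| ≤ P * √ε := by
    refine hAs.trans ?_
    have : √η ≤ √(c5 - c4) := Real.sqrt_le_sqrt h54
    rw [hP]
    calc 14 * (1 / √η) * √ε / √(c5 - c4) ≤ 14 * (1 / √η) * √ε / √η := by gcongr
      _ = _ := by ring
  have hA1a : A1 ≤ a1 := by
    have := (abs_le.1 hAs').2
    have : P * √ε ≤ P := mul_le_of_le_one_right hP0 hs1
    rw [ha1]; linarith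
  have hw2 : w.2 ≤ W2 := by
    rw [hW2, le_div_iff₀ (by linarith)]
    calc w.2 * (2 * α) ≤ w.2 * (2 * A2) := by gcongr
      _ ≤ A0 := by
        have : 0 ≤ w.1 * A1 := by positivity
        linarith
      _ ≤ (1 + ε / η) * r0 := hA0'
      _ ≤ (1 + 1 / η) * q := by gcongr; linarith
  have hW20 : 0 ≤ W2 := by linarith
  have hB10 : 0 < B1 := lt_of_lt_of_le (by positivity) hB1
  have c1' : |w.1 - w.2| * l ≤ E1 := by
    rw [hE1, le_div_iff₀ (by linarith)]
    -- Equation B rewritten: B₁ diverges, whereas B₂ - B₁ and B₀ stay bounded, so the two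
    -- frequencies approach each other.
    have e : (w.1 - w.2) * (2 * B1) = 2 * w.2 * (B2 - B1) - B0 := by linarith
    have : |w.1 - w.2| * (2 * B1) ≤ 2 * W2 * D + b0 := by
      rw [← abs_of_pos (by linarith : 0 < 2 * B1), ← abs_mul, e]
      refine (abs_sub _ _).trans ?_
      rw [abs_mul, abs_of_nonneg (by positivity : 0 ≤ 2 * w.2), abs_of_nonneg n0]
      gcongr
    calc |w.1 - w.2| * l * (2 * k) = |w.1 - w.2| * (2 * (k * l)) := by ring
      _ ≤ |w.1 - w.2| * (2 * B1) := by gcongr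
      _ ≤ _ := this
  have hE10 : 0 ≤ E1 := le_trans (by positivity) c1'
  refine ⟨c1'.trans (le_max_left _ _), le_trans ?_ (le_max_right _ _)⟩
  have hr10 : 0 < r1 := by linarith
  have er : r0 = 2 * R * r1 := by rw [hR]; field_simp
  have hRn : 0 ≤ 2 * R := by rw [hR]; positivity
  have hRq : 2 * R ≤ q / ρ := by
    rw [le_div_iff₀ hρ0]
    calc 2 * R * ρ ≤ 2 * R * r1 := by gcongr
      _ ≤ q := by linarith
  -- Equation A minus the elliptic relation r₀ = 2 R r₁. The difference of the frequencies enters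
  -- with the bounded factor A₁.
  have e : (w.2 - R) * (2 * (A1 + A2)) = (A0 - r0) - 2 * (w.1 - w.2) * A1 -
      2 * R * (A1 + A2 - r1) := by
    linear_combination -hA + er
  have hAr : |A0 - r0| ≤ q * (ε / η) := by
    rw [abs_of_nonneg (by linarith)]
    calc A0 - r0 ≤ ε / η * r0 := by linarith
      _ ≤ ε / η * q := by gcongr
      _ = _ := by ring
  rw [le_div_iff₀ (by linarith)]
  calc |w.2 - R| * l * (2 * α) ≤ |w.2 - R| * l * (2 * (A1 + A2)) := by gcongr; linarith
    _ = |(w.2 - R) * (2 * (A1 + A2))| * l := by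
      rw [abs_mul, abs_of_pos (by linarith : 0 < 2 * (A1 + A2))]; ring
    _ ≤ (q * (ε / η) + 2 * |w.1 - w.2| * a1 + q / ρ * (P * √ε)) * l := by
      gcongr
      rw [e]
      refine (abs_sub _ _).trans (add_le_add ((abs_sub _ _).trans (add_le_add hAr ?_)) ?_)
      · rw [abs_mul, abs_mul, abs_two, abs_of_nonneg n1]
        gcongr
      · rw [abs_mul, abs_of_nonneg hRn]
        gcongr
    _ = q / η * (ε * l) + 2 * (|w.1 - w.2| * l) * a1 + q / ρ * P * (√ε * l) := by ring
    _ ≤ q / η * 2 + 2 * E1 * a1 + q / ρ * P * 2 := by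
      have : 0 ≤ a1 := by linarith
      gcongr
    _ = _ := by ring

/-- Simultaneous collision of `c₁` with `c₂` and of `c₃` with `c₄`. -/
theorem exists_abs_sub_le_of_double_collision (hL : 0 < L) (hη : 0 < η) (hU : 0 < U) :
    ∃ C : ℝ, ∀ (c1 c2 c3 c4 c5 : ℝ) (w : ℝ × ℝ), Sorted5 c1 c2 c3 c4 c5 →
      SolvesPeriods c1 c2 c3 c4 c5 w → 0 < w.1 → 0 < w.2 → L ≤ c1 → η ≤ c3 - c2 → η ≤ c5 - c4 →
      c5 ≤ U → c2 - c1 ≤ 1 / 2 → c2 - c1 ≤ η ^ 2 → c4 - c3 ≤ 1 / 2 → c4 - c3 ≤ η ^ 2 →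
      |w.1 - 1 / 2| * Real.log (1 / (c2 - c1)) ≤ C ∧
      |w.1 - w.2| * Real.log (1 / (c4 - c3)) ≤ C := by
  have hl2 : 0 < Real.log 2 := Real.log_pos one_lt_two
  have hsU := Real.sqrt_pos.2 hU
  have hsη := Real.sqrt_pos.2 hη
  obtain ⟨D, hD⟩ : ∃ D, D = 2 * Real.pi * (U * √U / (η * η)) + 2 * √(U / (L * L)) := ⟨_, rfl⟩
  obtain ⟨D', hD'⟩ : ∃ D, D = 2 * Real.pi * (U / (η * √η)) + √U / √η * (2 * √(U / (η * η))) :=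
    ⟨_, rfl⟩
  have hD0 : 0 ≤ D := by rw [hD]; positivity
  have hD0' : 0 ≤ D' := by rw [hD']; positivity
  obtain ⟨k, hk⟩ : ∃ k, k = 1 / (2 * √U) := ⟨_, rfl⟩
  have hk0 : 0 < k := by rw [hk]; positivity
  obtain ⟨b0, hb0⟩ : ∃ b0, b0 = U * (1 / √(η ^ 3)) := ⟨_, rfl⟩
  have hb00 : 0 ≤ b0 := by rw [hb0]; positivity
  obtain ⟨a2, ha2⟩ : ∃ a2, a2 = 1 / η * (2 * √U) := ⟨_, rfl⟩
  obtain ⟨ρ, hρ⟩ : ∃ ρ, ρ = Real.pi / √U := ⟨_, rfl⟩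
  have hρ0 : 0 < ρ := by rw [hρ]; positivity
  obtain ⟨W1, hW1⟩ : ∃ W1, W1 = 1 / 2 + D / (2 * (k * Real.log 2)) := ⟨_, rfl⟩
  have hW10 : 0 ≤ W1 := by rw [hW1]; positivity
  obtain ⟨W2, hW2⟩ : ∃ W2, W2 = W1 + (b0 + 2 * W1 * D') / (2 * ρ) := ⟨_, rfl⟩
  refine ⟨max ((D + 2 * W2 * a2) / (2 * k)) ((2 * W2 * D' + b0) / (2 * k)), ?_⟩
  intro c1 c2 c3 c4 c5 w h hw w1 w2 h1 h32 h54 h5U hε hε' hδ hδ'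
  have ⟨h0, h12, h23, h34, h45⟩ := h
  have e21 : 0 < c2 - c1 := by linarith
  have e43 : 0 < c4 - c3 := by linarith
  have hA := h.equationA hw
  have hB := h.equationB hw
  have hAd := h.abs_perA0_sub_perA1_le hL hη h1 (by linarith) (by linarith) h5U
  have hBd := h.abs_perB2_sub_perB1_le hη h54 (by linarith) h5U
  have hA1 : k * Real.log (1 / (c2 - c1)) ≤ perA1 c1 c2 c3 c4 c5 := by
    refine le_trans ?_ (h.log_le_perA1 h5U)
    rw [hk, le_div_iff₀ hsU]
    have := half_log_one_div_le e21 hε' hη (by linarith : η ≤ c3 - c1)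
    refine le_trans (le_of_eq ?_) this
    field_simp
  have hB1 : k * Real.log (1 / (c4 - c3)) ≤ perB1 c1 c2 c3 c4 c5 := by
    refine le_trans ?_ (h.log_le_perB1 h5U)
    rw [hk, le_div_iff₀ hsU]
    have := half_log_one_div_le e43 hδ' hη (by linarith : η ≤ c4 - c2)
    refine le_trans (le_of_eq ?_) this
    field_simp
  have hB0 := h.perB0_le hη (by linarith) h5U
  have hA2 := h.perA2_le hη (by linarith) h5U
  have hB2 := (h.perB2_sub_mem hη (by linarith)).1
  have hr1 := pi_div_le_cubicPeriod h34 h45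
  have n0 := h.perB0_nonneg
  have n2 := h.perA2_nonneg
  rw [← hD] at hAd
  rw [← hD'] at hBd
  rw [← hb0] at hB0
  rw [← ha2] at hA2
  have hll := log_one_div_ge e21 hε
  have hll' := log_one_div_ge e43 hδ
  generalize Real.log (1 / (c2 - c1)) = l at *
  generalize Real.log (1 / (c4 - c3)) = l' at *
  generalize perA0 c1 c2 c3 c4 c5 = A0 at *
  generalize perA1 c1 c2 c3 c4 c5 = A1 at *
  generalize perA2 c1 c2 c3 c4 c5 = A2 at *
  generalize perB0 c1 c2 c3 c4 c5 = B0 at *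
  generalize perB1 c1 c2 c3 c4 c5 = B1 at *
  generalize perB2 c1 c2 c3 c4 c5 = B2 at *
  generalize (∫ s in c4..c5, cubicWeight c3 c4 c5 s) = r1 at *
  have hρ1 : ρ ≤ r1 := by
    refine le_trans ?_ hr1
    rw [hρ]
    have : 0 < √(c5 - c3) := Real.sqrt_pos.2 (by linarith)
    gcongr
    linarith
  have hl0 : 0 < l := by linarith
  have hl0' : 0 < l' := by linarith
  have hkl : k * Real.log 2 ≤ A1 := le_trans (by gcongr) hA1
  have hkl0 : 0 < k * Real.log 2 := by positivity
  have hA10 : 0 < A1 := by linarith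
  have hB10 : 0 < B1 := lt_of_lt_of_le (by positivity) hB1
  have hw1 : w.1 ≤ W1 := by
    have : (w.1 - 1 / 2) * (2 * A1) ≤ D := by
      have := (abs_le.1 hAd).2
      have : 0 ≤ w.2 * A2 := by positivity
      linarith
    have : w.1 - 1 / 2 ≤ D / (2 * A1) := by
      rwa [le_div_iff₀ (by linarith)]
    have : D / (2 * A1) ≤ D / (2 * (k * Real.log 2)) := by gcongr
    rw [hW1]; linarith
  have hB20 : 0 < B2 := by linarith
  -- Now B₁ and B₂ may both be large, so B₁ is replaced by B₂ + D', and the unbounded B₂ cancels up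
  -- to the term W1.
  have hw2 : w.2 ≤ W2 := by
    have : (w.2 - W1) * (2 * B2) ≤ b0 + 2 * W1 * D' := by
      have e1 : w.1 * B1 ≤ W1 * (B2 + D') := by
        have := (abs_le.1 hBd).1
        gcongr
        linarith
      linarith
    have h2 : w.2 - W1 ≤ (b0 + 2 * W1 * D') / (2 * B2) := by
      rwa [le_div_iff₀ (by linarith)]
    have h3 : (b0 + 2 * W1 * D') / (2 * B2) ≤ (b0 + 2 * W1 * D') / (2 * ρ) := by
      gcongr; linarith
    rw [hW2]; linarith
  constructor
  · refine le_trans ?_ (le_max_left _ _)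
    rw [le_div_iff₀ (by linarith)]
    have e : (w.1 - 1 / 2) * (2 * A1) = (A0 - A1) - 2 * w.2 * A2 := by linarith
    have : |w.1 - 1 / 2| * (2 * A1) ≤ D + 2 * W2 * a2 := by
      rw [← abs_of_pos (by linarith : 0 < 2 * A1), ← abs_mul, e]
      refine (abs_sub _ _).trans (add_le_add hAd ?_)
      rw [abs_of_nonneg (by positivity)]
      have : 0 ≤ W2 := by linarith
      gcongr
    calc |w.1 - 1 / 2| * l * (2 * k) = |w.1 - 1 / 2| * (2 * (k * l)) := by ring
      _ ≤ |w.1 - 1 / 2| * (2 * A1) := by gcongr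
      _ ≤ _ := this
  · refine le_trans ?_ (le_max_right _ _)
    rw [le_div_iff₀ (by linarith)]
    have e : (w.1 - w.2) * (2 * B1) = 2 * w.2 * (B2 - B1) - B0 := by linarith
    have hW20 : 0 ≤ W2 := by linarith
    have : |w.1 - w.2| * (2 * B1) ≤ 2 * W2 * D' + b0 := by
      rw [← abs_of_pos (by linarith : 0 < 2 * B1), ← abs_mul, e]
      refine (abs_sub _ _).trans ?_
      rw [abs_mul, abs_of_nonneg (by positivity : 0 ≤ 2 * w.2), abs_of_nonneg n0]
      gcongr
    calc |w.1 - w.2| * l' * (2 * k) = |w.1 - w.2| * (2 * (k * l')) := by ring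
      _ ≤ |w.1 - w.2| * (2 * B1) := by gcongr
      _ ≤ _ := this

/-- Simultaneous collision of `c₁` with `0` and of `c₃` with `c₄`. -/
theorem exists_le_sqrt_of_collision_high (hη : 0 < η) (hU : 0 < U) :
    ∃ C : ℝ, ∀ (c1 c2 c3 c4 c5 : ℝ) (w : ℝ × ℝ), Sorted5 c1 c2 c3 c4 c5 →
      SolvesPeriods c1 c2 c3 c4 c5 w → 0 < w.1 → 0 < w.2 → η ≤ c2 - c1 → η ≤ c3 - c2 →
      η ≤ c5 - c4 → c5 ≤ U → w.1 ≤ C * √c1 ∧ w.2 ≤ C * √c1 := by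
  have hsU := Real.sqrt_pos.2 hU
  obtain ⟨q, hq⟩ : ∃ q, q = (1 + U / η) * (1 / η * 2) := ⟨_, rfl⟩
  have hq0 : 0 < q := by rw [hq]; positivity
  obtain ⟨α, hα⟩ : ∃ α, α = η ^ 2 / (2 * √(U ^ 5)) := ⟨_, rfl⟩
  have hα0 : 0 < α := by rw [hα]; positivity
  -- The argument of the logarithm comes from (c₃-c₁)/(c₂-c₁) = 1 + (c₃-c₂)/(c₂-c₁) ≥ 1 + η/U. Upper
  -- bounds are enough here: the left side of equation A is O(√c₁), and both terms on its right are
  -- nonnegative with coefficients bounded below.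
  obtain ⟨β, hβ⟩ : ∃ β, β = Real.log (1 + η / U) / √U := ⟨_, rfl⟩
  have hβ0 : 0 < β := by
    rw [hβ]
    have : 0 < η / U := by positivity
    exact div_pos (Real.log_pos (by linarith)) hsU
  refine ⟨max (q / (2 * β)) (q / (2 * α)), ?_⟩
  intro c1 c2 c3 c4 c5 w h hw w1 w2 h21 h32 h54 h5U
  have ⟨h0, h12, h23, h34, h45⟩ := h
  have hA := h.equationA hw
  have hA2 := h.le_perA2 hη h54 h5U
  rw [← hα] at hA2
  have hA1 : β ≤ perA1 c1 c2 c3 c4 c5 := by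
    refine le_trans ?_ (h.log_le_perA1 h5U)
    rw [hβ]
    have : 0 < η / U := by positivity
    gcongr
    rw [le_div_iff₀ (by linarith)]
    have : η / U * (c2 - c1) ≤ η := by
      rw [div_mul_eq_mul_div, div_le_iff₀ hU]
      gcongr; linarith
    linarith
  have hA0 : perA0 c1 c2 c3 c4 c5 ≤ q * √c1 := by
    have hr0 := cubicPeriod_zero_le h0.le hη h21 (by linarith : c2 < c5)
    have hr0n : 0 ≤ ∫ s in (0 : ℝ)..c1, cubicWeight c1 c2 c5 s :=
      integral_nonneg_Ioo h0.le fun s _ => cubicWeight_nonneg s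
    refine (h.perA0_sub_mem hη (by linarith)).2.trans ?_
    rw [hq]
    calc _ ≤ (1 + U / η) * (1 / η * (2 * √c1)) := by gcongr; linarith
      _ = _ := by ring
  have hs := Real.sqrt_pos.2 h0
  constructor
  · refine le_trans ?_ (mul_le_mul_of_nonneg_right (le_max_left _ _) hs.le)
    rw [div_mul_eq_mul_div, le_div_iff₀ (by linarith)]
    have : 0 ≤ w.2 * perA2 c1 c2 c3 c4 c5 := mul_nonneg w2.le h.perA2_nonneg
    calc w.1 * (2 * β) ≤ w.1 * (2 * perA1 c1 c2 c3 c4 c5) := by gcongr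
      _ ≤ _ := by linarith
  · refine le_trans ?_ (mul_le_mul_of_nonneg_right (le_max_right _ _) hs.le)
    rw [div_mul_eq_mul_div, le_div_iff₀ (by linarith)]
    have : 0 ≤ w.1 * perA1 c1 c2 c3 c4 c5 := mul_nonneg w1.le h.perA1_nonneg
    calc w.2 * (2 * α) ≤ w.2 * (2 * perA2 c1 c2 c3 c4 c5) := by gcongr
      _ ≤ _ := by linarith

end Sorted5

/-! ### Periods with a simple pole emerging from two colliding roots -/

/-- The primitive is -2 log(√(e-s) + √(x-s)). Its value at the end of the interval is the only
source of log|e - x|. -/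
theorem integral_rsqrt_pair {u e x : ℝ} (hue : u < min e x) (hx : x ≠ e) :
    IntOn (fun s => 1 / √((e - s) * (x - s))) u (min e x) ∧
    (∫ s in u..(min e x), 1 / √((e - s) * (x - s))) =
      2 * Real.log (√(e - u) + √(x - u)) - Real.log |e - x| := by
  have hu1 : u < e := hue.trans_le (min_le_left _ _)
  have hu2 : u < x := hue.trans_le (min_le_right _ _)
  have hpos : ∀ s ∈ Icc u (min e x), 0 < √(e - s) + √(x - s) := fun s hs => by
    rcases lt_or_gt_of_ne hx with h | h
    · rw [min_eq_right h.le] at hs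
      exact add_pos_of_pos_of_nonneg (Real.sqrt_pos.2 (by linarith [hs.2])) (Real.sqrt_nonneg _)
    · rw [min_eq_left h.le] at hs
      exact add_pos_of_nonneg_of_pos (Real.sqrt_nonneg _) (Real.sqrt_pos.2 (by linarith [hs.2]))
  have H := ftc_of_nonneg hue.le (F := fun s => -(2 * Real.log (√(e - s) + √(x - s))))
    (f := fun s => 1 / √((e - s) * (x - s)))
    (((ContinuousOn.log (by fun_prop) fun s hs => (hpos s hs).ne').const_smul (2 : ℝ)).neg)
    (fun s hs => by
      have h1 : 0 < e - s := by linarith [hs.2, min_le_left e x]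
      have h2 : 0 < x - s := by linarith [hs.2, min_le_right e x]
      have r1 := Real.sqrt_pos.2 h1
      have r2 := Real.sqrt_pos.2 h2
      have d1 := ((hasDerivAt_id s).const_sub e).sqrt h1.ne'
      have d2 := ((hasDerivAt_id s).const_sub x).sqrt h2.ne'
      have := (((d1.add d2).log (hpos s ⟨hs.1.le, hs.2.le⟩).ne').const_mul (2 : ℝ)).neg
      refine this.congr_deriv ?_
      rw [Real.sqrt_mul h1.le]
      simp only [id, Pi.add_apply]
      field_simp
      ring)
    (fun s hs => by positivity)
  refine ⟨H.1, H.2.trans ?_⟩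
  have e1 : √(e - min e x) + √(x - min e x) = √|e - x| := by
    rcases le_total e x with h | h
    · rw [min_eq_left h, sub_self, Real.sqrt_zero, zero_add, abs_sub_comm,
        abs_of_nonneg (by linarith)]
    · rw [min_eq_right h, sub_self, Real.sqrt_zero, add_zero, abs_of_nonneg (by linarith)]
  simp only [e1]
  rw [Real.log_sqrt (abs_nonneg _)]
  ring

/-- The quotient is √(e-s)/√(x-s), and the difference of the two roots is at most √|x-e|. -/
theorem abs_div_sqrt_pair_sub_one_le {e x s : ℝ} (hs : s < min e x) :
    |(e - s) / √((e - s) * (x - s)) - 1| ≤ √|x - e| / √(min e x - s) := by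
  have h1 : 0 < e - s := by linarith [min_le_left e x]
  have h2 : 0 < x - s := by linarith [min_le_right e x]
  have r1 := Real.sqrt_pos.2 h1
  have r2 := Real.sqrt_pos.2 h2
  rw [Real.sqrt_mul h1.le, ← div_div, Real.div_sqrt, div_sub_one r2.ne', abs_div, abs_of_pos r2]
  rcases le_total e x with h | h
  · rw [min_eq_left h, abs_of_nonneg (by linarith : 0 ≤ x - e), abs_sub_comm,
      abs_of_nonneg (sub_nonneg.2 (Real.sqrt_le_sqrt (by linarith)))]
    have := sqrt_sub_sqrt_le h1.le (by linarith : e - s ≤ x - s)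
    rw [show x - s - (e - s) = x - e by ring] at this
    gcongr
  · rw [min_eq_right h, abs_sub_comm x e, abs_of_nonneg (by linarith : 0 ≤ e - x),
      abs_of_nonneg (sub_nonneg.2 (Real.sqrt_le_sqrt (by linarith)))]
    have := sqrt_sub_sqrt_le h2.le (by linarith : x - s ≤ e - s)
    rw [show e - s - (x - s) = e - x by ring] at this
    gcongr

section

variable {u e v C : ℝ} {f : ℝ → ℝ}

/-- The difference quotient at `e` has at most inverse square root singularities. -/
theorem intOn_slope (huv : u < v) (hf : Measurable f)
    (h : ∀ s ∈ Ioo u v, |f s - f e| ≤ |s - e| * (C / √((s - u) * (v - s)))) :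
    IntOn (fun s => (f s - f e) / (s - e)) u v := by
  refine IntOn.of_abs_le huv.le ((intOn_rsqrt_both huv).1.const_mul |C|) (by fun_prop)
    fun s hs => ?_
  rcases eq_or_ne s e with rfl | hse
  · simp only [sub_self, div_zero, abs_zero]
    positivity
  · have hp : 0 < |s - e| := abs_pos.2 (sub_ne_zero.2 hse)
    rw [abs_div, div_le_iff₀ hp, mul_one_div, mul_comm]
    refine (h s hs).trans (mul_le_mul_of_nonneg_left ?_ hp.le)
    gcongr
    exact le_abs_self C

theorem continuousAt_primitive {g : ℝ → ℝ} (hg : IntOn g u v) (he : e ∈ Ioo u v) :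
    ContinuousAt (fun y => ∫ s in u..y, g s) e := by
  have h := intervalIntegral.continuousOn_primitive_interval' hg left_mem_uIcc
  rw [uIcc_of_le (he.1.trans he.2).le] at h
  exact h.continuousAt (Icc_mem_nhds he.1 he.2)

theorem continuousAt_primitive_left {g : ℝ → ℝ} (hg : IntOn g u v) (he : e ∈ Ioo u v) :
    ContinuousAt (fun y => ∫ s in y..v, g s) e := by
  have h := (continuousAt_const (y := ∫ s in u..v, g s)).sub (continuousAt_primitive hg he)
  refine h.congr ?_
  filter_upwards [Ioo_mem_nhds he.1 he.2] with y hy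
  have hs : IntOn g u y := hg.mono_set (by
    rw [uIcc_of_le hy.1.le, uIcc_of_le (hy.1.trans hy.2).le]; exact Icc_subset_Icc_right hy.2.le)
  exact intervalIntegral.integral_interval_sub_left hg hs

/-- Replace f by its value at e, for which the integral is explicit. The remainder vanishes at e, so
√((e-s)(x-s)) may be replaced by e - s in the limit, which leaves the integral of the difference
quotient. -/
theorem tendsto_integral_pair_left (hue : u < e) (hev : e < v) (hC : 0 ≤ C) (hf : Measurable f)
    (h : ∀ s ∈ Ioo u v, |f s - f e| ≤ |s - e| * (C / √((s - u) * (v - s)))) :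
    Tendsto (fun x => (∫ s in u..(min e x), f s / √((e - s) * (x - s))) + f e * Real.log |e - x|)
      (𝓝[≠] e)
      (𝓝 (f e * (Real.log 4 + Real.log (e - u)) - ∫ s in u..e, (f s - f e) / (s - e))) := by
  have hh := intOn_slope (hue.trans hev) hf h
  have hcont : Tendsto (fun x => ∫ s in u..(min e x), (f s - f e) / (s - e)) (𝓝[≠] e)
      (𝓝 (∫ s in u..e, (f s - f e) / (s - e))) := by
    have hc := (continuousAt_primitive hh ⟨hue, hev⟩).tendsto
    have hm : Tendsto (fun x => min e x) (𝓝[≠] e) (𝓝 e) := by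
      have : ContinuousAt (fun x => min e x) e := by fun_prop
      simpa using this.tendsto.mono_left (nhdsWithin_le_nhds (s := {e}ᶜ))
    exact hc.comp hm
  have hlog : Tendsto (fun x => f e * (2 * Real.log (√(e - u) + √(x - u)))) (𝓝[≠] e)
      (𝓝 (f e * (Real.log 4 + Real.log (e - u)))) := by
    have hp : 0 < √(e - u) := Real.sqrt_pos.2 (by linarith)
    have hc : ContinuousAt (fun x => f e * (2 * Real.log (√(e - u) + √(x - u)))) e := by
      refine ContinuousAt.mul continuousAt_const (ContinuousAt.mul continuousAt_const ?_)
      exact ContinuousAt.log (by fun_prop) (by positivity)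
    have := hc.tendsto.mono_left (nhdsWithin_le_nhds (s := {e}ᶜ))
    convert this using 2
    rw [← two_mul, Real.log_mul two_ne_zero hp.ne', Real.log_sqrt (by linarith),
      show (4 : ℝ) = 2 ^ 2 by norm_num, Real.log_pow]
    push_cast; ring
  have herr : Tendsto (fun x => C / √(v - e) * Real.pi * √|x - e|) (𝓝[≠] e) (𝓝 0) := by
    have hc : ContinuousAt (fun x => C / √(v - e) * Real.pi * √|x - e|) e := by fun_prop
    have := hc.tendsto.mono_left (nhdsWithin_le_nhds (s := {e}ᶜ))
    simpa using this
  have key : ∀ᶠ x in 𝓝[≠] e, ‖((∫ s in u..(min e x), f s / √((e - s) * (x - s))) +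
      f e * Real.log |e - x|) - (f e * (2 * Real.log (√(e - u) + √(x - u))) -
        ∫ s in u..(min e x), (f s - f e) / (s - e))‖ ≤ C / √(v - e) * Real.pi * √|x - e| := by
    filter_upwards [self_mem_nhdsWithin, nhdsWithin_le_nhds (lt_mem_nhds hue)] with x hx hux
    have hm : u < min e x := lt_min hue hux
    have hmv : min e x < v := (min_le_left _ _).trans_lt hev
    obtain ⟨i1, e1⟩ := integral_rsqrt_pair hm hx
    have hhm : IntOn (fun s => (f s - f e) / (s - e)) u (min e x) :=
      hh.mono_set (by rw [uIcc_of_le hm.le, uIcc_of_le (hue.trans hev).le]; exact Icc_subset_Icc_right hmv.le)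
    -- The explicit singular part, minus the difference quotient, minus an error of order √|x - e|.
    have hrep : ∀ s ∈ Ioo u (min e x), f s / √((e - s) * (x - s)) =
        f e * (1 / √((e - s) * (x - s))) - (f s - f e) / (s - e) -
          (f s - f e) / (s - e) * ((e - s) / √((e - s) * (x - s)) - 1) := fun s hs => by
      have h1 : 0 < e - s := by linarith [hs.2, min_le_left e x]
      have h2 : 0 < x - s := by linarith [hs.2, min_le_right e x]
      have h3 : s - e ≠ 0 := by linarith
      have := Real.sqrt_pos.2 (mul_pos h1 h2)
      field_simp
      ring
    have hpw : ∀ s ∈ Ioo u (min e x),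
        |(f s - f e) / (s - e) * ((e - s) / √((e - s) * (x - s)) - 1)| ≤
          C / √(v - e) * √|x - e| * (1 / √((s - u) * (min e x - s))) := fun s hs => by
      have h1 : 0 < e - s := by linarith [hs.2, min_le_left e x]
      have h3 : 0 < |s - e| := abs_pos.2 (by linarith)
      have h4 : 0 < v - e := by linarith
      have h5 : 0 < s - u := by linarith [hs.1]
      have h6 : 0 < v - s := by linarith
      have h7 : 0 < min e x - s := by linarith [hs.2]
      have q4 := Real.sqrt_pos.2 h4
      have q5 := Real.sqrt_pos.2 h5
      have q7 := Real.sqrt_pos.2 h7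
      rw [abs_mul]
      calc _ ≤ C / √((s - u) * (v - s)) * (√|x - e| / √(min e x - s)) := by
            gcongr
            · rw [abs_div, div_le_iff₀ h3, mul_comm]
              exact h s ⟨hs.1, by linarith⟩
            · exact abs_div_sqrt_pair_sub_one_le hs.2
        _ ≤ C / (√(s - u) * √(v - e)) * (√|x - e| / √(min e x - s)) := by
            rw [Real.sqrt_mul h5.le]
            gcongr
            linarith
        _ = _ := by
            rw [Real.sqrt_mul h5.le]
            field_simp
    have hb := (intOn_rsqrt_both hm)
    have hi := IntOn.of_abs_le hm.le (hb.1.const_mul _) (by fun_prop) hpw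
    have hle := abs_integral_le_of_abs_le hm.le (hb.1.const_mul _) (by fun_prop) hpw
    rw [intervalIntegral.integral_const_mul, hb.2] at hle
    rw [integral_congr_Ioo hm.le hrep,
      intervalIntegral.integral_sub ((i1.const_mul _).sub hhm) hi,
      intervalIntegral.integral_sub (i1.const_mul _) hhm, intervalIntegral.integral_const_mul, e1,
      Real.norm_eq_abs]
    have e2 : ∀ A B D E F : ℝ, A * (B - D) - E - F + A * D - (A * B - E) = -F := fun _ _ _ _ _ => by
      ring
    rw [e2, abs_neg]
    refine hle.trans (le_of_eq (by ring))
  have h0 := squeeze_zero_norm' key herr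
  have := h0.add (hlog.sub hcont)
  rw [zero_add] at this
  refine this.congr fun x => ?_
  ring

/-- Obtained from the left version by s ↦ -s, which changes the sign of the difference quotient. -/
theorem tendsto_integral_pair_right (hue : u < e) (hev : e < v) (hC : 0 ≤ C) (hf : Measurable f)
    (h : ∀ s ∈ Ioo u v, |f s - f e| ≤ |s - e| * (C / √((s - u) * (v - s)))) :
    Tendsto (fun x => (∫ s in (max e x)..v, f s / √((e - s) * (x - s))) + f e * Real.log |e - x|)
      (𝓝[≠] e)
      (𝓝 (f e * (Real.log 4 + Real.log (v - e)) + ∫ s in e..v, (f s - f e) / (s - e))) := by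
  have H := tendsto_integral_pair_left (u := -v) (e := -e) (v := -u) (f := fun s => f (-s))
    (by linarith) (by linarith) hC (hf.comp measurable_neg) fun s hs => by
      have := h (-s) ⟨by linarith [hs.2], by linarith [hs.1]⟩
      rw [neg_neg]
      convert this using 1
      rw [show -s - e = -(s - -e) by ring, abs_neg,
        show (-s - u) * (v - -s) = (s - -v) * (-u - s) by ring]
  have hneg : Tendsto (fun x : ℝ => -x) (𝓝[≠] e) (𝓝[≠] (-e)) := by
    refine tendsto_nhdsWithin_iff.2 ⟨(continuous_neg.tendsto e).mono_left nhdsWithin_le_nhds, ?_⟩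
    filter_upwards [self_mem_nhdsWithin] with x hx
    simpa using hx
  have H' := H.comp hneg
  have e1 : (∫ s in -v..-e, (f (-s) - f (- -e)) / (s - -e)) = -∫ s in e..v, (f s - f e) / (s - e) := by
    have := intervalIntegral.integral_comp_neg (a := -v) (b := -e)
      (fun s => (f s - f e) / (s - e))
    rw [neg_neg, neg_neg] at this
    rw [← this, ← intervalIntegral.integral_neg]
    congr 1; ext s
    rw [neg_neg, ← div_neg]
    ring_nf
  rw [e1] at H'
  simp only [neg_neg] at H'
  convert H' using 2
  · rename_i x
    have := intervalIntegral.integral_comp_neg (a := -v) (b := min (-e) (-x))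
      (fun s => f s / √((e - s) * (x - s)))
    rw [neg_neg, min_neg_neg, neg_neg] at this
    simp only [Function.comp_apply]
    rw [min_neg_neg, ← this]
    congr 2
    · ext s
      rw [show (-e - s) * (-x - s) = (e - -s) * (x - -s) by ring]
    · rw [show -e - -x = -(e - x) by ring, abs_neg]
  · rw [show -e - -v = v - e by ring]; ring

end

/-! ### Elementary reduction of the regularized third kind periods -/

/-- A Chebyshev type inequality: the weighted mean of a decreasing function over an initial segment
exceeds its mean over the whole interval. The value ψ(y) at the cut separates the two means. -/
theorem integral_mul_lt_of_strictAntiOn {u y v : ℝ} {f ψ : ℝ → ℝ} (huy : u < y) (hyv : y < v)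
    (hf : IntOn f u v) (hfψ : IntOn (fun s => f s * ψ s) u v) (hpos : ∀ s ∈ Ioo u v, 0 < f s)
    (hψ : StrictAntiOn ψ (Ioo u v)) :
    (∫ s in u..y, f s) * (∫ s in u..v, f s * ψ s) <
      (∫ s in u..y, f s * ψ s) * ∫ s in u..v, f s := by
  have hmem : y ∈ Icc u v := ⟨huy.le, hyv.le⟩
  have s1 : uIcc u y ⊆ uIcc u v := uIcc_subset_uIcc_left (by rwa [uIcc_of_le (huy.trans hyv).le])
  have s2 : uIcc y v ⊆ uIcc u v := uIcc_subset_uIcc_right (by rwa [uIcc_of_le (huy.trans hyv).le])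
  have f1 : IntOn f u y := hf.mono_set s1
  have f2 : IntOn f y v := hf.mono_set s2
  have g1 : IntOn (fun s => f s * ψ s) u y := hfψ.mono_set s1
  have g2 : IntOn (fun s => f s * ψ s) y v := hfψ.mono_set s2
  rw [← intervalIntegral.integral_add_adjacent_intervals f1 f2,
    ← intervalIntegral.integral_add_adjacent_intervals g1 g2]
  have hl : 0 < ∫ s in u..y, f s := intervalIntegral.intervalIntegral_pos_of_pos_on f1
    (fun s hs => hpos s ⟨hs.1, hs.2.trans hyv⟩) huy
  have hr : 0 < ∫ s in y..v, f s := intervalIntegral.intervalIntegral_pos_of_pos_on f2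
    (fun s hs => hpos s ⟨huy.trans hs.1, hs.2⟩) hyv
  have hL : 0 < (∫ s in u..y, f s * ψ s) - ψ y * ∫ s in u..y, f s := by
    rw [← intervalIntegral.integral_const_mul, ← intervalIntegral.integral_sub g1 (f1.const_mul _)]
    refine intervalIntegral.intervalIntegral_pos_of_pos_on (g1.sub (f1.const_mul _))
      (fun s hs => ?_) huy
    have h1 := hpos s ⟨hs.1, hs.2.trans hyv⟩
    have h2 := hψ ⟨hs.1, hs.2.trans hyv⟩ ⟨huy, hyv⟩ hs.2
    have := mul_pos h1 (sub_pos.2 h2)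
    linarith
  have hR : (∫ s in y..v, f s * ψ s) ≤ ψ y * ∫ s in y..v, f s := by
    rw [← intervalIntegral.integral_const_mul]
    refine integral_le_of_le_Ioo hyv.le g2 (f2.const_mul _) fun s hs => ?_
    rw [mul_comm]
    exact mul_le_mul_of_nonneg_right (hψ ⟨huy, hyv⟩ ⟨huy.trans hs.1, hs.2⟩ hs.1).le
      (hpos s ⟨huy.trans hs.1, hs.2⟩).le
  nlinarith [mul_pos hL hr, mul_le_mul_of_nonneg_left hR hl.le]

section

variable {m M a e s : ℝ}

/-- The value of `1 / (σ(s) - e)` for the involution `σ = swapRoots m M a`. -/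
noncomputable def poleWeight (m M a e s : ℝ) : ℝ := (a - s) / ((a - e) * (swapRoots m M a e - s))

theorem swapRoots_sub (hs : s < a) (he : e < a) :
    swapRoots m M a s - e = (a - e) * (swapRoots m M a e - s) / (a - s) := by
  have h1 : a - s ≠ 0 := by linarith
  have h2 : a - e ≠ 0 := by linarith
  rw [swapRoots, swapRoots]; field_simp; ring

theorem poleWeight_eq (hs : s < a) (he : e < a) :
    poleWeight m M a e s = 1 / (swapRoots m M a s - e) := by
  rw [swapRoots_sub hs he, one_div_div, poleWeight]

/-- The elementary function in the reduction of the third kind integrals. -/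
noncomputable def polePrimitive (m M a e s : ℝ) : ℝ :=
  Real.log (s - swapRoots m M a e) -
    2 * Real.log (√((s - m) * (s - M)) + √((e - m) * (e - M)) / √(a - e) * √(a - s))

theorem cubicWeight_eq_mul (hs : s < a) :
    cubicWeight m M a s = 1 / (√((s - m) * (s - M)) * √(a - s)) := by
  rw [cubicWeight, ← Real.sqrt_mul' _ (by linarith)]
  congr 2; ring

/-- The conjugate factors multiply to a quadratic with roots e and its image under the involution.
This identity rationalizes the logarithm in `polePrimitive` and evaluates it at the end points. -/
theorem sq_sub_sq_swapRoots (hs : s ≤ a) (he : e < a) (hQs : 0 ≤ (s - m) * (s - M))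
    (hQe : 0 ≤ (e - m) * (e - M)) :
    √((s - m) * (s - M)) ^ 2 - (√((e - m) * (e - M)) / √(a - e) * √(a - s)) ^ 2 =
      (s - e) * (s - swapRoots m M a e) := by
  have h2 : a - e ≠ 0 := by linarith
  rw [mul_pow, div_pow, Real.sq_sqrt hQs, Real.sq_sqrt hQe, Real.sq_sqrt (by linarith : 0 ≤ a - e),
    Real.sq_sqrt (by linarith : 0 ≤ a - s), swapRoots]
  field_simp
  ring

/-- The third kind differentials with poles at e and at the image of e under the involution differ
by an elementary one. The singular difference quotient is thus traded for an integrand whose pole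
lies outside the interval. -/
theorem hasDerivAt_polePrimitive (hs : s < a) (he : e < a) (hQs : 0 < (s - m) * (s - M))
    (hQe : 0 < (e - m) * (e - M)) (hse : s ≠ e) (hσ : s ≠ swapRoots m M a e) :
    HasDerivAt (fun s => cubicWeight m M a e * polePrimitive m M a e s)
      ((cubicWeight m M a s - cubicWeight m M a e) / (s - e) -
        cubicWeight m M a s * poleWeight m M a e s) s := by
  have hA : 0 < a - s := by linarith
  have hAe : 0 < a - e := by linarith
  have hp := Real.sqrt_pos.2 hQs
  have hq := Real.sqrt_pos.2 hA
  have hpe := Real.sqrt_pos.2 hQe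
  have hqe := Real.sqrt_pos.2 hAe
  have hY : s - swapRoots m M a e ≠ 0 := sub_ne_zero.2 hσ
  have hX : s - e ≠ 0 := sub_ne_zero.2 hse
  have key := sq_sub_sq_swapRoots hs.le he hQs.le hQe.le
  have hsum : 0 < √((s - m) * (s - M)) + √((e - m) * (e - M)) / √(a - e) * √(a - s) := by
    positivity
  have dp := (((hasDerivAt_id s).sub_const m).mul ((hasDerivAt_id s).sub_const M)).sqrt hQs.ne'
  have dq := (((hasDerivAt_id s).const_sub a).sqrt hA.ne').const_mul
    (√((e - m) * (e - M)) / √(a - e))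
  have dΨ := ((((hasDerivAt_id s).sub_const (swapRoots m M a e)).log hY).sub
    (((dp.add dq).log hsum.ne').const_mul (2 : ℝ))).const_mul (cubicWeight m M a e)
  refine dΨ.congr_deriv ?_
  rw [cubicWeight_eq_mul hs, cubicWeight_eq_mul he, poleWeight]
  simp only [id, Pi.add_apply, Pi.mul_apply]
  have p2 := Real.sq_sqrt hQs.le
  have q2 := Real.sq_sqrt hA.le
  have pe2 := Real.sq_sqrt hQe.le
  have qe2 := Real.sq_sqrt hAe.le
  have hswap : (a - e) * (s - swapRoots m M a e) = (a - m) * (a - M) - (a - s) * (a - e) := by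
    rw [swapRoots]; field_simp; ring
  have hY' : swapRoots m M a e - s ≠ 0 := sub_ne_zero.2 hσ.symm
  generalize hp' : √((s - m) * (s - M)) = p at *
  generalize hq' : √(a - s) = q at *
  generalize hpe' : √((e - m) * (e - M)) = pe at *
  generalize hqe' : √(a - e) = qe at *
  generalize swapRoots m M a e = σ at *
  -- Rationalization by the conjugate. Here p, q and pe, qe are the square roots at s and at e, and
  -- σ is the image of e.
  have inv : 1 / (p + pe / qe * q) = (p - pe / qe * q) / ((s - e) * (s - σ)) := by
    rw [div_eq_div_iff hsum.ne' (mul_ne_zero hX hY), ← key]; ring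
  have hr2 : (pe / qe) ^ 2 = m + M - e - σ := by
    rw [div_pow, pe2, qe2, div_eq_iff hAe.ne']
    linear_combination -hswap
  have hN : ((1 * (s - M) + (s - m) * 1) / (2 * p) + pe / qe * (-1 / (2 * q))) *
      (2 * (p - pe / qe * q)) =
      (s - e) + (s - σ) - pe / qe * ((a - e) * (s - σ) + (a - s) * (s - e)) / (p * q) := by
    have h1 : (a - e) * (s - σ) + (a - s) * (s - e) = (2 * s - m - M) * q ^ 2 + p ^ 2 := by
      rw [p2, q2]; linear_combination hswap
    have h2 : (s - e) + (s - σ) = (2 * s - m - M) + (pe / qe) ^ 2 := by rw [hr2]; ring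
    rw [h1, h2]
    field_simp
    ring
  have hD : 1 / (s - σ) - 2 * (((1 * (s - M) + (s - m) * 1) / (2 * p) + pe / qe * (-1 / (2 * q))) /
      (p + pe / qe * q)) = -1 / (s - e) +
        pe / qe * ((a - e) * (s - σ) + (a - s) * (s - e)) / (p * q) / ((s - e) * (s - σ)) := by
    rw [div_eq_mul_one_div (_ + _) (p + pe / qe * q), inv]
    have : ∀ N P : ℝ, 2 * (N * (P / ((s - e) * (s - σ)))) = N * (2 * P) / ((s - e) * (s - σ)) :=
      fun N P => by ring
    rw [this, hN]
    field_simp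
    ring
  rw [hD, ← neg_sub s σ]
  have hqq : pe * (1 / (pe * qe)) / qe = 1 / (a - e) := by
    rw [← qe2]; field_simp
  rw [mul_add]
  have h3 : 1 / (pe * qe) * (pe / qe * ((a - e) * (s - σ) + (a - s) * (s - e)) / (p * q) /
      ((s - e) * (s - σ))) = 1 / (a - e) *
        (((a - e) * (s - σ) + (a - s) * (s - e)) / (p * q) / ((s - e) * (s - σ))) := by
    rw [← hqq]; ring
  rw [h3]
  field_simp
  ring

theorem swapRoots_swapRoots (hmM : m < M) (hMa : M < a) (hs : s < a) :
    swapRoots m M a (swapRoots m M a s) = s := by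
  have h1 : a - m ≠ 0 := by linarith
  have h2 : a - M ≠ 0 := by linarith
  have h3 : a - s ≠ 0 := by linarith
  have : a - swapRoots m M a s = (a - m) * (a - M) / (a - s) := by rw [swapRoots]; ring
  rw [swapRoots, this]; field_simp; ring

theorem lt_swapRoots (hMa : M < a) (hs : s < m) (hmM : m < M) : M < swapRoots m M a s := by
  have h3 : 0 < a - s := by linarith
  have : (a - m) * (a - M) / (a - s) < a - M := by
    rw [div_lt_iff₀ h3]; nlinarith
  rw [swapRoots]; linarith

theorem swapRoots_lt (hmM : m < M) (hs : M < s) (hsa : s < a) : swapRoots m M a s < m := by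
  have h3 : 0 < a - s := by linarith
  have : a - m < (a - m) * (a - M) / (a - s) := by
    rw [lt_div_iff₀ h3]; nlinarith
  rw [swapRoots]; linarith

theorem swapRoots_lt_right (hmM : m < M) (hMa : M < a) (hs : s < a) : swapRoots m M a s < a := by
  have : 0 < (a - m) * (a - M) / (a - s) :=
    div_pos (mul_pos (by linarith) (by linarith)) (by linarith)
  rw [swapRoots]; linarith

/-- A Lipschitz-type bound for the inverse square root of the cubic. -/
theorem abs_cubicWeight_sub_le (hs : s ∈ Icc 0 a) (he : e ∈ Icc 0 a) (hm : m ∈ Icc 0 a)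
    (hM : M ∈ Icc 0 a) (hQs : 0 < (m - s) * (M - s) * (a - s))
    (hQe : 0 < (m - e) * (M - e) * (a - e)) :
    |cubicWeight m M a s - cubicWeight m M a e| ≤
      |s - e| * (3 * a ^ 2 / ((m - e) * (M - e) * (a - e)) * cubicWeight m M a s) := by
  have rs := Real.sqrt_pos.2 hQs
  have re := Real.sqrt_pos.2 hQe
  have hd : |(m - e) * (M - e) * (a - e) - (m - s) * (M - s) * (a - s)| ≤ |s - e| * (3 * a ^ 2) := by
    have e1 : (m - e) * (M - e) * (a - e) - (m - s) * (M - s) * (a - s) =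
        (s - e) * ((m - e) * (M - e) + (m - e) * (a - s) + (M - s) * (a - s)) := by ring
    have hb : ∀ x ∈ Icc 0 a, ∀ y ∈ Icc 0 a, |x - y| ≤ a := fun x hx y hy =>
      abs_le.2 ⟨by linarith [hx.1, hy.2], by linarith [hx.2, hy.1]⟩
    have ha : a ∈ Icc 0 a := ⟨hs.1.trans hs.2, le_rfl⟩
    have ha0 : 0 ≤ a := ha.1
    rw [e1, abs_mul]
    gcongr
    refine (abs_add_three _ _ _).trans ?_
    rw [abs_mul, abs_mul, abs_mul]
    calc _ ≤ a * a + a * a + a * a := by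
          gcongr
          exacts [hb _ hm _ he, hb _ hM _ he, hb _ hm _ he, hb _ ha _ hs, hb _ hM _ hs, hb _ ha _ hs]
      _ = _ := by ring
  have e2 : cubicWeight m M a s - cubicWeight m M a e =
      (√((m - e) * (M - e) * (a - e)) - √((m - s) * (M - s) * (a - s))) /
        (√((m - s) * (M - s) * (a - s)) * √((m - e) * (M - e) * (a - e))) := by
    rw [cubicWeight, cubicWeight]; field_simp
  have e3 : |√((m - e) * (M - e) * (a - e)) - √((m - s) * (M - s) * (a - s))| ≤
      |s - e| * (3 * a ^ 2) / √((m - e) * (M - e) * (a - e)) := by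
    rw [le_div_iff₀ re]
    refine le_trans ?_ hd
    have := Real.sq_sqrt hQs.le
    have := Real.sq_sqrt hQe.le
    calc _ ≤ |√((m - e) * (M - e) * (a - e)) - √((m - s) * (M - s) * (a - s))| *
          (√((m - e) * (M - e) * (a - e)) + √((m - s) * (M - s) * (a - s))) := by
          gcongr; linarith
      _ = |(√((m - e) * (M - e) * (a - e)) - √((m - s) * (M - s) * (a - s))) *
          (√((m - e) * (M - e) * (a - e)) + √((m - s) * (M - s) * (a - s)))| := by
          rw [abs_mul, abs_of_pos (add_pos re rs)]
      _ = _ := by congr 1; nlinarith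
  rw [e2, abs_div, abs_of_pos (mul_pos rs re)]
  calc _ ≤ |s - e| * (3 * a ^ 2) / √((m - e) * (M - e) * (a - e)) /
        (√((m - s) * (M - s) * (a - s)) * √((m - e) * (M - e) * (a - e))) := by gcongr
    _ = |s - e| * (3 * a ^ 2 / (√((m - e) * (M - e) * (a - e)) * √((m - e) * (M - e) * (a - e))) *
        cubicWeight m M a s) := by
        rw [cubicWeight]; field_simp
    _ = _ := by rw [Real.mul_self_sqrt hQe.le]

/-- This and its counterpart on (M,a) supply the hypothesis of the limit theorems for the pinched
integrals. -/
theorem exists_abs_cubicWeight_sub_le_low (hm : 0 < m) (hmM : m < M) (hMa : M < a)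
    (he : e ∈ Ioo 0 m) : ∃ C, 0 ≤ C ∧ ∀ s ∈ Ioo 0 m,
      |cubicWeight m M a s - cubicWeight m M a e| ≤
        |s - e| * (C / √((s - 0) * (m - s))) := by
  have hQ : ∀ s ∈ Ioo 0 m, 0 < (m - s) * (M - s) * (a - s) := fun s hs =>
    mul_pos (mul_pos (by linarith [hs.2]) (by linarith [hs.2])) (by linarith [hs.2])
  have hQe := hQ e he
  have hd : 0 < (M - m) * (a - m) := mul_pos (by linarith) (by linarith)
  have hd' := Real.sqrt_pos.2 hd
  refine ⟨3 * a ^ 2 / ((m - e) * (M - e) * (a - e)) * (√a / √((M - m) * (a - m))),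
    by positivity, fun s hs => ?_⟩
  refine (abs_cubicWeight_sub_le ⟨hs.1.le, by linarith [hs.2]⟩ ⟨he.1.le, by linarith [he.2]⟩
    ⟨hm.le, by linarith⟩ ⟨by linarith, hMa.le⟩ (hQ s hs) hQe).trans ?_
  refine mul_le_mul_of_nonneg_left ?_ (abs_nonneg _)
  rw [mul_div_assoc (3 * a ^ 2 / _)]
  refine mul_le_mul_of_nonneg_left ?_ (by positivity)
  have h1 : 0 < s - 0 := by linarith [hs.1]
  have h2 : 0 < m - s := by linarith [hs.2]
  have r1 := Real.sqrt_pos.2 h1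
  have r2 := Real.sqrt_pos.2 h2
  rw [cubicWeight, div_div, ← Real.sqrt_mul hd.le, div_le_div_iff₀ (Real.sqrt_pos.2 (hQ s hs))
    (Real.sqrt_pos.2 (by positivity)), one_mul, ← Real.sqrt_mul (by linarith)]
  refine Real.sqrt_le_sqrt ?_
  have h3 : 0 < M - m := by linarith
  have h4 : 0 < M - s := by linarith
  have h5 : 0 < a - m := by linarith
  calc (M - m) * (a - m) * ((s - 0) * (m - s)) = (s - 0) * ((m - s) * (M - m) * (a - m)) := by ring
    _ ≤ a * ((m - s) * (M - s) * (a - s)) := by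
      gcongr <;> first | positivity | linarith

theorem exists_abs_cubicWeight_sub_le_high (hm : 0 < m) (hmM : m < M) (hMa : M < a)
    (he : e ∈ Ioo M a) : ∃ C, 0 ≤ C ∧ ∀ s ∈ Ioo M a,
      |cubicWeight m M a s - cubicWeight m M a e| ≤
        |s - e| * (C / √((s - M) * (a - s))) := by
  have hQ' : ∀ s, (m - s) * (M - s) * (a - s) = (s - m) * ((s - M) * (a - s)) := fun s => by ring
  have hQ : ∀ s ∈ Ioo M a, 0 < (m - s) * (M - s) * (a - s) := fun s hs => by
    rw [hQ']
    exact mul_pos (by linarith [hs.1]) (mul_pos (by linarith [hs.1]) (by linarith [hs.2]))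
  have hQe := hQ e he
  have hd : 0 < M - m := by linarith
  have hd' := Real.sqrt_pos.2 hd
  refine ⟨3 * a ^ 2 / ((m - e) * (M - e) * (a - e)) * (1 / √(M - m)),
    by positivity, fun s hs => ?_⟩
  refine (abs_cubicWeight_sub_le ⟨by linarith [hs.1], hs.2.le⟩ ⟨by linarith [he.1], he.2.le⟩
    ⟨hm.le, by linarith⟩ ⟨by linarith, hMa.le⟩ (hQ s hs) hQe).trans ?_
  refine mul_le_mul_of_nonneg_left ?_ (abs_nonneg _)
  rw [mul_div_assoc (3 * a ^ 2 / _)]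
  refine mul_le_mul_of_nonneg_left ?_ (by positivity)
  have h1 : 0 < s - M := by linarith [hs.1]
  have h2 : 0 < a - s := by linarith [hs.2]
  rw [cubicWeight, div_div, ← Real.sqrt_mul hd.le, hQ']
  have := Real.sqrt_pos.2 (mul_pos hd (mul_pos h1 h2))
  gcongr
  linarith [hs.1]

end

section

variable {m M a e : ℝ}

theorem continuousOn_poleWeight {S : Set ℝ} (he : e < a) (h : ∀ s ∈ S, s ≠ swapRoots m M a e) :
    ContinuousOn (poleWeight m M a e) S := by
  unfold poleWeight
  refine ContinuousOn.div (by fun_prop) (by fun_prop) fun s hs => ?_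
  exact mul_ne_zero (by linarith) (sub_ne_zero.2 (h s hs).symm)

theorem continuousOn_polePrimitive {S : Set ℝ} (he : e < a) (hQe : 0 < (e - m) * (e - M))
    (h : ∀ s ∈ S, s ≠ swapRoots m M a e ∧ s ≤ a ∧ (s = a → 0 < (s - m) * (s - M))) :
    ContinuousOn (polePrimitive m M a e) S := by
  unfold polePrimitive
  have hr : 0 < √((e - m) * (e - M)) / √(a - e) :=
    div_pos (Real.sqrt_pos.2 hQe) (Real.sqrt_pos.2 (by linarith))
  refine ContinuousOn.sub (ContinuousOn.log (by fun_prop) fun s hs => sub_ne_zero.2 (h s hs).1)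
    (ContinuousOn.mul continuousOn_const (ContinuousOn.log (by fun_prop) fun s hs => ?_))
  obtain ⟨-, h1, h2⟩ := h s hs
  rcases eq_or_lt_of_le h1 with h1 | h1
  · have := Real.sqrt_pos.2 (h2 h1)
    positivity
  · have : 0 < √(a - s) := Real.sqrt_pos.2 (by linarith)
    positivity

/-- The exponential of the elementary contribution of the lower limit `0`. -/
noncomputable def poleRatio (m M a e : ℝ) : ℝ :=
  (√(m * M) - √((e - m) * (e - M)) / √(a - e) * √a) /
    (√(m * M) + √((e - m) * (e - M)) / √(a - e) * √a)

/-- Numerator and denominator are conjugate, and by `sq_sub_sq_swapRoots` at s = 0 their product is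
e times its image, hence positive. -/
theorem poleRatio_mem (hmM : m < M) (hMa : M < a) (he : e ∈ Ioo 0 m) :
    poleRatio m M a e ∈ Ioo 0 1 := by
  have ⟨he0, hem⟩ := he
  have hQe : 0 < (e - m) * (e - M) := mul_pos_of_neg_of_neg (by linarith) (by linarith)
  have hr : 0 < √((e - m) * (e - M)) / √(a - e) :=
    div_pos (Real.sqrt_pos.2 hQe) (Real.sqrt_pos.2 (by linarith))
  have hq : 0 < √a := Real.sqrt_pos.2 (by linarith)
  have hp : 0 < √(m * M) := Real.sqrt_pos.2 (mul_pos (by linarith) (by linarith))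
  have key := sq_sub_sq_swapRoots (m := m) (M := M) (a := a) (s := 0) (by linarith)
    (by linarith : e < a) (by nlinarith) hQe.le
  rw [sub_zero, show (0 - m) * (0 - M) = m * M by ring] at key
  have hσ := lt_swapRoots hMa hem hmM
  have h1 : 0 < √(m * M) - √((e - m) * (e - M)) / √(a - e) * √a := by
    have : 0 < (√(m * M) - √((e - m) * (e - M)) / √(a - e) * √a) *
        (√(m * M) + √((e - m) * (e - M)) / √(a - e) * √a) := by
      have : 0 < e * swapRoots m M a e := mul_pos he0 (by linarith)
      nlinarith
    exact (pos_iff_pos_of_mul_pos this).2 (by positivity)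
  have h2 : 0 < √((e - m) * (e - M)) / √(a - e) * √a := by positivity
  rw [poleRatio]
  exact ⟨div_pos h1 (by positivity), (div_lt_one (by positivity)).2 (by linarith)⟩

/-- Integrate the derivative identity over (0,m). The primitive is continuous at s = e, so that
point can be excepted. At the branch point m only a logarithm of m - e remains, and the limit 0,
which is not a branch point, produces `poleRatio`. -/
theorem log_sub_integral_slope_low (hm : 0 < m) (hmM : m < M) (hMa : M < a) (he : e ∈ Ioo 0 m) :
    cubicWeight m M a e * (Real.log e - Real.log (m - e)) -
        (∫ s in (0 : ℝ)..m, (cubicWeight m M a s - cubicWeight m M a e) / (s - e)) =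
      cubicWeight m M a e * Real.log (poleRatio m M a e) -
        ∫ s in (0 : ℝ)..m, cubicWeight m M a s * poleWeight m M a e s := by
  have ⟨he0, hem⟩ := he
  have hea : e < a := by linarith
  have hQe : 0 < (e - m) * (e - M) := mul_pos_of_neg_of_neg (by linarith) (by linarith)
  have hσ := lt_swapRoots hMa hem hmM
  obtain ⟨C, hC, hb⟩ := exists_abs_cubicWeight_sub_le_low hm hmM hMa he
  have i1 := intOn_slope hm measurable_cubicWeight hb
  have i2 : IntOn (fun s => cubicWeight m M a s * poleWeight m M a e s) 0 m := by
    refine (intOn_cubicWeight_outer hm.le hmM hMa).mul_continuousOn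
      (continuousOn_poleWeight hea fun s hs => ?_)
    rw [uIcc_of_le hm.le] at hs
    exact (by linarith [hs.2] : s < swapRoots m M a e).ne
  have H := MeasureTheory.integral_eq_of_hasDerivAt_off_countable_of_le
    (fun s => cubicWeight m M a e * polePrimitive m M a e s)
    (fun s => (cubicWeight m M a s - cubicWeight m M a e) / (s - e) -
        cubicWeight m M a s * poleWeight m M a e s) hm.le (countable_singleton e)
    (continuousOn_const.mul (continuousOn_polePrimitive hea hQe fun s hs =>
      ⟨(by linarith [hs.2] : s < swapRoots m M a e).ne, by linarith [hs.2], fun h => by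
        linarith [hs.2]⟩))
    (fun s hs => hasDerivAt_polePrimitive (by linarith [hs.1.2]) hea
      (mul_pos_of_neg_of_neg (by linarith [hs.1.2]) (by linarith [hs.1.2])) hQe hs.2
      (by linarith [hs.1.2] : s < swapRoots m M a e).ne) (i1.sub i2)
  rw [intervalIntegral.integral_sub i1 i2] at H
  have hr : 0 < √((e - m) * (e - M)) / √(a - e) :=
    div_pos (Real.sqrt_pos.2 hQe) (Real.sqrt_pos.2 (by linarith))
  have km := sq_sub_sq_swapRoots (m := m) (M := M) (s := m) (by linarith) hea (by simp) hQe.le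
  have k0 := sq_sub_sq_swapRoots (m := m) (M := M) (a := a) (s := 0) (by linarith) hea
    (by nlinarith) hQe.le
  have hrat := (poleRatio_mem hmM hMa he).1
  have hq0 : 0 < √a := Real.sqrt_pos.2 (by linarith)
  have hqm : 0 < √(a - m) := Real.sqrt_pos.2 (by linarith)
  have em : polePrimitive m M a e m = -Real.log (m - e) := by
    rw [polePrimitive]
    rw [sub_self, zero_mul, Real.sqrt_zero] at km ⊢
    rw [zero_add]
    have h1 : Real.log ((m - e) * (m - swapRoots m M a e)) =
        2 * Real.log (√((e - m) * (e - M)) / √(a - e) * √(a - m)) := by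
      rw [← km, zero_pow two_ne_zero, zero_sub, Real.log_neg_eq_log, Real.log_pow]; norm_cast
    rw [Real.log_mul (by linarith) (by linarith)] at h1
    linarith
  have e0 : polePrimitive m M a e 0 = Real.log (poleRatio m M a e) - Real.log e := by
    rw [polePrimitive]
    rw [poleRatio] at hrat ⊢
    rw [sub_zero, show (0 - m) * (0 - M) = m * M by ring] at k0 ⊢
    have hp : 0 < √(m * M) + √((e - m) * (e - M)) / √(a - e) * √a := by positivity
    have hd : √(m * M) - √((e - m) * (e - M)) / √(a - e) * √a ≠ 0 := fun h => by
      rw [h, zero_div] at hrat; exact lt_irrefl _ hrat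
    rw [Real.log_div hd hp.ne']
    have h1 := congrArg Real.log k0
    rw [sq_sub_sq, Real.log_mul hp.ne' hd, Real.log_mul (by linarith) (by linarith),
      zero_sub, Real.log_neg_eq_log] at h1
    linarith
  rw [em, e0] at H
  linear_combination -H

/-- Both end points are branch points here, so no extra elementary term survives. -/
theorem log_sub_integral_slope_high (hm : 0 < m) (hmM : m < M) (hMa : M < a) (he : e ∈ Ioo M a) :
    cubicWeight m M a e * (Real.log (e - M) - Real.log (a - e)) -
        (∫ s in M..a, (cubicWeight m M a s - cubicWeight m M a e) / (s - e)) =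
      -∫ s in M..a, cubicWeight m M a s * poleWeight m M a e s := by
  have ⟨heM, hea⟩ := he
  have hQ : ∀ s, M < s → 0 < (s - m) * (s - M) := fun s hs => mul_pos (by linarith) (by linarith)
  have hQe := hQ e heM
  have hσ := swapRoots_lt hmM heM hea
  obtain ⟨C, hC, hb⟩ := exists_abs_cubicWeight_sub_le_high hm hmM hMa he
  have i1 := intOn_slope hMa measurable_cubicWeight hb
  have i2 : IntOn (fun s => cubicWeight m M a s * poleWeight m M a e s) M a := by
    refine (intOn_cubicWeight_inner hmM hMa).mul_continuousOn
      (continuousOn_poleWeight hea fun s hs => ?_)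
    rw [uIcc_of_le hMa.le] at hs
    exact (by linarith [hs.1] : swapRoots m M a e < s).ne'
  have H := MeasureTheory.integral_eq_of_hasDerivAt_off_countable_of_le
    (fun s => cubicWeight m M a e * polePrimitive m M a e s)
    (fun s => (cubicWeight m M a s - cubicWeight m M a e) / (s - e) -
        cubicWeight m M a s * poleWeight m M a e s) hMa.le (countable_singleton e)
    (continuousOn_const.mul (continuousOn_polePrimitive hea hQe fun s hs =>
      ⟨(by linarith [hs.1] : swapRoots m M a e < s).ne', hs.2, fun h => hQ s (by linarith)⟩))
    (fun s hs => hasDerivAt_polePrimitive hs.1.2 hea (hQ s hs.1.1) hQe hs.2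
      (by linarith [hs.1.1] : swapRoots m M a e < s).ne') (i1.sub i2)
  rw [intervalIntegral.integral_sub i1 i2] at H
  have hr : 0 < √((e - m) * (e - M)) / √(a - e) :=
    div_pos (Real.sqrt_pos.2 hQe) (Real.sqrt_pos.2 (by linarith))
  have kM := sq_sub_sq_swapRoots (m := m) (M := M) (s := M) hMa.le hea (by simp) hQe.le
  have ka := sq_sub_sq_swapRoots (m := m) (M := M) (a := a) (s := a) le_rfl hea
    (hQ a hMa).le hQe.le
  have eM : polePrimitive m M a e M = -Real.log (e - M) := by
    rw [polePrimitive]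
    rw [sub_self, mul_zero, Real.sqrt_zero] at kM ⊢
    rw [zero_add]
    have h1 : Real.log ((M - e) * (M - swapRoots m M a e)) =
        2 * Real.log (√((e - m) * (e - M)) / √(a - e) * √(a - M)) := by
      rw [← kM, zero_pow two_ne_zero, zero_sub, Real.log_neg_eq_log, Real.log_pow]; norm_cast
    rw [Real.log_mul (by linarith) (by linarith), ← neg_sub e M, Real.log_neg_eq_log] at h1
    linarith
  have ea : polePrimitive m M a e a = -Real.log (a - e) := by
    rw [polePrimitive]
    rw [sub_self, Real.sqrt_zero, mul_zero] at ka ⊢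
    rw [add_zero]
    have h1 := congrArg Real.log ka
    rw [zero_pow two_ne_zero, sub_zero, Real.log_pow, Real.log_mul (by linarith) (by linarith)] at h1
    push_cast at h1
    linarith
  rw [eM, ea] at H
  linear_combination -H

/-- The residual third kind period at a pole in `(0, m)`. -/
noncomputable def lowPole (m M a e : ℝ) : ℝ :=
  cubicWeight m M a e * Real.log (poleRatio m M a e) -
    (∫ s in (0 : ℝ)..m, cubicWeight m M a s * poleWeight m M a e s) +
    2 * sortedRotation m M a * ∫ s in M..a, cubicWeight m M a s * (1 / (s - e))

/-- The residual third kind period at a pole in `(M, a)`. -/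
noncomputable def highPole (m M a e : ℝ) : ℝ :=
  (∫ s in (0 : ℝ)..m, cubicWeight m M a s * (1 / (e - s))) +
    2 * sortedRotation m M a * ∫ s in M..a, cubicWeight m M a s * poleWeight m M a e s

theorem cubicWeight_pos_inner (hmM : m < M) {s : ℝ} (hs : s ∈ Ioo M a) :
    0 < cubicWeight m M a s := by
  have h : (m - s) * (M - s) * (a - s) = (s - m) * (s - M) * (a - s) := by ring
  rw [cubicWeight, h]
  exact one_div_pos.2 (Real.sqrt_pos.2 (mul_pos (mul_pos (by linarith [hs.1]) (by linarith [hs.1]))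
    (by linarith [hs.2])))

theorem cubicWeight_pos_outer (hmM : m < M) (hMa : M < a) {s : ℝ} (hs : s < m) :
    0 < cubicWeight m M a s :=
  one_div_pos.2 (Real.sqrt_pos.2 (mul_pos (mul_pos (by linarith) (by linarith)) (by linarith)))

theorem integral_cubicWeight_inner_pos (hmM : m < M) (hMa : M < a) :
    0 < ∫ s in M..a, cubicWeight m M a s :=
  intervalIntegral.intervalIntegral_pos_of_pos_on (intOn_cubicWeight_inner hmM hMa)
    (fun _ hs => cubicWeight_pos_inner hmM hs) hMa

/-- Twice the rotation number is the fraction of the inner period carried by the segment from M to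
the image of 0. This brings the residual periods into the scope of the Chebyshev inequality. -/
theorem two_mul_sortedRotation (hm : 0 < m) (hmM : m < M) (hMa : M < a) :
    2 * sortedRotation m M a * (∫ s in M..a, cubicWeight m M a s) =
      ∫ s in M..(swapRoots m M a 0), cubicWeight m M a s := by
  have h1 := integral_swapRoots hm hmM hMa (fun _ => 1)
  simp only [mul_one] at h1
  have h2 : sortedRotation m M a = (∫ s in (0 : ℝ)..m, cubicWeight m M a s) /
      (2 * ∫ s in M..a, cubicWeight m M a s) := sortedRotation_eq hm.le hMa
  have := integral_cubicWeight_inner_pos hmM hMa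
  rw [h1, h2]; field_simp

/-- The logarithmic term is negative because `poleRatio` is below 1. After transport by the
involution, the two integrals compare the mean of the decreasing function 1/(s - e) over an initial
segment with its mean over (M,a). -/
theorem lowPole_neg (hmM : m < M) (hMa : M < a) (he : e ∈ Ioo 0 m) :
    lowPole m M a e < 0 := by
  have ⟨he0, hem⟩ := he
  have hm : 0 < m := by linarith
  have hrat := poleRatio_mem hmM hMa he
  have hw := cubicWeight_pos_outer hmM hMa hem
  have hlog := mul_neg_of_pos_of_neg hw (Real.log_neg hrat.1 hrat.2)
  have h0 : (∫ s in (0 : ℝ)..m, cubicWeight m M a s * poleWeight m M a e s) =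
      ∫ s in M..(swapRoots m M a 0), cubicWeight m M a s * (1 / (s - e)) := by
    rw [integral_swapRoots hm hmM hMa (fun s => 1 / (s - e))]
    exact integral_congr_Ioo hm.le fun s hs => by
      rw [poleWeight_eq (by linarith [hs.2]) (by linarith)]
  have hi : IntOn (fun s => cubicWeight m M a s * (1 / (s - e))) M a := by
    refine (intOn_cubicWeight_inner hmM hMa).mul_continuousOn (ContinuousOn.div (by fun_prop)
      (by fun_prop) fun s hs => ?_)
    rw [uIcc_of_le hMa.le] at hs
    exact (by linarith [hs.1] : (0 : ℝ) < s - e).ne'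
  have hch := integral_mul_lt_of_strictAntiOn (ψ := fun s => 1 / (s - e))
    (lt_swapRoots hMa hm hmM) (swapRoots_lt_right hmM hMa (by linarith : (0 : ℝ) < a))
    (intOn_cubicWeight_inner hmM hMa) hi (fun s hs => cubicWeight_pos_inner hmM hs)
    (fun s hs t ht hst => one_div_lt_one_div_of_lt (by linarith [hs.1]) (by linarith))
  rw [← two_mul_sortedRotation hm hmM hMa] at hch
  have hp := integral_cubicWeight_inner_pos hmM hMa
  rw [lowPole, h0]
  nlinarith

/-- The same comparison with the function -`poleWeight`, which is decreasing on (M,a). There is no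
logarithmic term. -/
theorem highPole_pos (hm : 0 < m) (hmM : m < M) (hMa : M < a) (he : e ∈ Ioo M a) :
    0 < highPole m M a e := by
  have ⟨heM, hea⟩ := he
  have hσ := swapRoots_lt hmM heM hea
  have h0 : (∫ s in (0 : ℝ)..m, cubicWeight m M a s * (1 / (e - s))) =
      ∫ s in M..(swapRoots m M a 0), cubicWeight m M a s * -poleWeight m M a e s := by
    rw [integral_swapRoots hm hmM hMa (fun s => -poleWeight m M a e s)]
    exact integral_congr_Ioo hm.le fun s hs => by
      rw [poleWeight_eq (swapRoots_lt_right hmM hMa (by linarith [hs.2])) hea,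
        swapRoots_swapRoots hmM hMa (by linarith [hs.2]), ← neg_sub e s, one_div_neg_eq_neg_one_div,
        neg_neg]
  have hi : IntOn (fun s => cubicWeight m M a s * -poleWeight m M a e s) M a := by
    refine (intOn_cubicWeight_inner hmM hMa).mul_continuousOn
      (continuousOn_poleWeight hea fun s hs => ?_).neg
    rw [uIcc_of_le hMa.le] at hs
    exact (by linarith [hs.1] : swapRoots m M a e < s).ne'
  have hch := integral_mul_lt_of_strictAntiOn (ψ := fun s => -poleWeight m M a e s)
    (lt_swapRoots hMa hm hmM) (swapRoots_lt_right hmM hMa (by linarith : (0 : ℝ) < a))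
    (intOn_cubicWeight_inner hmM hMa) hi (fun s hs => cubicWeight_pos_inner hmM hs)
    (fun s hs t ht hst => by
      have e1 : ∀ r, -poleWeight m M a e r = (a - r) / ((a - e) * (r - swapRoots m M a e)) :=
        fun r => by rw [poleWeight, ← neg_sub r (swapRoots m M a e), mul_neg, div_neg, neg_neg]
      simp only [e1]
      have h1 : 0 < s - swapRoots m M a e := by linarith [hs.1]
      have h2 : 0 < t - swapRoots m M a e := by linarith
      have h3 : 0 < a - e := by linarith
      rw [div_lt_div_iff₀ (mul_pos h3 h2) (mul_pos h3 h1)]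
      have h4 : 0 < a - t := by linarith [ht.2]
      have : (a - t) * (s - swapRoots m M a e) < (a - s) * (t - swapRoots m M a e) := by
        apply mul_lt_mul'' <;> linarith
      nlinarith)
  rw [← two_mul_sortedRotation hm hmM hMa, ← h0] at hch
  have hp := integral_cubicWeight_inner_pos hmM hMa
  have e2 : (∫ s in M..a, cubicWeight m M a s * -poleWeight m M a e s) =
      -∫ s in M..a, cubicWeight m M a s * poleWeight m M a e s := by
    rw [← intervalIntegral.integral_neg]; congr 1; ext s; ring
  rw [e2] at hch
  rw [highPole]
  nlinarith

end

/-! ### Limits that determine the logarithmic coefficients -/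

section

variable {m M a e : ℝ}

theorem tendsto_abs_sub_nhdsNE (e : ℝ) : Tendsto (fun x => |e - x|) (𝓝[≠] e) (𝓝[>] 0) := by
  refine tendsto_nhdsWithin_iff.2 ⟨?_, ?_⟩
  · have : ContinuousAt (fun x => |e - x|) e := by fun_prop
    simpa using this.tendsto.mono_left (nhdsWithin_le_nhds (s := {e}ᶜ))
  · filter_upwards [self_mem_nhdsWithin] with x hx
    exact abs_pos.2 (sub_ne_zero.2 (Ne.symm hx))

theorem tendsto_log_abs_sub (e : ℝ) :
    Tendsto (fun x => Real.log |e - x|) (𝓝[≠] e) atBot :=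
  Real.tendsto_log_nhdsGT_zero.comp (tendsto_abs_sub_nhdsNE e)

theorem tendsto_sqrt_mul_log_abs_sub (e : ℝ) :
    Tendsto (fun x => √|e - x| * Real.log |e - x|) (𝓝[≠] e) (𝓝 0) := by
  have := (tendsto_log_mul_rpow_nhdsGT_zero (r := 1 / 2) (by norm_num)).comp
    (tendsto_abs_sub_nhdsNE e)
  refine this.congr fun x => ?_
  simp only [Function.comp_apply]
  rw [Real.sqrt_eq_rpow, mul_comm]

theorem tendsto_abs_mul_log_abs_sub (e : ℝ) :
    Tendsto (fun x => |e - x| * Real.log |e - x|) (𝓝[≠] e) (𝓝 0) := by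
  have h1 := tendsto_sqrt_mul_log_abs_sub e
  have h2 : Tendsto (fun x => √|e - x|) (𝓝[≠] e) (𝓝 0) := by
    have : ContinuousAt (fun x => √|e - x|) e := by fun_prop
    simpa using this.tendsto.mono_left (nhdsWithin_le_nhds (s := {e}ᶜ))
  have := h2.mul h1
  rw [zero_mul] at this
  refine this.congr fun x => ?_
  rw [← mul_assoc, Real.mul_self_sqrt (abs_nonneg _)]

theorem tendsto_mul_log_of_abs_le {g h : ℝ → ℝ} {P : ℝ} (hh : Tendsto (fun x => h x * Real.log |e - x|)
    (𝓝[≠] e) (𝓝 0)) (hg : ∀ᶠ x in 𝓝[≠] e, |g x| ≤ P * |h x|) :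
    Tendsto (fun x => g x * Real.log |e - x|) (𝓝[≠] e) (𝓝 0) := by
  have h1 := (hh.abs.const_mul P)
  rw [abs_zero, mul_zero] at h1
  refine squeeze_zero_norm' ?_ h1
  filter_upwards [hg] with x hx
  rw [Real.norm_eq_abs, abs_mul, abs_mul, ← mul_assoc]
  gcongr

theorem tendsto_zero_of_abs_mul_log_le {g : ℝ → ℝ} {C : ℝ}
    (hg : ∀ᶠ x in 𝓝[≠] e, |g x| * Real.log (1 / |e - x|) ≤ C) :
    Tendsto g (𝓝[≠] e) (𝓝 0) := by
  have h1 : Tendsto (fun x => C / Real.log (1 / |e - x|)) (𝓝[≠] e) (𝓝 0) := by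
    refine Tendsto.const_div_atTop ?_ C
    refine (tendsto_neg_atBot_atTop.comp (tendsto_log_abs_sub e)).congr fun x => ?_
    simp
  refine squeeze_zero_norm' ?_ h1
  filter_upwards [hg, (tendsto_log_abs_sub e).eventually_lt_atBot 0] with x hx hl
  have : 0 < Real.log (1 / |e - x|) := by rw [one_div, Real.log_inv]; linarith
  rwa [Real.norm_eq_abs, le_div_iff₀ this]

theorem quintic_low_pair (x s : ℝ) : quintic (min e x) (max e x) m M a s =
    ((e - s) * (x - s)) * ((m - s) * (M - s) * (a - s)) := by
  rw [quintic, mul_sub_min_max]; ring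

theorem quintic_high_pair (x s : ℝ) : quintic m M (min e x) (max e x) a s =
    ((e - s) * (x - s)) * ((m - s) * (M - s) * (a - s)) := by
  rw [quintic, mul_assoc ((m - s) * (M - s)), mul_sub_min_max]; ring

theorem div_sqrt_pair_mul {q y Q : ℝ} (hy : 0 ≤ y) : q / √(y * Q) = q * (1 / √Q) / √y := by
  rw [Real.sqrt_mul hy, mul_one_div, div_div, mul_comm √y]

theorem sub_mul_sub_nonneg_of_le {x s : ℝ} (h : s ≤ min e x) : 0 ≤ (e - s) * (x - s) :=
  mul_nonneg (by linarith [min_le_left e x]) (by linarith [min_le_right e x])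

theorem sub_mul_sub_nonneg_of_ge {x s : ℝ} (h : max e x ≤ s) : 0 ≤ (e - s) * (x - s) :=
  mul_nonneg_of_nonpos_of_nonpos (by linarith [le_max_left e x]) (by linarith [le_max_right e x])

theorem tendsto_min_self (e : ℝ) : Tendsto (fun x => min e x) (𝓝[≠] e) (𝓝 e) := by
  have : ContinuousAt (fun x => min e x) e := by fun_prop
  simpa using this.tendsto.mono_left (nhdsWithin_le_nhds (s := {e}ᶜ))

theorem tendsto_max_self (e : ℝ) : Tendsto (fun x => max e x) (𝓝[≠] e) (𝓝 e) := by
  have : ContinuousAt (fun x => max e x) e := by fun_prop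
  simpa using this.tendsto.mono_left (nhdsWithin_le_nhds (s := {e}ᶜ))

theorem tendsto_div_log {K : ℝ → ℝ} {k r : ℝ}
    (h : Tendsto (fun x => K x + k * Real.log |e - x|) (𝓝[≠] e) (𝓝 r)) :
    Tendsto (fun x => K x / Real.log |e - x|) (𝓝[≠] e) (𝓝 (-k)) := by
  have h1 := (h.div_atBot (tendsto_log_abs_sub e)).sub_const k
  rw [zero_sub] at h1
  refine h1.congr' ?_
  filter_upwards [(tendsto_log_abs_sub e).eventually_lt_atBot 0] with x hx
  have := hx.ne
  field_simp
  ring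

/-- First component of the logarithmic coefficient at a pole in `(0, m)`. -/
noncomputable def lowCoeff (m M a e : ℝ) : ℝ := -lowPole m M a e / (2 * cubicWeight m M a e)

/-- The logarithmic coefficient at a pole in `(M, a)`, up to sign. -/
noncomputable def highCoeff (m M a e : ℝ) : ℝ := highPole m M a e / (2 * cubicWeight m M a e)

/-- In the zeroth equation the first two periods both behave like -f(e) log|e - x|, with f =
`cubicWeight`, and their difference converges. Thus (w₁ - 1/2) · 2K₁ = (K₀ - K₁) + 2w₂K₂ tends to
`lowPole`. Equation B, where all periods converge, transfers the coefficient to the second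
component. -/
theorem tendsto_collision_low (hmM : m < M) (hMa : M < a) (he : e ∈ Ioo 0 m) {w : ℝ → ℝ × ℝ}
    (hw : ∀ᶠ x in 𝓝[≠] e, SolvesPeriods (min e x) (max e x) m M a (w x) ∧
      0 < (w x).1 ∧ 0 < (w x).2) :
    Tendsto (fun x => ((w x).1 - 1 / 2) * Real.log |e - x|) (𝓝[≠] e) (𝓝 (lowCoeff m M a e)) ∧
    Tendsto (fun x => ((w x).2 - sortedRotation m M a) * Real.log |e - x|) (𝓝[≠] e)
      (𝓝 (lowCoeff m M a e * ((∫ s in e..m, cubicWeight m M a s) /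
        ∫ s in M..a, cubicWeight m M a s))) := by
  have ⟨he0, hem⟩ := he
  have hm : 0 < m := by linarith
  have hη : 0 < M - m := by linarith
  have ha : 0 < a := by linarith
  have hfe : 0 < cubicWeight m M a e := cubicWeight_pos_outer hmM hMa hem
  have hx0 : ∀ᶠ x in 𝓝[≠] e, x ∈ Ioo (e / 2) m :=
    nhdsWithin_le_nhds (Ioo_mem_nhds (by linarith) hem)
  have hε : ∀ᶠ x in 𝓝[≠] e, |e - x| < 1 / 2 :=
    ((tendsto_abs_sub_nhdsNE e).mono_right nhdsWithin_le_nhds).eventually_lt_const (by norm_num)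
  have hS : ∀ᶠ x in 𝓝[≠] e, Sorted5 (min e x) (max e x) m M a ∧ e / 2 ≤ min e x ∧
      max e x - min e x = |e - x| := by
    filter_upwards [hx0, self_mem_nhdsWithin] with x hx hxe
    exact ⟨⟨lt_min he0 (by linarith [hx.1]), min_lt_max.2 (Ne.symm hxe), max_lt hem hx.2, hmM, hMa⟩,
      le_min (by linarith) hx.1.le, max_sub_min_eq_abs' _ _⟩
  obtain ⟨C, hC⟩ := Sorted5.exists_abs_sub_le_of_collision_low (half_pos he0) hη ha
  have hbd : ∀ᶠ x in 𝓝[≠] e, |(w x).1 - 1 / 2| * Real.log (1 / |e - x|) ≤ C ∧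
      |(w x).2 - sortedRotation m M a| * Real.log (1 / |e - x|) ≤ C := by
    filter_upwards [hw, hS, hε] with x hx hs hx2
    rw [← hs.2.2] at hx2 ⊢
    exact hC _ _ _ _ _ _ hs.1 hx.1 hx.2.1 hx.2.2 hs.2.1 le_rfl le_rfl hx2.le
  have hw2 : Tendsto (fun x => (w x).2) (𝓝[≠] e) (𝓝 (sortedRotation m M a)) := by
    have := (tendsto_zero_of_abs_mul_log_le (hbd.mono fun x hx => hx.2)).add_const
      (sortedRotation m M a)
    simpa using this
  obtain ⟨C', hC', hsl⟩ := exists_abs_cubicWeight_sub_le_low hm hmM hMa he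
  have T0 := tendsto_integral_pair_left he0 hem hC' measurable_cubicWeight hsl
  have T1 := tendsto_integral_pair_right he0 hem hC' measurable_cubicWeight hsl
  have Td := T0.sub T1
  have hih := intOn_slope (he0.trans hem) measurable_cubicWeight hsl
  -- The terms with log 4 cancel, and the two difference quotient integrals join to one over (0,m),
  -- to which the elementary reduction applies.
  have hlim : cubicWeight m M a e * (Real.log 4 + Real.log (e - 0)) - (∫ s in (0 : ℝ)..e, (cubicWeight m M a s - cubicWeight m M a e) / (s - e)) -
      (cubicWeight m M a e * (Real.log 4 + Real.log (m - e)) + ∫ s in e..m, (cubicWeight m M a s - cubicWeight m M a e) / (s - e)) =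
      cubicWeight m M a e * Real.log (poleRatio m M a e) - ∫ s in (0 : ℝ)..m, cubicWeight m M a s * poleWeight m M a e s := by
    have hmem : e ∈ uIcc 0 m := by rw [uIcc_of_le hm.le]; exact ⟨he0.le, hem.le⟩
    have i1 := hih.mono_set (uIcc_subset_uIcc_left hmem)
    have i2 := hih.mono_set (uIcc_subset_uIcc_right hmem)
    rw [← log_sub_integral_slope_low hm hmM hMa he,
      ← intervalIntegral.integral_add_adjacent_intervals i1 i2, sub_zero]
    ring
  rw [hlim] at Td
  -- This period is symmetric in the colliding roots, so they need not be sorted, and it is analytic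
  -- through x = e.
  have TK2 : Tendsto (fun x => normK2 0 e x m M a) (𝓝[≠] e)
      (𝓝 (∫ s in M..a, cubicWeight m M a s * (1 / (s - e)))) := by
    have h1 : AnalyticAt ℝ (fun x => normK2 0 e x m M a) e :=
      analyticAt_normK2 analyticAt_const analyticAt_id analyticAt_const analyticAt_const
        analyticAt_const (by linarith) (by simp only [id]; linarith) hmM hMa.le 0
    have h2 := h1.continuousAt.tendsto.mono_left (nhdsWithin_le_nhds (s := {e}ᶜ))
    convert h2 using 2
    rw [← integral_quintic_two hMa]
    refine integral_congr_Ioo hMa.le fun s hs => ?_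
    have : quintic e e m M a s = (s - e) ^ 2 * ((m - s) * (M - s) * (a - s)) := by
      rw [quintic]; ring
    rw [this, div_sqrt_pair_mul (sq_nonneg _), Real.sqrt_sq (by linarith [hs.1]), cubicWeight]
    ring
  have hK : ∀ᶠ x in 𝓝[≠] e, (∫ s in (0 : ℝ)..(min e x), cubicWeight m M a s / √((e - s) * (x - s))) -
      2 * (w x).1 * (∫ s in (max e x)..m, cubicWeight m M a s / √((e - s) * (x - s))) +
      2 * (w x).2 * normK2 0 e x m M a = 0 := by
    filter_upwards [hw, hS] with x hx hs
    have h1 := hx.1 0 (by simp)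
    have e0 : (∫ s in (0 : ℝ)..(min e x), s ^ 0 / √(quintic (min e x) (max e x) m M a s)) =
        ∫ s in (0 : ℝ)..(min e x), cubicWeight m M a s / √((e - s) * (x - s)) :=
      integral_congr_Ioo hs.1.pos.le fun s h => by
        rw [quintic_low_pair, div_sqrt_pair_mul (sub_mul_sub_nonneg_of_le h.2.le), cubicWeight]
        ring
    have e1 : (∫ s in (max e x)..m, s ^ 0 / √(quintic (min e x) (max e x) m M a s)) =
        ∫ s in (max e x)..m, cubicWeight m M a s / √((e - s) * (x - s)) :=
      integral_congr_Ioo hs.1.lt23.le fun s h => by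
        rw [quintic_low_pair, div_sqrt_pair_mul (sub_mul_sub_nonneg_of_ge h.1.le), cubicWeight]
        ring
    have e2 : (∫ s in M..a, s ^ 0 / √(quintic (min e x) (max e x) m M a s)) =
        normK2 0 e x m M a := by
      rw [← integral_quintic_two hMa]
      refine integral_congr_Ioo hMa.le fun s h => ?_
      rw [quintic_low_pair, quintic]
      ring_nf
    rw [e0, e1, e2] at h1
    linarith
  have C1 : Tendsto (fun x => ((w x).1 - 1 / 2) * Real.log |e - x|) (𝓝[≠] e)
      (𝓝 (lowCoeff m M a e)) := by
    have hden := (tendsto_div_log T1).const_mul 2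
    have hnum := Td.add ((hw2.const_mul 2).mul TK2)
    have hq := hnum.div hden (by linarith)
    have hval : (cubicWeight m M a e * Real.log (poleRatio m M a e) -
        (∫ s in (0 : ℝ)..m, cubicWeight m M a s * poleWeight m M a e s) +
        2 * sortedRotation m M a * ∫ s in M..a, cubicWeight m M a s * (1 / (s - e))) / (2 * -cubicWeight m M a e) =
        lowCoeff m M a e := by
      rw [lowCoeff, lowPole]
      rw [mul_neg, div_neg, neg_div]
    rw [hval] at hq
    refine hq.congr' ?_
    filter_upwards [hK, (tendsto_log_abs_sub e).eventually_lt_atBot 0,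
      (tendsto_div_log T1).eventually_lt_const (by linarith : -cubicWeight m M a e < 0)] with x hx hl hk
    have hk' : (∫ s in (max e x)..m, cubicWeight m M a s / √((e - s) * (x - s))) ≠ 0 := fun h => by
      rw [h, zero_div] at hk; exact lt_irrefl _ hk
    simp only [Pi.div_apply]
    have : (∫ s in (0 : ℝ)..(min e x), cubicWeight m M a s / √((e - s) * (x - s))) =
      2 * (w x).1 * (∫ s in (max e x)..m, cubicWeight m M a s / √((e - s) * (x - s))) -
      2 * (w x).2 * normK2 0 e x m M a := by linarith
    rw [this]
    have := hl.ne
    field_simp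
    ring
  refine ⟨C1, ?_⟩
  have hr1 := integral_cubicWeight_inner_pos hmM hMa
  have TB2log : Tendsto (fun x => (perB2 (min e x) (max e x) m M a - ∫ s in M..a, cubicWeight m M a s) *
      Real.log |e - x|) (𝓝[≠] e) (𝓝 0) := by
    refine tendsto_mul_log_of_abs_le (tendsto_abs_mul_log_abs_sub e)
      (P := (∫ s in M..a, cubicWeight m M a s) / (M - m)) ?_
    filter_upwards [hS] with x hs
    obtain ⟨h1, h2⟩ := hs.1.perB2_sub_mem hη (by linarith [hs.1.lt23])
    rw [hs.2.2] at h2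
    rw [abs_of_nonneg (sub_nonneg.2 h1), abs_abs]
    have e1 : (∫ s in M..a, cubicWeight m M a s) / (M - m) * |e - x| =
      (1 + |e - x| / (M - m)) * (∫ s in M..a, cubicWeight m M a s) - ∫ s in M..a, cubicWeight m M a s := by ring
    rw [e1]
    linarith
  have TB2 : Tendsto (fun x => perB2 (min e x) (max e x) m M a) (𝓝[≠] e)
      (𝓝 (∫ s in M..a, cubicWeight m M a s)) := by
    have := (TB2log.div_atBot (tendsto_log_abs_sub e)).add_const (∫ s in M..a, cubicWeight m M a s)
    rw [zero_add] at this
    refine this.congr' ?_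
    filter_upwards [(tendsto_log_abs_sub e).eventually_lt_atBot 0] with x hl
    have := hl.ne
    field_simp
    ring
  have hPb : ∀ᶠ x in 𝓝[≠] e, √|e - x| / √(min e x) ≤ √|e - x| / √(e / 2) := by
    filter_upwards [hS] with x hs
    have : 0 < √(e / 2) := Real.sqrt_pos.2 (by linarith)
    have := Real.sqrt_le_sqrt hs.2.1
    gcongr
  have TB01 : Tendsto (fun x => (perB0 (min e x) (max e x) m M a + perB1 (min e x) (max e x) m M a -
      ∫ s in (0 : ℝ)..m, cubicWeight m M a s) * Real.log |e - x|) (𝓝[≠] e) (𝓝 0) := by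
    refine tendsto_mul_log_of_abs_le (tendsto_sqrt_mul_log_abs_sub e)
      (P := 14 * (√a / (M - m)) / √(e / 2)) ?_
    filter_upwards [hS, hPb] with x hs hb
    have h1 := (hs.1.abs_perB0_add_perB1_sub_le hη le_rfl le_rfl).1
    rw [hs.2.2] at h1
    rw [abs_of_nonneg (Real.sqrt_nonneg _)]
    refine h1.trans ?_
    have := mul_le_mul_of_nonneg_left hb (by positivity : 0 ≤ 14 * (√a / (M - m)))
    calc _ = 14 * (√a / (M - m)) * (√|e - x| / √(min e x)) := by ring
      _ ≤ _ := this
      _ = _ := by ring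
  have TB1 : Tendsto (fun x => perB1 (min e x) (max e x) m M a) (𝓝[≠] e)
      (𝓝 (∫ s in e..m, cubicWeight m M a s)) := by
    have h0 : Tendsto (fun x => (perB1 (min e x) (max e x) m M a -
        ∫ s in (max e x)..m, cubicWeight m M a s) * Real.log |e - x|) (𝓝[≠] e) (𝓝 0) := by
      refine tendsto_mul_log_of_abs_le (tendsto_sqrt_mul_log_abs_sub e)
        (P := 4 * (√a / (M - m)) / √(e / 2)) ?_
      filter_upwards [hS, hPb] with x hs hb
      have h1 := (hs.1.abs_perB0_add_perB1_sub_le hη le_rfl le_rfl).2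
      rw [hs.2.2] at h1
      rw [abs_of_nonneg (Real.sqrt_nonneg _)]
      refine h1.trans ?_
      have := mul_le_mul_of_nonneg_left hb (by positivity : 0 ≤ 4 * (√a / (M - m)))
      calc _ = 4 * (√a / (M - m)) * (√|e - x| / √(min e x)) := by ring
        _ ≤ _ := this
        _ = _ := by ring
    have h1 := (continuousAt_primitive_left (intOn_cubicWeight_outer hm.le hmM hMa) he).tendsto.comp
      (tendsto_max_self e)
    have := (h0.div_atBot (tendsto_log_abs_sub e)).add h1
    rw [zero_add] at this
    refine this.congr' ?_
    filter_upwards [(tendsto_log_abs_sub e).eventually_lt_atBot 0] with x hl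
    simp only [Function.comp_apply]
    have := hl.ne
    field_simp
    ring
  -- Equation B minus the elliptic relation, times the logarithm. The errors of the limit periods
  -- are powers of the gap and disappear, and only the term with w₁ - 1/2 contributes.
  have hnum := (TB01.add ((C1.const_mul 2).mul TB1)).sub (TB2log.const_mul
    (2 * sortedRotation m M a))
  have hq := hnum.div (TB2.const_mul 2) (by linarith)
  have hval : (0 + 2 * lowCoeff m M a e * (∫ s in e..m, cubicWeight m M a s) - 2 * sortedRotation m M a * 0) /
      (2 * ∫ s in M..a, cubicWeight m M a s) = lowCoeff m M a e * ((∫ s in e..m, cubicWeight m M a s) / ∫ s in M..a, cubicWeight m M a s) := by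
    field_simp
    ring
  rw [hval] at hq
  refine hq.congr' ?_
  filter_upwards [hw, hS, TB2.eventually_const_lt hr1] with x hx hs h2
  have hB := hs.1.equationB hx.1
  have hR : 2 * sortedRotation m M a * (∫ s in M..a, cubicWeight m M a s) = ∫ s in (0 : ℝ)..m, cubicWeight m M a s := by
    have h2 : sortedRotation m M a = (∫ s in (0 : ℝ)..m, cubicWeight m M a s) / (2 * ∫ s in M..a, cubicWeight m M a s) :=
      sortedRotation_eq hm.le hMa
    rw [h2]; field_simp
  simp only [Pi.div_apply]
  rw [div_eq_iff (by linarith)]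
  linear_combination Real.log |e - x| * hB + Real.log |e - x| * hR

/-- Now the last two periods diverge: (w₁ - w₂) · 2K₂ = K₀ - 2w₁(K₁ - K₂) tends to `highPole`.
Equation A yields the coefficient of the second component, and addition that of the first. -/
theorem tendsto_collision_high (hm : 0 < m) (hmM : m < M) (he : e ∈ Ioo M a)
    {w : ℝ → ℝ × ℝ}
    (hw : ∀ᶠ x in 𝓝[≠] e, SolvesPeriods m M (min e x) (max e x) a (w x) ∧
      0 < (w x).1 ∧ 0 < (w x).2) :
    Tendsto (fun x => ((w x).1 - sortedRotation m M a) * Real.log |e - x|) (𝓝[≠] e)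
      (𝓝 (-(highCoeff m M a e * ((∫ s in e..a, cubicWeight m M a s) /
        ∫ s in M..a, cubicWeight m M a s)))) ∧
    Tendsto (fun x => ((w x).2 - sortedRotation m M a) * Real.log |e - x|) (𝓝[≠] e)
      (𝓝 (highCoeff m M a e * ((∫ s in M..e, cubicWeight m M a s) /
        ∫ s in M..a, cubicWeight m M a s))) := by
  have ⟨heM, hea⟩ := he
  have hMa : M < a := by linarith
  have ha : 0 < a := by linarith
  have hη1 : 0 < M - m := by linarith
  have hη : 0 < min (M - m) ((a - e) / 2) := lt_min hη1 (by linarith)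
  have hfe : 0 < cubicWeight m M a e := cubicWeight_pos_inner hmM he
  have hx0 : ∀ᶠ x in 𝓝[≠] e, x ∈ Ioo M ((a + e) / 2) :=
    nhdsWithin_le_nhds (Ioo_mem_nhds heM (by linarith))
  have hε : ∀ᶠ x in 𝓝[≠] e, |e - x| < 1 / 2 :=
    ((tendsto_abs_sub_nhdsNE e).mono_right nhdsWithin_le_nhds).eventually_lt_const (by norm_num)
  have hS : ∀ᶠ x in 𝓝[≠] e, Sorted5 m M (min e x) (max e x) a ∧ (a - e) / 2 ≤ a - max e x ∧
      max e x - min e x = |e - x| := by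
    filter_upwards [hx0, self_mem_nhdsWithin] with x hx hxe
    have h2 : max e x ≤ (a + e) / 2 := max_le (by linarith) hx.2.le
    exact ⟨⟨hm, hmM, lt_min heM hx.1, min_lt_max.2 (Ne.symm hxe), by linarith⟩,
      by linarith, max_sub_min_eq_abs' _ _⟩
  obtain ⟨C, hC⟩ := Sorted5.exists_abs_sub_le_of_collision_high hη ha
  have hbd : ∀ᶠ x in 𝓝[≠] e, |(w x).1 - (w x).2| * Real.log (1 / |e - x|) ≤ C ∧
      |(w x).2 - sortedRotation m M a| * Real.log (1 / |e - x|) ≤ C := by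
    filter_upwards [hw, hS, hε] with x hx hs hx2
    rw [← hs.2.2] at hx2 ⊢
    exact hC _ _ _ _ _ _ hs.1 hx.1 hx.2.1 hx.2.2 (min_le_left _ _)
      ((min_le_right _ _).trans hs.2.1) le_rfl hx2.le
  have hw1 : Tendsto (fun x => (w x).1) (𝓝[≠] e) (𝓝 (sortedRotation m M a)) := by
    have := ((tendsto_zero_of_abs_mul_log_le (hbd.mono fun x hx => hx.1)).add
      (tendsto_zero_of_abs_mul_log_le (hbd.mono fun x hx => hx.2))).add_const
        (sortedRotation m M a)
    simpa using this
  obtain ⟨C', hC', hsl⟩ := exists_abs_cubicWeight_sub_le_high hm hmM hMa he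
  have T0 := tendsto_integral_pair_left heM hea hC' measurable_cubicWeight hsl
  have T1 := tendsto_integral_pair_right heM hea hC' measurable_cubicWeight hsl
  have Td := T0.sub T1
  have hih := intOn_slope hMa measurable_cubicWeight hsl
  have hmem : e ∈ uIcc M a := by rw [uIcc_of_le hMa.le]; exact ⟨heM.le, hea.le⟩
  have hlim : cubicWeight m M a e * (Real.log 4 + Real.log (e - M)) -
      (∫ s in M..e, (cubicWeight m M a s - cubicWeight m M a e) / (s - e)) -
      (cubicWeight m M a e * (Real.log 4 + Real.log (a - e)) +
        ∫ s in e..a, (cubicWeight m M a s - cubicWeight m M a e) / (s - e)) =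
      -∫ s in M..a, cubicWeight m M a s * poleWeight m M a e s := by
    have i1 := hih.mono_set (uIcc_subset_uIcc_left hmem)
    have i2 := hih.mono_set (uIcc_subset_uIcc_right hmem)
    rw [← log_sub_integral_slope_high hm hmM hMa he,
      ← intervalIntegral.integral_add_adjacent_intervals i1 i2]
    ring
  rw [hlim] at Td
  have TK0 : Tendsto (fun x => √m * normK0 0 m M e x a) (𝓝[≠] e)
      (𝓝 (∫ s in (0 : ℝ)..m, cubicWeight m M a s * (1 / (e - s)))) := by
    have h1 : AnalyticAt ℝ (fun x => √m * normK0 0 m M e x a) e :=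
      analyticAt_const.mul (analyticAt_normK0 analyticAt_const analyticAt_const analyticAt_const
        analyticAt_id analyticAt_const hm.le hmM (by linarith) (by simp only [id]; linarith)
        (by linarith) 0)
    have h2 := h1.continuousAt.tendsto.mono_left (nhdsWithin_le_nhds (s := {e}ᶜ))
    convert h2 using 2
    rw [← integral_quintic_zero hm.le]
    refine integral_congr_Ioo hm.le fun s hs => ?_
    have : quintic m M e e a s = (e - s) ^ 2 * ((m - s) * (M - s) * (a - s)) := by
      rw [quintic]; ring
    rw [this, div_sqrt_pair_mul (sq_nonneg _), Real.sqrt_sq (by linarith [hs.2]), cubicWeight]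
    ring
  have hK : ∀ᶠ x in 𝓝[≠] e, √m * normK0 0 m M e x a -
      2 * (w x).1 * (∫ s in M..(min e x), cubicWeight m M a s / √((e - s) * (x - s))) +
      2 * (w x).2 * (∫ s in (max e x)..a, cubicWeight m M a s / √((e - s) * (x - s))) = 0 := by
    filter_upwards [hw, hS] with x hx hs
    have h1 := hx.1 0 (by simp)
    have e1 : (∫ s in M..(min e x), s ^ 0 / √(quintic m M (min e x) (max e x) a s)) =
        ∫ s in M..(min e x), cubicWeight m M a s / √((e - s) * (x - s)) :=
      integral_congr_Ioo hs.1.lt23.le fun s h => by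
        rw [quintic_high_pair, div_sqrt_pair_mul (sub_mul_sub_nonneg_of_le h.2.le), cubicWeight]
        ring
    have e2 : (∫ s in (max e x)..a, s ^ 0 / √(quintic m M (min e x) (max e x) a s)) =
        ∫ s in (max e x)..a, cubicWeight m M a s / √((e - s) * (x - s)) :=
      integral_congr_Ioo hs.1.lt45.le fun s h => by
        rw [quintic_high_pair, div_sqrt_pair_mul (sub_mul_sub_nonneg_of_ge h.1.le), cubicWeight]
        ring
    have e0 : (∫ s in (0 : ℝ)..m, s ^ 0 / √(quintic m M (min e x) (max e x) a s)) =
        √m * normK0 0 m M e x a := by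
      rw [← integral_quintic_zero hm.le]
      refine integral_congr_Ioo hm.le fun s h => ?_
      rw [quintic_high_pair, quintic]
      ring_nf
    rw [e0, e1, e2] at h1
    linarith
  have C1 : Tendsto (fun x => ((w x).1 - (w x).2) * Real.log |e - x|) (𝓝[≠] e)
      (𝓝 (-highCoeff m M a e)) := by
    have hden := (tendsto_div_log T1).const_mul 2
    have hnum := TK0.sub ((hw1.const_mul 2).mul Td)
    have hq := hnum.div hden (by linarith)
    have hval : ((∫ s in (0 : ℝ)..m, cubicWeight m M a s * (1 / (e - s))) -
        2 * sortedRotation m M a * -∫ s in M..a, cubicWeight m M a s * poleWeight m M a e s) /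
        (2 * -cubicWeight m M a e) = -highCoeff m M a e := by
      rw [highCoeff, highPole, mul_neg, mul_neg, div_neg, sub_neg_eq_add]
    rw [hval] at hq
    refine hq.congr' ?_
    filter_upwards [hK, (tendsto_log_abs_sub e).eventually_lt_atBot 0,
      (tendsto_div_log T1).eventually_lt_const (by linarith : -cubicWeight m M a e < 0)]
      with x hx hl hk
    have hk' : (∫ s in (max e x)..a, cubicWeight m M a s / √((e - s) * (x - s))) ≠ 0 := fun h => by
      rw [h, zero_div] at hk; exact lt_irrefl _ hk
    simp only [Pi.div_apply]
    have h0 : √m * normK0 0 m M e x a = 2 * (w x).1 *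
        (∫ s in M..(min e x), cubicWeight m M a s / √((e - s) * (x - s))) - 2 * (w x).2 *
        (∫ s in (max e x)..a, cubicWeight m M a s / √((e - s) * (x - s))) := by linarith
    rw [h0]
    have := hl.ne
    field_simp
    ring
  have hr1 := integral_cubicWeight_inner_pos hmM hMa
  have hPb : ∀ᶠ x in 𝓝[≠] e, √|e - x| / √(a - max e x) ≤ √|e - x| / √((a - e) / 2) := by
    filter_upwards [hS] with x hs
    have : 0 < √((a - e) / 2) := Real.sqrt_pos.2 (by linarith)
    have := Real.sqrt_le_sqrt hs.2.1
    gcongr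
  have TA12log : Tendsto (fun x => (perA1 m M (min e x) (max e x) a +
      perA2 m M (min e x) (max e x) a - ∫ s in M..a, cubicWeight m M a s) * Real.log |e - x|)
      (𝓝[≠] e) (𝓝 0) := by
    refine tendsto_mul_log_of_abs_le (tendsto_sqrt_mul_log_abs_sub e)
      (P := 14 * (1 / √(M - m)) / √((a - e) / 2)) ?_
    filter_upwards [hS, hPb] with x hs hb
    have h1 := (hs.1.abs_perA1_add_perA2_sub_le hη1 le_rfl).1
    rw [hs.2.2] at h1
    rw [abs_of_nonneg (Real.sqrt_nonneg _)]
    refine h1.trans ?_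
    have := mul_le_mul_of_nonneg_left hb (by positivity : 0 ≤ 14 * (1 / √(M - m)))
    calc _ = 14 * (1 / √(M - m)) * (√|e - x| / √(a - max e x)) := by ring
      _ ≤ _ := this
      _ = _ := by ring
  have TA12 : Tendsto (fun x => perA1 m M (min e x) (max e x) a +
      perA2 m M (min e x) (max e x) a) (𝓝[≠] e) (𝓝 (∫ s in M..a, cubicWeight m M a s)) := by
    have := (TA12log.div_atBot (tendsto_log_abs_sub e)).add_const
      (∫ s in M..a, cubicWeight m M a s)
    rw [zero_add] at this
    refine this.congr' ?_
    filter_upwards [(tendsto_log_abs_sub e).eventually_lt_atBot 0] with x hl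
    have := hl.ne
    field_simp
    ring
  have TA1 : Tendsto (fun x => perA1 m M (min e x) (max e x) a) (𝓝[≠] e)
      (𝓝 (∫ s in M..e, cubicWeight m M a s)) := by
    have h0 : Tendsto (fun x => (perA1 m M (min e x) (max e x) a -
        ∫ s in M..(min e x), cubicWeight m M a s) * Real.log |e - x|) (𝓝[≠] e) (𝓝 0) := by
      refine tendsto_mul_log_of_abs_le (tendsto_sqrt_mul_log_abs_sub e)
        (P := 4 * (1 / √(M - m)) / √((a - e) / 2)) ?_
      filter_upwards [hS, hPb] with x hs hb
      have h1 := (hs.1.abs_perA1_add_perA2_sub_le hη1 le_rfl).2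
      rw [hs.2.2] at h1
      rw [abs_of_nonneg (Real.sqrt_nonneg _)]
      refine h1.trans ?_
      have := mul_le_mul_of_nonneg_left hb (by positivity : 0 ≤ 4 * (1 / √(M - m)))
      calc _ = 4 * (1 / √(M - m)) * (√|e - x| / √(a - max e x)) := by ring
        _ ≤ _ := this
        _ = _ := by ring
    have h1 := (continuousAt_primitive (intOn_cubicWeight_inner hmM hMa) he).tendsto.comp
      (tendsto_min_self e)
    have := (h0.div_atBot (tendsto_log_abs_sub e)).add h1
    rw [zero_add] at this
    refine this.congr' ?_
    filter_upwards [(tendsto_log_abs_sub e).eventually_lt_atBot 0] with x hl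
    simp only [Function.comp_apply]
    have := hl.ne
    field_simp
    ring
  have hr0n : 0 ≤ ∫ s in (0 : ℝ)..m, cubicWeight m M a s :=
    integral_nonneg_Ioo hm.le fun s _ => cubicWeight_nonneg s
  have TA0 : Tendsto (fun x => (perA0 m M (min e x) (max e x) a -
      ∫ s in (0 : ℝ)..m, cubicWeight m M a s) * Real.log |e - x|) (𝓝[≠] e) (𝓝 0) := by
    refine tendsto_mul_log_of_abs_le (tendsto_abs_mul_log_abs_sub e)
      (P := (∫ s in (0 : ℝ)..m, cubicWeight m M a s) / (M - m)) ?_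
    filter_upwards [hS] with x hs
    obtain ⟨h1, h2⟩ := hs.1.perA0_sub_mem hη1 (by linarith [hs.1.lt23])
    rw [hs.2.2] at h2
    rw [abs_of_nonneg (sub_nonneg.2 h1), abs_abs]
    have e1 : (∫ s in (0 : ℝ)..m, cubicWeight m M a s) / (M - m) * |e - x| =
      (1 + |e - x| / (M - m)) * (∫ s in (0 : ℝ)..m, cubicWeight m M a s) -
        ∫ s in (0 : ℝ)..m, cubicWeight m M a s := by ring
    rw [e1]
    linarith
  have C2 : Tendsto (fun x => ((w x).2 - sortedRotation m M a) * Real.log |e - x|) (𝓝[≠] e)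
      (𝓝 (highCoeff m M a e * ((∫ s in M..e, cubicWeight m M a s) /
        ∫ s in M..a, cubicWeight m M a s))) := by
    have hnum := (TA0.sub ((C1.const_mul 2).mul TA1)).sub (TA12log.const_mul
      (2 * sortedRotation m M a))
    have hq := hnum.div (TA12.const_mul 2) (by linarith)
    have hval : (0 - 2 * -highCoeff m M a e * (∫ s in M..e, cubicWeight m M a s) -
        2 * sortedRotation m M a * 0) / (2 * ∫ s in M..a, cubicWeight m M a s) =
        highCoeff m M a e * ((∫ s in M..e, cubicWeight m M a s) /
          ∫ s in M..a, cubicWeight m M a s) := by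
      field_simp
      ring
    rw [hval] at hq
    refine hq.congr' ?_
    filter_upwards [hw, hS, TA12.eventually_const_lt hr1] with x hx hs h2
    have hA := hs.1.equationA hx.1
    have hR : 2 * sortedRotation m M a * (∫ s in M..a, cubicWeight m M a s) =
        ∫ s in (0 : ℝ)..m, cubicWeight m M a s := by
      have h2 : sortedRotation m M a = (∫ s in (0 : ℝ)..m, cubicWeight m M a s) /
          (2 * ∫ s in M..a, cubicWeight m M a s) := sortedRotation_eq hm.le hMa
      rw [h2]; field_simp
    simp only [Pi.div_apply]
    rw [div_eq_iff (by linarith)]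
    linear_combination Real.log |e - x| * hA + Real.log |e - x| * hR
  refine ⟨?_, C2⟩
  have hsum := C1.add C2
  -- Splitting the inner period at e turns 1 minus one fraction into the other.
  have hval : -highCoeff m M a e + highCoeff m M a e * ((∫ s in M..e, cubicWeight m M a s) /
      ∫ s in M..a, cubicWeight m M a s) = -(highCoeff m M a e *
        ((∫ s in e..a, cubicWeight m M a s) / ∫ s in M..a, cubicWeight m M a s)) := by
    have hi := intOn_cubicWeight_inner hmM hMa
    have i1 := hi.mono_set (uIcc_subset_uIcc_left hmem)
    have i2 := hi.mono_set (uIcc_subset_uIcc_right hmem)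
    have := intervalIntegral.integral_add_adjacent_intervals i1 i2
    rw [← this] at hr1 ⊢
    field_simp
    ring
  rw [hval] at hsum
  refine hsum.congr fun x => ?_
  ring

end

/-! ### Analyticity and positivity of the logarithmic coefficients -/

section

variable {m M a e : ℝ}

/-- The singularity at m moves into the fixed weight of `intR`. The rest depends analytically on the
roots and is an analytic family. The next three identities do the same for the other intervals. -/
theorem integral_cubicWeight_mul_right {u : ℝ} (hu : u ≤ m) (φ : ℝ → ℝ) :
    (∫ s in u..m, cubicWeight m M a s * φ s) =
      √(m - u) * intR u m (fun s => 1 / √((M - s) * (a - s)) * φ s) := by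
  rw [← integral_div_sqrt_right hu]
  refine integral_congr_Ioo hu fun s hs => ?_
  rw [cubicWeight, mul_assoc, Real.sqrt_mul (sub_nonneg.2 hs.2.le), ← one_div_mul_one_div]
  ring

theorem integral_cubicWeight_mul_both (hMa : M < a) (φ : ℝ → ℝ) :
    (∫ s in M..a, cubicWeight m M a s * φ s) = intB M a (fun s => 1 / √(s - m) * φ s) := by
  rw [← integral_div_sqrt_both hMa]
  refine integral_congr_Ioo hMa.le fun s hs => ?_
  have : (m - s) * (M - s) * (a - s) = ((s - M) * (a - s)) * (s - m) := by ring
  rw [cubicWeight, this, Real.sqrt_mul (mul_nonneg (sub_nonneg.2 hs.1.le) (sub_nonneg.2 hs.2.le)),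
    ← one_div_mul_one_div]
  ring

theorem integral_cubicWeight_left (he : e ∈ Ioo M a) :
    (∫ s in M..e, cubicWeight m M a s) =
      √(e - M) * intL M e (fun s => 1 / √((s - m) * (a - s))) := by
  rw [← integral_div_sqrt_left he.1.le]
  refine integral_congr_Ioo he.1.le fun s hs => ?_
  have : (m - s) * (M - s) * (a - s) = (s - M) * ((s - m) * (a - s)) := by ring
  rw [cubicWeight, this, Real.sqrt_mul (sub_nonneg.2 hs.1.le), ← one_div_mul_one_div]
  ring

theorem integral_cubicWeight_end (he : e ∈ Ioo M a) :
    (∫ s in e..a, cubicWeight m M a s) =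
      √(a - e) * intR e a (fun s => 1 / √((s - m) * (s - M))) := by
  rw [← integral_div_sqrt_right he.2.le]
  refine integral_congr_Ioo he.2.le fun s hs => ?_
  have : (m - s) * (M - s) * (a - s) = (a - s) * ((s - m) * (s - M)) := by ring
  rw [cubicWeight, this, Real.sqrt_mul (sub_nonneg.2 hs.2.le), ← one_div_mul_one_div]
  ring

theorem lowCoeff_pos (hmM : m < M) (hMa : M < a) (he : e ∈ Ioo 0 m) : 0 < lowCoeff m M a e :=
  div_pos (neg_pos.2 (lowPole_neg hmM hMa he))
    (mul_pos two_pos (cubicWeight_pos_outer hmM hMa he.2))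

theorem highCoeff_pos (hm : 0 < m) (hmM : m < M) (hMa : M < a) (he : e ∈ Ioo M a) :
    0 < highCoeff m M a e :=
  div_pos (highPole_pos hm hmM hMa he) (mul_pos two_pos (cubicWeight_pos_inner hmM he))

theorem integral_cubicWeight_right_pos (hmM : m < M) (hMa : M < a) (he : e < m) :
    0 < ∫ s in e..m, cubicWeight m M a s :=
  intervalIntegral.intervalIntegral_pos_of_pos_on (intOn_cubicWeight_outer he.le hmM hMa)
    (fun _ hs => cubicWeight_pos_outer hmM hMa hs.2) he

theorem integral_cubicWeight_sub_pos (hmM : m < M) (hMa : M < a) {u v : ℝ} (hu : M ≤ u)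
    (huv : u < v) (hv : v ≤ a) : 0 < ∫ s in u..v, cubicWeight m M a s := by
  refine intervalIntegral.intervalIntegral_pos_of_pos_on
    ((intOn_cubicWeight_inner hmM hMa).mono_set ?_)
    (fun s hs => cubicWeight_pos_inner hmM ⟨by linarith [hs.1], by linarith [hs.2]⟩) huv
  rw [uIcc_of_le huv.le, uIcc_of_le hMa.le]
  exact Icc_subset_Icc hu hv

end

section

variable {X : Type*} [NormedAddCommGroup X] [NormedSpace ℝ X] {x₀ : X} {m M : X → ℝ} {a e : ℝ}

theorem analyticAt_log_comp {f : X → ℝ} (hf : AnalyticAt ℝ f x₀) (h : 0 < f x₀) :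
    AnalyticAt ℝ (fun x => Real.log (f x)) x₀ :=
  (Real.contDiffAt_log (n := ⊤) |>.2 h.ne').analyticAt.comp hf

theorem analyticAt_swapRoots (hm : AnalyticAt ℝ m x₀) (hM : AnalyticAt ℝ M x₀) (he : e < a) :
    AnalyticAt ℝ (fun x => swapRoots (m x) (M x) a e) x₀ := by
  unfold swapRoots
  exact analyticAt_const.sub (((analyticAt_const.sub hm).mul (analyticAt_const.sub hM)).div
    analyticAt_const (by linarith))

theorem analyticAt_cubicWeight (hm : AnalyticAt ℝ m x₀) (hM : AnalyticAt ℝ M x₀)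
    (h : 0 < (m x₀ - e) * (M x₀ - e) * (a - e)) :
    AnalyticAt ℝ (fun x => cubicWeight (m x) (M x) a e) x₀ := by
  unfold cubicWeight
  exact analyticAt_const.div (analyticAt_sqrt (((hm.sub analyticAt_const).mul
    (hM.sub analyticAt_const)).mul analyticAt_const) h) (Real.sqrt_pos.2 h).ne'

theorem analyticAt_integral_inner (hm : AnalyticAt ℝ m x₀) (hM : AnalyticAt ℝ M x₀)
    (h1 : m x₀ < M x₀) (h2 : M x₀ < a) {φ : X → ℝ → ℝ}
    (hφ : IsAnalyticFamily (fun x σ => φ x (M x + (a - M x) * σ)) x₀) :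
    AnalyticAt ℝ (fun x => ∫ s in (M x)..a, cubicWeight (m x) (M x) a s * φ x s) x₀ := by
  have hA := IsAnalyticFamily.affine hM (analyticAt_const (v := a))
  have h := analyticAt_intB (u := M) (v := fun _ => a) (G := fun x s => 1 / √(s - m x) * φ x s)
    (.mul (.rsqrt (.sub hA (.param hm)) fun σ hσ => by
      have := (affine_mem_Icc h2.le hσ).1
      linarith) hφ)
  refine h.congr ?_
  filter_upwards [hM.continuousAt.eventually_lt_const h2] with x hx
  exact (integral_cubicWeight_mul_both hx _).symm

theorem analyticAt_integral_outer {u : ℝ} (hm : AnalyticAt ℝ m x₀) (hM : AnalyticAt ℝ M x₀)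
    (h0 : u < m x₀) (h1 : m x₀ < M x₀) (h2 : M x₀ < a) {φ : X → ℝ → ℝ}
    (hφ : IsAnalyticFamily (fun x σ => φ x (u + (m x - u) * σ)) x₀) :
    AnalyticAt ℝ (fun x => ∫ s in u..(m x), cubicWeight (m x) (M x) a s * φ x s) x₀ := by
  have hA := IsAnalyticFamily.affine (analyticAt_const (v := u)) hm
  have h := analyticAt_intR (u := fun _ => u) (v := m)
    (G := fun x s => 1 / √((M x - s) * (a - s)) * φ x s)
    (.mul (.rsqrt (.mul (.sub (.param hM) hA) (.sub (.param analyticAt_const) hA)) fun σ hσ => by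
      have := (affine_mem_Icc h0.le hσ).2
      exact mul_pos (by linarith) (by linarith)) hφ)
  refine ((analyticAt_sqrt (hm.sub (analyticAt_const (v := u))) (by simpa using h0)).mul h).congr ?_
  filter_upwards [hm.continuousAt.eventually_const_lt h0] with x hx
  exact (integral_cubicWeight_mul_right hx.le _).symm

theorem analyticAt_lowCoeff (hm : AnalyticAt ℝ m x₀) (hM : AnalyticAt ℝ M x₀)
    (h1 : m x₀ < M x₀) (h2 : M x₀ < a) (he : e ∈ Ioo 0 (m x₀)) :
    AnalyticAt ℝ (fun x => lowCoeff (m x) (M x) a e) x₀ := by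
  have ⟨he0, hem⟩ := he
  have hea : e < a := by linarith
  have hσ := lt_swapRoots h2 hem h1
  have hQ : 0 < (m x₀ - e) * (M x₀ - e) * (a - e) :=
    mul_pos (mul_pos (by linarith) (by linarith)) (by linarith)
  have hQ' : 0 < (e - m x₀) * (e - M x₀) := mul_pos_of_neg_of_neg (by linarith) (by linarith)
  have hw := analyticAt_cubicWeight hm hM hQ
  have hmM : 0 < m x₀ * M x₀ := mul_pos (by linarith) (by linarith)
  have hr : AnalyticAt ℝ (fun x => √((e - m x) * (e - M x)) / √(a - e) * √a) x₀ :=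
    ((analyticAt_sqrt ((analyticAt_const.sub hm).mul (analyticAt_const.sub hM)) hQ').div
      analyticAt_const (Real.sqrt_pos.2 (by linarith)).ne').mul analyticAt_const
  have hp : AnalyticAt ℝ (fun x => √(m x * M x)) x₀ := analyticAt_sqrt (hm.mul hM) hmM
  have hpos : 0 < √(m x₀ * M x₀) + √((e - m x₀) * (e - M x₀)) / √(a - e) * √a := by
    have := Real.sqrt_pos.2 hmM
    positivity
  have hrat : AnalyticAt ℝ (fun x => Real.log (poleRatio (m x) (M x) a e)) x₀ := by
    refine analyticAt_log_comp ?_ (poleRatio_mem h1 h2 he).1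
    unfold poleRatio
    exact (hp.sub hr).div (hp.add hr) hpos.ne'
  have hA := IsAnalyticFamily.affine (analyticAt_const (v := (0 : ℝ))) hm
  have hB := IsAnalyticFamily.affine hM (analyticAt_const (v := a))
  have hI : AnalyticAt ℝ (fun x => ∫ s in (0 : ℝ)..(m x),
      cubicWeight (m x) (M x) a s * poleWeight (m x) (M x) a e s) x₀ := by
    refine analyticAt_integral_outer hm hM (by linarith) h1 h2 ?_
    have := (IsAnalyticFamily.sub (.param (analyticAt_const (v := a))) hA).mul
      (IsAnalyticFamily.inv (IsAnalyticFamily.mul (.param (analyticAt_const (v := a - e)))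
        (IsAnalyticFamily.sub (.param (analyticAt_swapRoots hm hM hea)) hA)) fun σ hσ => by
          have := (affine_mem_Icc (by linarith : 0 ≤ m x₀) hσ).2
          exact mul_pos (by linarith) (by linarith))
    refine this.congr (Eventually.of_forall fun x σ _ => ?_)
    rw [poleWeight, mul_one_div]
  have hJ : AnalyticAt ℝ (fun x => ∫ s in (M x)..a,
      cubicWeight (m x) (M x) a s * (1 / (s - e))) x₀ :=
    analyticAt_integral_inner hm hM h1 h2 (.inv (.sub hB (.param analyticAt_const)) fun σ hσ => by
      have := (affine_mem_Icc h2.le hσ).1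
      linarith)
  unfold lowCoeff lowPole
  refine ((((hw.mul hrat).sub hI).add ((analyticAt_const.mul (analyticAt_sortedRotation hm hM
    analyticAt_const (by linarith) h1 h2.le)).mul hJ)).neg).div (analyticAt_const.mul hw) ?_
  exact (mul_pos two_pos (cubicWeight_pos_outer h1 h2 hem)).ne'

theorem analyticAt_highCoeff (hm : AnalyticAt ℝ m x₀) (hM : AnalyticAt ℝ M x₀)
    (h0 : 0 < m x₀) (h1 : m x₀ < M x₀) (he : e ∈ Ioo (M x₀) a) :
    AnalyticAt ℝ (fun x => highCoeff (m x) (M x) a e) x₀ := by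
  have ⟨heM, hea⟩ := he
  have h2 : M x₀ < a := by linarith
  have hσ := swapRoots_lt h1 heM hea
  have hQ : 0 < (m x₀ - e) * (M x₀ - e) * (a - e) :=
    mul_pos (mul_pos_of_neg_of_neg (by linarith) (by linarith)) (by linarith)
  have hw := analyticAt_cubicWeight hm hM hQ
  have hA := IsAnalyticFamily.affine (analyticAt_const (v := (0 : ℝ))) hm
  have hB := IsAnalyticFamily.affine hM (analyticAt_const (v := a))
  have hI : AnalyticAt ℝ (fun x => ∫ s in (M x)..a,
      cubicWeight (m x) (M x) a s * poleWeight (m x) (M x) a e s) x₀ := by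
    refine analyticAt_integral_inner hm hM h1 h2 ?_
    have := (IsAnalyticFamily.sub hB (.param (analyticAt_const (v := a)))).mul
      (IsAnalyticFamily.inv (IsAnalyticFamily.mul (.param (analyticAt_const (v := a - e)))
        (IsAnalyticFamily.sub hB (.param (analyticAt_swapRoots hm hM hea)))) fun σ hσ => by
          have := (affine_mem_Icc h2.le hσ).1
          exact mul_pos (by linarith) (by linarith))
    refine this.congr (Eventually.of_forall fun x σ _ => ?_)
    rw [poleWeight, mul_one_div, ← neg_sub a, ← neg_sub (swapRoots (m x) (M x) a e), mul_neg,
      neg_div_neg_eq]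
  have hJ : AnalyticAt ℝ (fun x => ∫ s in (0 : ℝ)..(m x),
      cubicWeight (m x) (M x) a s * (1 / (e - s))) x₀ :=
    analyticAt_integral_outer hm hM h0 h1 h2 (.inv (.sub (.param analyticAt_const) hA)
      fun σ hσ => by
        have := (affine_mem_Icc h0.le hσ).2
        linarith)
  unfold highCoeff highPole
  refine (hJ.add ((analyticAt_const.mul (analyticAt_sortedRotation hm hM
    analyticAt_const h0 h1 h2.le)).mul hI)).div (analyticAt_const.mul hw) ?_
  exact (mul_pos two_pos (cubicWeight_pos_inner h1 he)).ne'

theorem analyticAt_innerPeriod (hm : AnalyticAt ℝ m x₀) (hM : AnalyticAt ℝ M x₀)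
    (h1 : m x₀ < M x₀) (h2 : M x₀ < a) :
    AnalyticAt ℝ (fun x => ∫ s in (M x)..a, cubicWeight (m x) (M x) a s) x₀ := by
  have := analyticAt_integral_inner hm hM h1 h2 (φ := fun _ _ => 1)
    (.param (analyticAt_const (v := 1)))
  simpa only [mul_one] using this

theorem analyticAt_outerPeriod (hm : AnalyticAt ℝ m x₀) (hM : AnalyticAt ℝ M x₀)
    (h0 : e < m x₀) (h1 : m x₀ < M x₀) (h2 : M x₀ < a) :
    AnalyticAt ℝ (fun x => ∫ s in e..(m x), cubicWeight (m x) (M x) a s) x₀ := by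
  have := analyticAt_integral_outer hm hM h0 h1 h2 (φ := fun _ _ => 1)
    (.param (analyticAt_const (v := 1)))
  simpa only [mul_one] using this

theorem analyticAt_innerPeriod_left (hm : AnalyticAt ℝ m x₀) (hM : AnalyticAt ℝ M x₀)
    (h1 : m x₀ < M x₀) (he : e ∈ Ioo (M x₀) a) :
    AnalyticAt ℝ (fun x => ∫ s in (M x)..e, cubicWeight (m x) (M x) a s) x₀ := by
  have hA := IsAnalyticFamily.affine hM (analyticAt_const (v := e))
  have h := analyticAt_intL (u := M) (v := fun _ => e) (G := fun x s => 1 / √((s - m x) * (a - s)))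
    (.rsqrt (.mul (.sub hA (.param hm)) (.sub (.param analyticAt_const) hA)) fun σ hσ => by
      have := affine_mem_Icc he.1.le hσ
      exact mul_pos (by linarith [this.1]) (by linarith [this.2, he.2]))
  refine ((analyticAt_sqrt ((analyticAt_const (v := e)).sub hM) (by simpa using he.1)).mul h).congr ?_
  filter_upwards [hM.continuousAt.eventually_lt_const he.1] with x hx
  exact (integral_cubicWeight_left ⟨hx, he.2⟩).symm

theorem analyticAt_innerPeriod_right (hm : AnalyticAt ℝ m x₀) (hM : AnalyticAt ℝ M x₀)
    (h1 : m x₀ < M x₀) (he : e ∈ Ioo (M x₀) a) :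
    AnalyticAt ℝ (fun x => ∫ s in e..a, cubicWeight (m x) (M x) a s) x₀ := by
  have hA := IsAnalyticFamily.affine (analyticAt_const (v := e) (x := x₀)) (analyticAt_const (v := a))
  have h := analyticAt_intR (u := fun _ => e) (v := fun _ => a)
    (G := fun x s => 1 / √((s - m x) * (s - M x)))
    (.rsqrt (.mul (.sub hA (.param hm)) (.sub hA (.param hM))) fun σ hσ => by
      have := (affine_mem_Icc he.2.le hσ).1
      exact mul_pos (by linarith [he.1]) (by linarith [he.1]))
  refine ((analyticAt_const (v := √(a - e))).mul h).congr ?_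
  filter_upwards [hM.continuousAt.eventually_lt_const he.1] with x hx
  exact (integral_cubicWeight_end ⟨hx, he.2⟩).symm

end

/-! ### Transfer of the uniform estimates to the caustic space -/

section

variable {a b c : ℝ} {p r : ℝ × ℝ}

theorem sorted5_of_mem (hc : 0 < c) (hcb : c < b) (hba : b < a) (hp : p ∈ causticSpace a b c) :
    Sorted5 (min c p.1) (max c p.1) (min b p.2) (max b p.2) a := by
  obtain ⟨h0, h1, h2, h3, h4⟩ := sorted_of_mem hc hcb hba hp
  exact ⟨h0, h1, h2, h3, h4⟩

theorem solvesPeriods_frequencyMap (hc : 0 < c) (hcb : c < b) (hba : b < a)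
    (hp : p ∈ causticSpace a b c) :
    SolvesPeriods (min c p.1) (max c p.1) (min b p.2) (max b p.2) a (frequencyMap a b c p) := by
  have h := isFrequency_frequencyMap hc hcb hba hp
  intro i hi
  have := h i hi
  simpa only [K0, K1, K2, T_eq_quintic] using this

theorem abs_invLog (x : ℝ) : |invLog x| = |(Real.log (1 / |x|))⁻¹| := by
  rw [invLog, one_div |x|, Real.log_inv, inv_neg, abs_neg, one_div]

theorem le_mul_abs_invLog {x y C : ℝ} (hx : 0 < |x|) (hx1 : |x| ≤ 1 / 2)
    (h : |y| * Real.log (1 / |x|) ≤ C) : |y| ≤ C * |invLog x| := by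
  have hl : 0 < Real.log (1 / |x|) := (Real.log_pos one_lt_two).trans_le (log_one_div_ge hx hx1)
  rw [abs_invLog, abs_of_pos (inv_pos.2 hl), ← div_eq_mul_inv, le_div_iff₀ hl]
  exact h

theorem norm_mk_le_of_abs_le {x y K : ℝ} (hx : |x| ≤ K) (hy : |y| ≤ K) : ‖(x, y)‖ ≤ K := by
  rw [Prod.norm_def]; exact max_le hx hy

theorem eventually_abs_fst_sub_le (c : ℝ) (t : ℝ) {δ : ℝ} (hδ : 0 < δ) :
    ∀ᶠ p : ℝ × ℝ in 𝓝 (c, t), |c - p.1| ≤ δ := by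
  have : ContinuousAt (fun p : ℝ × ℝ => |c - p.1|) (c, t) := by fun_prop
  have h := this.tendsto.eventually_lt_const (u := δ) (by simpa using hδ)
  exact h.mono fun p hp => hp.le

theorem eventually_abs_snd_sub_le (b : ℝ) (t : ℝ) {δ : ℝ} (hδ : 0 < δ) :
    ∀ᶠ p : ℝ × ℝ in 𝓝 (t, b), |b - p.2| ≤ δ := by
  have : ContinuousAt (fun p : ℝ × ℝ => |b - p.2|) (t, b) := by fun_prop
  have h := this.tendsto.eventually_lt_const (u := δ) (by simpa using hδ)
  exact h.mono fun p hp => hp.le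

/-- The comparison value depends on the running λ₂ and not on its limit t, so the estimate is valid
along the inner edges and at the vertexes t = c and t = a. Only t = b is excluded, where a second
pair of roots collides. -/
theorem frequencyMap_sub_isBigO_low (hc : 0 < c) (hcb : c < b) (hba : b < a) {t : ℝ} (ht : t ≠ b) :
    (fun p : ℝ × ℝ => frequencyMap a b c p -
      (1 / 2, sortedRotation (min b p.2) (max b p.2) a)) =O[𝓝[causticSpace a b c] (c, t)]
      fun p => invLog (c - p.1) := by
  have hη : 0 < |b - t| / 2 := half_pos (abs_pos.2 (sub_ne_zero.2 ht.symm))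
  obtain ⟨C, hC⟩ := Sorted5.exists_abs_sub_le_of_collision_low (half_pos hc) hη
    (by linarith : 0 < a)
  refine IsBigO.of_bound C ?_
  have e1 := eventually_abs_fst_sub_le c t (by norm_num : (0 : ℝ) < 1 / 2)
  have e2 := eventually_abs_fst_sub_le c t (half_pos hc)
  have e3 := eventually_abs_snd_sub_le t c hη
  filter_upwards [self_mem_nhdsWithin, nhdsWithin_le_nhds e1, nhdsWithin_le_nhds e2,
    nhdsWithin_le_nhds e3] with p hp h1 h2 h3
  have hs := sorted5_of_mem hc hcb hba hp
  have hpos := frequencyMap_pos hc hcb hba hp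
  have hgap : max c p.1 - min c p.1 = |c - p.1| := max_sub_min_eq_abs' _ _
  have hgap' : max b p.2 - min b p.2 = |b - p.2| := max_sub_min_eq_abs' _ _
  have hL : c / 2 ≤ min c p.1 := le_min (by linarith) (by linarith [(abs_le.1 h2).2])
  have h4 : |b - t| / 2 ≤ max b p.2 - min b p.2 := by
    rw [hgap']
    have : |b - t| ≤ |b - p.2| + |t - p.2| := by
      have := abs_sub_le b p.2 t
      rwa [abs_sub_comm p.2 t] at this
    linarith
  have := hC _ _ _ _ _ _ hs (solvesPeriods_frequencyMap hc hcb hba hp) hpos.1 hpos.2 hL h4 le_rfl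
    (by rw [hgap]; exact h1)
  have hx : 0 < |c - p.1| := by rw [← hgap]; linarith [hs.lt12]
  rw [hgap] at this
  exact norm_mk_le_of_abs_le (le_mul_abs_invLog hx h1 this.1) (le_mul_abs_invLog hx h1 this.2)

theorem frequencyMap_sub_isBigO_high (hc : 0 < c) (hcb : c < b) (hba : b < a) {t : ℝ}
    (ht : t ≠ c) :
    (fun p : ℝ × ℝ => frequencyMap a b c p - (sortedRotation (min c p.1) (max c p.1) a,
      sortedRotation (min c p.1) (max c p.1) a)) =O[𝓝[causticSpace a b c] (t, b)]
      fun p => invLog (b - p.2) := by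
  have hη : 0 < min (|c - t| / 2) ((a - b) / 2) :=
    lt_min (half_pos (abs_pos.2 (sub_ne_zero.2 ht.symm))) (by linarith)
  obtain ⟨C, hC⟩ := Sorted5.exists_abs_sub_le_of_collision_high hη (by linarith : 0 < a)
  -- The first component is compared with the rotation number through the second one, which doubles
  -- the constant.
  refine IsBigO.of_bound (C + C) ?_
  have e1 := eventually_abs_snd_sub_le b t (by norm_num : (0 : ℝ) < 1 / 2)
  have e2 := eventually_abs_snd_sub_le b t (by linarith : 0 < (a - b) / 2)
  have e3 := eventually_abs_fst_sub_le t b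
    (half_pos (abs_pos.2 (sub_ne_zero.2 ht.symm)))
  filter_upwards [self_mem_nhdsWithin, nhdsWithin_le_nhds e1, nhdsWithin_le_nhds e2,
    nhdsWithin_le_nhds e3] with p hp h1 h2 h3
  have hs := sorted5_of_mem hc hcb hba hp
  have hpos := frequencyMap_pos hc hcb hba hp
  have hgap : max c p.1 - min c p.1 = |c - p.1| := max_sub_min_eq_abs' _ _
  have hgap' : max b p.2 - min b p.2 = |b - p.2| := max_sub_min_eq_abs' _ _
  have hL : (a - b) / 2 ≤ a - max b p.2 := by
    have : max b p.2 ≤ (a + b) / 2 := max_le (by linarith) (by linarith [(abs_le.1 h2).1])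
    linarith
  have h4 : |c - t| / 2 ≤ max c p.1 - min c p.1 := by
    rw [hgap]
    have : |c - t| ≤ |c - p.1| + |t - p.1| := by
      have := abs_sub_le c p.1 t
      rwa [abs_sub_comm p.1 t] at this
    linarith
  have := hC _ _ _ _ _ _ hs (solvesPeriods_frequencyMap hc hcb hba hp) hpos.1 hpos.2
    ((min_le_left _ _).trans h4) ((min_le_right _ _).trans hL) le_rfl (by rw [hgap']; exact h1)
  have hx : 0 < |b - p.2| := by rw [← hgap']; linarith [hs.lt34]
  rw [hgap'] at this
  have k1 := le_mul_abs_invLog hx h1 this.1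
  have k2 := le_mul_abs_invLog hx h1 this.2
  have k0 : 0 ≤ C * |invLog (b - p.2)| := (abs_nonneg _).trans k1
  rw [add_mul]
  refine norm_mk_le_of_abs_le ?_ (k2.trans (le_add_of_nonneg_left k0))
  have e : (frequencyMap a b c p).1 - sortedRotation (min c p.1) (max c p.1) a =
    ((frequencyMap a b c p).1 - (frequencyMap a b c p).2) +
      ((frequencyMap a b c p).2 - sortedRotation (min c p.1) (max c p.1) a) := by ring
  show |(frequencyMap a b c p).1 - sortedRotation (min c p.1) (max c p.1) a| ≤ _
  rw [e]
  exact (abs_add_le _ _).trans (add_le_add k1 k2)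

theorem frequencyMap_sub_isBigO_corner (hc : 0 < c) (hcb : c < b) (hba : b < a) :
    (fun p => frequencyMap a b c p - (1 / 2, 1 / 2))
      =O[𝓝[causticSpace a b c] (c, b)] fun p => |invLog (c - p.1)| + |invLog (b - p.2)| := by
  have hη : 0 < min ((b - c) / 2) ((a - b) / 2) := lt_min (by linarith) (by linarith)
  obtain ⟨C, hC⟩ := Sorted5.exists_abs_sub_le_of_double_collision (half_pos hc) hη
    (by linarith : 0 < a)
  refine IsBigO.of_bound C ?_
  have e1 := eventually_abs_fst_sub_le c b (by norm_num : (0 : ℝ) < 1 / 2)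
  have e2 := eventually_abs_snd_sub_le b c (by norm_num : (0 : ℝ) < 1 / 2)
  have e3 := eventually_abs_fst_sub_le c b (half_pos hc)
  have e4 := eventually_abs_snd_sub_le b c (by linarith : 0 < (a - b) / 2)
  have e5 := eventually_abs_fst_sub_le c b (by linarith : 0 < (b - c) / 4)
  have e6 := eventually_abs_snd_sub_le b c (by linarith : 0 < (b - c) / 4)
  have e7 := eventually_abs_fst_sub_le c b (pow_pos hη 2)
  have e8 := eventually_abs_snd_sub_le b c (pow_pos hη 2)
  filter_upwards [self_mem_nhdsWithin, nhdsWithin_le_nhds (e1.and e2), nhdsWithin_le_nhds (e3.and e4),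
    nhdsWithin_le_nhds (e5.and e6), nhdsWithin_le_nhds (e7.and e8)] with p hp h1 h2 h3 h4
  have hs := sorted5_of_mem hc hcb hba hp
  have hpos := frequencyMap_pos hc hcb hba hp
  have hgap : max c p.1 - min c p.1 = |c - p.1| := max_sub_min_eq_abs' _ _
  have hgap' : max b p.2 - min b p.2 = |b - p.2| := max_sub_min_eq_abs' _ _
  have hL : c / 2 ≤ min c p.1 := le_min (by linarith) (by linarith [(abs_le.1 h2.1).2])
  have hL' : (a - b) / 2 ≤ a - max b p.2 := by
    have : max b p.2 ≤ (a + b) / 2 := max_le (by linarith) (by linarith [(abs_le.1 h2.2).1])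
    linarith
  have hm : (b - c) / 2 ≤ min b p.2 - max c p.1 := by
    have k1 : b - (b - c) / 4 ≤ min b p.2 :=
      le_min (by linarith) (by linarith [(abs_le.1 h3.2).2])
    have k2 : max c p.1 ≤ c + (b - c) / 4 :=
      max_le (by linarith) (by linarith [(abs_le.1 h3.1).1])
    linarith
  have := hC _ _ _ _ _ _ hs (solvesPeriods_frequencyMap hc hcb hba hp) hpos.1 hpos.2 hL
    ((min_le_left _ _).trans hm) ((min_le_right _ _).trans hL') le_rfl
    (by rw [hgap]; exact h1.1) (by rw [hgap]; exact h4.1)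
    (by rw [hgap']; exact h1.2) (by rw [hgap']; exact h4.2)
  have hx : 0 < |c - p.1| := by rw [← hgap]; linarith [hs.lt12]
  have hx' : 0 < |b - p.2| := by rw [← hgap']; linarith [hs.lt34]
  rw [hgap, hgap'] at this
  have k1 := le_mul_abs_invLog hx h1.1 this.1
  have k2 := le_mul_abs_invLog hx' h1.2 this.2
  have n1 := (abs_nonneg _).trans k1
  have n2 := (abs_nonneg _).trans k2
  rw [Real.norm_of_nonneg (by positivity), mul_add]
  refine norm_mk_le_of_abs_le (k1.trans (le_add_of_nonneg_right n2)) ?_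
  have e : (frequencyMap a b c p).2 - 1 / 2 = ((frequencyMap a b c p).1 - 1 / 2) -
    ((frequencyMap a b c p).1 - (frequencyMap a b c p).2) := by ring
  show |(frequencyMap a b c p).2 - 1 / 2| ≤ _
  rw [e]
  exact (abs_sub _ _).trans (add_le_add k1 k2)

theorem frequencyMap_isBigO_sqrt_high (hc : 0 < c) (hcb : c < b) (hba : b < a) :
    frequencyMap a b c =O[𝓝[causticSpace a b c] (0, b)] fun p => √p.1 := by
  have hη : 0 < min (min (c / 2) ((b - c) / 2)) ((a - b) / 2) :=
    lt_min (lt_min (by linarith) (by linarith)) (by linarith)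
  obtain ⟨C, hC⟩ := Sorted5.exists_le_sqrt_of_collision_high hη (by linarith : 0 < a)
  refine IsBigO.of_bound C ?_
  have e1 := eventually_abs_fst_sub_le 0 b (half_pos hc)
  have e2 := eventually_abs_snd_sub_le b 0 (by linarith : 0 < (a - b) / 2)
  have e3 := eventually_abs_snd_sub_le b 0 (by linarith : 0 < (b - c) / 2)
  filter_upwards [self_mem_nhdsWithin, nhdsWithin_le_nhds e1, nhdsWithin_le_nhds e2,
    nhdsWithin_le_nhds e3] with p hp h1 h2 h3
  have hs := sorted5_of_mem hc hcb hba hp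
  have hpos := frequencyMap_pos hc hcb hba hp
  have hp1 : p.1 ≤ c / 2 := by linarith [(abs_le.1 h1).1]
  have k1 : min c p.1 = p.1 := min_eq_right (by linarith)
  have k2 : max c p.1 = c := max_eq_left (by linarith)
  have hL' : (a - b) / 2 ≤ a - max b p.2 := by
    have : max b p.2 ≤ (a + b) / 2 := max_le (by linarith) (by linarith [(abs_le.1 h2).1])
    linarith
  have hm : (b - c) / 2 ≤ min b p.2 - max c p.1 := by
    have : (b + c) / 2 ≤ min b p.2 := le_min (by linarith) (by linarith [(abs_le.1 h3).2])
    rw [k2]; linarith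
  have := hC _ _ _ _ _ _ hs (solvesPeriods_frequencyMap hc hcb hba hp) hpos.1 hpos.2
    ((min_le_left _ _).trans ((min_le_left _ _).trans (by rw [k1, k2]; linarith)))
    ((min_le_left _ _).trans ((min_le_right _ _).trans hm)) ((min_le_right _ _).trans hL') le_rfl
  rw [k1] at this
  rw [Real.norm_of_nonneg (Real.sqrt_nonneg _)]
  exact norm_mk_le_of_abs_le ((abs_of_pos hpos.1).trans_le this.1)
    ((abs_of_pos hpos.2).trans_le this.2)

theorem tendsto_invLog_zero : Tendsto invLog (𝓝 0) (𝓝 0) := by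
  have h : Tendsto invLog (𝓝[≠] 0) (𝓝 0) := by
    have := (tendsto_log_abs_sub 0).inv_tendsto_atBot
    refine this.congr fun x => ?_
    simp only [Pi.inv_apply, invLog, zero_sub, abs_neg, one_div]
  -- With log 0 = 0 and 1/0 = 0 the default value agrees with the limit, so the full neighbourhood
  -- may be used instead of the punctured one.
  have h0 : invLog 0 = 0 := by simp [invLog]
  have : ContinuousAt invLog 0 := by
    rw [continuousAt_iff_punctured_nhds, h0]; exact h
  rw [ContinuousAt, h0] at this
  exact this

/-! ### Limits at the border -/

theorem tendsto_frequencyMap_regular (hc : 0 < c) (hcb : c < b) (hba : b < a)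
    (hp : p ∈ causticClosure a b c) (h1 : p.1 ≠ c) (h2 : p.2 ≠ b) :
    Tendsto (frequencyMap a b c) (𝓝[causticSpace a b c] p) (𝓝 (freqExt a b c p)) := by
  refine ((continuousAt_freqExt hc hcb hba hp h1 h2).tendsto.mono_left
    nhdsWithin_le_nhds).congr' ?_
  filter_upwards [self_mem_nhdsWithin] with q hq
  exact (frequencyMap_eq hc hcb hba hq).symm

theorem continuousAt_invLog_fst (t : ℝ) :
    Tendsto (fun p : ℝ × ℝ => invLog (c - p.1)) (𝓝 (c, t)) (𝓝 0) := by
  refine tendsto_invLog_zero.comp ?_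
  have : ContinuousAt (fun p : ℝ × ℝ => c - p.1) (c, t) := by fun_prop
  simpa using this.tendsto

theorem continuousAt_invLog_snd (t : ℝ) :
    Tendsto (fun p : ℝ × ℝ => invLog (b - p.2)) (𝓝 (t, b)) (𝓝 0) := by
  refine tendsto_invLog_zero.comp ?_
  have : ContinuousAt (fun p : ℝ × ℝ => b - p.2) (t, b) := by fun_prop
  simpa using this.tendsto

theorem rhoZ_eq (hb : 0 < b) (hba : b < a) {t : ℝ} (ht : t ∈ Icc 0 a) (htb : t ≠ b) :
    rhoZ a b t = sortedRotation (min b t) (max b t) a :=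
  rotationFunction_eq hb hba ht htb

theorem rhoY_eq (hc : 0 < c) (hca : c < a) {t : ℝ} (ht : t ∈ Icc 0 a) (htc : t ≠ c) :
    rhoY a c t = sortedRotation (min c t) (max c t) a :=
  rotationFunction_eq hc hca ht htc

theorem tendsto_frequencyMap_low (hc : 0 < c) (hcb : c < b) (hba : b < a) {t : ℝ}
    (ht : t ∈ Icc c a) (htb : t ≠ b) :
    Tendsto (frequencyMap a b c) (𝓝[causticSpace a b c] (c, t)) (𝓝 (1 / 2, rhoZ a b t)) := by
  have hb : 0 < b := hc.trans hcb
  have ht' : t ∈ Icc 0 a := ⟨hc.le.trans ht.1, ht.2⟩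
  have h1 := (frequencyMap_sub_isBigO_low hc hcb hba htb).trans_tendsto
    ((continuousAt_invLog_fst t).mono_left nhdsWithin_le_nhds)
  have h2 : ContinuousAt (fun p : ℝ × ℝ => ((1 / 2 : ℝ), sortedRotation (min b p.2) (max b p.2) a))
      (c, t) :=
    continuousAt_const.prodMk ((continuousAt_sortedRotation hb hba ht' htb).comp (f := Prod.snd)
      (x := (c, t)) continuousAt_snd)
  have h3 := h1.add (h2.tendsto.mono_left (nhdsWithin_le_nhds (s := causticSpace a b c)))
  rw [zero_add, ← rhoZ_eq hb hba ht' htb] at h3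
  refine h3.congr fun q => ?_
  rw [sub_add_cancel]

theorem tendsto_frequencyMap_high (hc : 0 < c) (hcb : c < b) (hba : b < a) {t : ℝ}
    (ht : t ∈ Icc 0 b) (htc : t ≠ c) :
    Tendsto (frequencyMap a b c) (𝓝[causticSpace a b c] (t, b)) (𝓝 (rhoY a c t, rhoY a c t)) := by
  have hca : c < a := hcb.trans hba
  have ht' : t ∈ Icc 0 a := ⟨ht.1, ht.2.trans hba.le⟩
  have h1 := (frequencyMap_sub_isBigO_high hc hcb hba htc).trans_tendsto
    ((continuousAt_invLog_snd t).mono_left nhdsWithin_le_nhds)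
  have h0 := (continuousAt_sortedRotation hc hca ht' htc).comp (f := Prod.fst)
      (x := (t, b)) continuousAt_fst
  have h2 : ContinuousAt (fun p : ℝ × ℝ => (sortedRotation (min c p.1) (max c p.1) a,
      sortedRotation (min c p.1) (max c p.1) a)) (t, b) := h0.prodMk h0
  have h3 := h1.add (h2.tendsto.mono_left (nhdsWithin_le_nhds (s := causticSpace a b c)))
  rw [zero_add, ← rhoY_eq hc hca ht' htc] at h3
  refine h3.congr fun q => ?_
  rw [sub_add_cancel]

theorem tendsto_frequencyMap_corner (hc : 0 < c) (hcb : c < b) (hba : b < a) :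
    Tendsto (frequencyMap a b c) (𝓝[causticSpace a b c] (c, b)) (𝓝 (1 / 2, 1 / 2)) := by
  have h := ((continuousAt_invLog_fst (c := c) b).abs.add
    (continuousAt_invLog_snd (b := b) c).abs).mono_left
      (nhdsWithin_le_nhds (s := causticSpace a b c))
  rw [abs_zero, add_zero] at h
  have h3 := ((frequencyMap_sub_isBigO_corner hc hcb hba).trans_tendsto h).add_const
    ((1 / 2 : ℝ), (1 / 2 : ℝ))
  rw [zero_add] at h3
  refine h3.congr fun q => ?_
  rw [sub_add_cancel]

theorem isOpen_causticSpace : IsOpen (causticSpace a b c) := by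
  have h1 : IsOpen (E c ∪ H1 b c) := isOpen_Ioo.union isOpen_Ioo
  have h2 : IsOpen (H1 b c ∪ H2 a b) := isOpen_Ioo.union isOpen_Ioo
  exact (isOpen_lt continuous_fst continuous_snd).inter
    ((h1.preimage continuous_fst).inter (h2.preimage continuous_snd))

theorem mem_causticSpace_iff (hc : 0 < c) (hcb : c < b) (hba : b < a) :
    p ∈ causticSpace a b c ↔
      p.1 < p.2 ∧ p.1 ∈ Ioo 0 b ∧ p.1 ≠ c ∧ p.2 ∈ Ioo c a ∧ p.2 ≠ b := by
  simp only [causticSpace, E, H1, H2, mem_ofPred_eq, mem_union, mem_Ioo]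
  constructor
  · rintro ⟨h, h1, h2⟩
    refine ⟨h, ?_⟩
    rcases h1 with h1 | h1 <;> rcases h2 with h2 | h2 <;>
      exact ⟨⟨by linarith, by linarith⟩, by intro h; linarith, ⟨by linarith, by linarith⟩,
        by intro h; linarith⟩
  · rintro ⟨h, h1, h2, h3, h4⟩
    refine ⟨h, ?_, ?_⟩
    · rcases lt_or_gt_of_ne h2 with h2 | h2
      · exact Or.inl ⟨h1.1, h2⟩
      · exact Or.inr ⟨h2, h1.2⟩
    · rcases lt_or_gt_of_ne h4 with h4 | h4
      · exact Or.inl ⟨h3.1, h4⟩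
      · exact Or.inr ⟨h4, h3.2⟩

theorem closure_causticSpace (hc : 0 < c) (hcb : c < b) (hba : b < a) :
    closure (causticSpace a b c) = causticClosure a b c := by
  apply Subset.antisymm
  · refine closure_minimal (fun p hp => ?_) ?_
    · obtain ⟨h, h1, -, h2, -⟩ := (mem_causticSpace_iff hc hcb hba).1 hp
      exact ⟨h.le, ⟨h1.1.le, h1.2.le⟩, ⟨h2.1.le, h2.2.le⟩⟩
    · exact (isClosed_le continuous_fst continuous_snd).inter
        ((isClosed_Icc.preimage continuous_fst).inter (isClosed_Icc.preimage continuous_snd))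
  · rintro p ⟨h, h1, h2⟩
    -- Move from p towards the interior point (c/2, (b+c)/2) along a segment. The strict
    -- inequalities hold at once, and it remains to avoid λ₁ = c and λ₂ = b.
    have hz : Tendsto (fun ε : ℝ => (p.1 + ε * (c / 2 - p.1), p.2 + ε * ((b + c) / 2 - p.2)))
        (𝓝[>] 0) (𝓝 p) := by
      have : ContinuousAt (fun ε : ℝ => (p.1 + ε * (c / 2 - p.1), p.2 + ε * ((b + c) / 2 - p.2)))
        0 := by fun_prop
      simpa using this.tendsto.mono_left (nhdsWithin_le_nhds (s := Ioi 0))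
    refine mem_closure_of_tendsto hz ?_
    -- A segment whose end z is different from d can lie over d at its starting point, but not
    -- immediately afterwards.
    have key : ∀ x z d : ℝ, z ≠ d → ∀ᶠ ε in 𝓝[>] (0 : ℝ), x + ε * (z - x) ≠ d := by
      intro x z d hzd
      rcases eq_or_ne x d with rfl | hx
      · filter_upwards [self_mem_nhdsWithin] with ε hε h
        have : ε * (z - x) = 0 := by linarith
        rcases mul_eq_zero.1 this with h0 | h0
        · exact (ne_of_gt hε) h0
        · exact hzd (by linarith)
      · have : ContinuousAt (fun ε : ℝ => x + ε * (z - x)) 0 := by fun_prop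
        exact nhdsWithin_le_nhds (this.eventually_ne (by simpa using hx))
    filter_upwards [self_mem_nhdsWithin, nhdsWithin_le_nhds (Iio_mem_nhds one_pos),
      key p.1 (c / 2) c (by linarith), key p.2 ((b + c) / 2) b (by linarith)] with ε h0 h1' k1 k2
    have h0' : 0 < ε := h0
    have h1'' : 0 < 1 - ε := sub_pos.2 h1'
    rw [mem_causticSpace_iff hc hcb hba]
    have q1 := mul_nonneg h1''.le h1.1
    have q2 := mul_nonneg h1''.le (sub_nonneg.2 h1.2)
    have q3 := mul_nonneg h1''.le (sub_nonneg.2 h2.1)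
    have q4 := mul_nonneg h1''.le (sub_nonneg.2 h2.2)
    have q5 := mul_nonneg h1''.le (sub_nonneg.2 h)
    have r1 := mul_pos h0' hc
    have r2 := mul_pos h0' (sub_pos.2 hcb)
    have r3 := mul_pos h0' (sub_pos.2 hba)
    refine ⟨?_, ⟨?_, ?_⟩, k1, ⟨?_, ?_⟩, k2⟩ <;> simp only <;> nlinarith

/-- The continuous extension of the frequency map. -/
noncomputable def closedFrequency (a b c : ℝ) : ℝ × ℝ → ℝ × ℝ :=
  extendFrom (causticSpace a b c) (frequencyMap a b c)

theorem closedFrequency_eq_of_tendsto (hc : 0 < c) (hcb : c < b) (hba : b < a)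
    (hp : p ∈ causticClosure a b c)
    (h : Tendsto (frequencyMap a b c) (𝓝[causticSpace a b c] p) (𝓝 r)) :
    closedFrequency a b c p = r :=
  extendFrom_eq (by rwa [closure_causticSpace hc hcb hba]) h

theorem closedFrequency_regular (hc : 0 < c) (hcb : c < b) (hba : b < a)
    (hp : p ∈ causticClosure a b c) (h1 : p.1 ≠ c) (h2 : p.2 ≠ b) :
    closedFrequency a b c p = freqExt a b c p :=
  closedFrequency_eq_of_tendsto hc hcb hba hp (tendsto_frequencyMap_regular hc hcb hba hp h1 h2)

theorem closedFrequency_low (hc : 0 < c) (hcb : c < b) (hba : b < a) {t : ℝ}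
    (ht : t ∈ Icc c a) (htb : t ≠ b) : closedFrequency a b c (c, t) = (1 / 2, rhoZ a b t) :=
  closedFrequency_eq_of_tendsto hc hcb hba ⟨ht.1, ⟨hc.le, hcb.le⟩, ht⟩
    (tendsto_frequencyMap_low hc hcb hba ht htb)

theorem closedFrequency_high (hc : 0 < c) (hcb : c < b) (hba : b < a) {t : ℝ}
    (ht : t ∈ Icc 0 b) (htc : t ≠ c) :
    closedFrequency a b c (t, b) = (rhoY a c t, rhoY a c t) :=
  closedFrequency_eq_of_tendsto hc hcb hba ⟨ht.2, ht, ⟨hcb.le, hba.le⟩⟩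
    (tendsto_frequencyMap_high hc hcb hba ht htc)

theorem closedFrequency_corner (hc : 0 < c) (hcb : c < b) (hba : b < a) :
    closedFrequency a b c (c, b) = (1 / 2, 1 / 2) :=
  closedFrequency_eq_of_tendsto hc hcb hba ⟨hcb.le, ⟨hc.le, hcb.le⟩, ⟨hcb.le, hba.le⟩⟩
    (tendsto_frequencyMap_corner hc hcb hba)

theorem continuousOn_closedFrequency (hc : 0 < c) (hcb : c < b) (hba : b < a) :
    ContinuousOn (closedFrequency a b c) (causticClosure a b c) := by
  refine continuousOn_extendFrom (closure_causticSpace hc hcb hba).ge fun p hp => ?_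
  obtain ⟨x, y⟩ := p
  rcases eq_or_ne x c with rfl | h1
  · rcases eq_or_ne y b with rfl | h2
    · exact ⟨_, tendsto_frequencyMap_corner hc hcb hba⟩
    · exact ⟨_, tendsto_frequencyMap_low hc hcb hba hp.2.2 h2⟩
  · rcases eq_or_ne y b with rfl | h2
    · exact ⟨_, tendsto_frequencyMap_high hc hcb hba hp.2.1 h1⟩
    · exact ⟨_, tendsto_frequencyMap_regular hc hcb hba hp h1 h2⟩

theorem closedFrequency_eq (hc : 0 < c) (hcb : c < b) (hba : b < a)
    (hp : p ∈ causticSpace a b c) : closedFrequency a b c p = frequencyMap a b c p := by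
  have hm := (mem_causticSpace_iff hc hcb hba).1 hp
  have hcl : p ∈ causticClosure a b c := by
    rw [← closure_causticSpace hc hcb hba]; exact subset_closure hp
  rw [closedFrequency_regular hc hcb hba hcl hm.2.2.1 hm.2.2.2.2, frequencyMap_eq hc hcb hba hp]

end

section

variable {a b c t : ℝ} {p r : ℝ × ℝ}

/-- The auxiliary functions are extended along their own intervals. Agreement with a component of
the extended frequency inside an edge, together with its continuity along the closed edge, gives
agreement at the ends too. -/
theorem extendFrom_eq_of_continuousWithinAt {A S : Set ℝ} {g φ : ℝ → ℝ} (ht : t ∈ closure A)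
    (hφ : ContinuousWithinAt φ S t) (h : ∀ᶠ s in 𝓝[A] t, s ∈ S ∧ g s = φ s) :
    extendFrom A g t = φ t := by
  refine extendFrom_eq ht ((hφ.tendsto.mono_left ?_).congr' ?_)
  · exact le_inf inf_le_left (le_principal_iff.2 (h.mono fun s hs => hs.1))
  · exact h.mono fun s hs => hs.2.symm

/-! ### Values of the extended frequency map on the border -/

theorem closure_E_union_H1 (hc : 0 < c) (hcb : c < b) : closure (E c ∪ H1 b c) = Icc 0 b :=
  closure_rotation_domain hc hcb

theorem mem_E_union_H1_iff (hc : 0 < c) (hcb : c < b) :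
    t ∈ E c ∪ H1 b c ↔ t ∈ Ioo 0 b ∧ t ≠ c := by
  simp only [E, H1, mem_union, mem_Ioo]
  constructor
  · rintro (h | h)
    · exact ⟨⟨h.1, h.2.trans hcb⟩, h.2.ne⟩
    · exact ⟨⟨hc.trans h.1, h.2⟩, h.1.ne'⟩
  · rintro ⟨h, h'⟩
    rcases lt_or_gt_of_ne h' with h' | h'
    · exact Or.inl ⟨h.1, h'⟩
    · exact Or.inr ⟨h', h.2⟩

theorem mem_H1_union_H2_iff (hcb : c < b) (hba : b < a) :
    t ∈ H1 b c ∪ H2 a b ↔ t ∈ Ioo c a ∧ t ≠ b := by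
  simp only [H1, H2, mem_union, mem_Ioo]
  constructor
  · rintro (h | h)
    · exact ⟨⟨h.1, h.2.trans hba⟩, h.2.ne⟩
    · exact ⟨⟨hcb.trans h.1, h.2⟩, h.1.ne'⟩
  · rintro ⟨h, h'⟩
    rcases lt_or_gt_of_ne h' with h' | h'
    · exact Or.inl ⟨h.1, h'⟩
    · exact Or.inr ⟨h', h.2⟩

theorem continuousOn_closedFrequency_comp (hc : 0 < c) (hcb : c < b) (hba : b < a) {S : Set ℝ}
    {γ : ℝ → ℝ × ℝ} (hγ : Continuous γ) (h : MapsTo γ S (causticClosure a b c)) :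
    ContinuousOn (fun s => closedFrequency a b c (γ s)) S :=
  (continuousOn_closedFrequency hc hcb hba).comp hγ.continuousOn h

/-- The value of the rotation function at the focal parameter is read off from the frequency: along
λ₂ = b the extended map is continuous, and its value at (c,b) is known from the double collision. -/
theorem rhoY_self (hc : 0 < c) (hcb : c < b) (hba : b < a) : rhoY a c c = 1 / 2 := by
  have hca := hcb.trans hba
  have hcont := continuousOn_closedFrequency_comp hc hcb hba (S := Icc 0 b)
    (γ := fun s => (s, b)) (by fun_prop) fun s hs => ⟨hs.2, hs, ⟨hcb.le, hba.le⟩⟩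
  have h := extendFrom_eq_of_continuousWithinAt (A := Ioo 0 c ∪ Ioo c a) (S := Icc 0 b)
    (t := c) (g := fun s => rotationNumber s c a)
    (φ := fun s => (closedFrequency a b c (s, b)).1)
    (by rw [closure_rotation_domain hc hca]; exact ⟨hc.le, hca.le⟩)
    (hcont.fst c ⟨hc.le, hcb.le⟩) (by
      filter_upwards [self_mem_nhdsWithin, nhdsWithin_le_nhds (Ioo_mem_nhds hc hcb)] with s hs h
      have hsc : s ≠ c := by
        rcases hs with hs | hs
        · exact hs.2.ne
        · exact hs.1.ne'
      have hs' : s ∈ Icc 0 b := ⟨h.1.le, h.2.le⟩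
      refine ⟨hs', ?_⟩
      rw [closedFrequency_high hc hcb hba hs' hsc,
        rhoY_eq hc hca ⟨h.1.le, h.2.le.trans hba.le⟩ hsc,
        rotationNumber_eq hc.le hca h.1.le (h.2.trans hba)])
  rw [closedFrequency_corner hc hcb hba] at h
  exact h

theorem rhoZ_self (hc : 0 < c) (hcb : c < b) (hba : b < a) : rhoZ a b b = 1 / 2 := by
  have hb := hc.trans hcb
  have hcont := continuousOn_closedFrequency_comp hc hcb hba (S := Icc c a)
    (γ := fun s => (c, s)) (by fun_prop) fun s hs => ⟨hs.1, ⟨hc.le, hcb.le⟩, hs⟩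
  have h := extendFrom_eq_of_continuousWithinAt (A := Ioo 0 b ∪ Ioo b a) (S := Icc c a)
    (t := b) (g := fun s => rotationNumber s b a)
    (φ := fun s => (closedFrequency a b c (c, s)).2)
    (by rw [closure_rotation_domain hb hba]; exact ⟨hb.le, hba.le⟩)
    (hcont.snd b ⟨hcb.le, hba.le⟩) (by
      filter_upwards [self_mem_nhdsWithin, nhdsWithin_le_nhds (Ioo_mem_nhds hcb hba)] with s hs h
      have hsb : s ≠ b := by
        rcases hs with hs | hs
        · exact hs.2.ne
        · exact hs.1.ne'
      have hs' : s ∈ Icc c a := ⟨h.1.le, h.2.le⟩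
      refine ⟨hs', ?_⟩
      rw [closedFrequency_low hc hcb hba hs' hsb,
        rhoZ_eq hb hba ⟨hc.le.trans h.1.le, h.2.le⟩ hsb,
        rotationNumber_eq hb.le hba (hc.le.trans h.1.le) h.2])
  rw [closedFrequency_corner hc hcb hba] at h
  exact h

theorem closedFrequency_edge_high (hc : 0 < c) (hcb : c < b) (hba : b < a) (ht : t ∈ Icc 0 b) :
    closedFrequency a b c (t, b) = (rhoY a c t, rhoY a c t) := by
  rcases eq_or_ne t c with rfl | h
  · rw [closedFrequency_corner hc hcb hba, rhoY_self hc hcb hba]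
  · exact closedFrequency_high hc hcb hba ht h

theorem closedFrequency_edge_low (hc : 0 < c) (hcb : c < b) (hba : b < a) (ht : t ∈ Icc c a) :
    closedFrequency a b c (c, t) = (1 / 2, rhoZ a b t) := by
  rcases eq_or_ne t b with rfl | h
  · rw [closedFrequency_corner hc hcb hba, rhoZ_self hc hcb hba]
  · exact closedFrequency_low hc hcb hba ht h

theorem closedFrequency_zero (hc : 0 < c) (hcb : c < b) (hba : b < a) (ht : t ∈ Icc c a) :
    closedFrequency a b c (0, t) = (0, 0) := by
  rcases eq_or_ne t b with rfl | h
  · rw [closedFrequency_high hc hcb hba ⟨le_rfl, (hc.trans hcb).le⟩ hc.ne,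
      rhoY_eq hc (hcb.trans hba) ⟨le_rfl, (hc.trans (hcb.trans hba)).le⟩ hc.ne, sortedRotation,
      min_eq_right hc.le, Real.sqrt_zero, zero_mul]
  · rw [closedFrequency_regular hc hcb hba ⟨hc.le.trans ht.1, ⟨le_rfl, (hc.trans hcb).le⟩, ht⟩
      hc.ne h, freqExt, min_eq_right hc.le, Real.sqrt_zero, zero_smul]
    rfl

theorem closedFrequency_edge_x (hc : 0 < c) (hcb : c < b) (hba : b < a) (ht : t ∈ Icc 0 b) :
    closedFrequency a b c (t, a) = (rhoX b c t, nuX a b c t) := by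
  have hmem : MapsTo (fun s => (s, a)) (Icc 0 b) (causticClosure a b c) :=
    fun s hs => ⟨hs.2.trans hba.le, hs, ⟨(hcb.trans hba).le, le_rfl⟩⟩
  have hcont := continuousOn_closedFrequency_comp hc hcb hba
    (γ := fun s => (s, a)) (by fun_prop) hmem
  have hcl : t ∈ closure (E c ∪ H1 b c) := by rwa [closure_E_union_H1 hc hcb]
  have key : ∀ s ∈ E c ∪ H1 b c, s ∈ Icc 0 b ∧
      (rotationNumber s c b, nuXInterior a b c s) = closedFrequency a b c (s, a) := by
    intro s hs
    have h := (mem_E_union_H1_iff hc hcb).1 hs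
    have h' : s ∈ Icc 0 b := ⟨h.1.1.le, h.1.2.le⟩
    exact ⟨h', by rw [closedFrequency_regular hc hcb hba (hmem h') h.2 hba.ne',
      freqExt_edge_x hc hcb hba hs]⟩
  refine (Prod.ext ?_ ?_ : (rhoX b c t, nuX a b c t) = _).symm
  · exact extendFrom_eq_of_continuousWithinAt (φ := fun s => (closedFrequency a b c (s, a)).1) hcl
      (hcont.fst t ht) (mem_of_superset self_mem_nhdsWithin fun s hs =>
        ⟨(key s hs).1, congrArg Prod.fst (key s hs).2⟩)
  · exact extendFrom_eq_of_continuousWithinAt (φ := fun s => (closedFrequency a b c (s, a)).2) hcl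
      (hcont.snd t ht) (mem_of_superset self_mem_nhdsWithin fun s hs =>
        ⟨(key s hs).1, congrArg Prod.snd (key s hs).2⟩)

theorem closedFrequency_edge_y (hc : 0 < c) (hcb : c < b) (hba : b < a) (ht : t ∈ Icc b a) :
    closedFrequency a b c (b, t) = (nuY a b c t, rhoY a c t) := by
  have hca := hcb.trans hba
  have hb := hc.trans hcb
  have hmem : MapsTo (fun s => (b, s)) (Icc b a) (causticClosure a b c) :=
    fun s hs => ⟨hs.1, ⟨hb.le, le_rfl⟩, ⟨hcb.le.trans hs.1, hs.2⟩⟩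
  have hcont := continuousOn_closedFrequency_comp hc hcb hba
    (γ := fun s => (b, s)) (by fun_prop) hmem
  have hcl : closure (H2 a b) = Icc b a := closure_Ioo hba.ne
  have key : ∀ s ∈ H2 a b, s ∈ Icc b a ∧
      (nuYInterior a b c s, rotationNumber s c a) = closedFrequency a b c (b, s) := by
    intro s hs
    have h' : s ∈ Icc b a := ⟨hs.1.le, hs.2.le⟩
    exact ⟨h', by rw [closedFrequency_regular hc hcb hba (hmem h') hcb.ne' hs.1.ne',
      freqExt_edge_y hc hcb hs]⟩
  have hI : ∀ s ∈ Icc b a, s ∈ Icc 0 a ∧ s ≠ c := fun s hs =>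
    ⟨⟨hb.le.trans hs.1, hs.2⟩, (hcb.trans_le hs.1).ne'⟩
  -- The rotation function lives on all of [0,a], so its own extension cannot be compared inside H₂
  -- alone. Both sides are continuous on [b,a] and agree on a dense subset.
  have hsnd : EqOn (fun s => sortedRotation (min c s) (max c s) a)
      (fun s => (closedFrequency a b c (b, s)).2) (Icc b a) := by
    refine EqOn.of_subset_closure (s := H2 a b) (fun s hs => ?_) (fun s hs =>
      (continuousAt_sortedRotation hc hca (hI s hs).1 (hI s hs).2).continuousWithinAt)
      hcont.snd (fun s hs => (key s hs).1) hcl.ge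
    have k := key s hs
    rw [← rotationNumber_eq hc.le hca (hI s k.1).1.1 hs.2]
    exact congrArg Prod.snd k.2
  refine (Prod.ext ?_ ?_ : (nuY a b c t, rhoY a c t) = _).symm
  · exact extendFrom_eq_of_continuousWithinAt (φ := fun s => (closedFrequency a b c (b, s)).1)
      (hcl.ge ht) (hcont.fst t ht) (mem_of_superset self_mem_nhdsWithin fun s hs =>
        ⟨(key s hs).1, congrArg Prod.fst (key s hs).2⟩)
  · exact (rhoY_eq hc hca (hI t ht).1 (hI t ht).2).trans (hsnd ht)

/-- The curve t ↦ (t, max c t) runs along the edge λ₂ = c and then along the diagonal, so both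
border formulas, with the common function ν_z, come from one continuity argument. -/
theorem closedFrequency_edge_z (hc : 0 < c) (hcb : c < b) (hba : b < a) (ht : t ∈ Icc 0 b) :
    closedFrequency a b c (t, max c t) = (nuZ a b c t, rhoZ a b (min c t)) := by
  have hb := hc.trans hcb
  have hmem : MapsTo (fun s => (s, max c s)) (Icc 0 b) (causticClosure a b c) :=
    fun s hs => ⟨le_max_right _ _, hs, ⟨le_max_left _ _, max_le (hcb.trans hba).le
      (hs.2.trans hba.le)⟩⟩
  have hcont := continuousOn_closedFrequency_comp hc hcb hba
    (γ := fun s => (s, max c s)) (by fun_prop) hmem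
  have hcl : closure (E c ∪ H1 b c) = Icc 0 b := closure_E_union_H1 hc hcb
  have hI : ∀ s ∈ Icc 0 b, min c s ∈ Icc 0 a ∧ min c s < b := fun s hs =>
    ⟨⟨le_min hc.le hs.1, (min_le_left _ _).trans (hcb.trans hba).le⟩,
      (min_le_left _ _).trans_lt hcb⟩
  have hR : ∀ s ∈ Icc 0 b, rhoZ a b (min c s) = sortedRotation (min c s) b a := fun s hs => by
    rw [rhoZ_eq hb hba (hI s hs).1 (hI s hs).2.ne, min_eq_right (hI s hs).2.le,
      max_eq_left (hI s hs).2.le]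
  have key : ∀ s ∈ E c ∪ H1 b c, s ∈ Icc 0 b ∧
      (nuZInterior a b c s, sortedRotation (min c s) b a) =
        closedFrequency a b c (s, max c s) := by
    intro s hs
    have h := (mem_E_union_H1_iff hc hcb).1 hs
    have h' : s ∈ Icc 0 b := ⟨h.1.1.le, h.1.2.le⟩
    have hlt : max c s < b := max_lt hcb h.1.2
    refine ⟨h', ?_⟩
    rw [closedFrequency_regular hc hcb hba (hmem h') h.2 hlt.ne, ← normFreq_edge_z hc hcb hba hs,
      freqExt, min_eq_right hlt.le, max_eq_left hlt.le]
  have hsnd : EqOn (fun s => rhoZ a b (min c s))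
      (fun s => (closedFrequency a b c (s, max c s)).2) (Icc 0 b) := by
    refine EqOn.of_subset_closure (s := E c ∪ H1 b c) (fun s hs => ?_) ?_
      hcont.snd (fun s hs => (key s hs).1) hcl.ge
    · have k := key s hs
      rw [hR s k.1]
      exact congrArg Prod.snd k.2
    · refine ContinuousOn.congr (f := fun s => sortedRotation (min b (min c s))
        (max b (min c s)) a) (fun s hs => ?_) fun s hs => rhoZ_eq hb hba (hI s hs).1 (hI s hs).2.ne
      exact ((continuousAt_sortedRotation hb hba (hI s hs).1 (hI s hs).2.ne).comp
        (f := fun s => min c s) (by fun_prop)).continuousWithinAt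
  refine (Prod.ext ?_ ?_ : (nuZ a b c t, rhoZ a b (min c t)) = _).symm
  · exact extendFrom_eq_of_continuousWithinAt
      (φ := fun s => (closedFrequency a b c (s, max c s)).1)
      (hcl.ge ht) (hcont.fst t ht) (mem_of_superset self_mem_nhdsWithin fun s hs =>
        ⟨(key s hs).1, congrArg Prod.fst (key s hs).2⟩)
  · exact hsnd ht

end

/-! ### Asymptotics along the edges and at the vertexes -/

section

variable {a b c t : ℝ} {p r : ℝ × ℝ}

theorem analyticOnNhd_frequencyMap (hc : 0 < c) (hcb : c < b) (hba : b < a) :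
    AnalyticOnNhd ℝ (frequencyMap a b c) (causticSpace a b c) := by
  intro p hp
  have h := (mem_causticSpace_iff hc hcb hba).1 hp
  have hcl : p ∈ causticClosure a b c := by
    rw [← closure_causticSpace hc hcb hba]; exact subset_closure hp
  refine (analyticAt_freqExt hc hcb hba hcl h.2.1.1.ne' h.2.2.1 h.2.2.2.2).congr ?_
  filter_upwards [isOpen_causticSpace.mem_nhds hp] with q hq
  exact (frequencyMap_eq hc hcb hba hq).symm

/-! ### The edge `lam1 = 0` -/

/-- The coefficient of `√lam1` in the frequency map near the edge `lam1 = 0`. -/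
noncomputable def flatCoeff (a b c t : ℝ) : ℝ × ℝ := normFreq 0 c (min b t) (max b t) a

theorem analyticOnNhd_flatCoeff (hc : 0 < c) (hcb : c < b) (hba : b < a) :
    AnalyticOnNhd ℝ (flatCoeff a b c) (H1 b c ∪ H2 a b) := by
  intro t ht
  obtain ⟨h, hb⟩ := (mem_H1_union_H2_iff hcb hba).1 ht
  exact analyticAt_normFreq analyticAt_const analyticAt_const
    (analyticAt_min_const analyticAt_id hb) (analyticAt_max_const analyticAt_id hb)
    analyticAt_const le_rfl hc (le_min hcb.le h.1.le) (min_lt_max.2 hb.symm)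
    (max_le hba.le h.2.le)

theorem flatCoeff_pos (hc : 0 < c) (hcb : c < b) (hba : b < a) (ht : t ∈ H1 b c ∪ H2 a b) :
    0 < (flatCoeff a b c t).1 ∧ 0 < (flatCoeff a b c t).2 := by
  obtain ⟨h, hb⟩ := (mem_H1_union_H2_iff hcb hba).1 ht
  exact normFreq_pos le_rfl hc (le_min hcb.le h.1.le) (min_lt_max.2 hb.symm)
    (max_le hba.le h.2.le)

/-- The normalized frequency is analytic through λ₁ = 0, so it changes by O(λ₁), and the prefactor
√λ₁ raises the exponent to 3/2. -/
theorem frequencyMap_sub_flatCoeff_isBigO (hc : 0 < c) (hcb : c < b) (hba : b < a)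
    (ht : t ∈ H1 b c ∪ H2 a b) :
    (fun x : ℝ => frequencyMap a b c (x, t) - √x • flatCoeff a b c t)
      =O[𝓝[>] 0] fun x : ℝ => x ^ (3 / 2 : ℝ) := by
  obtain ⟨h, hb⟩ := (mem_H1_union_H2_iff hcb hba).1 ht
  set N : ℝ × ℝ → ℝ × ℝ := fun q =>
    normFreq (min c q.1) (max c q.1) (min b q.2) (max b q.2) a with hN
  have hcl : ((0 : ℝ), t) ∈ causticClosure a b c :=
    ⟨(hc.trans h.1).le, ⟨le_rfl, (hc.trans hcb).le⟩, ⟨h.1.le, h.2.le⟩⟩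
  have hA : AnalyticAt ℝ N (0, t) := analyticAt_normFreq_sorted hc hcb hba hcl hc.ne hb
  have hN0 : N (0, t) = flatCoeff a b c t := by
    simp only [hN, flatCoeff, min_eq_right hc.le, max_eq_left hc.le]
  have hd : DifferentiableAt ℝ (fun x : ℝ => N (x, t)) 0 :=
    hA.differentiableAt.comp (0 : ℝ) (f := fun x : ℝ => (x, t)) (by fun_prop)
  have h1 := (isBigO_refl (fun x : ℝ => √x) (𝓝[>] 0)).smul
    (hd.isBigO_sub.mono nhdsWithin_le_nhds)
  refine h1.congr' ?_ ?_
  · filter_upwards [self_mem_nhdsWithin, nhdsWithin_le_nhds (Iio_mem_nhds hc)] with x h0 hxc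
    have hx : (x, t) ∈ causticSpace a b c := (mem_causticSpace_iff hc hcb hba).2
      ⟨lt_trans hxc h.1, ⟨h0, lt_trans hxc hcb⟩, ne_of_lt hxc, h, hb⟩
    rw [frequencyMap_eq hc hcb hba hx, freqExt, ← hN0, smul_sub]
    simp only [min_eq_right (le_of_lt hxc : x ≤ c)]
    simp only [hN, min_eq_right (le_of_lt hxc : x ≤ c)]
  · filter_upwards [self_mem_nhdsWithin] with x h0
    have h0 : 0 < x := h0
    rw [sub_zero, smul_eq_mul, Real.sqrt_eq_rpow]
    nth_rewrite 2 [← Real.rpow_one x]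
    rw [← Real.rpow_add h0]
    norm_num

theorem frequencyMap_isBigO_sqrt (hc : 0 < c) (hcb : c < b) (hba : b < a) (ht : t ∈ Icc c a)
    (hb : t ≠ b) : frequencyMap a b c =O[𝓝[causticSpace a b c] (0, t)] fun p => √p.1 := by
  have hcl : ((0 : ℝ), t) ∈ causticClosure a b c :=
    ⟨hc.le.trans ht.1, ⟨le_rfl, (hc.trans hcb).le⟩, ht⟩
  have hA := (analyticAt_normFreq_sorted hc hcb hba hcl hc.ne hb).continuousAt
  have h1 := (hA.tendsto.mono_left (nhdsWithin_le_nhds (s := causticSpace a b c))).isBigO_one ℝ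
  have h2 : (fun p : ℝ × ℝ => √(min c p.1)) =O[𝓝[causticSpace a b c] (0, t)] fun p => √p.1 :=
    IsBigO.of_norm_le fun p => by
      rw [Real.norm_of_nonneg (Real.sqrt_nonneg _)]
      exact Real.sqrt_le_sqrt (min_le_right _ _)
  refine (h2.smul h1).congr' ?_ (Eventually.of_forall fun p => by simp)
  filter_upwards [self_mem_nhdsWithin] with q hq
  exact (frequencyMap_eq hc hcb hba hq).symm

/-! ### The inner edges -/

/-- A vanishing coefficient would demand that f vanish near e. This is where the sign of the
residual periods is used. -/
theorem isEquivalent_mul_invLog {f : ℝ → ℝ} {k e : ℝ} (hk : k ≠ 0)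
    (h : Tendsto (fun x => f x * Real.log |e - x|) (𝓝[≠] e) (𝓝 k)) :
    f ~[𝓝[≠] e] fun x => k * invLog (e - x) := by
  refine isEquivalent_of_tendsto_one ?_
  have h1 := h.div_const k
  rw [div_self hk] at h1
  refine h1.congr fun x => ?_
  rw [Pi.div_apply, invLog, one_div, div_eq_mul_inv, div_eq_mul_inv, mul_inv, inv_inv]
  ring

/-- The coefficient of the logarithmic singularity of the frequency map at the inner edges
`lam1 = c` and `lam2 = b`. -/
noncomputable def innerCoeff (a b c : ℝ) (p : ℝ × ℝ) : ℝ × ℝ :=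
  if p.1 = c then
    (lowCoeff (min b p.2) (max b p.2) a c,
      lowCoeff (min b p.2) (max b p.2) a c *
        ((∫ s in c..(min b p.2), cubicWeight (min b p.2) (max b p.2) a s) /
          ∫ s in (max b p.2)..a, cubicWeight (min b p.2) (max b p.2) a s))
  else
    (-(highCoeff (min c p.1) (max c p.1) a b *
        ((∫ s in b..a, cubicWeight (min c p.1) (max c p.1) a s) /
          ∫ s in (max c p.1)..a, cubicWeight (min c p.1) (max c p.1) a s)),
      highCoeff (min c p.1) (max c p.1) a b *
        ((∫ s in (max c p.1)..b, cubicWeight (min c p.1) (max c p.1) a s) /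
          ∫ s in (max c p.1)..a, cubicWeight (min c p.1) (max c p.1) a s))

theorem analyticOnNhd_innerCoeff_low (hc : 0 < c) (hcb : c < b) (hba : b < a) :
    AnalyticOnNhd ℝ (fun t => innerCoeff a b c (c, t)) (H1 b c ∪ H2 a b) := by
  intro t ht
  obtain ⟨h, hb⟩ := (mem_H1_union_H2_iff hcb hba).1 ht
  simp only [innerCoeff, if_true]
  have a1 := analyticAt_min_const (analyticAt_id (𝕜 := ℝ)) hb
  have a2 := analyticAt_max_const (analyticAt_id (𝕜 := ℝ)) hb
  have hlt : min b t < max b t := min_lt_max.2 hb.symm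
  have hM : max b t < a := max_lt hba h.2
  have he : c < min b t := lt_min hcb h.1
  have k := analyticAt_lowCoeff a1 a2 hlt hM ⟨hc, he⟩
  have k2 := analyticAt_innerPeriod a1 a2 hlt hM
  exact k.prod (k.mul ((analyticAt_outerPeriod a1 a2 he hlt hM).div k2
    (integral_cubicWeight_inner_pos hlt hM).ne'))

theorem analyticOnNhd_innerCoeff_high (hc : 0 < c) (hcb : c < b) (hba : b < a) :
    AnalyticOnNhd ℝ (fun t => innerCoeff a b c (t, b)) (E c ∪ H1 b c) := by
  intro t ht
  obtain ⟨h, hb⟩ := (mem_E_union_H1_iff hc hcb).1 ht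
  have a1 := analyticAt_min_const (analyticAt_id (𝕜 := ℝ)) hb
  have a2 := analyticAt_max_const (analyticAt_id (𝕜 := ℝ)) hb
  have hlt : min c t < max c t := min_lt_max.2 hb.symm
  have hM : max c t < b := max_lt hcb h.2
  have hm : 0 < min c t := lt_min hc h.1
  have k := analyticAt_highCoeff a1 a2 hm hlt ⟨hM, hba⟩
  have k2 := analyticAt_innerPeriod a1 a2 hlt (hM.trans hba)
  have k3 := (integral_cubicWeight_inner_pos hlt (hM.trans hba)).ne'
  refine ((k.mul ((analyticAt_innerPeriod_right a1 a2 hlt ⟨hM, hba⟩).div k2 k3)).neg.prod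
    (k.mul ((analyticAt_innerPeriod_left a1 a2 hlt ⟨hM, hba⟩).div k2 k3))).congr ?_
  filter_upwards [isOpen_ne.mem_nhds hb] with s hs
  simp only [innerCoeff, if_neg hs]
  rfl

theorem frequencyMap_isEquivalent_low (hc : 0 < c) (hcb : c < b) (hba : b < a)
    (ht : t ∈ H1 b c ∪ H2 a b) :
    (fun x => (frequencyMap a b c (x, t)).1 - (closedFrequency a b c (c, t)).1)
      ~[𝓝[≠] c] (fun x => (innerCoeff a b c (c, t)).1 * invLog (c - x)) ∧
    (fun x => (frequencyMap a b c (x, t)).2 - (closedFrequency a b c (c, t)).2)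
      ~[𝓝[≠] c] (fun x => (innerCoeff a b c (c, t)).2 * invLog (c - x)) := by
  obtain ⟨h, hb⟩ := (mem_H1_union_H2_iff hcb hba).1 ht
  have hlt : min b t < max b t := min_lt_max.2 hb.symm
  have hM : max b t < a := max_lt hba h.2
  have he : c < min b t := lt_min hcb h.1
  have hw : ∀ᶠ x in 𝓝[≠] c, SolvesPeriods (min c x) (max c x) (min b t) (max b t) a
      (frequencyMap a b c (x, t)) ∧ 0 < (frequencyMap a b c (x, t)).1 ∧
      0 < (frequencyMap a b c (x, t)).2 := by
    filter_upwards [self_mem_nhdsWithin, nhdsWithin_le_nhds (Ioo_mem_nhds hc he)] with x hx h'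
    have hm : (x, t) ∈ causticSpace a b c := (mem_causticSpace_iff hc hcb hba).2
      ⟨h'.2.trans_le (min_le_right _ _), ⟨h'.1, h'.2.trans_le (min_le_left _ _)⟩, hx, h, hb⟩
    exact ⟨solvesPeriods_frequencyMap hc hcb hba hm, frequencyMap_pos hc hcb hba hm⟩
  obtain ⟨k1, k2⟩ := tendsto_collision_low hlt hM ⟨hc, he⟩ hw
  have hpos := lowCoeff_pos hlt hM ⟨hc, he⟩
  rw [closedFrequency_edge_low hc hcb hba ⟨h.1.le, h.2.le⟩,
    rhoZ_eq (hc.trans hcb) hba ⟨(hc.trans h.1).le, h.2.le⟩ hb]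
  simp only [innerCoeff, if_true]
  exact ⟨isEquivalent_mul_invLog hpos.ne' k1, isEquivalent_mul_invLog (mul_pos hpos
    (div_pos (integral_cubicWeight_right_pos hlt hM he)
      (integral_cubicWeight_inner_pos hlt hM))).ne' k2⟩

theorem frequencyMap_isEquivalent_high (hc : 0 < c) (hcb : c < b) (hba : b < a)
    (ht : t ∈ E c ∪ H1 b c) :
    (fun y => (frequencyMap a b c (t, y)).1 - (closedFrequency a b c (t, b)).1)
      ~[𝓝[≠] b] (fun y => (innerCoeff a b c (t, b)).1 * invLog (b - y)) ∧
    (fun y => (frequencyMap a b c (t, y)).2 - (closedFrequency a b c (t, b)).2)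
      ~[𝓝[≠] b] (fun y => (innerCoeff a b c (t, b)).2 * invLog (b - y)) := by
  obtain ⟨h, hb⟩ := (mem_E_union_H1_iff hc hcb).1 ht
  have hlt : min c t < max c t := min_lt_max.2 hb.symm
  have hM : max c t < b := max_lt hcb h.2
  have hm : 0 < min c t := lt_min hc h.1
  have hw : ∀ᶠ y in 𝓝[≠] b, SolvesPeriods (min c t) (max c t) (min b y) (max b y) a
      (frequencyMap a b c (t, y)) ∧ 0 < (frequencyMap a b c (t, y)).1 ∧
      0 < (frequencyMap a b c (t, y)).2 := by
    filter_upwards [self_mem_nhdsWithin, nhdsWithin_le_nhds (Ioo_mem_nhds hM hba)] with y hy h'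
    have hm : (t, y) ∈ causticSpace a b c := (mem_causticSpace_iff hc hcb hba).2
      ⟨(le_max_right _ _).trans_lt h'.1, h, hb, ⟨(le_max_left _ _).trans_lt h'.1, h'.2⟩, hy⟩
    exact ⟨solvesPeriods_frequencyMap hc hcb hba hm, frequencyMap_pos hc hcb hba hm⟩
  obtain ⟨k1, k2⟩ := tendsto_collision_high hm hlt ⟨hM, hba⟩ hw
  have hpos := highCoeff_pos hm hlt (hM.trans hba) ⟨hM, hba⟩
  have hI := integral_cubicWeight_inner_pos hlt (hM.trans hba)
  rw [closedFrequency_edge_high hc hcb hba ⟨h.1.le, h.2.le⟩,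
    rhoY_eq hc (hcb.trans hba) ⟨h.1.le, (h.2.trans hba).le⟩ hb]
  simp only [innerCoeff, if_neg hb]
  exact ⟨isEquivalent_mul_invLog (neg_ne_zero.2 (mul_pos hpos (div_pos
      (integral_cubicWeight_sub_pos hlt (hM.trans hba) hM.le hba le_rfl) hI)).ne') k1,
    isEquivalent_mul_invLog (mul_pos hpos (div_pos
      (integral_cubicWeight_sub_pos hlt (hM.trans hba) le_rfl hM hba.le) hI)).ne' k2⟩

/-! ### Regular border points and vertexes -/

/-- At such points the frequency is the restriction of a map that is analytic in a full
neighbourhood, hence differentiable. -/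
theorem frequencyMap_sub_isBigO_regular (hc : 0 < c) (hcb : c < b) (hba : b < a)
    (hr : r ∈ causticClosure a b c) (h0 : r.1 ≠ 0) (h1 : r.1 ≠ c) (h2 : r.2 ≠ b) :
    (fun p => frequencyMap a b c p - closedFrequency a b c r) =O[𝓝[causticSpace a b c] r]
      fun p => p - r := by
  rw [closedFrequency_regular hc hcb hba hr h1 h2]
  refine ((analyticAt_freqExt hc hcb hba hr h0 h1 h2).differentiableAt.isBigO_sub.mono
    nhdsWithin_le_nhds).congr' ?_ EventuallyEq.rfl
  filter_upwards [self_mem_nhdsWithin] with q hq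
  rw [frequencyMap_eq hc hcb hba hq]

theorem mem_edgesR (hc : 0 < c) (hcb : c < b) (hba : b < a) (hr : r ∈ edgesR a b c) :
    r ∈ causticClosure a b c ∧ r.1 ≠ 0 ∧ r.1 ≠ c ∧ r.2 ≠ b := by
  obtain ⟨x, y⟩ := r
  simp only [edgesR, E, H1, H2, mem_union, mem_prod, mem_Ioo, mem_singleton_iff,
    mem_ofPred_eq] at hr
  simp only [causticClosure, mem_ofPred_eq, mem_Icc]
  rcases hr with (((⟨h, rfl⟩ | ⟨rfl, h⟩) | ⟨rfl, h⟩) | ⟨h, rfl⟩) | ⟨h, rfl⟩ <;>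
    refine ⟨⟨?_, ⟨?_, ?_⟩, ?_, ?_⟩, ?_, ?_, ?_⟩ <;> linarith

/-- The logarithmic estimate with the running λ₂ is combined with the differentiability of the
rotation function at t ≠ b. It covers both (c,c) and (c,a). -/
theorem frequencyMap_sub_isBigO_vertex_low (hc : 0 < c) (hcb : c < b) (hba : b < a)
    (ht : t ∈ Icc c a) (hb : t ≠ b) :
    (fun p => frequencyMap a b c p - (1 / 2, rhoZ a b t))
      =O[𝓝[causticSpace a b c] (c, t)] fun p => |invLog (c - p.1)| + |p.2 - t| := by
  have hb0 := hc.trans hcb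
  have ht' : t ∈ Icc 0 a := ⟨hc.le.trans ht.1, ht.2⟩
  have hd : DifferentiableAt ℝ (fun s => ((1 / 2 : ℝ), sortedRotation (min b s) (max b s) a)) t :=
    (differentiableAt_const _).prodMk (analyticAt_sortedRotation
      (analyticAt_min_const analyticAt_id hb) (analyticAt_max_const analyticAt_id hb)
      analyticAt_const (lt_min hb0 (hc.trans_le ht.1)) (min_lt_max.2 hb.symm)
      (max_le hba.le ht.2)).differentiableAt
  have h1 := ((hd.isBigO_sub.comp_tendsto (continuousAt_snd (p := (c, t)))).mono
    (nhdsWithin_le_nhds (s := causticSpace a b c)))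
  have h2 := frequencyMap_sub_isBigO_low hc hcb hba hb
  refine ((h2.trans (k := fun p => |invLog (c - p.1)| + |p.2 - t|) ?_).add
    (h1.trans (k := fun p => |invLog (c - p.1)| + |p.2 - t|) ?_)).congr_left fun p => ?_
  · refine IsBigO.of_norm_le fun p => ?_
    exact le_add_of_nonneg_right (abs_nonneg _)
  · refine IsBigO.of_norm_le fun p => ?_
    exact le_add_of_nonneg_left (abs_nonneg _)
  · rw [rhoZ_eq hb0 hba ht' hb]
    simp only [Function.comp, sub_add_sub_cancel]

theorem frequencyMap_sub_isBigO_vertex_high (hc : 0 < c) (hcb : c < b) (hba : b < a) :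
    (fun p => frequencyMap a b c p - (rhoY a c b, rhoY a c b))
      =O[𝓝[causticSpace a b c] (b, b)] fun p => |b - p.1| + |invLog (b - p.2)| := by
  have hb0 := hc.trans hcb
  have hs := (analyticAt_sortedRotation
      (analyticAt_min_const analyticAt_id hcb.ne') (analyticAt_max_const analyticAt_id hcb.ne')
      (analyticAt_const (v := a)) (lt_min hc hb0) (min_lt_max.2 hcb.ne)
      (max_le (hcb.trans hba).le hba.le)).differentiableAt
  have hd := hs.prodMk hs
  have h1 := ((hd.isBigO_sub.comp_tendsto (continuousAt_fst (p := (b, b)))).mono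
    (nhdsWithin_le_nhds (s := causticSpace a b c)))
  have h2 := frequencyMap_sub_isBigO_high hc hcb hba hcb.ne'
  refine ((h2.trans (k := fun p => |b - p.1| + |invLog (b - p.2)|) ?_).add
    (h1.trans (k := fun p => |b - p.1| + |invLog (b - p.2)|) ?_)).congr_left fun p => ?_
  · refine IsBigO.of_norm_le fun p => ?_
    exact le_add_of_nonneg_left (abs_nonneg _)
  · refine IsBigO.of_norm_le fun p => ?_
    rw [abs_sub_comm]
    exact le_add_of_nonneg_right (abs_nonneg _)
  · rw [rhoY_eq hc (hcb.trans hba) ⟨hb0.le, hba.le⟩ hcb.ne']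
    simp only [Function.comp, id, sub_add_sub_cancel]

theorem frequencyMap_sub_isBigO_vertex_regular (hc : 0 < c) (hcb : c < b) (hba : b < a) :
    (fun p => frequencyMap a b c p - (rhoX b c b, rhoY a c a))
      =O[𝓝[causticSpace a b c] (b, a)] fun p => |b - p.1| + |a - p.2| := by
  have hb0 := hc.trans hcb
  have h := frequencyMap_sub_isBigO_regular hc hcb hba (r := (b, a))
    ⟨hba.le, ⟨hb0.le, le_rfl⟩, ⟨(hcb.trans hba).le, le_rfl⟩⟩ hb0.ne' hcb.ne' hba.ne'
  have e : closedFrequency a b c (b, a) = (rhoX b c b, rhoY a c a) :=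
    Prod.ext (by rw [closedFrequency_edge_x hc hcb hba ⟨hb0.le, le_rfl⟩])
      (by rw [closedFrequency_edge_y hc hcb hba ⟨hba.le, le_rfl⟩])
  rw [e] at h
  refine h.trans (IsBigO.of_norm_le fun p => ?_)
  rw [Prod.norm_def, abs_sub_comm b, abs_sub_comm a]
  exact max_le_add_of_nonneg (norm_nonneg _) (norm_nonneg _)

end

/-! ### The theorem assembled from its parts -/

theorem theorem5p2 (a b c : ℝ) (hc : 0 < c) (hcb : c < b) (hba : b < a) :
    -- the frequency map is well defined: the linear system has exactly one solution
    (∀ p ∈ causticSpace a b c, ∀ w : ℝ × ℝ,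
      IsFrequency a b c p w ↔ w = frequencyMap a b c p) ∧
    -- analyticity
    AnalyticOnNhd ℝ (frequencyMap a b c) (causticSpace a b c) ∧
    -- continuous extension to the closure, and its values on the border
    (∃ Ω : ℝ × ℝ → ℝ × ℝ,
      ContinuousOn Ω (closure (causticSpace a b c)) ∧
      EqOn Ω (frequencyMap a b c) (causticSpace a b c) ∧
      (∀ t ∈ Icc c a, Ω (0, t) = (0, 0)) ∧
      (∀ t ∈ Icc 0 b, Ω (t, b) = (rhoY a c t, rhoY a c t)) ∧
      (∀ t ∈ Icc c a, Ω (c, t) = (1 / 2, rhoZ a b t)) ∧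
      (∀ t ∈ Icc 0 b, Ω (t, a) = (rhoX b c t, nuX a b c t)) ∧
      (∀ t ∈ Icc b a, Ω (b, t) = (nuY a b c t, rhoY a c t)) ∧
      (∀ t ∈ Icc 0 c, Ω (t, c) = (nuZ a b c t, rhoZ a b t)) ∧
      (∀ t ∈ Icc c b, Ω (t, t) = (nuZ a b c t, rhoZ a b c)) ∧
      -- asymptotics at the two left edges
      (∃ κG : ℝ → ℝ × ℝ,
        AnalyticOnNhd ℝ κG (H1 b c ∪ H2 a b) ∧
        ∀ t ∈ H1 b c ∪ H2 a b, 0 < (κG t).1 ∧ 0 < (κG t).2 ∧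
          (fun x : ℝ => frequencyMap a b c (x, t) - √x • κG t)
            =O[𝓝[>] 0] fun x : ℝ => x ^ (3 / 2 : ℝ)) ∧
      -- asymptotics at the four inner edges
      (∃ κS : ℝ × ℝ → ℝ × ℝ,
        AnalyticOnNhd ℝ (fun t : ℝ => κS (c, t)) (H1 b c ∪ H2 a b) ∧
        AnalyticOnNhd ℝ (fun t : ℝ => κS (t, b)) (E c ∪ H1 b c) ∧
        (∀ t ∈ H1 b c ∪ H2 a b,
          (fun x : ℝ => (frequencyMap a b c (x, t)).1 - (Ω (c, t)).1)
            ~[𝓝[≠] c] (fun x : ℝ => (κS (c, t)).1 * invLog (c - x)) ∧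
          (fun x : ℝ => (frequencyMap a b c (x, t)).2 - (Ω (c, t)).2)
            ~[𝓝[≠] c] (fun x : ℝ => (κS (c, t)).2 * invLog (c - x))) ∧
        (∀ t ∈ E c ∪ H1 b c,
          (fun y : ℝ => (frequencyMap a b c (t, y)).1 - (Ω (t, b)).1)
            ~[𝓝[≠] b] (fun y : ℝ => (κS (t, b)).1 * invLog (b - y)) ∧
          (fun y : ℝ => (frequencyMap a b c (t, y)).2 - (Ω (t, b)).2)
            ~[𝓝[≠] b] (fun y : ℝ => (κS (t, b)).2 * invLog (b - y)))) ∧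
      -- asymptotics at the five remaining edges
      (∀ r ∈ edgesR a b c,
        (fun p => frequencyMap a b c p - Ω r) =O[𝓝[causticSpace a b c] r] fun p => p - r)) ∧
    -- asymptotics at the eight vertexes
    (frequencyMap a b c =O[𝓝[causticSpace a b c] (0, c)] fun p => √p.1) ∧
    (frequencyMap a b c =O[𝓝[causticSpace a b c] (0, b)] fun p => √p.1) ∧
    (frequencyMap a b c =O[𝓝[causticSpace a b c] (0, a)] fun p => √p.1) ∧
    ((fun p => frequencyMap a b c p - (1 / 2, rhoZ a b c))
      =O[𝓝[causticSpace a b c] (c, c)] fun p => |invLog (c - p.1)| + |p.2 - c|) ∧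
    ((fun p => frequencyMap a b c p - (1 / 2, 1 / 2))
      =O[𝓝[causticSpace a b c] (c, b)] fun p => |invLog (c - p.1)| + |invLog (b - p.2)|) ∧
    ((fun p => frequencyMap a b c p - (1 / 2, rhoZ a b a))
      =O[𝓝[causticSpace a b c] (c, a)] fun p => |invLog (c - p.1)| + |a - p.2|) ∧
    ((fun p => frequencyMap a b c p - (rhoY a c b, rhoY a c b))
      =O[𝓝[causticSpace a b c] (b, b)] fun p => |b - p.1| + |invLog (b - p.2)|) ∧
    ((fun p => frequencyMap a b c p - (rhoX b c b, rhoY a c a))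
      =O[𝓝[causticSpace a b c] (b, a)] fun p => |b - p.1| + |a - p.2|) := by
  refine ⟨fun p hp w => ?_, analyticOnNhd_frequencyMap hc hcb hba,
    ⟨closedFrequency a b c, ?_, fun p hp => closedFrequency_eq hc hcb hba hp,
      fun t ht => closedFrequency_zero hc hcb hba ht,
      fun t ht => closedFrequency_edge_high hc hcb hba ht,
      fun t ht => closedFrequency_edge_low hc hcb hba ht,
      fun t ht => closedFrequency_edge_x hc hcb hba ht,
      fun t ht => closedFrequency_edge_y hc hcb hba ht, fun t ht => ?_, fun t ht => ?_,
      ⟨flatCoeff a b c, analyticOnNhd_flatCoeff hc hcb hba, fun t ht =>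
        ⟨(flatCoeff_pos hc hcb hba ht).1, (flatCoeff_pos hc hcb hba ht).2,
          frequencyMap_sub_flatCoeff_isBigO hc hcb hba ht⟩⟩,
      ⟨innerCoeff a b c, analyticOnNhd_innerCoeff_low hc hcb hba,
        analyticOnNhd_innerCoeff_high hc hcb hba,
        fun t ht => frequencyMap_isEquivalent_low hc hcb hba ht,
        fun t ht => frequencyMap_isEquivalent_high hc hcb hba ht⟩, fun r hr => ?_⟩,
    frequencyMap_isBigO_sqrt hc hcb hba ⟨le_rfl, (hcb.trans hba).le⟩ hcb.ne,
    frequencyMap_isBigO_sqrt_high hc hcb hba,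
    frequencyMap_isBigO_sqrt hc hcb hba ⟨(hcb.trans hba).le, le_rfl⟩ hba.ne',
    frequencyMap_sub_isBigO_vertex_low hc hcb hba ⟨le_rfl, (hcb.trans hba).le⟩ hcb.ne,
    frequencyMap_sub_isBigO_corner hc hcb hba, ?_,
    frequencyMap_sub_isBigO_vertex_high hc hcb hba,
    frequencyMap_sub_isBigO_vertex_regular hc hcb hba⟩
  · rw [isFrequency_iff hc hcb hba hp, frequencyMap_eq hc hcb hba hp]
  · rw [closure_causticSpace hc hcb hba]
    exact continuousOn_closedFrequency hc hcb hba
  · have := closedFrequency_edge_z hc hcb hba (t := t) ⟨ht.1, ht.2.trans hcb.le⟩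
    rwa [max_eq_left ht.2, min_eq_right ht.2] at this
  · have := closedFrequency_edge_z hc hcb hba (t := t) ⟨hc.le.trans ht.1, ht.2⟩
    rwa [max_eq_right ht.1, min_eq_left ht.1] at this
  · obtain ⟨h, h0, h1, h2⟩ := mem_edgesR hc hcb hba hr
    exact frequencyMap_sub_isBigO_regular hc hcb hba h h0 h1 h2
  · simp only [abs_sub_comm a]
    exact frequencyMap_sub_isBigO_vertex_low hc hcb hba ⟨(hcb.trans hba).le, le_rfl⟩ hba.ne'
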